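/- **Conventions.** All structures are finite. A *tree-ordered graph* is a structure with a symmetric irreflexive relation $E$ and a strict partial order $\prec$ that has a minimum $r$ (the root) and in which the elements below any element form a chain. A class $\mathscr C$ of tree-ordered graphs (closed under isomorphism) is *TOWS* if for some $t$ no member contains $K_{t,t}$ as a subgraph in $E$; *hereditary* if it is closed under induced substructures containing the root; *independent* if there are $d$ and a first-order formula $\varphi(\bar x;\bar y)$ over $\{E,\prec\}$ with $|\bar x|=|\bar y|=d$ such that for each finite graph $G$ there are $\mathbf N\in\mathscr C$ and an injection $f:V(G)\to N^d$ with $uv\in E(G)\iff\mathbf N\models\varphi(f(u);f(v))$. **Definable induced tree-ordered minors.** Given unary predicates $V,D$ on a tree-ordered graph $\mathbf M$, $\mathsf{Shrink}(\mathbf M,V,D)$ has as domain the root and all $x$ with $V(x)\wedge\neg D(x)$, with the induced order; distinct $x,y$ are adjacent iff there is an edge $x'y'$ of $\mathbf M$ between vertices that are not deleted (not in $D$, or equal to $r$) such that $x$ (resp. $y$) is the largest element of the domain that is $\preceq x'$ (resp. $\preceq y'$). A *definable induced tree-ordered minor* is a map $\mathsf I:\mathbf M\mapsto\mathsf{Shrink}(\mathbf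 M,V,D)$ where $V$ and $D$ are defined by two fixed first-order formulas over $\{E,\prec\}$. **Cores.** A *core* $\tau$ of length $h$ is a tree-ordered graph whose domain consists of the root $r$, layers $V(\mu_s)=\{\mu_s(i,j):i,j\in[2]\}$, $1\le s\le h$, and, in type 1 only, layers $A=\{a(1),a(2)\}$ (before $\mu_1$) and $B=\{b(1),b(2)\}$ (after $\mu_h$). Each layer is independent in $E$ and is contained in or disjoint from the $E$-neighbourhood of $r$; there are no $E$-edges between non-consecutive layers. A *matching* pair $(\mu_s,\mu_{s+1})$ is one where the $E$-edges between the two layers are either none or exactly all $\mu_s(i,j)\mu_{s+1}(i,j)$; the order relations between them are either none, or exactly all $\mu_s(i,j)\prec\mu_{s+1}(i,j)$, or exactly all $\mu_{s+1}(i,j)\prec\mu_s(i,j)$; and not both are none. It is *plain* if there are edges but no order relations. * *Type 1* ($h\ge1$): all layers are antichains, non-consecutive layers are incomparable, all pairs $(\mu_s,\mu_{s+1})$ are matching; between $A$ and $\mu_1$ the edges are none or exactly all $a(i)\mu_1(i,j)$, the order relations are none or exactly all $a(i)\prec\mu_1(i,j)$, not both none; likewise between $B$ and $\mu_h$ with $b(j)\mu_h(i,j)$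 and $b(j)\prec\mu_h(i,j)$. * *Type 2* ($h\ge2$): on $V(\mu_1)$ the order is $\mu_1(i,j)\prec\mu_1(i',j')\iff i=i',\,j<j'$; on $V(\mu_h)$ it is $\mu_h(i,j)\prec\mu_h(i',j')\iff j=j',\,i<i'$; other layers are antichains; non-consecutive layers are incomparable; $(\mu_1,\mu_2)$ and $(\mu_{h-1},\mu_h)$ are plain matchings and the other pairs $(\mu_s,\mu_{s+1})$ are matching. * *Type 3* ($h\ge2$): $V(\mu_1)$ is a chain ordered lexicographically by $(i,j)$; $V(\mu_h)$ is a chain ordered lexicographically by $(j,i)$, each of the two coordinates being taken in increasing or in decreasing order; other layers are antichains. No element of another layer is below an element of $V(\mu_1)$, and no element of $V(\mu_s)$, $1<s<h$, is below an element of $V(\mu_h)$. Non-consecutive layers among $\mu_2,\dots,\mu_{h-1}$ are incomparable; each $V(\mu_s)$, $s\ge3$, is either entirely above $V(\mu_1)$ or incomparable to it; each $V(\mu_s)$, $2\le s\le h-2$, is either entirely above $V(\mu_h)$ or incomparable to it. For $1<s<h-1$, $(\mu_s,\mu_{s+1})$ is matching. Either the edges between $\mu_1$ and $\mu_2$ are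 exactly all $\mu_1(i,j)\mu_2(i,j)$ and $V(\mu_2)$ is either entirely above $V(\mu_1)$ or has no element above one of $V(\mu_1)$, or there are no such edges and $\mu_1(i,j)\prec\mu_2(i',j')\iff i\le i'$. Either the edges between $\mu_{h-1}$ and $\mu_h$ are exactly all $\mu_{h-1}(i,j)\mu_h(i,j)$ and $V(\mu_{h-1})$ is either entirely above $V(\mu_h)$ or has no element above one of $V(\mu_h)$, or there are no such edges and $\mu_h(i,j)\prec\mu_{h-1}(i',j')\iff j\le j'$ (resp. $j\ge j'$ if the order on $V(\mu_h)$ takes $j$ in decreasing order). For $n\ge2$, the *twist* $\tau[n]$ is obtained from $\tau$ by letting the indices range over $[n]$ instead of $[2]$, the relations between two vertices being those of $\tau$ between two vertices of the same layers whose row indices and whose column indices compare ($<,=,>$) in the same way. **Groundings and racks.** Let $G$ be a bipartite graph with parts $A,B$; let $G^{(h)}$ be its $h$-subdivision, $L_0=A$, $L_{h+1}=B$, and $L_k$ ($1\le k\le h$) the set of subdivision vertices at distance $k$ from the end in $A$ of the subdivided edge. For $\mathfrak G=(h,N_r)$ with $N_r\subseteq\{0,\dots,h+1\}$, the *$\mathfrak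 G$-grounding* of $G$ is $G^{(h)}$ plus a new vertex $r$ adjacent exactly to $\bigcup_{k\in N_r}L_k$, where $x\prec y\iff x=r\ne y$. For $\mathfrak R=(h,N_r,C_A,C_B)$ with $N_r$ as before, $C_A\subseteq\{1,\dots,h+1\}$, $C_B\subseteq\{1,\dots,h\}$, $C_A\cap C_B=\emptyset$, and linear orders on $A$ and $B$, the *$\mathfrak R$-rack* of $G$ has the same vertices and edges, and $\prec$ is the tree-order with the following predecessors: a non-minimal element of $A$ (resp. $B$) has its predecessor in $A$ (resp. $B$); $\min A$ has $r$; $\min B$ has $\max A$ if $h+1\in C_A$ and $r$ otherwise; $x\in L_k$, $1\le k\le h$, has $\max A$ if $k\in C_A$, $\max B$ if $k\in C_B$, and $r$ otherwise (where $\max\emptyset$ is read as $r$). **Theorem.** For every core $\tau$ there are a polynomial-time computable map ${\rm Host}_\tau$, from finite bipartite graphs given with their two parts, each linearly ordered, to tree-ordered graphs, and a definable induced tree-ordered minor $\mathsf I_\tau$, such that: 1. ${\rm Host}_\tau(G)\in\mathscr C$ for every $G$ and every independent hereditary TOWS class $\mathscr C$ of tree-ordered graphs with $\tau[n]\in\mathscr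 C$ for all $n\ge2$; 2. if $\tau$ has type 1 or 2, then there is $\mathfrak G$ (depending only on $\tau$) such that for every $G$, $\mathsf I_\tau({\rm Host}_\tau(G))$ is isomorphic to the $\mathfrak G$-grounding of $G$; 3. if $\tau$ has type 3, then there is $\mathfrak R$ (depending only on $\tau$) such that for every $G$, $\mathsf I_\tau({\rm Host}_\tau(G))$ is isomorphic to the $\mathfrak R$-rack of $G$. -/

import Mathlib

/-! ### Tree-ordered graphs -/

/-- A `{E, ≺}`-structure. -/
structure TOStruct where
  V : Type
  E : V → V → Prop
  lt : V → V → Prop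

/-- `lt` is a strict tree-order with minimum (root) `r`. -/
structure IsTreeOrder {V : Type} (lt : V → V → Prop) (r : V) : Prop where
  irrefl : ∀ x, ¬ lt x x
  trans : ∀ x y z, lt x y → lt y z → lt x z
  root_lt : ∀ x, x ≠ r → lt r x
  chain : ∀ x y z, lt x z → lt y z → lt x y ∨ x = y ∨ lt y x

namespace TOStruct

/-- `x` is the minimum of the order. -/
def IsRoot (M : TOStruct) (x : M.V) : Prop := ∀ y, y ≠ x → M.lt x y

/-- Finite tree-ordered graphs. -/
structure IsTreeOrderedGraph (M : TOStruct) : Prop where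
  finite : Finite M.V
  symm : ∀ x y, M.E x y → M.E y x
  loopless : ∀ x, ¬ M.E x x
  treeOrder : ∃ r, IsTreeOrder M.lt r

/-- Isomorphism of `{E, ≺}`-structures. -/
def Iso (M N : TOStruct) : Prop :=
  ∃ e : M.V ≃ N.V, (∀ x y, M.E x y ↔ N.E (e x) (e y)) ∧ (∀ x y, M.lt x y ↔ N.lt (e x) (e y))

/-- `N` is isomorphic to an induced substructure of `M` that contains the root of `M`. -/
def IsInducedSub (N M : TOStruct) : Prop :=
  ∃ f : N.V → M.V, Function.Injective f ∧
    (∀ x y, N.E x y ↔ M.E (f x) (f y)) ∧ (∀ x y, N.lt x y ↔ M.lt (f x) (f y)) ∧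
    ∃ x, M.IsRoot (f x)

/-- `K_{t,t}` is a subgraph of the `E`-reduct. -/
def HasBiclique (M : TOStruct) (t : ℕ) : Prop :=
  ∃ f g : Fin t → M.V, Function.Injective f ∧ Function.Injective g ∧
    (∀ i j, f i ≠ g j) ∧ ∀ i j, M.E (f i) (g j)

end TOStruct

/-- A class of tree-ordered graphs whose `E`-reducts are weakly sparse. -/
def IsTOWSClass (C : Set TOStruct) : Prop :=
  (∀ M ∈ C, M.IsTreeOrderedGraph) ∧ ∃ t : ℕ, ∀ M ∈ C, ¬ M.HasBiclique t

/-- Closed under (isomorphic copies of) induced tree-ordered subgraphs including the root. -/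
def IsHereditary (C : Set TOStruct) : Prop :=
  ∀ M ∈ C, ∀ N : TOStruct, N.IsInducedSub M → N ∈ C

/-! ### First-order logic over `{E, ≺}` -/

inductive TORel : ℕ → Type
  | edge : TORel 2
  | lt : TORel 2

def toLang : FirstOrder.Language.{0, 0} := ⟨fun _ => Empty, TORel⟩

instance TOStruct.instStructure (M : TOStruct) : toLang.Structure M.V where
  funMap := fun f => Empty.elim f
  RelMap := fun {_} R =>
    match R with
    | TORel.edge => fun x => M.E (x 0) (x 1)
    | TORel.lt => fun x => M.lt (x 0) (x 1)

/-- The class of all finite graphs is defined in `C`: a fixed formula `φ(x̄; ȳ)`, evaluated on an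
injective assignment of `d`-tuples to the vertices, yields the adjacency relation. -/
def IsIndependent (C : Set TOStruct) : Prop :=
  ∃ (d : ℕ) (φ : toLang.Formula (Fin d ⊕ Fin d)),
    ∀ (W : Type) [Finite W] (G : SimpleGraph W),
      ∃ N ∈ C, ∃ f : W → (Fin d → N.V), Function.Injective f ∧
        ∀ a b, G.Adj a b ↔ φ.Realize (Sum.elim (f a) (f b))

/-! ### Definable induced tree-ordered minors -/

/-- The vertices that remain in `shrink M S D`. -/
def TOStruct.Kept (M : TOStruct) (S D : M.V → Prop) (x : M.V) : Prop :=
  (S x ∧ ¬ D x) ∨ M.IsRoot x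

/-- `Shrink`: delete the non-root vertices in `D`, then contract every remaining vertex to the
largest kept vertex that is `⪯` to it (so that `S` marks the minima of the contracted parts).
Loops created by the contraction are discarded. -/
def TOStruct.shrink (M : TOStruct) (S D : M.V → Prop) : TOStruct where
  V := {x : M.V // M.Kept S D x}
  E := fun x y => x ≠ y ∧ ∃ x' y' : M.V, M.E x' y' ∧
    (x.1 = x' ∨ M.lt x.1 x') ∧ (y.1 = y' ∨ M.lt y.1 y') ∧
    (¬ D x' ∨ M.IsRoot x') ∧ (¬ D y' ∨ M.IsRoot y') ∧
    ∀ z, ((M.lt x.1 z ∧ (z = x' ∨ M.lt z x')) ∨ (M.lt y.1 z ∧ (z = y' ∨ M.lt z y'))) →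
      ¬ M.Kept S D z
  lt := fun x y => M.lt x.1 y.1

/-- A definable induced tree-ordered minor: first-order formulas defining the two predicates
to which `Shrink` is applied. -/
structure DefinableMinor where
  formS : toLang.Formula Unit
  formD : toLang.Formula Unit

def DefinableMinor.apply (I : DefinableMinor) (M : TOStruct) : TOStruct :=
  M.shrink (fun x => I.formS.Realize (fun _ => x)) (fun x => I.formD.Realize (fun _ => x))

/-! ### Cores and twists -/

inductive CoreType
  | one
  | two
  | three

/-- Vertices of a twist of order `n` and length `h`: the root, the mesh vertices (`mesh s i j` is
`μ_{s+1}(i,j)`) and, in type 1 only, the guards `a(i)` and `b(j)`. -/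
inductive TwistVertex (t : CoreType) (h n : ℕ) : Type
  | root
  | a (ht : t = CoreType.one) (i : Fin n)
  | mesh (s : Fin h) (i j : Fin n)
  | b (ht : t = CoreType.one) (j : Fin n)

namespace TwistVertex

variable {t : CoreType} {h n : ℕ}

/-- The layers `A, V(μ_1), …, V(μ_h), B` are numbered `0, 1, …, h, h + 1`. -/
def layer : TwistVertex t h n → Option ℕ
  | root => none
  | a _ _ => some 0
  | mesh s _ _ => some (s.1 + 1)
  | b _ _ => some (h + 1)

def row : TwistVertex t h n → ℕ
  | root => 0
  | a _ i => i.1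
  | mesh _ i _ => i.1
  | b _ _ => 0

def col : TwistVertex t h n → ℕ
  | root => 0
  | a _ _ => 0
  | mesh _ _ j => j.1
  | b _ j => j.1

/-- The vertex of the core in the same layer with row `p` and column `q`. -/
def place (p q : Fin 2) : TwistVertex t h n → TwistVertex t h 2
  | root => root
  | a ht _ => a ht p
  | mesh s _ _ => mesh s p q
  | b ht _ => b ht q

end TwistVertex

section Patterns

variable {W : Type} (R : W → W → Prop) (μ ν : Fin 2 → Fin 2 → W)

def Never : Prop := ∀ i j i' j', ¬ R (μ i j) (ν i' j')

def Always : Prop := ∀ i j i' j', R (μ i j) (ν i' j')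

def Diag : Prop := ∀ i j i' j', R (μ i j) (ν i' j') ↔ i = i' ∧ j = j'

def SameRow : Prop := ∀ i j i' j', R (μ i j) (ν i' j') ↔ i = i'

def SameCol : Prop := ∀ i j i' j', R (μ i j) (ν i' j') ↔ j = j'

end Patterns

section Pairs

variable {W : Type} (E lt : W → W → Prop) (μ ν : Fin 2 → Fin 2 → W)

/-- Matching with `E`-edges only. -/
def PlainMatching : Prop := Never lt μ ν ∧ Never lt ν μ ∧ Diag E μ ν

/-- One of the five types of matchings: order only (in either direction), order and `E`-edges
(in either direction), `E`-edges only. -/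
def IsMatchingPair : Prop :=
  (Diag lt μ ν ∧ Never lt ν μ ∧ Never E μ ν) ∨
  (Never lt μ ν ∧ Diag lt ν μ ∧ Never E μ ν) ∨
  (Diag lt μ ν ∧ Never lt ν μ ∧ Diag E μ ν) ∨
  (Never lt μ ν ∧ Diag lt ν μ ∧ Diag E μ ν) ∨
  PlainMatching E lt μ ν

/-- The three types of vertical stars; `α i j` stands for the guard `a(i)`. -/
def IsVerticalStar (α : Fin 2 → Fin 2 → W) : Prop :=
  Never lt μ α ∧
  ((SameRow lt α μ ∧ Never E α μ) ∨ (SameRow lt α μ ∧ SameRow E α μ) ∨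
    (Never lt α μ ∧ SameRow E α μ))

/-- The three types of horizontal stars; `β i j` stands for the guard `b(j)`. -/
def IsHorizontalStar (β : Fin 2 → Fin 2 → W) : Prop :=
  Never lt μ β ∧
  ((SameCol lt β μ ∧ Never E β μ) ∨ (SameCol lt β μ ∧ SameCol E β μ) ∨
    (Never lt β μ ∧ SameCol E β μ))

end Pairs

section Cores

variable {t : CoreType} {h : ℕ}

/-- What is common to the cores of all types. -/
structure IsCoreCommon (E lt : TwistVertex t h 2 → TwistVertex t h 2 → Prop) : Prop where
  symm : ∀ x y, E x y → E y x
  loopless : ∀ x, ¬ E x x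
  treeOrder : IsTreeOrder lt TwistVertex.root
  /-- Each layer is contained in the `E`-neighbourhood of the root or disjoint from it. -/
  root_homogeneous : ∀ x y p, x.layer = some p → y.layer = some p →
    (E TwistVertex.root x ↔ E TwistVertex.root y)
  /-- Layers are independent, and only consecutive layers may be joined by `E`-edges. -/
  edge_consecutive : ∀ x y p q, x.layer = some p → y.layer = some q → E x y →
    p + 1 = q ∨ q + 1 = p

structure IsCoreOne (ht : t = CoreType.one)
    (E lt : TwistVertex t h 2 → TwistVertex t h 2 → Prop) : Prop where
  one_le : 1 ≤ h
  /-- Layers are antichains, and only consecutive layers may be comparable. -/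
  lt_consecutive : ∀ x y p q, x.layer = some p → y.layer = some q → lt x y →
    p + 1 = q ∨ q + 1 = p
  first : ∀ s : Fin h, s.1 = 0 →
    IsVerticalStar E lt (TwistVertex.mesh s) (fun i _ => TwistVertex.a ht i)
  middle : ∀ s s' : Fin h, s.1 + 1 = s'.1 →
    IsMatchingPair E lt (TwistVertex.mesh s) (TwistVertex.mesh s')
  last : ∀ s : Fin h, s.1 + 1 = h →
    IsHorizontalStar E lt (TwistVertex.mesh s) (fun _ j => TwistVertex.b ht j)

structure IsCoreTwo (E lt : TwistVertex t h 2 → TwistVertex t h 2 → Prop) : Prop where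
  two_le : 2 ≤ h
  /-- Only consecutive layers may contain comparable vertices of distinct layers. -/
  lt_consecutive : ∀ x y p q, x.layer = some p → y.layer = some q → lt x y →
    p = q ∨ p + 1 = q ∨ q + 1 = p
  order_first : ∀ s : Fin h, s.1 = 0 → ∀ i j i' j',
    lt (TwistVertex.mesh s i j) (TwistVertex.mesh s i' j') ↔ i = i' ∧ j < j'
  order_middle : ∀ s : Fin h, s.1 ≠ 0 → s.1 + 1 ≠ h →
    Never lt (TwistVertex.mesh s) (TwistVertex.mesh s)
  order_last : ∀ s : Fin h, s.1 + 1 = h → ∀ i j i' j',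
    lt (TwistVertex.mesh s i j) (TwistVertex.mesh s i' j') ↔ j = j' ∧ i < i'
  outer : ∀ s s' : Fin h, s.1 + 1 = s'.1 → (s.1 = 0 ∨ s'.1 + 1 = h) →
    PlainMatching E lt (TwistVertex.mesh s) (TwistVertex.mesh s')
  middle : ∀ s s' : Fin h, s.1 + 1 = s'.1 → s.1 ≠ 0 → s'.1 + 1 ≠ h →
    IsMatchingPair E lt (TwistVertex.mesh s) (TwistVertex.mesh s')

/-- `i < j`, or `j < i` if `rev`. -/
def revLT (rev : Bool) (i j : Fin 2) : Prop := if rev then j < i else i < j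

/-- `revI` and `revJ` select one of the four anti-lexicographic orders on the last layer:
columns first, increasing or decreasing, then rows, increasing or decreasing. -/
structure IsCoreThreeWith (revI revJ : Bool)
    (E lt : TwistVertex t h 2 → TwistVertex t h 2 → Prop) : Prop where
  two_le : 2 ≤ h
  order_first : ∀ s : Fin h, s.1 = 0 → ∀ i j i' j',
    lt (TwistVertex.mesh s i j) (TwistVertex.mesh s i' j') ↔ i < i' ∨ (i = i' ∧ j < j')
  order_middle : ∀ s : Fin h, s.1 ≠ 0 → s.1 + 1 ≠ h →
    Never lt (TwistVertex.mesh s) (TwistVertex.mesh s)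
  order_last : ∀ s : Fin h, s.1 + 1 = h → ∀ i j i' j',
    lt (TwistVertex.mesh s i j) (TwistVertex.mesh s i' j') ↔
      revLT revJ j j' ∨ (j = j' ∧ revLT revI i i')
  /-- Non-consecutive layers among `V(μ_2), …, V(μ_{h-1})` are incomparable. -/
  middle_far : ∀ s s' : Fin h, s.1 ≠ 0 → s'.1 ≠ 0 → s.1 + 1 ≠ h → s'.1 + 1 ≠ h →
    s.1 + 1 < s'.1 → Never lt (TwistVertex.mesh s) (TwistVertex.mesh s') ∧
      Never lt (TwistVertex.mesh s') (TwistVertex.mesh s)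
  not_lt_first : ∀ s s' : Fin h, s.1 = 0 → s'.1 ≠ 0 →
    Never lt (TwistVertex.mesh s') (TwistVertex.mesh s)
  not_lt_last : ∀ s s' : Fin h, s.1 + 1 = h → s'.1 ≠ 0 → s'.1 + 1 ≠ h →
    Never lt (TwistVertex.mesh s') (TwistVertex.mesh s)
  /-- A layer not consecutive to `V(μ_1)` is either greater than `V(μ_1)` or incomparable to it. -/
  first_far : ∀ s s' : Fin h, s.1 = 0 → 1 < s'.1 →
    Never lt (TwistVertex.mesh s) (TwistVertex.mesh s') ∨
      Always lt (TwistVertex.mesh s) (TwistVertex.mesh s')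
  /-- The same for `V(μ_h)` and the layers `V(μ_2), …, V(μ_{h-2})`. -/
  last_far : ∀ s s' : Fin h, s.1 + 1 = h → s'.1 ≠ 0 → s'.1 + 1 < s.1 →
    Never lt (TwistVertex.mesh s) (TwistVertex.mesh s') ∨
      Always lt (TwistVertex.mesh s) (TwistVertex.mesh s')
  /-- `(μ_1, μ_2)` is an `E`-matching, with possibly `V(μ_1) ≺ V(μ_2)`, or simply vertical. -/
  first : ∀ s s' : Fin h, s.1 = 0 → s'.1 = 1 →
    (Diag E (TwistVertex.mesh s) (TwistVertex.mesh s') ∧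
      (Never lt (TwistVertex.mesh s) (TwistVertex.mesh s') ∨
        Always lt (TwistVertex.mesh s) (TwistVertex.mesh s'))) ∨
    (Never E (TwistVertex.mesh s) (TwistVertex.mesh s') ∧
      ∀ i j i' j', lt (TwistVertex.mesh s i j) (TwistVertex.mesh s' i' j') ↔ i ≤ i')
  middle : ∀ s s' : Fin h, s.1 + 1 = s'.1 → s.1 ≠ 0 → s'.1 + 1 ≠ h →
    IsMatchingPair E lt (TwistVertex.mesh s) (TwistVertex.mesh s')
  /-- `(μ_{h-1}, μ_h)` is an `E`-matching, with possibly `V(μ_h) ≺ V(μ_{h-1})`, or simply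
  horizontal, in the direction of the order on the columns. -/
  last : ∀ s s' : Fin h, s.1 + 1 = s'.1 → s'.1 + 1 = h →
    (Diag E (TwistVertex.mesh s) (TwistVertex.mesh s') ∧
      (Never lt (TwistVertex.mesh s') (TwistVertex.mesh s) ∨
        Always lt (TwistVertex.mesh s') (TwistVertex.mesh s))) ∨
    (Never E (TwistVertex.mesh s) (TwistVertex.mesh s') ∧
      ∀ i j i' j', lt (TwistVertex.mesh s' i j) (TwistVertex.mesh s i' j') ↔
        j = j' ∨ revLT revJ j j')

end Cores

/-- A core: a tree-ordered graph on the vertices of a twist of order `2`, of one of three types. -/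
structure Core where
  type : CoreType
  h : ℕ
  E : TwistVertex type h 2 → TwistVertex type h 2 → Prop
  lt : TwistVertex type h 2 → TwistVertex type h 2 → Prop
  common : IsCoreCommon E lt
  isOne : ∀ ht : type = CoreType.one, IsCoreOne ht E lt
  isTwo : type = CoreType.two → IsCoreTwo E lt
  isThree : type = CoreType.three → ∃ revI revJ, IsCoreThreeWith revI revJ E lt

/-- `0` if `i ≤ i'` and `1` otherwise. The pair `(rank2 i i', rank2 i' i)` has the same order type
as `(i, i')`. -/
def rank2 (i i' : ℕ) : Fin 2 := if i' < i then 1 else 0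

/-- `τ[n]`, the regular extension of the core to order `n`: the relations between two vertices
are those between two vertices of the core in the same layers whose row indices and column indices
have the same order types. (Where a vertex has no row or no column, the relations of the core do
not depend on that index of the other vertex.) -/
def Core.twist (τ : Core) (n : ℕ) : TOStruct where
  V := TwistVertex τ.type τ.h n
  E := fun x y => τ.E (x.place (rank2 x.row y.row) (rank2 x.col y.col))
    (y.place (rank2 y.row x.row) (rank2 y.col x.col))
  lt := fun x y => τ.lt (x.place (rank2 x.row y.row) (rank2 x.col y.col))
    (y.place (rank2 y.row x.row) (rank2 y.col x.col))

/-! ### Bipartite graphs, groundings and racks -/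

/-- A finite bipartite graph with parts `A = Fin nA` and `B = Fin nB`. Read as an ordered bipartite
graph, its parts carry the natural linear orders. -/
structure BipGraph where
  nA : ℕ
  nB : ℕ
  adj : Fin nA → Fin nB → Bool

/-- The vertices of the `h`-subdivision of `G`, and a root. The vertex `sub i j _ k` is the
subdivision vertex at distance `k + 1` from `a i` on the path that replaces the edge `ij`. -/
inductive SubdivVertex (G : BipGraph) (h : ℕ) : Type
  | root
  | a (i : Fin G.nA)
  | sub (i : Fin G.nA) (j : Fin G.nB) (hij : G.adj i j = true) (k : Fin h)
  | b (j : Fin G.nB)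

namespace SubdivVertex

variable {G : BipGraph} {h : ℕ}

/-- `L_0 = A`, the layers of subdivision vertices `L_1, …, L_h`, and `L_{h+1} = B`. -/
def layer : SubdivVertex G h → Option ℕ
  | root => none
  | a _ => some 0
  | sub _ _ _ k => some (k.1 + 1)
  | b _ => some (h + 1)

/-- The `k`-th vertex (`0 ≤ k ≤ h + 1`) of the path that replaces the edge `ij`. -/
def onPath (h : ℕ) (i : Fin G.nA) (j : Fin G.nB) (hij : G.adj i j = true) :
    ℕ → SubdivVertex G h
  | 0 => a i
  | k + 1 => if hk : k < h then sub i j hij ⟨k, hk⟩ else b j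

/-- Adjacency in the `h`-subdivision of `G`. -/
def subdivAdj (x y : SubdivVertex G h) : Prop :=
  ∃ (i : Fin G.nA) (j : Fin G.nB) (hij : G.adj i j = true) (k : ℕ), k ≤ h ∧
    ((x = onPath h i j hij k ∧ y = onPath h i j hij (k + 1)) ∨
      (y = onPath h i j hij k ∧ x = onPath h i j hij (k + 1)))

/-- The `h`-subdivision of `G` together with a root adjacent to the layers with index in `N`. -/
def rootedAdj (N : Finset ℕ) (x y : SubdivVertex G h) : Prop :=
  subdivAdj x y ∨ (x = root ∧ ∃ p ∈ N, y.layer = some p) ∨ (y = root ∧ ∃ p ∈ N, x.layer = some p)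

/-- `max A` (and the root if `A` is empty). -/
def maxA (G : BipGraph) (h : ℕ) : SubdivVertex G h :=
  if hA : 0 < G.nA then a ⟨G.nA - 1, Nat.sub_lt hA Nat.one_pos⟩ else root

/-- `max B` (and the root if `B` is empty). -/
def maxB (G : BipGraph) (h : ℕ) : SubdivVertex G h :=
  if hB : 0 < G.nB then b ⟨G.nB - 1, Nat.sub_lt hB Nat.one_pos⟩ else root

/-- The predecessor function of a rack (its value at the root is irrelevant). -/
def pred (CA CB : Finset ℕ) : SubdivVertex G h → SubdivVertex G h
  | root => root
  | a ⟨0, _⟩ => root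
  | a ⟨i + 1, hi⟩ => a ⟨i, Nat.lt_of_succ_lt hi⟩
  | b ⟨0, _⟩ => if h + 1 ∈ CA then maxA G h else root
  | b ⟨j + 1, hj⟩ => b ⟨j, Nat.lt_of_succ_lt hj⟩
  | sub _ _ _ k => if k.1 + 1 ∈ CA then maxA G h else if k.1 + 1 ∈ CB then maxB G h else root

end SubdivVertex

structure GroundingParam where
  h : ℕ
  N : Finset ℕ
  N_sub : N ⊆ Finset.range (h + 2)

/-- The `(h, N)`-grounding of `G`. -/
def grounding (P : GroundingParam) (G : BipGraph) : TOStruct where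
  V := SubdivVertex G P.h
  E := SubdivVertex.rootedAdj P.N
  lt := fun x y => x = SubdivVertex.root ∧ y ≠ SubdivVertex.root

structure RackParam where
  h : ℕ
  N : Finset ℕ
  CA : Finset ℕ
  CB : Finset ℕ
  N_sub : N ⊆ Finset.range (h + 2)
  CA_sub : CA ⊆ Finset.Icc 1 (h + 1)
  CB_sub : CB ⊆ Finset.Icc 1 h
  disj : Disjoint CA CB

/-- The `(h, N, CA, CB)`-rack of the ordered bipartite graph `G`. -/
def rack (P : RackParam) (G : BipGraph) : TOStruct where
  V := SubdivVertex G P.h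
  E := SubdivVertex.rootedAdj P.N
  lt := Relation.TransGen fun x y => y ≠ SubdivVertex.root ∧ SubdivVertex.pred P.CA P.CB y = x

/-! ### Polynomial time

Random access machines with uniform cost whose only arithmetic operations are addition and
truncated subtraction, presented as structured programs, with random access to the input and
sequential output. -/

inductive RamProg : Type
  | skip
  | const (d c : ℕ)
  | add (d x y : ℕ)
  | sub (d x y : ℕ)
  | load (d x : ℕ)
  | store (d x : ℕ)
  | input (d x : ℕ)
  | output (x : ℕ)
  | seq (p q : RamProg)
  | ite (x : ℕ) (p q : RamProg)
  | loop (x : ℕ) (p : RamProg)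

structure RamState where
  mem : ℕ → ℕ
  out : List ℕ

def RamState.set (σ : RamState) (d v : ℕ) : RamState := ⟨Function.update σ.mem d v, σ.out⟩

/-- `RamRuns w p σ σ' k`: on input `w`, program `p` started in state `σ` halts in state `σ'` after
`k` steps. -/
inductive RamRuns (w : List ℕ) : RamProg → RamState → RamState → ℕ → Prop
  | skip (σ) : RamRuns w RamProg.skip σ σ 1
  | const (σ d c) : RamRuns w (RamProg.const d c) σ (σ.set d c) 1
  | add (σ d x y) : RamRuns w (RamProg.add d x y) σ (σ.set d (σ.mem x + σ.mem y)) 1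
  | sub (σ d x y) : RamRuns w (RamProg.sub d x y) σ (σ.set d (σ.mem x - σ.mem y)) 1
  | load (σ d x) : RamRuns w (RamProg.load d x) σ (σ.set d (σ.mem (σ.mem x))) 1
  | store (σ d x) : RamRuns w (RamProg.store d x) σ (σ.set (σ.mem d) (σ.mem x)) 1
  | input (σ d x) : RamRuns w (RamProg.input d x) σ (σ.set d (w.getD (σ.mem x) 0)) 1
  | output (σ x) : RamRuns w (RamProg.output x) σ ⟨σ.mem, σ.out ++ [σ.mem x]⟩ 1
  | seq {p q σ σ' σ'' k k'} : RamRuns w p σ σ' k → RamRuns w q σ' σ'' k' →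
      RamRuns w (RamProg.seq p q) σ σ'' (k + k')
  | ite_true {x p q σ σ' k} : σ.mem x ≠ 0 → RamRuns w p σ σ' k →
      RamRuns w (RamProg.ite x p q) σ σ' (k + 1)
  | ite_false {x p q σ σ' k} : σ.mem x = 0 → RamRuns w q σ σ' k →
      RamRuns w (RamProg.ite x p q) σ σ' (k + 1)
  | loop_done {x p σ} : σ.mem x = 0 → RamRuns w (RamProg.loop x p) σ σ 1
  | loop_step {x p σ σ' σ'' k k'} : σ.mem x ≠ 0 → RamRuns w p σ σ' k →
      RamRuns w (RamProg.loop x p) σ' σ'' k' → RamRuns w (RamProg.loop x p) σ σ'' (k + k' + 1)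

/-- `f` is computed by a program whose number of steps is bounded by a polynomial in the size of
the argument; arguments and values are given by the codes `enc` and `enc'`. -/
def PolyTimeComputable {α β : Type} (size : α → ℕ) (enc : α → List ℕ) (enc' : β → List ℕ)
    (f : α → β) : Prop :=
  ∃ (p : RamProg) (q : Polynomial ℕ), ∀ x : α, ∃ (σ : RamState) (k : ℕ),
    RamRuns (enc x) p ⟨fun _ => 0, []⟩ σ k ∧ σ.out = enc' (f x) ∧ k ≤ q.eval (size x)

/-- The entries of a Boolean matrix, row by row. -/
def matrixCode {m n : ℕ} (A : Fin m → Fin n → Bool) : List ℕ :=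
  (List.finRange m).flatMap fun i => (List.finRange n).map fun j => (A i j).toNat

/-- The number of vertices. -/
def BipGraph.size (G : BipGraph) : ℕ := G.nA + G.nB

def BipGraph.code (G : BipGraph) : List ℕ := G.nA :: G.nB :: matrixCode G.adj

/-- A `{E, ≺}`-structure with domain `Fin n`, given by two Boolean matrices. -/
structure CodedStruct where
  n : ℕ
  E : Fin n → Fin n → Bool
  lt : Fin n → Fin n → Bool

def CodedStruct.code (M : CodedStruct) : List ℕ := M.n :: (matrixCode M.E ++ matrixCode M.lt)

def CodedStruct.toStruct (M : CodedStruct) : TOStruct where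
  V := Fin M.n
  E := fun x y => M.E x y = true
  lt := fun x y => M.lt x y = true

/-! The relations between two vertices of a twist depend only on their layers and on how their rows
and their columns compare. A host is therefore described by a layout, which assigns a layer, a row
and a column to each of its vertices: every mesh layer has one cell for each edge `ij` of `G`, in
row `2 + 3 * i` and column `2 + 3 * j` (up to reversing the columns in type 3), and each vertex of
`G` gets a bounded number of side vertices. A host is an induced substructure, with the root, of a
twist of order `3 * nA + 3 * nB + 4` (`Core.IsLayout.isInducedSub`), so it lies in every hereditary
class that contains the twists. Its matrices are computed by nested loops that compare linear
functions of the indices and look up a fixed table (`Core.polyTime_host`).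

For the minor, the cells of an edge `ij`, taken through the layers, lead from the end `i` to the end
`j`, and consecutive cells are joined by an edge or by the order. The tree-order axioms and the
incomparability of distant layers force the layers linked by the order into groups of at most three
consecutive layers, each with exactly one minimal layer (`LayerPath`). Contracting each group to its
minimal layer turns the paths into those of a subdivision of `G`, and the root becomes adjacent to
whole layers of it (`IsPathHost.rootedAdj_iff`). `TOStruct.shrink_iso` reduces an isomorphism with a
minor to knowing the kept vertices and the contraction.

In type 1 the guards are the ends of the paths. In type 2 the side vertex of an end lies at the
bottom of the chain formed by its row of `μ_1` or its column of `μ_h`. In both types the vertices to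
keep are those with only the root below, and nothing is deleted (`IsPathHost.grounding_iso`).

In type 3 the first and the last layer are single chains, which a formula has to cut into rows
(columns). Each row gets a kept vertex at its start, then come its cells, then two marks `1` and
`2`. A vertex of family `3` sits in the layer next to the chain: it is adjacent to the mark `1` or,
if that layer is simply vertical (horizontal) over the chain, it covers the mark `1`. The mark `2`
is bare, that is, without neighbours other than the root, and it covers the mark `1`, which is not
bare or has another cover that is a bare leaf; this makes the mark `2` `Terminal`. The vertices that
cover only the root and terminal vertices, called `Initial`, are then the kept ones among the
vertices that are not deleted, and the vertices of family `3` that are joined to a mark by an edge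
are recognised as `Pendant` and deleted (`RackFrame.initial_iff`, `RackFrame.pendant_iff`). The rest
of a row is contracted to its kept vertex, while a layer above an entire chain keeps that relation,
and the result is a rack (`RackFrame.shrink_iso_rack`). Both chains are treated at once: the core is
abstracted to a `RackFrame`, in which a Boolean `t` exchanges rows and columns. A core of type 3
with two layers has no room for family `3` and needs no marks. -/

/-! ### First-order definability -/

section Definability

open FirstOrder FirstOrder.Language

/-- A property of valuations of the variables `0, 1, 2, …` that is defined by a formula. -/
def FODef (P : ∀ M : TOStruct, (ℕ → M.V) → Prop) : Prop :=
  ∃ φ : toLang.Formula ℕ, ∀ (M : TOStruct) (v : ℕ → M.V), φ.Realize v ↔ P M v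

namespace FODef

variable {P Q : ∀ M : TOStruct, (ℕ → M.V) → Prop}

theorem congr (hP : FODef P) (h : ∀ M v, P M v ↔ Q M v) : FODef Q := by
  obtain ⟨φ, hφ⟩ := hP
  exact ⟨φ, fun M v => (hφ M v).trans (h M v)⟩

theorem edge (i j : ℕ) : FODef fun M v => M.E (v i) (v j) :=
  ⟨Relations.formula₂ (L := toLang) (TORel.edge : toLang.Relations 2)
    (Term.var i) (Term.var j), fun _ _ => Formula.realize_rel₂⟩

theorem lt (i j : ℕ) : FODef fun M v => M.lt (v i) (v j) :=
  ⟨Relations.formula₂ (L := toLang) (TORel.lt : toLang.Relations 2)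
    (Term.var i) (Term.var j), fun _ _ => Formula.realize_rel₂⟩

theorem eq (i j : ℕ) : FODef fun _ v => v i = v j :=
  ⟨Term.equal (L := toLang) (Term.var i) (Term.var j), fun _ _ => by
    rw [Formula.realize_equal]; exact Iff.rfl⟩

theorem neg (hP : FODef P) : FODef fun M v => ¬ P M v := by
  obtain ⟨φ, hφ⟩ := hP
  exact ⟨φ.not, fun M v => by rw [Formula.realize_not, hφ]⟩

theorem imp (hP : FODef P) (hQ : FODef Q) : FODef fun M v => P M v → Q M v := by
  obtain ⟨φ, hφ⟩ := hP
  obtain ⟨ψ, hψ⟩ := hQ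
  exact ⟨φ.imp ψ, fun M v => by rw [Formula.realize_imp, hφ, hψ]⟩

theorem or (hP : FODef P) (hQ : FODef Q) : FODef fun M v => P M v ∨ Q M v :=
  (hP.neg.imp hQ).congr fun _ _ => by tauto

theorem and (hP : FODef P) (hQ : FODef Q) : FODef fun M v => P M v ∧ Q M v :=
  (hP.imp hQ.neg).neg.congr fun _ _ => by tauto

theorem ex (i : ℕ) (hP : FODef P) : FODef fun M v => ∃ x, P M (Function.update v i x) := by
  obtain ⟨φ, hφ⟩ := hP
  -- Variable `i` becomes the only bound variable and the others stay free, so the quantifier ranges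
  -- over exactly the value that `Function.update` overwrites.
  refine ⟨(BoundedFormula.relabel (n := 1) (k := 0)
    (fun m => if m = i then Sum.inr 0 else Sum.inl m) φ).ex, fun M v => ?_⟩
  unfold Formula.Realize
  rw [BoundedFormula.realize_ex]
  refine exists_congr fun x => ?_
  rw [BoundedFormula.realize_relabel, ← hφ]
  unfold Formula.Realize
  refine iff_of_eq (congrArg₂ _ (funext fun m => ?_) (Subsingleton.elim _ _))
  by_cases h : m = i <;> simp [h, Fin.snoc]

theorem all (i : ℕ) (hP : FODef P) : FODef fun M v => ∀ x, P M (Function.update v i x) :=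
  (hP.neg.ex i).neg.congr fun _ _ => by simp

theorem isRoot (i : ℕ) : FODef fun M v => M.IsRoot (v i) :=
  (((eq (i + 1) i).neg.imp (lt i (i + 1))).all (i + 1)).congr fun M v => by
    simp [TOStruct.IsRoot]

end FODef

/-- A definable property of vertices. -/
def IsFOProperty (Q : ∀ M : TOStruct, M.V → Prop) : Prop :=
  ∃ φ : toLang.Formula Unit, ∀ (M : TOStruct) (x : M.V), φ.Realize (fun _ => x) ↔ Q M x

theorem FODef.isFOProperty {Q : ∀ M : TOStruct, M.V → Prop}
    (h : FODef fun M v => Q M (v 0)) : IsFOProperty Q := by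
  obtain ⟨φ, hφ⟩ := h
  exact ⟨φ.relabel fun _ => (), fun M x => by
    rw [Formula.realize_relabel, hφ]; rfl⟩

/-! ### Vertex properties from which the minors are defined -/

namespace TOStruct

variable (M : TOStruct)

/-- `u` is covered by `x`. -/
def Cov (u x : M.V) : Prop := M.lt u x ∧ ∀ z, M.lt u z → ¬ M.lt z x

/-- No vertex other than the root is adjacent to `x`. -/
def Bare (x : M.V) : Prop := ∀ y, M.E x y → M.IsRoot y

def Leaf (x : M.V) : Prop := ∀ y, ¬ M.lt x y

/-- The bare vertices that cover a non-bare vertex, or a vertex with another bare leaf as cover. -/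
def Terminal (p : M.V) : Prop :=
  M.Bare p ∧ ∃ u, ¬ M.IsRoot u ∧ M.Cov u p ∧
    (¬ M.Bare u ∨ ∃ q, q ≠ p ∧ M.Cov u q ∧ M.Bare q ∧ M.Leaf q)

/-- The vertices which cover only the root and terminal vertices. -/
def Initial (x : M.V) : Prop := ∀ u, M.Cov u x → M.IsRoot u ∨ M.Terminal u

/-- The vertices which have a neighbour, other than the root, that is covered by a bare vertex. -/
def Pendant (x : M.V) : Prop :=
  ¬ M.IsRoot x ∧ ∃ c, ¬ M.IsRoot c ∧ M.E x c ∧ ∃ u, M.Cov c u ∧ M.Bare u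

/-- Only the root is below `x`. -/
def Low (x : M.V) : Prop := ∀ u, M.lt u x → M.IsRoot u

end TOStruct

namespace FODef

/-- The quantified variable `i + j + 1` exceeds both `i` and `j`, which are arbitrary, so it
captures neither. -/
theorem cov (i j : ℕ) : FODef fun M v => M.Cov (v i) (v j) :=
  ((lt i j).and (((lt i (i + j + 1)).imp (lt (i + j + 1) j).neg).all (i + j + 1))).congr
    fun M v => by
      have h1 : i ≠ i + j + 1 := by omega
      have h2 : j ≠ i + j + 1 := by omega
      simp [TOStruct.Cov, h1, h2]

theorem bare (i : ℕ) : FODef fun M v => M.Bare (v i) :=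
  (((edge i (i + 1)).imp (isRoot (i + 1))).all (i + 1)).congr fun M v => by
    simp [TOStruct.Bare]

theorem leaf (i : ℕ) : FODef fun M v => M.Leaf (v i) :=
  ((lt i (i + 1)).neg.all (i + 1)).congr fun M v => by simp [TOStruct.Leaf]

theorem terminal (i : ℕ) : FODef fun M v => M.Terminal (v i) :=
  ((bare i).and (((isRoot (i + 1)).neg.and ((cov (i + 1) i).and ((bare (i + 1)).neg.or
    (((eq (i + 2) i).neg.and ((cov (i + 1) (i + 2)).and
      ((bare (i + 2)).and (leaf (i + 2))))).ex (i + 2))))).ex (i + 1))).congr fun M v => by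
        simp [TOStruct.Terminal]

theorem initial (i : ℕ) : FODef fun M v => M.Initial (v i) :=
  (((cov (i + 1) i).imp ((isRoot (i + 1)).or (terminal (i + 1)))).all (i + 1)).congr
    fun M v => by simp [TOStruct.Initial]

theorem pendant (i : ℕ) : FODef fun M v => M.Pendant (v i) :=
  ((isRoot i).neg.and (((isRoot (i + 1)).neg.and ((edge i (i + 1)).and
    (((cov (i + 1) (i + 2)).and (bare (i + 2))).ex (i + 2)))).ex (i + 1))).congr
      fun M v => by simp [TOStruct.Pendant]

theorem low (i : ℕ) : FODef fun M v => M.Low (v i) :=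
  (((lt (i + 1) i).imp (isRoot (i + 1))).all (i + 1)).congr fun M v => by simp [TOStruct.Low]

/-- The deletion predicate of the minors that only contract. -/
theorem never : FODef fun _ _ => False :=
  ((eq 0 0).and (eq 0 0).neg).congr fun _ _ => by simp

end FODef

theorem exists_definableMinor {S D : ∀ M : TOStruct, M.V → Prop} (hS : IsFOProperty S)
    (hD : IsFOProperty D) : ∃ I : DefinableMinor, ∀ M, I.apply M = M.shrink (S M) (D M) := by
  obtain ⟨φ, hφ⟩ := hS
  obtain ⟨ψ, hψ⟩ := hD
  refine ⟨⟨φ, ψ⟩, fun M => ?_⟩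
  unfold DefinableMinor.apply
  congr 1
  · funext x; exact propext (hφ M x)
  · funext x; exact propext (hψ M x)

end Definability

/-! ### Invariance of definable minors under isomorphism -/

namespace TOStruct

theorem Iso.trans {M N K : TOStruct} (h : M.Iso N) (h' : N.Iso K) : M.Iso K := by
  obtain ⟨e, h1, h2⟩ := h
  obtain ⟨f, h3, h4⟩ := h'
  exact ⟨e.trans f, fun x y => (h1 x y).trans (h3 _ _), fun x y => (h2 x y).trans (h4 _ _)⟩

theorem isRoot_equiv {M N : TOStruct} (e : M.V ≃ N.V) (hlt : ∀ x y, M.lt x y ↔ N.lt (e x) (e y))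
    (x : M.V) : N.IsRoot (e x) ↔ M.IsRoot x := by
  unfold IsRoot
  constructor
  · intro h y hy
    exact (hlt x y).2 (h (e y) (by simpa using hy))
  · intro h y hy
    have := (hlt x (e.symm y)).1 (h _ (by rintro rfl; simp at hy))
    simpa using this

/-- Isomorphisms preserve formulas. -/
theorem realize_iso {M N : TOStruct} (e : M.V ≃ N.V) (hE : ∀ x y, M.E x y ↔ N.E (e x) (e y))
    (hlt : ∀ x y, M.lt x y ↔ N.lt (e x) (e y)) (φ : toLang.Formula Unit) (x : M.V) :
    φ.Realize (fun _ => e x) ↔ φ.Realize (fun _ => x) := by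
  let E : toLang.Equiv M.V N.V :=
    { e with
      map_fun' := fun f => Empty.elim f
      map_rel' := fun r => by
        cases r
        · exact fun v => (hE (v 0) (v 1)).symm
        · exact fun v => (hlt (v 0) (v 1)).symm }
  exact FirstOrder.Language.StrongHomClass.realize_formula E φ (v := fun _ => x)

/-- Hosts are output as structures on `Fin n`, whereas their minors are analysed on structures with
named vertices. Formulas transfer along an isomorphism, and `Kept` and the contraction are defined
from them and the relations. -/
theorem apply_iso {M N : TOStruct} (h : M.Iso N) (I : DefinableMinor) :
    (I.apply M).Iso (I.apply N) := by
  obtain ⟨e, hE, hlt⟩ := h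
  have hr := isRoot_equiv e hlt
  have hS := fun x => realize_iso e hE hlt I.formS x
  have hD := fun x => realize_iso e hE hlt I.formD x
  have hk : ∀ x, M.Kept (fun x => I.formS.Realize fun _ => x)
      (fun x => I.formD.Realize fun _ => x) x ↔ N.Kept (fun x => I.formS.Realize fun _ => x)
      (fun x => I.formD.Realize fun _ => x) (e x) := fun x => by
    simp only [Kept, hr, hS, hD]
  refine ⟨e.subtypeEquiv hk, fun x y => and_congr
    (not_congr (e.subtypeEquiv hk).injective.eq_iff.symm) ?_, fun x y => hlt _ _⟩
  obtain ⟨x, hx⟩ := x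
  obtain ⟨y, hy⟩ := y
  rw [e.surjective.exists]
  refine exists_congr fun x' => ?_
  rw [e.surjective.exists]
  refine exists_congr fun y' => ?_
  rw [e.surjective.forall]
  have h1 : ((e.subtypeEquiv hk) ⟨x, hx⟩).1 = e x := rfl
  have h2 : ((e.subtypeEquiv hk) ⟨y, hy⟩).1 = e y := rfl
  erw [h1, h2]
  simp only [EmbeddingLike.apply_eq_iff_eq, ← hE, ← hlt, hr, hD, ← hk]

end TOStruct

/-! ### Structured programming on random access machines -/

section Ram

open Polynomial

/-- The variables of a program are kept in the odd registers; register `0` is a counter. -/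
def RamState.env (σ : RamState) (r : ℕ) : ℕ := σ.mem (2 * r + 1)

/-- The input, and the first `m` variables, are bounded by `N`. -/
def RamBounded (w : List ℕ) (e : ℕ → ℕ) (m N : ℕ) : Prop :=
  (∀ x ∈ w, x ≤ N) ∧ ∀ r < m, e r ≤ N

theorem RamBounded.mono {w : List ℕ} {e : ℕ → ℕ} {m m' N : ℕ} (h : RamBounded w e m N)
    (hm : m' ≤ m) : RamBounded w e m' N :=
  ⟨h.1, fun r hr => h.2 r (hr.trans_le hm)⟩

theorem RamBounded.congr {w : List ℕ} {e e' : ℕ → ℕ} {m N : ℕ} (h : RamBounded w e m N)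
    (he : ∀ r < m, e r = e' r) : RamBounded w e' m N :=
  ⟨h.1, fun r hr => he r hr ▸ h.2 r hr⟩

/-- `f` is a polynomially bounded function of the input and of the first `m` variables, and can be
computed in polynomial time into any register `l` beyond these variables, without changing smaller
registers. -/
structure RamEx (m : ℕ) (f : List ℕ → (ℕ → ℕ) → ℕ) : Prop where
  dep : ∀ w e e', (∀ r < m, e r = e' r) → f w e = f w e'
  bound : ∃ v : ℕ[X], ∀ w e N, RamBounded w e m N → f w e ≤ v.eval N
  run : ∀ l, 2 * m + 1 ≤ l → ∃ (p : RamProg) (c : ℕ[X]), ∀ w σ N, RamBounded w σ.env m N →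
    ∃ σ' k, RamRuns w p σ σ' k ∧ k ≤ c.eval N ∧ σ'.out = σ.out ∧ σ'.mem l = f w σ.env ∧
      ∀ r < l, σ'.mem r = σ.mem r

/-- What `RamCmd` does with a list of numbers: append it to the output, or add its length to the
counter. -/
def RamEffect (count : Bool) (σ σ' : RamState) (g : List ℕ) : Prop :=
  if count then σ'.out = σ.out ∧ σ'.mem 0 = σ.mem 0 + g.length
  else σ'.out = σ.out ++ g ∧ σ'.mem 0 = σ.mem 0

theorem RamEffect.nil {count : Bool} {σ σ' : RamState} (h : σ'.out = σ.out)
    (h0 : σ'.mem 0 = σ.mem 0) : RamEffect count σ σ' [] := by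
  cases count <;> simp [RamEffect, h, h0]

theorem RamEffect.trans {count : Bool} {σ σ' σ'' : RamState} {g g' : List ℕ}
    (h : RamEffect count σ σ' g) (h' : RamEffect count σ' σ'' g') :
    RamEffect count σ σ'' (g ++ g') := by
  cases count <;> simp_all [RamEffect, Nat.add_assoc]

/-- The list `g` can be output (or counted) in polynomial time without changing the first `m`
variables. -/
structure RamCmd (count : Bool) (m : ℕ) (g : List ℕ → (ℕ → ℕ) → List ℕ) : Prop where
  dep : ∀ w e e', (∀ r < m, e r = e' r) → g w e = g w e'
  run : ∃ (p : RamProg) (c : ℕ[X]), ∀ w σ N, RamBounded w σ.env m N →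
    ∃ σ' k, RamRuns w p σ σ' k ∧ k ≤ c.eval N ∧ RamEffect count σ σ' (g w σ.env) ∧
      ∀ r, 0 < r → r < 2 * m + 1 → σ'.mem r = σ.mem r

theorem RamState.set_self (σ : RamState) (d v : ℕ) : (σ.set d v).mem d = v := by
  simp [RamState.set]

theorem RamState.set_ne (σ : RamState) {d r : ℕ} (v : ℕ) (h : r ≠ d) :
    (σ.set d v).mem r = σ.mem r := by
  simp [RamState.set, h]

/-- A loop whose `n` rounds take at most `C` steps each. -/
theorem ramRuns_loop {w : List ℕ} {x : ℕ} {p : RamProg} {n C : ℕ}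
    (Inv : ℕ → RamState → Prop)
    (step : ∀ k < n, ∀ σ, Inv k σ → σ.mem x ≠ 0 ∧
      ∃ σ' t, RamRuns w p σ σ' t ∧ t ≤ C ∧ Inv (k + 1) σ')
    (halts : ∀ σ, Inv n σ → σ.mem x = 0) :
    ∀ σ, Inv 0 σ → ∃ σ' t, RamRuns w (RamProg.loop x p) σ σ' t ∧ t ≤ n * (C + 1) + 1 ∧
      Inv n σ' := by
  -- Induction on the number `d` of rounds still to run, for an arbitrary current round `k`.
  suffices h : ∀ d k, k + d = n → ∀ σ, Inv k σ → ∃ σ' t, RamRuns w (RamProg.loop x p) σ σ' t ∧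
      t ≤ d * (C + 1) + 1 ∧ Inv n σ' from fun σ hσ => h n 0 (by omega) σ hσ
  intro d
  induction d with
  | zero =>
    rintro k rfl σ hσ
    exact ⟨σ, 1, RamRuns.loop_done (halts σ hσ), by simp, hσ⟩
  | succ d ih =>
    intro k hk σ hσ
    obtain ⟨h0, σ', t, hr, ht, hI⟩ := step k (by omega) σ hσ
    obtain ⟨σ'', t', hr', ht', hI'⟩ := ih (k + 1) (by omega) σ' hI
    exact ⟨σ'', _, RamRuns.loop_step h0 hr hr', by linarith [Nat.succ_mul d (C + 1)], hI'⟩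

namespace RamEx

variable {m : ℕ} {f g : List ℕ → (ℕ → ℕ) → ℕ}

theorem const (m c : ℕ) : RamEx m fun _ _ => c where
  dep _ _ _ _ := rfl
  bound := ⟨C c, fun _ _ _ _ => by simp⟩
  run l _ := ⟨.const l c, 1, fun _ σ _ _ => ⟨_, _, .const σ l c, by simp, rfl,
    σ.set_self l c, fun _ hr => σ.set_ne c hr.ne⟩⟩

theorem var {m r : ℕ} (hr : r < m) : RamEx m fun _ e => e r where
  dep _ _ _ h := h r hr
  bound := ⟨X, fun _ _ _ h => by simpa using h.2 r hr⟩
  run l hl := by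
    -- For lack of a copy instruction, register `l` is cleared and the variable is added to it. As
    -- `2 * r + 1 < l`, clearing does not destroy the variable.
    refine ⟨.seq (.const l 0) (.add l (2 * r + 1) l), 2, fun w σ N _ =>
      ⟨_, _, .seq (.const σ l 0) (.add _ l (2 * r + 1) l), by simp, rfl, ?_, fun s hs => ?_⟩⟩
    · rw [RamState.set_self, RamState.set_self, RamState.set_ne _ _ (by omega)]; rfl
    · rw [RamState.set_ne _ _ hs.ne, RamState.set_ne _ _ hs.ne]

theorem mono {m' : ℕ} (hf : RamEx m f) (h : m ≤ m') : RamEx m' f where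
  dep w e e' he := hf.dep w e e' fun r hr => he r (hr.trans_le h)
  bound := hf.bound.imp fun _ hv w e N hb => hv w e N (hb.mono h)
  run l hl := by
    obtain ⟨p, c, hp⟩ := hf.run l (by omega)
    exact ⟨p, c, fun w σ N hb => hp w σ N (hb.mono h)⟩

/-- Two expressions computed into consecutive registers. -/
theorem run_pair (hf : RamEx m f) (hg : RamEx m g) (l : ℕ) (hl : 2 * m + 1 ≤ l) :
    ∃ (p : RamProg) (c : ℕ[X]), ∀ w σ N, RamBounded w σ.env m N →
      ∃ σ' k, RamRuns w p σ σ' k ∧ k ≤ c.eval N ∧ σ'.out = σ.out ∧ σ'.mem l = f w σ.env ∧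
        σ'.mem (l + 1) = g w σ.env ∧ ∀ r < l, σ'.mem r = σ.mem r := by
  obtain ⟨p, c, hp⟩ := hf.run l hl
  -- The second program changes no register below `l + 1`, so the first value survives in `l`.
  obtain ⟨p', c', hp'⟩ := hg.run (l + 1) (by omega)
  refine ⟨.seq p p', c + c', fun w σ N hb => ?_⟩
  obtain ⟨σ₁, k₁, h₁, hk₁, ho₁, hl₁, hr₁⟩ := hp w σ N hb
  have he : ∀ r < m, σ.env r = σ₁.env r := fun r hr => (hr₁ _ (by omega)).symm
  obtain ⟨σ₂, k₂, h₂, hk₂, ho₂, hl₂, hr₂⟩ := hp' w σ₁ N (hb.congr he)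
  refine ⟨σ₂, _, .seq h₁ h₂, by simpa using Nat.add_le_add hk₁ hk₂, ho₂.trans ho₁, ?_, ?_, ?_⟩
  · rw [hr₂ l (by omega), hl₁]
  · rw [hl₂, hg.dep w _ _ he]
  · intro r hr
    rw [hr₂ r (by omega), hr₁ r hr]

theorem add (hf : RamEx m f) (hg : RamEx m g) : RamEx m fun w e => f w e + g w e where
  dep w e e' h := by rw [hf.dep w e e' h, hg.dep w e e' h]
  bound := by
    obtain ⟨v, hv⟩ := hf.bound
    obtain ⟨u, hu⟩ := hg.bound
    exact ⟨v + u, fun w e N h => by simpa using Nat.add_le_add (hv w e N h) (hu w e N h)⟩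
  run l hl := by
    obtain ⟨p, c, hp⟩ := run_pair hf hg l hl
    refine ⟨.seq p (.add l l (l + 1)), c + 1, fun w σ N hb => ?_⟩
    obtain ⟨σ₁, k, h, hk, ho, h1, h2, hr⟩ := hp w σ N hb
    refine ⟨_, _, .seq h (.add σ₁ l l (l + 1)), by simpa using hk, ho, ?_, fun r hr' => ?_⟩
    · rw [RamState.set_self, h1, h2]
    · rw [RamState.set_ne _ _ hr'.ne, hr r hr']

theorem sub (hf : RamEx m f) (hg : RamEx m g) : RamEx m fun w e => f w e - g w e where
  dep w e e' h := by rw [hf.dep w e e' h, hg.dep w e e' h]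
  bound := by
    obtain ⟨v, hv⟩ := hf.bound
    exact ⟨v, fun w e N h => (Nat.sub_le _ _).trans (hv w e N h)⟩
  run l hl := by
    obtain ⟨p, c, hp⟩ := run_pair hf hg l hl
    refine ⟨.seq p (.sub l l (l + 1)), c + 1, fun w σ N hb => ?_⟩
    obtain ⟨σ₁, k, h, hk, ho, h1, h2, hr⟩ := hp w σ N hb
    refine ⟨_, _, .seq h (.sub σ₁ l l (l + 1)), by simpa using hk, ho, ?_, fun r hr' => ?_⟩
    · rw [RamState.set_self, h1, h2]
    · rw [RamState.set_ne _ _ hr'.ne, hr r hr']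

theorem input (hf : RamEx m f) : RamEx m fun w e => w.getD (f w e) 0 where
  dep w e e' h := by rw [hf.dep w e e' h]
  bound := by
    refine ⟨X, fun w e N h => ?_⟩
    rw [eval_X, List.getD_eq_getElem?_getD]
    rcases hx : w[f w e]? with _ | x
    · simp
    · exact h.1 x (List.mem_of_getElem? hx)
  run l hl := by
    obtain ⟨p, c, hp⟩ := hf.run l hl
    refine ⟨.seq p (.input l l), c + 1, fun w σ N hb => ?_⟩
    obtain ⟨σ₁, k, h, hk, ho, h1, hr⟩ := hp w σ N hb
    refine ⟨_, _, .seq h (.input σ₁ l l), by simpa using hk, ho, ?_, fun r hr' => ?_⟩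
    · rw [RamState.set_self, h1]
    · rw [RamState.set_ne _ _ hr'.ne, hr r hr']

theorem ite {c : List ℕ → (ℕ → ℕ) → ℕ} (hc : RamEx m c) (hf : RamEx m f) (hg : RamEx m g) :
    RamEx m fun w e => if c w e ≠ 0 then f w e else g w e where
  dep w e e' h := by rw [hc.dep w e e' h, hf.dep w e e' h, hg.dep w e e' h]
  bound := by
    obtain ⟨v, hv⟩ := hf.bound
    obtain ⟨u, hu⟩ := hg.bound
    refine ⟨v + u, fun w e N h => ?_⟩
    have h1 := hv w e N h
    have h2 := hu w e N h
    rw [eval_add]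
    split_ifs <;> omega
  run l hl := by
    obtain ⟨p, c₀, hp⟩ := hc.run l hl
    obtain ⟨p₁, c₁, hp₁⟩ := hf.run l hl
    obtain ⟨p₂, c₂, hp₂⟩ := hg.run l hl
    refine ⟨.seq p (.ite l p₁ p₂), c₀ + c₁ + c₂ + 1, fun w σ N hb => ?_⟩
    obtain ⟨σ', k, h, hk, ho, h1, hr⟩ := hp w σ N hb
    have he : ∀ r < m, σ.env r = σ'.env r := fun r hr' => (hr _ (by omega)).symm
    obtain ⟨σ₁, k₁, g₁, hk₁, ho₁, l₁, hr₁⟩ := hp₁ w σ' N (hb.congr he)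
    obtain ⟨σ₂, k₂, g₂, hk₂, ho₂, l₂, hr₂⟩ := hp₂ w σ' N (hb.congr he)
    by_cases h0 : c w σ.env = 0
    · refine ⟨σ₂, _, .seq h (.ite_false (h1.trans h0) g₂), ?_, ho₂.trans ho, ?_, fun r hr' => ?_⟩
      · simp only [eval_add, eval_one]; omega
      · rw [l₂, if_neg (by simpa using h0), hg.dep w _ _ he]
      · rw [hr₂ r hr', hr r hr']
    · refine ⟨σ₁, _, .seq h (.ite_true (by rwa [h1]) g₁), ?_, ho₁.trans ho, ?_, fun r hr' => ?_⟩
      · simp only [eval_add, eval_one]; omega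
      · rw [l₁, if_pos h0, hf.dep w _ _ he]
      · rw [hr₁ r hr', hr r hr']

theorem mul (hf : RamEx m f) (hg : RamEx m g) : RamEx m fun w e => f w e * g w e where
  dep w e e' h := by rw [hf.dep w e e' h, hg.dep w e e' h]
  bound := by
    obtain ⟨v, hv⟩ := hf.bound
    obtain ⟨u, hu⟩ := hg.bound
    exact ⟨v * u, fun w e N h => by simpa using Nat.mul_le_mul (hv w e N h) (hu w e N h)⟩
  run l hl := by
    -- Repeated addition: `l` accumulates, `l + 1` counts down from the first factor, `l + 2` holds
    -- the second factor and `l + 3` the constant `1`. The polynomial bound of the first factor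
    -- bounds the number of rounds, of four steps each.
    obtain ⟨p, c, hp⟩ := run_pair hf hg (l + 1) (by omega)
    obtain ⟨v, hv⟩ := hf.bound
    refine ⟨.seq p (.seq (.const l 0) (.loop (l + 1) (.seq (.add l l (l + 2))
      (.seq (.const (l + 3) 1) (.sub (l + 1) (l + 1) (l + 3)))))), c + v * 4 + 2,
      fun w σ N hb => ?_⟩
    obtain ⟨σ₁, k, h, hk, ho, h1, h2, hr⟩ := hp w σ N hb
    obtain ⟨σ₂, t, hrun, ht, hI⟩ := ramRuns_loop (w := w) (x := l + 1)
      (p := .seq (.add l l (l + 2)) (.seq (.const (l + 3) 1) (.sub (l + 1) (l + 1) (l + 3))))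
      (n := f w σ.env) (C := 3)
      (fun i τ => τ.mem (l + 1) = f w σ.env - i ∧ τ.mem l = i * g w σ.env ∧
        τ.mem (l + 2) = g w σ.env ∧ τ.out = σ.out ∧ ∀ r < l, τ.mem r = σ.mem r)
      (fun i hi τ ⟨a1, a2, a3, a4, a5⟩ => ⟨by omega, _, _,
        .seq (.add τ _ _ _) (.seq (.const _ _ _) (.sub _ _ _ _)), le_refl _, by
          rw [RamState.set_self, RamState.set_ne _ _ (by omega), RamState.set_ne _ _ (by omega),
            RamState.set_self, a1]; omega, by
          rw [RamState.set_ne _ _ (by omega), RamState.set_ne _ _ (by omega), RamState.set_self,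
            a2, a3]; ring, by
          rw [RamState.set_ne _ _ (by omega), RamState.set_ne _ _ (by omega),
            RamState.set_ne _ _ (by omega), a3], a4, fun r hr' => by
          rw [RamState.set_ne _ _ (by omega), RamState.set_ne _ _ (by omega),
            RamState.set_ne _ _ (by omega), a5 r hr']⟩)
      (fun τ hτ => by rw [hτ.1]; omega) (σ₁.set l 0)
      ⟨by rw [RamState.set_ne _ _ (by omega), h1]; rfl, by rw [RamState.set_self]; simp, by
        rw [RamState.set_ne _ _ (by omega), h2], ho, fun r hr' => by
        rw [RamState.set_ne _ _ (by omega), hr r (by omega)]⟩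
    refine ⟨σ₂, _, .seq h (.seq (.const σ₁ l 0) hrun), ?_, hI.2.2.2.1, hI.2.1, hI.2.2.2.2⟩
    have := hv w σ.env N hb
    simp only [eval_add, eval_mul, eval_ofNat]
    omega

end RamEx

namespace RamCmd

variable {count : Bool} {m : ℕ} {g g' : List ℕ → (ℕ → ℕ) → List ℕ}

theorem nil (count : Bool) (m : ℕ) : RamCmd count m fun _ _ => [] where
  dep _ _ _ _ := rfl
  run := ⟨.skip, 1, fun _ σ _ _ => ⟨σ, 1, .skip σ, by simp, .nil rfl rfl, fun _ _ _ => rfl⟩⟩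

theorem append (hg : RamCmd count m g) (hg' : RamCmd count m g') :
    RamCmd count m fun w e => g w e ++ g' w e where
  dep w e e' h := by rw [hg.dep w e e' h, hg'.dep w e e' h]
  run := by
    obtain ⟨p, c, hp⟩ := hg.run
    obtain ⟨p', c', hp'⟩ := hg'.run
    refine ⟨.seq p p', c + c', fun w σ N hb => ?_⟩
    obtain ⟨σ₁, k₁, h₁, hk₁, ho₁, hr₁⟩ := hp w σ N hb
    have he : ∀ r < m, σ.env r = σ₁.env r := fun r hr => (hr₁ _ (by omega) (by omega)).symm
    obtain ⟨σ₂, k₂, h₂, hk₂, ho₂, hr₂⟩ := hp' w σ₁ N (hb.congr he)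
    refine ⟨σ₂, _, .seq h₁ h₂, by simpa using Nat.add_le_add hk₁ hk₂, ?_, fun r h0 hr => ?_⟩
    · rw [hg'.dep w _ _ he]
      exact ho₁.trans ho₂
    · rw [hr₂ r h0 hr, hr₁ r h0 hr]

theorem out (count : Bool) {f : List ℕ → (ℕ → ℕ) → ℕ} (hf : RamEx m f) :
    RamCmd count m fun w e => [f w e] where
  dep w e e' h := by rw [hf.dep w e e' h]
  run := by
    obtain ⟨p, c, hp⟩ := hf.run (2 * m + 1) le_rfl
    cases count
    · refine ⟨.seq p (.output (2 * m + 1)), c + 1, fun w σ N hb => ?_⟩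
      obtain ⟨σ₁, k, h, hk, ho, hl, hr⟩ := hp w σ N hb
      refine ⟨_, _, .seq h (.output σ₁ _), by simpa using hk, ⟨?_, hr 0 (by omega)⟩,
        fun r _ => hr r⟩
      rw [← ho, ← hl]
    -- In counting mode the value is irrelevant: the list has length `1`, and `1` is added to
    -- register `0`.
    · refine ⟨.seq (.const (2 * m + 1) 1) (.add 0 0 (2 * m + 1)), 2, fun w σ N hb =>
        ⟨_, _, .seq (.const σ _ _) (.add _ _ _ _), by simp, ⟨rfl, ?_⟩, fun r h0 hr => ?_⟩⟩
      · rw [RamState.set_self, RamState.set_self, RamState.set_ne _ _ (by omega)]; rfl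
      · rw [RamState.set_ne _ _ (by omega), RamState.set_ne _ _ (by omega)]

theorem ite {f : List ℕ → (ℕ → ℕ) → ℕ} (hf : RamEx m f) (hg : RamCmd count m g)
    (hg' : RamCmd count m g') :
    RamCmd count m fun w e => if f w e ≠ 0 then g w e else g' w e where
  dep w e e' h := by rw [hf.dep w e e' h, hg.dep w e e' h, hg'.dep w e e' h]
  run := by
    obtain ⟨p, c, hp⟩ := hf.run (2 * m + 1) le_rfl
    obtain ⟨p₁, c₁, hp₁⟩ := hg.run
    obtain ⟨p₂, c₂, hp₂⟩ := hg'.run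
    refine ⟨.seq p (.ite (2 * m + 1) p₁ p₂), c + c₁ + c₂ + 1, fun w σ N hb => ?_⟩
    obtain ⟨σ', k, h, hk, ho, hl, hr⟩ := hp w σ N hb
    have he : ∀ r < m, σ.env r = σ'.env r := fun r hr' => (hr _ (by omega)).symm
    have h0 : RamEffect count σ σ' [] := .nil ho (hr 0 (by omega))
    obtain ⟨σ₁, k₁, g₁, hk₁, ho₁, hr₁⟩ := hp₁ w σ' N (hb.congr he)
    obtain ⟨σ₂, k₂, g₂, hk₂, ho₂, hr₂⟩ := hp₂ w σ' N (hb.congr he)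
    by_cases hz : f w σ.env = 0
    · refine ⟨σ₂, _, .seq h (.ite_false (hl.trans hz) g₂), ?_, ?_, fun r hr0 hr' => ?_⟩
      · simp only [eval_add, eval_one]; omega
      · rw [if_neg (by simpa using hz), hg'.dep w _ _ he]; exact h0.trans ho₂
      · rw [hr₂ r hr0 hr', hr r hr']
    · refine ⟨σ₁, _, .seq h (.ite_true (by rwa [hl]) g₁), ?_, ?_, fun r hr0 hr' => ?_⟩
      · simp only [eval_add, eval_one]; omega
      · rw [if_pos hz, hg.dep w _ _ he]; exact h0.trans ho₁
      · rw [hr₁ r hr0 hr', hr r hr']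

/-- The loop variable is the new variable `m`, in register `2 * m + 1`; register `2 * m + 2` holds
the number of remaining rounds. The body, a command over `m + 1` variables, preserves all registers
from `1` to `2 * m + 2`, so both survive it. -/
theorem forLoop {f : List ℕ → (ℕ → ℕ) → ℕ} (hf : RamEx m f) (hg : RamCmd count (m + 1) g) :
    RamCmd count m fun w e => (List.range (f w e)).flatMap fun k =>
      g w (Function.update e m k) where
  dep w e e' h := by
    rw [hf.dep w e e' h]
    congr 1
    funext k
    refine hg.dep w _ _ fun r hr => ?_
    by_cases hrm : r = m
    · simp [hrm]
    · simpa [hrm] using h r (by omega)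
  run := by
    obtain ⟨p, c, hp⟩ := hf.run (2 * m + 2) (by omega)
    obtain ⟨v, hv⟩ := hf.bound
    obtain ⟨q, d, hq⟩ := hg.run
    refine ⟨.seq p (.seq (.const (2 * m + 1) 0) (.loop (2 * m + 2) (.seq q
      (.seq (.const (2 * m + 3) 1) (.seq (.add (2 * m + 1) (2 * m + 1) (2 * m + 3))
        (.sub (2 * m + 2) (2 * m + 2) (2 * m + 3))))))),
      -- In the body all variables, including the loop variable, are bounded by `N + v.eval N`,
      -- whence the substitution in `d`. The summand `4` pays for the increment, the decrement,
      -- their constant and the test.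
      c + v * (d.comp (X + v) + 4) + 2, fun w σ N hb => ?_⟩
    obtain ⟨σ₁, k, h, hk, ho, hl, hr⟩ := hp w σ N hb
    have hB := hv w σ.env N hb
    have key := ramRuns_loop (w := w) (x := 2 * m + 2) (p := .seq q
      (.seq (.const (2 * m + 3) 1) (.seq (.add (2 * m + 1) (2 * m + 1) (2 * m + 3))
        (.sub (2 * m + 2) (2 * m + 2) (2 * m + 3))))) (n := f w σ.env)
      (C := d.eval (N + v.eval N) + 3)
      (fun i τ => τ.mem (2 * m + 2) = f w σ.env - i ∧ τ.mem (2 * m + 1) = i ∧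
        RamEffect count σ τ ((List.range i).flatMap fun k => g w (Function.update σ.env m k)) ∧
        ∀ r, 0 < r → r < 2 * m + 1 → τ.mem r = σ.mem r)
      (fun i hi τ ⟨a1, a2, a3, a4⟩ => ?_)
      (fun τ hτ => by rw [hτ.1]; omega) (σ₁.set (2 * m + 1) 0)
      ⟨by rw [RamState.set_ne _ _ (by omega), hl]; rfl, RamState.set_self _ _ _, ?_,
        fun r h0 hr' => by rw [RamState.set_ne _ _ (by omega), hr r (by omega)]⟩
    · obtain ⟨σ₂, t, hrun, ht, hI⟩ := key
      refine ⟨σ₂, _, .seq h (.seq (.const σ₁ _ 0) hrun), ?_, hI.2.2.1, hI.2.2.2⟩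
      simp only [eval_add, eval_mul, eval_comp, eval_X, eval_ofNat]
      have := Nat.mul_le_mul_right (d.eval (N + v.eval N) + 4) hB
      have ht' : t ≤ f w σ.env * (d.eval (N + v.eval N) + 4) + 1 := ht
      omega
    · have hτe : ∀ r < m + 1, τ.env r = Function.update σ.env m i r := fun r hr' => by
        by_cases hrm : r = m
        · subst hrm; simpa [RamState.env] using a2
        · simpa [hrm, RamState.env] using a4 _ (by omega) (by omega)
      have hτb : RamBounded w τ.env (m + 1) (N + v.eval N) := by
        refine ⟨fun x hx => (hb.1 x hx).trans (Nat.le_add_right _ _), fun r hr' => ?_⟩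
        rw [hτe r hr']
        by_cases hrm : r = m
        · subst hrm; simp only [Function.update_self]; omega
        · simpa [hrm] using (hb.2 r (by omega)).trans (Nat.le_add_right _ _)
      obtain ⟨τ', t, hτr, ht, hτo, hτm⟩ := hq w τ _ hτb
      refine ⟨by omega, _, _, .seq hτr (.seq (.const _ _ _) (.seq (.add _ _ _ _)
        (.sub _ _ _ _))), by omega, ?_, ?_, ?_, fun r h0 hr' => ?_⟩
      · have h1 := hτm (2 * m + 2) (by omega) (by omega)
        simp [RamState.set, h1, a1]
        omega
      · have h1 := hτm (2 * m + 1) (by omega) (by omega)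
        simp [RamState.set, h1, a2]
      · rw [List.range_succ, List.flatMap_append]
        refine a3.trans ?_
        rw [hg.dep w _ _ hτe] at hτo
        simp only [List.flatMap_cons, List.flatMap_nil, List.append_nil]
        revert hτo
        simp [RamEffect, RamState.set]
      · rw [RamState.set_ne _ _ (by omega), RamState.set_ne _ _ (by omega),
          RamState.set_ne _ _ (by omega), hτm r h0 (by omega), a4 r h0 hr']
    · refine .nil ?_ ?_
      · exact ho
      · rw [RamState.set_ne _ _ (by omega), hr 0 (by omega)]

/-- Concatenation over a fixed list. -/
theorem flatMap {ι : Type} (l : List ι) {g : ι → List ℕ → (ℕ → ℕ) → List ℕ}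
    (h : ∀ i, RamCmd count m (g i)) : RamCmd count m fun w e => l.flatMap fun i => g i w e := by
  induction l with
  | nil => exact nil count m
  | cons i l ih => simpa using (h i).append ih

end RamCmd

end Ram

/-! ### Hosts -/

/-- The size of the part `A` (`false`) or `B` (`true`). -/
def BipGraph.part (G : BipGraph) : Bool → ℕ
  | false => G.nA
  | true => G.nB

/-- The vertices of a host: the root, `nf t` vertices for each vertex of the part `t`, and `L`
vertices for each edge. -/
inductive HostVertex (G : BipGraph) (nf : Bool → ℕ) (L : ℕ) : Type
  | root
  | side (t : Bool) (f : Fin (nf t)) (k : Fin (G.part t))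
  | cell (s : Fin L) (i : Fin G.nA) (j : Fin G.nB) (hij : G.adj i j = true)

namespace HostVertex

variable (G : BipGraph) (nf : Bool → ℕ) (L : ℕ)

def enumSides : List (HostVertex G nf L) :=
  [false, true].flatMap fun t => (List.finRange (nf t)).flatMap fun f =>
    (List.finRange (G.part t)).map fun k => side t f k

def enumCells : List (HostVertex G nf L) :=
  (List.finRange L).flatMap fun s => (List.finRange G.nA).flatMap fun i =>
    (List.finRange G.nB).flatMap fun j => if hij : G.adj i j = true then [cell s i j hij] else []

def enum : List (HostVertex G nf L) := root :: (enumSides G nf L ++ enumCells G nf L)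

variable {G nf L}

theorem mem_enum (x : HostVertex G nf L) : x ∈ enum G nf L := by
  rcases x with _ | ⟨t, f, k⟩ | ⟨s, i, j, hij⟩
  · simp [enum]
  · cases t <;> simp [enum, enumSides]
  · refine List.mem_cons_of_mem _ (List.mem_append_right _ ?_)
    simp only [enumCells, List.mem_flatMap]
    exact ⟨s, List.mem_finRange s, i, List.mem_finRange i, j, List.mem_finRange j, by simp [hij]⟩

theorem nodup_enumSides : (enumSides G nf L).Nodup := by
  have h : ∀ t, ((List.finRange (nf t)).flatMap fun f =>
      (List.finRange (G.part t)).map fun k => (side t f k : HostVertex G nf L)).Nodup := by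
    intro t
    rw [List.nodup_flatMap]
    refine ⟨fun f _ => (List.nodup_finRange _).map fun k k' h => by simpa using h, ?_⟩
    refine (List.nodup_finRange _).imp fun {f f'} hne => ?_
    rw [Function.onFun, List.disjoint_left]
    intro x hx hx'
    simp only [List.mem_map, List.mem_finRange, true_and] at hx hx'
    obtain ⟨k, rfl⟩ := hx
    obtain ⟨k', h⟩ := hx'
    exact hne (by simp at h; exact h.1.symm)
  simp only [enumSides, List.flatMap_cons, List.flatMap_nil, List.append_nil]
  refine List.nodup_append.2 ⟨h false, h true, ?_⟩
  intro x hx y hy hxy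
  simp only [List.mem_flatMap, List.mem_map, List.mem_finRange, true_and] at hx hy
  obtain ⟨_, _, rfl⟩ := hx
  obtain ⟨_, _, rfl⟩ := hy
  simp at hxy

theorem nodup_enumCells : (enumCells G nf L).Nodup := by
  unfold enumCells
  rw [List.nodup_flatMap]
  constructor
  · intro s _
    rw [List.nodup_flatMap]
    constructor
    · intro i _
      rw [List.nodup_flatMap]
      constructor
      · intro j _
        split_ifs <;> simp
      · refine (List.nodup_finRange _).imp fun {j j'} hne => ?_
        rw [Function.onFun, List.disjoint_left]
        intro x hx hx'
        split_ifs at hx hx' <;> simp_all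
    · refine (List.nodup_finRange _).imp fun {i i'} hne => ?_
      rw [Function.onFun, List.disjoint_left]
      intro x hx hx'
      simp only [List.mem_flatMap, List.mem_finRange, true_and] at hx hx'
      obtain ⟨j, hx⟩ := hx
      obtain ⟨j', hx'⟩ := hx'
      split_ifs at hx hx' <;> simp_all
  · refine (List.nodup_finRange _).imp fun {s s'} hne => ?_
    rw [Function.onFun, List.disjoint_left]
    intro x hx hx'
    simp only [List.mem_flatMap, List.mem_finRange, true_and] at hx hx'
    obtain ⟨i, j, hx⟩ := hx
    obtain ⟨i', j', hx'⟩ := hx'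
    split_ifs at hx hx' <;> simp_all

theorem nodup_enum : (enum G nf L).Nodup := by
  refine List.nodup_cons.2 ⟨?_, List.nodup_append.2 ⟨nodup_enumSides, nodup_enumCells, ?_⟩⟩
  · intro h
    rcases List.mem_append.1 h with h | h
    · simp [enumSides] at h
    · simp only [enumCells, List.mem_flatMap] at h
      obtain ⟨_, _, _, _, _, _, h⟩ := h
      split_ifs at h <;> simp at h
  · intro x hx y hy hxy
    simp only [enumSides, enumCells, List.mem_flatMap, List.mem_map] at hx hy
    obtain ⟨_, _, _, _, _, _, rfl⟩ := hx
    obtain ⟨_, _, _, _, _, _, hy⟩ := hy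
    split_ifs at hy <;> simp_all

end HostVertex

/-- A layer with a row and a column. -/
structure Code where
  layer : Option ℕ
  row : ℕ
  col : ℕ

/-- A linear function of the sizes of the two parts and of an index, possibly reversed in the
interval `[0, 3 nA + 3 nB + 3]`. -/
structure Coord where
  c : ℕ
  cA : ℕ
  cB : ℕ
  ck : ℕ
  rev : Bool

def Coord.val (x : Coord) (nA nB k : ℕ) : ℕ :=
  if x.rev then 3 * nA + 3 * nB + 3 - (x.c + x.cA * nA + x.cB * nB + x.ck * k)
  else x.c + x.cA * nA + x.cB * nB + x.ck * k

/-- Layers, rows and columns for the vertices of a host. -/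
structure Layout where
  nf : Bool → ℕ
  L : ℕ
  sideLayer : (t : Bool) → Fin (nf t) → ℕ
  sideRow : (t : Bool) → Fin (nf t) → Coord
  sideCol : (t : Bool) → Fin (nf t) → Coord
  cellLayer : Fin L → ℕ
  cellRow : Coord
  cellCol : Coord

namespace Layout

variable (Λ : Layout) (G : BipGraph)

abbrev Vertex : Type := HostVertex G Λ.nf Λ.L

def sideCode (t : Bool) (f : Fin (Λ.nf t)) (nA nB k : ℕ) : Code :=
  ⟨some (Λ.sideLayer t f), (Λ.sideRow t f).val nA nB k, (Λ.sideCol t f).val nA nB k⟩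

def cellCode (s : Fin Λ.L) (nA nB i j : ℕ) : Code :=
  ⟨some (Λ.cellLayer s), Λ.cellRow.val nA nB i, Λ.cellCol.val nA nB j⟩

def code : Λ.Vertex G → Code
  | .root => ⟨none, 0, 0⟩
  | .side t f k => Λ.sideCode t f G.nA G.nB k
  | .cell s i j _ => Λ.cellCode s G.nA G.nB i j

end Layout

open Classical in
/-- The vertex in layer `s`, row `p` and column `q`. -/
noncomputable def TwistVertex.ofLayer {t : CoreType} {h n : ℕ} (s : Option ℕ) (p q : Fin n) :
    TwistVertex t h n :=
  match s with
  | none => .root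
  | some s =>
    if hs : 1 ≤ s ∧ s ≤ h then .mesh ⟨s - 1, by omega⟩ p q
    else if ht : t = CoreType.one then if s = 0 then .a ht p else .b ht q
    else .root

/-- An index that a guard or the root lacks counts as `0` in `row` and `col`, so a code must carry a
`0` there. -/
def TwistVertex.HasCode {t : CoreType} {h n : ℕ} (x : TwistVertex t h n) (c : Code) : Prop :=
  x.layer = c.layer ∧ x.row = c.row ∧ x.col = c.col

/-- `place` overwrites both indices, so only the layer matters. -/
theorem TwistVertex.HasCode.place {t : CoreType} {h n : ℕ} {x : TwistVertex t h n} {c : Code}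
    (hx : x.HasCode c) (p q : Fin 2) : x.place p q = .ofLayer c.layer p q := by
  obtain ⟨hl, -, -⟩ := hx
  rw [← hl]
  rcases x with _ | ⟨ht, i⟩ | ⟨s, i, j⟩ | ⟨ht, j⟩
  · rfl
  · simp [TwistVertex.place, TwistVertex.ofLayer, TwistVertex.layer, ht]
  · simp [TwistVertex.place, TwistVertex.ofLayer, TwistVertex.layer]
  · simp [TwistVertex.place, TwistVertex.ofLayer, TwistVertex.layer, ht]

theorem TwistVertex.hasCode_mesh {t : CoreType} {h n : ℕ} {s p q : ℕ} (h1 : 1 ≤ s) (h2 : s ≤ h)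
    (hp : p < n) (hq : q < n) : ∃ x : TwistVertex t h n, x.HasCode ⟨some s, p, q⟩ :=
  ⟨.mesh ⟨s - 1, by omega⟩ ⟨p, hp⟩ ⟨q, hq⟩, by
    simp [TwistVertex.layer, h1], rfl, rfl⟩

namespace Core

variable (τ : Core)

/-- The adjacency of a twist in terms of codes alone. The order of the twist does not enter, so
hosts can be studied without embedding them first. -/
def codeE (c c' : Code) : Prop :=
  τ.E (.ofLayer c.layer (rank2 c.row c'.row) (rank2 c.col c'.col))
    (.ofLayer c'.layer (rank2 c'.row c.row) (rank2 c'.col c.col))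

def codeLt (c c' : Code) : Prop :=
  τ.lt (.ofLayer c.layer (rank2 c.row c'.row) (rank2 c.col c'.col))
    (.ofLayer c'.layer (rank2 c'.row c.row) (rank2 c'.col c.col))

/-- The substructure of a twist that is selected by a layout. -/
def hostStruct (Λ : Layout) (G : BipGraph) : TOStruct where
  V := Λ.Vertex G
  E x y := τ.codeE (Λ.code G x) (Λ.code G y)
  lt x y := τ.codeLt (Λ.code G x) (Λ.code G y)

open Classical in
noncomputable def host (Λ : Layout) (G : BipGraph) : CodedStruct where
  n := (HostVertex.enum G Λ.nf Λ.L).length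
  E u v := decide (τ.codeE (Λ.code G ((HostVertex.enum G Λ.nf Λ.L).get u))
    (Λ.code G ((HostVertex.enum G Λ.nf Λ.L).get v)))
  lt u v := decide (τ.codeLt (Λ.code G ((HostVertex.enum G Λ.nf Λ.L).get u))
    (Λ.code G ((HostVertex.enum G Λ.nf Λ.L).get v)))

theorem host_iso (Λ : Layout) (G : BipGraph) : (τ.host Λ G).toStruct.Iso (τ.hostStruct Λ G) := by
  let e : Fin (HostVertex.enum G Λ.nf Λ.L).length ≃ HostVertex G Λ.nf Λ.L :=
    Equiv.ofBijective _ ⟨List.nodup_iff_injective_get.1 HostVertex.nodup_enum,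
      fun x => List.get_of_mem (HostVertex.mem_enum x)⟩
  refine ⟨e, fun x y => ?_, fun x y => ?_⟩ <;>
    simp only [CodedStruct.toStruct, host, hostStruct, decide_eq_true_eq] <;> exact Iff.rfl

theorem isRoot_twist (n : ℕ) : (τ.twist n).IsRoot TwistVertex.root := by
  intro y hy
  refine τ.common.treeOrder.root_lt _ ?_
  rcases y with _ | _ | _ | _
  · exact absurd rfl hy
  all_goals simp [TwistVertex.place]

/-- A layout that gives distinct codes of vertices of a twist to the vertices of the host. -/
structure IsLayout (Λ : Layout) : Prop where
  injective : ∀ G, Function.Injective (Λ.code G)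
  valid : ∀ G, ∀ x : Λ.Vertex G, ∃ y : TwistVertex τ.type τ.h (3 * G.nA + 3 * G.nB + 4),
    y.HasCode (Λ.code G x)

variable {τ}

/-- A twist relates its vertices through their codes only, so sending each host vertex to a twist
vertex with the same code preserves both relations, and injectivity of the codes makes the map
injective. The root of the twist is hit because it is the only vertex without a layer. -/
theorem IsLayout.isInducedSub {Λ : Layout} (hΛ : τ.IsLayout Λ) (G : BipGraph) :
    (τ.host Λ G).toStruct.IsInducedSub (τ.twist (3 * G.nA + 3 * G.nB + 4)) := by
  obtain ⟨e, hE, hlt⟩ := τ.host_iso Λ G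
  choose f hf using hΛ.valid G
  have hrel : ∀ (R : _ → _ → Prop) (x y : Λ.Vertex G),
      R ((f x).place (rank2 (f x).row (f y).row) (rank2 (f x).col (f y).col))
        ((f y).place (rank2 (f y).row (f x).row) (rank2 (f y).col (f x).col)) ↔
      R (.ofLayer (Λ.code G x).layer (rank2 (Λ.code G x).row (Λ.code G y).row)
          (rank2 (Λ.code G x).col (Λ.code G y).col))
        (.ofLayer (Λ.code G y).layer (rank2 (Λ.code G y).row (Λ.code G x).row)
          (rank2 (Λ.code G y).col (Λ.code G x).col)) := by
    intro R x y
    rw [(hf x).place, (hf y).place, (hf x).2.1, (hf x).2.2, (hf y).2.1, (hf y).2.2]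
  refine ⟨fun x => f (e x), fun x y hxy => ?_, fun x y => ?_, fun x y => ?_,
    e.symm HostVertex.root, ?_⟩
  · have h : f (e x) = f (e y) := hxy
    refine e.injective (hΛ.injective G ?_)
    have h1 := hf (e x)
    have h2 := hf (e y)
    rw [h] at h1
    rcases hc : Λ.code G (e x) with ⟨a, b, c⟩
    rcases hc' : Λ.code G (e y) with ⟨a', b', c'⟩
    rw [hc] at h1
    rw [hc'] at h2
    rw [Code.mk.injEq]
    exact ⟨h1.1.symm.trans h2.1, h1.2.1.symm.trans h2.2.1, h1.2.2.symm.trans h2.2.2⟩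
  · exact (hE x y).trans (hrel τ.E (e x) (e y)).symm
  · exact (hlt x y).trans (hrel τ.lt (e x) (e y)).symm
  · have h : f HostVertex.root = TwistVertex.root := by
      have h1 := (hf HostVertex.root).1
      rcases hx : f HostVertex.root with _ | _ | _ | _
      · rfl
      all_goals
        rw [hx] at h1
        simp [TwistVertex.layer, Layout.code] at h1
    have h2 : e (e.symm HostVertex.root) = HostVertex.root := e.apply_symm_apply _
    exact (congrArg (τ.twist _).IsRoot ((congrArg f h2).trans h)).mpr (τ.isRoot_twist _)

end Core

/-! ### Hosts are computable in polynomial time -/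

section HostPolyTime

open Polynomial

/-- Truncated subtraction decides the comparison: `p - p'` is nonzero exactly when `rank2 p p'` is
`1`. It is thus enough to compute `F` for each of the two constant values. -/
theorem RamEx.rank {m : ℕ} {p p' : List ℕ → (ℕ → ℕ) → ℕ} (hp : RamEx m p) (hp' : RamEx m p')
    {F : Fin 2 → List ℕ → (ℕ → ℕ) → ℕ} (hF : ∀ b, RamEx m (F b)) :
    RamEx m fun w e => F (rank2 (p w e) (p' w e)) w e := by
  have h := (hp.sub hp').ite (hF 1) (hF 0)
  have heq : (fun w e => F (rank2 (p w e) (p' w e)) w e) =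
      fun w e => if p w e - p' w e ≠ 0 then F 1 w e else F 0 w e := by
    funext w e
    by_cases h : p' w e < p w e
    · rw [rank2, if_pos h, if_pos (by omega)]
    · rw [rank2, if_neg h, if_neg (by omega)]
  rwa [heq]

theorem RamEx.coord {m : ℕ} (x : Coord) (hm : 2 ≤ m) {k : List ℕ → (ℕ → ℕ) → ℕ}
    (hk : RamEx m k) : RamEx m fun w e => x.val (e 0) (e 1) (k w e) := by
  have h : RamEx m fun w e => x.c + x.cA * e 0 + x.cB * e 1 + x.ck * k w e :=
    (((RamEx.const m x.c).add ((RamEx.const m x.cA).mul (.var (by omega)))).add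
      ((RamEx.const m x.cB).mul (.var (by omega)))).add ((RamEx.const m x.ck).mul hk)
  unfold Coord.val
  cases x.rev
  · exact h
  · exact ((((RamEx.const m 3).mul (.var (by omega))).add
      ((RamEx.const m 3).mul (.var (by omega)))).add (.const m 3)).sub h

open Classical in
/-- The relations of a core between vertices with given layers are computable. -/
theorem RamEx.relation {m : ℕ} {t : CoreType} {h : ℕ}
    (R : TwistVertex t h 2 → TwistVertex t h 2 → Prop)
    (s s' : Option ℕ) {p q p' q' : List ℕ → (ℕ → ℕ) → ℕ} (hp : RamEx m p) (hq : RamEx m q)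
    (hp' : RamEx m p') (hq' : RamEx m q') :
    RamEx m fun w e => (decide (R
      (.ofLayer s (rank2 (p w e) (p' w e)) (rank2 (q w e) (q' w e)))
      (.ofLayer s' (rank2 (p' w e) (p w e)) (rank2 (q' w e) (q w e))))).toNat :=
  -- The four ranks are replaced by constants one after the other. What remains is an entry of the
  -- finite table of the core, hard-wired into the program.
  hp.rank hp' (F := fun a w e => (decide (R
      (.ofLayer s a (rank2 (q w e) (q' w e)))
      (.ofLayer s' (rank2 (p' w e) (p w e)) (rank2 (q' w e) (q w e))))).toNat) fun a =>
  hq.rank hq' (F := fun b w e => (decide (R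
      (.ofLayer s a b)
      (.ofLayer s' (rank2 (p' w e) (p w e)) (rank2 (q' w e) (q w e))))).toNat) fun b =>
  hp'.rank hp (F := fun c w e => (decide (R
      (.ofLayer s a b) (.ofLayer s' c (rank2 (q' w e) (q w e))))).toNat) fun c =>
  hq'.rank hq (F := fun d _ _ => (decide (R (.ofLayer s a b) (.ofLayer s' c d))).toNat)
    fun _ => .const m _

/-- The adjacency of `i` and `j`, read from the code of a bipartite graph. -/
def codeAdj (w : List ℕ) (nB i j : ℕ) : ℕ := w.getD (2 + i * nB + j) 0

namespace Layout

variable (Λ : Layout)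

/-- The concatenation of the lists `Φ c` over the codes of the vertices of a host. -/
def visit (w : List ℕ) (nA nB : ℕ) (Φ : Code → List ℕ) : List ℕ :=
  Φ ⟨none, 0, 0⟩ ++ (([false, true].flatMap fun t => (List.finRange (Λ.nf t)).flatMap fun f =>
    (List.range (bif t then nB else nA)).flatMap fun k => Φ (Λ.sideCode t f nA nB k)) ++
  (List.finRange Λ.L).flatMap fun s => (List.range nA).flatMap fun i =>
    (List.range nB).flatMap fun j =>
      if codeAdj w nB i j ≠ 0 then Φ (Λ.cellCode s nA nB i j) else [])

/-- Families and layers form fixed lists and are unrolled in the program; loops run only over the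
indices of vertices of `G`. The hypothesis on `Φ` is for all `m' ≥ m` because each enclosing loop
adds a variable, and this is also what permits nesting one visit in another. -/
theorem ramCmd_visit {count : Bool} {m : ℕ} (hm : 2 ≤ m) {Φ : List ℕ → (ℕ → ℕ) → Code → List ℕ}
    (hdep : ∀ w e e', (∀ r < m, e r = e' r) → Φ w e = Φ w e')
    (hΦ : ∀ m', m ≤ m' → ∀ (s : Option ℕ) (p q : List ℕ → (ℕ → ℕ) → ℕ), RamEx m' p →
      RamEx m' q → RamCmd count m' fun w e => Φ w e ⟨s, p w e, q w e⟩) :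
    RamCmd count m fun w e => Λ.visit w (e 0) (e 1) (Φ w e) := by
  have hup : ∀ w e r k, m ≤ r → Φ w (Function.update e r k) = Φ w e := fun w e r k hr =>
    hdep w _ _ fun s hs => Function.update_of_ne (by omega) _ _
  refine (hΦ m le_rfl none _ _ (.const m 0) (.const m 0)).append (RamCmd.append ?_ ?_)
  · refine .flatMap _ fun t => .flatMap _ fun f => ?_
    have hf : RamEx m fun _ e => bif t then e 1 else e 0 := by
      cases t <;> exact .var (by omega)
    have := RamCmd.forLoop hf (hΦ (m + 1) (by omega) (some (Λ.sideLayer t f)) _ _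
      (RamEx.coord (Λ.sideRow t f) (by omega) (.var (Nat.lt_succ_self m)))
      (RamEx.coord (Λ.sideCol t f) (by omega) (.var (Nat.lt_succ_self m))))
    refine cast (congrArg _ ?_) this
    funext w e
    congr 1
    funext k
    rw [hup w e m k le_rfl]
    simp only [Function.update_self, Function.update_of_ne (show (0 : ℕ) ≠ m by omega),
      Function.update_of_ne (show (1 : ℕ) ≠ m by omega)]
    rfl
  · refine .flatMap _ fun s => ?_
    have hadj : RamEx (m + 2) fun w e => codeAdj w (e 1) (e m) (e (m + 1)) :=
      (((RamEx.const _ 2).add ((RamEx.var (by omega)).mul (.var (by omega)))).add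
        (.var (by omega))).input
    have hcell := hΦ (m + 2) (by omega) (some (Λ.cellLayer s)) _ _
      (RamEx.coord Λ.cellRow (by omega) (.var (show m < m + 2 by omega)))
      (RamEx.coord Λ.cellCol (by omega) (.var (show m + 1 < m + 2 by omega)))
    have := RamCmd.forLoop (.var (show 0 < m by omega)) (RamCmd.forLoop
      (.var (show 1 < m + 1 by omega)) (.ite hadj hcell (.nil count (m + 2))))
    refine cast (congrArg _ ?_) this
    funext w e
    congr 1
    funext i
    simp only [Function.update_of_ne (show (1 : ℕ) ≠ m by omega)]
    congr 1
    funext j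
    rw [hup _ _ (m + 1) j (by omega), hup w e m i le_rfl]
    simp only [Function.update_self, Function.update_of_ne (show (0 : ℕ) ≠ m by omega),
      Function.update_of_ne (show (1 : ℕ) ≠ m by omega),
      Function.update_of_ne (show (0 : ℕ) ≠ m + 1 by omega),
      Function.update_of_ne (show (1 : ℕ) ≠ m + 1 by omega),
      Function.update_of_ne (show m ≠ m + 1 by omega)]
    rfl

end Layout

theorem matrixCode_eq_ofFn {m n : ℕ} (A : Fin m → Fin n → Bool) :
    matrixCode A = List.ofFn fun k : Fin (m * n) => (A k.divNat k.modNat).toNat := by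
  rw [List.ofFn_mul, matrixCode, List.flatMap_def, List.ofFn_eq_map]
  congr 2
  funext i
  rw [List.ofFn_eq_map]
  congr 1
  funext j
  have hn : 0 < n := j.pos
  congr 2
  · exact Fin.ext (by simp [Fin.divNat, Nat.add_div, hn, Nat.div_eq_of_lt j.2,
      Nat.mod_eq_of_lt j.2])
  · exact Fin.ext (by simp [Fin.modNat, Nat.mod_eq_of_lt j.2])

theorem codeAdj_code (G : BipGraph) (i : Fin G.nA) (j : Fin G.nB) :
    codeAdj G.code G.nB i j = (G.adj i j).toNat := by
  have hn : 0 < G.nB := j.pos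
  have hlt : i.1 * G.nB + j.1 < G.nA * G.nB := by
    calc i.1 * G.nB + j.1 < (i.1 + 1) * G.nB := by rw [Nat.succ_mul]; omega
      _ ≤ G.nA * G.nB := Nat.mul_le_mul_right _ i.2
  rw [codeAdj, BipGraph.code, show 2 + i.1 * G.nB + j.1 = i.1 * G.nB + j.1 + 1 + 1 by omega,
    List.getD_cons_succ, List.getD_cons_succ, matrixCode_eq_ofFn, List.getD_eq_getElem?_getD,
    List.getElem?_ofFn, dif_pos hlt, Option.getD_some]
  congr 2
  · exact Fin.ext (by simp [Fin.divNat, Nat.add_div, hn, Nat.div_eq_of_lt j.2,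
      Nat.mod_eq_of_lt j.2])
  · exact Fin.ext (by simp [Fin.modNat, Nat.mod_eq_of_lt j.2])

theorem code_le (G : BipGraph) : ∀ x ∈ G.code, x ≤ G.size + 1 := by
  intro x hx
  simp only [BipGraph.code, List.mem_cons, matrixCode, List.mem_flatMap, List.mem_map] at hx
  unfold BipGraph.size
  rcases hx with rfl | rfl | ⟨i, _, j, _, rfl⟩
  · omega
  · omega
  · have := Bool.toNat_le (G.adj i j); omega

theorem List.flatMap_range_eq_finRange {α : Type} (n : ℕ) (F : ℕ → List α) :
    (List.range n).flatMap F = (List.finRange n).flatMap fun i => F i.1 := by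
  rw [← List.map_coe_finRange_eq_range, List.flatMap_map]

theorem List.flatMap_finRange_get {α β : Type} (l : List α) (F : α → List β) :
    (List.finRange l.length).flatMap (fun i => F (l.get i)) = l.flatMap F := by
  conv_rhs => rw [← List.map_get_finRange l]
  rw [List.flatMap_map]

/-- The loops meet the vertices in the order of `HostVertex.enum`, so the entries come out in the
order of the matrices of `Core.host`. A pair `i, j` that is not an edge contributes the empty list
on both sides. -/
theorem Layout.visit_code (Λ : Layout) (G : BipGraph) (Φ : Code → List ℕ) :
    Λ.visit G.code G.nA G.nB Φ = (HostVertex.enum G Λ.nf Λ.L).flatMap fun x => Φ (Λ.code G x) := by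
  unfold Layout.visit HostVertex.enum HostVertex.enumSides HostVertex.enumCells
  conv_rhs => rw [List.flatMap_cons, List.flatMap_append]
  congr 1
  congr 1
  · simp only [List.flatMap_assoc, List.flatMap_map, List.flatMap_range_eq_finRange]
    congr 1
    funext t
    cases t <;> rfl
  · simp only [List.flatMap_assoc, List.flatMap_range_eq_finRange]
    congr 1
    funext s
    congr 1
    funext i
    congr 1
    funext j
    rw [codeAdj_code]
    by_cases h : G.adj i j = true
    · rw [dif_pos h, if_pos (by simp [h])]
      simp [Layout.code]
    · rw [dif_neg h, if_neg (by simpa using h)]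
      rfl

-- The code of a structure starts with its number of vertices, which is found by a visit in counting
-- mode; two nested visits then output each of the two matrices row by row.
open Classical in
theorem Core.polyTime_host (τ : Core) (Λ : Layout) :
    PolyTimeComputable BipGraph.size BipGraph.code CodedStruct.code (τ.host Λ) := by
  have hrel : ∀ R : TwistVertex τ.type τ.h 2 → TwistVertex τ.type τ.h 2 → Prop,
      RamCmd false 2 fun w e => Λ.visit w (e 0) (e 1) fun c => Λ.visit w (e 0) (e 1) fun c' =>
        [(decide (R (.ofLayer c.layer (rank2 c.row c'.row) (rank2 c.col c'.col))
          (.ofLayer c'.layer (rank2 c'.row c.row) (rank2 c'.col c.col)))).toNat] := by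
    intro R
    refine Λ.ramCmd_visit le_rfl (fun w e e' h => ?_) fun m hm s p q hp hq =>
      Λ.ramCmd_visit hm (fun w e e' h => ?_) fun m' hm' s' p' q' hp' hq' => .out _
        (RamEx.relation R s s' (hp.mono hm') (hq.mono hm') hp' hq')
    · rw [h 0 (by omega), h 1 (by omega)]
    · rw [hp.dep w e e' h, hq.dep w e e' h]
  have hcount : RamCmd true 2 fun w e => Λ.visit w (e 0) (e 1) fun _ => [0] :=
    Λ.ramCmd_visit le_rfl (fun _ _ _ _ => rfl) fun m _ _ _ _ _ _ => .out _ (.const m 0)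
  obtain ⟨p₀, c₀, h₀⟩ := hcount.run
  obtain ⟨p₁, c₁, h₁⟩ := (hrel τ.E).run
  obtain ⟨p₂, c₂, h₂⟩ := (hrel τ.lt).run
  -- The two sizes become the variables `0` and `1`, in registers `1` and `3`. Register `0` is still
  -- `0`, which serves as the address of the first input and as the start of the count.
  refine ⟨.seq (.input 1 0) (.seq (.const 3 1) (.seq (.input 3 3) (.seq p₀ (.seq (.output 0)
    (.seq p₁ p₂))))), (c₀ + c₁ + c₂ + 4).comp (X + 1), fun G => ?_⟩
  let σ : RamState := (((⟨fun _ => 0, []⟩ : RamState).set 1 G.nA).set 3 1).set 3 G.nB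
  have e0 : σ.env 0 = G.nA := rfl
  have e1 : σ.env 1 = G.nB := rfl
  have hb : RamBounded G.code σ.env 2 (G.size + 1) := by
    refine ⟨code_le G, fun r hr => ?_⟩
    unfold BipGraph.size
    obtain rfl | rfl : r = 0 ∨ r = 1 := by omega
    · rw [e0]; omega
    · rw [e1]; omega
  obtain ⟨σ₀, k₀, r₀, hk₀, ⟨ho₀, hm₀⟩, hr₀⟩ := h₀ G.code σ _ hb
  have he₀ : ∀ r < 2, σ.env r = σ₀.env r := fun r hr => (hr₀ _ (by omega) (by omega)).symm
  let σ₀' : RamState := ⟨σ₀.mem, σ₀.out ++ [σ₀.mem 0]⟩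
  obtain ⟨σ₁, k₁, r₁, hk₁, ⟨ho₁, -⟩, hr₁⟩ := h₁ G.code σ₀' _ (hb.congr he₀)
  have he₁ : ∀ r < 2, σ.env r = σ₁.env r := fun r hr =>
    (he₀ r hr).trans (hr₁ _ (by omega) (by omega)).symm
  obtain ⟨σ₂, k₂, r₂, hk₂, ⟨ho₂, -⟩, hr₂⟩ := h₂ G.code σ₁ _ (hb.congr he₁)
  refine ⟨σ₂, _, .seq (.input _ _ _) (.seq (.const _ _ _) (.seq (.input _ _ _) (.seq r₀
    (.seq (.output _ _) (.seq r₁ r₂))))), ?_, ?_⟩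
  · have a0 : σ₀'.env 0 = G.nA := (he₀ 0 (by omega)).symm.trans e0
    have a1 : σ₀'.env 1 = G.nB := (he₀ 1 (by omega)).symm.trans e1
    have b0 : σ₁.env 0 = G.nA := (he₁ 0 (by omega)).symm.trans e0
    have b1 : σ₁.env 1 = G.nB := (he₁ 1 (by omega)).symm.trans e1
    rw [ho₂, ho₁, a0, a1, b0, b1]
    have hn : σ₀'.out = [(HostVertex.enum G Λ.nf Λ.L).length] := by
      have : σ₀.mem 0 = (HostVertex.enum G Λ.nf Λ.L).length := by
        rw [hm₀, e0, e1, Λ.visit_code]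
        have : σ.mem 0 = 0 := rfl
        simp [this]
      simp only [σ₀', ho₀, this]
      rfl
    rw [hn, CodedStruct.code]
    simp only [Λ.visit_code]
    rw [List.append_assoc, List.singleton_append]
    have hmat : ∀ R : TwistVertex τ.type τ.h 2 → TwistVertex τ.type τ.h 2 → Prop,
        ((HostVertex.enum G Λ.nf Λ.L).flatMap fun x => (HostVertex.enum G Λ.nf Λ.L).flatMap fun y =>
          [(decide (R (.ofLayer (Λ.code G x).layer (rank2 (Λ.code G x).row (Λ.code G y).row)
              (rank2 (Λ.code G x).col (Λ.code G y).col))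
            (.ofLayer (Λ.code G y).layer (rank2 (Λ.code G y).row (Λ.code G x).row)
              (rank2 (Λ.code G y).col (Λ.code G x).col)))).toNat]) =
        matrixCode fun u v : Fin (HostVertex.enum G Λ.nf Λ.L).length =>
          decide (R (.ofLayer (Λ.code G ((HostVertex.enum G Λ.nf Λ.L).get u)).layer
              (rank2 (Λ.code G ((HostVertex.enum G Λ.nf Λ.L).get u)).row
                (Λ.code G ((HostVertex.enum G Λ.nf Λ.L).get v)).row)
              (rank2 (Λ.code G ((HostVertex.enum G Λ.nf Λ.L).get u)).col
                (Λ.code G ((HostVertex.enum G Λ.nf Λ.L).get v)).col))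
            (.ofLayer (Λ.code G ((HostVertex.enum G Λ.nf Λ.L).get v)).layer
              (rank2 (Λ.code G ((HostVertex.enum G Λ.nf Λ.L).get v)).row
                (Λ.code G ((HostVertex.enum G Λ.nf Λ.L).get u)).row)
              (rank2 (Λ.code G ((HostVertex.enum G Λ.nf Λ.L).get v)).col
                (Λ.code G ((HostVertex.enum G Λ.nf Λ.L).get u)).col))) := by
      intro R
      rw [matrixCode, ← List.flatMap_finRange_get]
      congr 1
      funext u
      rw [← List.flatMap_finRange_get, List.map_eq_flatMap]
    rw [hmat, hmat]
    rfl
  · simp only [eval_comp, eval_add, eval_X, eval_one, eval_ofNat]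
    omega

end HostPolyTime

/-! ### Contracting comparable layers -/

/-- The layers `0, …, H` of a path, some pairs of consecutive ones being comparable: `up t` if the
layer `t` is below the layer `t + 1`, and `dn t` if it is above. -/
structure LayerPath (H : ℕ) (up dn : ℕ → Prop) : Prop where
  up_lt : ∀ t, up t → t + 1 < H
  dn_pos : ∀ t, dn t → 0 < t
  dn_lt : ∀ t, dn t → t < H
  pos : 0 < H
  up_dn : ∀ t, up t → ¬ dn t
  up_up : ∀ t, up t → ¬ up (t + 1)
  dn_dn : ∀ t, dn t → ¬ dn (t + 1)
  up_dn_succ : ∀ t, up t → ¬ dn (t + 1)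

section LayerGroups

variable (up dn : ℕ → Prop)

open Classical in
/-- The index of the group of comparable layers that contains a layer. -/
noncomputable def layerGroup : ℕ → ℕ
  | 0 => 0
  | t + 1 => layerGroup t + if up t ∨ dn t then 0 else 1

/-- The layer `s` is not above a consecutive layer. -/
def MinLayer (s : ℕ) : Prop := (∀ t, t + 1 = s → ¬ up t) ∧ ¬ dn s

variable {up dn}

theorem layerGroup_succ_of_cont {t : ℕ} (h : up t ∨ dn t) :
    layerGroup up dn (t + 1) = layerGroup up dn t := by
  simp [layerGroup, h]

theorem layerGroup_succ_of_not {t : ℕ} (h : ¬ (up t ∨ dn t)) :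
    layerGroup up dn (t + 1) = layerGroup up dn t + 1 := by
  simp only [layerGroup, if_neg h]

theorem layerGroup_mono : Monotone (layerGroup up dn) :=
  monotone_nat_of_le_succ fun t => by simp [layerGroup]

theorem layerGroup_succ_le (t : ℕ) : layerGroup up dn (t + 1) ≤ layerGroup up dn t + 1 := by
  by_cases h : up t ∨ dn t
  · rw [layerGroup_succ_of_cont h]; omega
  · rw [layerGroup_succ_of_not h]

theorem cont_of_layerGroup_eq {s t s' : ℕ} (h : layerGroup up dn s = layerGroup up dn s')
    (h1 : s ≤ t) (h2 : t + 1 ≤ s') : up t ∨ dn t := by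
  by_contra hc
  have h3 := layerGroup_succ_of_not hc
  have h4 := layerGroup_mono (up := up) (dn := dn) h1
  have h5 := layerGroup_mono (up := up) (dn := dn) h2
  omega

/-- Every step of the group index is taken. -/
theorem exists_layerGroup_step {H k : ℕ} (hk : k < layerGroup up dn H) :
    ∃ t < H, layerGroup up dn t = k ∧ layerGroup up dn (t + 1) = k + 1 := by
  induction H with
  | zero => simp [layerGroup] at hk
  | succ H ih =>
    by_cases h : k < layerGroup up dn H
    · obtain ⟨t, ht, h1⟩ := ih h
      exact ⟨t, by omega, h1⟩
    · have := layerGroup_succ_le (up := up) (dn := dn) H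
      exact ⟨H, by omega, by omega, by omega⟩

namespace LayerPath

variable {H : ℕ}

theorem minLayer_zero (h : LayerPath H up dn) : MinLayer up dn 0 :=
  ⟨fun t ht => by omega, fun h0 => absurd (h.dn_pos 0 h0) (by omega)⟩

theorem minLayer_last (h : LayerPath H up dn) : MinLayer up dn H :=
  ⟨fun t ht hu => by have := h.up_lt t hu; omega, fun h0 => absurd (h.dn_lt H h0) (by omega)⟩

/-- From a minimal layer to a later layer of the same group, the first step must be `up`. If it is
the only step, the later layer is not minimal; otherwise the next step is `up` or `dn`, but neither
may follow `up`. -/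
theorem minLayer_unique (h : LayerPath H up dn) {s s' : ℕ} (hs : MinLayer up dn s)
    (hs' : MinLayer up dn s') (heq : layerGroup up dn s = layerGroup up dn s') : s = s' := by
  wlog hlt : s < s' generalizing s s'
  · rcases Nat.lt_trichotomy s s' with h1 | h1 | h1
    · exact absurd h1 hlt
    · exact h1
    · exact (this hs' hs heq.symm h1).symm
  exfalso
  rcases cont_of_layerGroup_eq heq le_rfl hlt with h1 | h1
  · by_cases h2 : s + 1 = s'
    · exact hs'.1 s h2 h1
    · rcases cont_of_layerGroup_eq heq (Nat.le_succ s) (by omega) with h3 | h3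
      · exact h.up_up s h1 h3
      · exact h.up_dn_succ s h1 h3
  · exact hs.2 h1

/-- Every layer is in the group of a minimal layer. -/
theorem exists_minLayer (h : LayerPath H up dn) {s : ℕ} (hs : s ≤ H) :
    ∃ m ≤ H, MinLayer up dn m ∧ layerGroup up dn m = layerGroup up dn s ∧
      (m = s ∨ (up m ∧ s = m + 1) ∨ (dn s ∧ m = s + 1)) := by
  by_cases h1 : dn s
  · refine ⟨s + 1, h.dn_lt s h1, ⟨fun t ht hu => ?_, h.dn_dn s h1⟩,
      layerGroup_succ_of_cont (Or.inr h1), .inr (.inr ⟨h1, rfl⟩)⟩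
    obtain rfl : t = s := by omega
    exact h.up_dn t hu h1
  by_cases h2 : ∃ t, t + 1 = s ∧ up t
  · obtain ⟨t, rfl, hu⟩ := h2
    refine ⟨t, by omega, ⟨fun t' ht hu' => ?_, h.up_dn t hu⟩,
      (layerGroup_succ_of_cont (Or.inl hu)).symm, .inr (.inl ⟨hu, rfl⟩)⟩
    subst ht
    exact h.up_up t' hu' hu
  · exact ⟨s, hs, ⟨fun t ht hu => h2 ⟨t, ht, hu⟩, h1⟩, rfl, .inl rfl⟩

/-- The layers `0` and `H` are both minimal and `0 < H`, so their groups differ. Hence the truncated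
subtraction in `layerGroup up dn H - 1`, the number of subdivision layers, is a true one. -/
theorem layerGroup_last_pos (h : LayerPath H up dn) : 0 < layerGroup up dn H := by
  by_contra h0
  have := h.minLayer_unique h.minLayer_zero h.minLayer_last (by simp [layerGroup]; omega)
  have := h.pos
  omega

theorem exists_minLayer_of_le (h : LayerPath H up dn) {k : ℕ} (hk : k ≤ layerGroup up dn H) :
    ∃ m ≤ H, MinLayer up dn m ∧ layerGroup up dn m = k := by
  rcases hk.lt_or_eq with hk | rfl
  · obtain ⟨t, ht, h1, -⟩ := exists_layerGroup_step hk
    obtain ⟨m, hm, hm1, hm2, -⟩ := h.exists_minLayer ht.le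
    exact ⟨m, hm, hm1, hm2.trans h1⟩
  · exact ⟨H, le_rfl, h.minLayer_last, rfl⟩

end LayerPath

end LayerGroups

/-! ### Recognizing a definable minor -/

/-- A sufficient condition for `shrink M S D` to be isomorphic to `U`: the vertices of `U` are
embedded in `M` by `σ` as the kept vertices, and `π` is the contraction. -/
theorem TOStruct.shrink_iso {M U : TOStruct} {S D : M.V → Prop} (σ : U.V → M.V) (π : M.V → U.V)
    (hinj : Function.Injective σ) (hkept : ∀ x, M.Kept S D x ↔ ∃ u, σ u = x)
    (hlt : ∀ u v, U.lt u v ↔ M.lt (σ u) (σ v)) (hasymm : ∀ u v, U.lt u v → ¬ U.lt v u)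
    (hle : ∀ x, ¬ D x ∨ M.IsRoot x → σ (π x) = x ∨ M.lt (σ (π x)) x)
    (hmax : ∀ x, ¬ D x ∨ M.IsRoot x → ∀ u, σ u = x ∨ M.lt (σ u) x → u = π x ∨ U.lt u (π x))
    (hE : ∀ u v, U.E u v ↔ u ≠ v ∧ ∃ x y, M.E x y ∧ (¬ D x ∨ M.IsRoot x) ∧
      (¬ D y ∨ M.IsRoot y) ∧ π x = u ∧ π y = v) :
    (M.shrink S D).Iso U := by
  -- The condition in `shrink` is that no kept vertex lies strictly above `σ u` and weakly below
  -- `x`. As `σ (π x)` is the greatest kept vertex weakly below `x`, this means `π x = u`.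
  have hπ : ∀ x, ¬ D x ∨ M.IsRoot x → ∀ u, ((σ u = x ∨ M.lt (σ u) x) ∧
      ∀ z, M.lt (σ u) z ∧ (z = x ∨ M.lt z x) → ¬ M.Kept S D z) ↔ π x = u := by
    intro x hx u
    constructor
    · rintro ⟨h1, h2⟩
      rcases hmax x hx u h1 with h3 | h3
      · exact h3.symm
      · exact absurd ((hkept _).2 ⟨_, rfl⟩) (h2 (σ (π x)) ⟨(hlt _ _).1 h3, hle x hx⟩)
    · rintro rfl
      refine ⟨hle x hx, fun z ⟨h1, h2⟩ hz => ?_⟩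
      obtain ⟨v, rfl⟩ := (hkept z).1 hz
      have h3 := (hlt _ _).2 h1
      rcases hmax x hx v h2 with rfl | h4
      · exact hasymm _ _ h3 h3
      · exact hasymm _ _ h3 h4
  let e : U.V ≃ (M.shrink S D).V := Equiv.ofBijective (fun u => ⟨σ u, (hkept _).2 ⟨u, rfl⟩⟩)
    ⟨fun u v h => hinj (Subtype.ext_iff.1 h), fun ⟨x, hx⟩ => by
      obtain ⟨u, rfl⟩ := (hkept x).1 hx
      exact ⟨u, rfl⟩⟩
  refine ⟨e.symm, fun x y => ?_, fun x y => ?_⟩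
  · obtain ⟨u, rfl⟩ := e.surjective x
    obtain ⟨v, rfl⟩ := e.surjective y
    rw [e.symm_apply_apply, e.symm_apply_apply, hE]
    refine and_congr (not_congr e.injective.eq_iff) (exists_congr fun x' => exists_congr fun y' => ?_)
    constructor
    · rintro ⟨h1, h2, h3, h4, h5, h6⟩
      exact ⟨h1, h4, h5, (hπ x' h4 u).1 ⟨h2, fun z hz => h6 z (.inl hz)⟩,
        (hπ y' h5 v).1 ⟨h3, fun z hz => h6 z (.inr hz)⟩⟩
    · rintro ⟨h1, h4, h5, h2, h3⟩
      obtain ⟨a1, a2⟩ := (hπ x' h4 u).2 h2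
      obtain ⟨b1, b2⟩ := (hπ y' h5 v).2 h3
      exact ⟨h1, a1, b1, h4, h5, fun z hz => hz.elim (a2 z) (b2 z)⟩
  · obtain ⟨u, rfl⟩ := e.surjective x
    obtain ⟨v, rfl⟩ := e.surjective y
    rw [e.symm_apply_apply, e.symm_apply_apply]
    exact (hlt u v).symm

namespace SubdivVertex

variable {G : BipGraph} {h : ℕ}

theorem layer_onPath (i : Fin G.nA) (j : Fin G.nB) (hij : G.adj i j = true) {k : ℕ}
    (hk : k ≤ h + 1) : (onPath h i j hij k).layer = some k := by
  rcases k with _ | k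
  · rfl
  · by_cases hkh : k < h
    · simp [onPath, hkh, layer]
    · obtain rfl : k = h := by omega
      simp [onPath, layer]

end SubdivVertex

/-- A structure `M` with a contraction `π` to the subdivision of `G` in which every edge of `G` is
replaced by a path through the layers `0, …, H`, and the root is adjacent to whole layers. -/
structure IsPathHost (G : BipGraph) (H : ℕ) (up dn hasE radj : ℕ → Prop) (M : TOStruct)
    (nd : M.V → Prop) (r : M.V) (π : M.V → SubdivVertex G (layerGroup up dn H - 1))
    (lay : M.V → ℕ) (pv : ℕ → (i : Fin G.nA) → (j : Fin G.nB) → G.adj i j = true → M.V) :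
    Prop where
  symm : ∀ x y, M.E x y → M.E y x
  nd_root : nd r
  π_root : π r = SubdivVertex.root
  lay_le : ∀ x, nd x → x ≠ r → lay x ≤ H
  π_layer : ∀ x, nd x → x ≠ r → (π x).layer = some (layerGroup up dn (lay x))
  nd_path : ∀ t ≤ H, ∀ i j hij, nd (pv t i j hij)
  π_path : ∀ t ≤ H, ∀ i j hij, π (pv t i j hij) = SubdivVertex.onPath _ i j hij (layerGroup up dn t)
  edge_path : ∀ t < H, hasE t → ∀ i j hij, M.E (pv t i j hij) (pv (t + 1) i j hij)
  path_of_edge : ∀ x y, nd x → nd y → x ≠ r → y ≠ r → M.E x y → π x = π y ∨ ∃ t < H, ∃ i j hij,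
    (x = pv t i j hij ∧ y = pv (t + 1) i j hij) ∨ (y = pv t i j hij ∧ x = pv (t + 1) i j hij)
  hasE_of_not : ∀ t < H, ¬ up t → ¬ dn t → hasE t
  edge_root : ∀ x, nd x → x ≠ r → (M.E r x ↔ radj (lay x))
  -- Each layer of a group must be represented over each vertex of the subdivision in that group,
  -- including the isolated vertices of `G`. Otherwise the adjacency to the root, inherited from any
  -- layer of the group, would not be uniform.
  surj : ∀ u : SubdivVertex G (layerGroup up dn H - 1), ∀ t ≤ H,
    u.layer = some (layerGroup up dn t) → ∃ x, nd x ∧ x ≠ r ∧ π x = u ∧ lay x = t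

open Classical in
/-- The indices of the groups that contain a layer adjacent to the root. -/
noncomputable def rootGroups (H : ℕ) (up dn radj : ℕ → Prop) : Finset ℕ :=
  ((Finset.range (H + 1)).filter radj).image (layerGroup up dn)

theorem LayerPath.rootGroups_subset {H : ℕ} {up dn : ℕ → Prop} (h : LayerPath H up dn)
    (radj : ℕ → Prop) :
    rootGroups H up dn radj ⊆ Finset.range (layerGroup up dn H - 1 + 2) := by
  intro k hk
  simp only [rootGroups, Finset.mem_image, Finset.mem_filter, Finset.mem_range] at hk
  obtain ⟨t, ⟨ht, -⟩, rfl⟩ := hk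
  have := layerGroup_mono (up := up) (dn := dn) (show t ≤ H by omega)
  have := h.layerGroup_last_pos
  rw [Finset.mem_range]
  omega

namespace IsPathHost

variable {G : BipGraph} {H : ℕ} {up dn hasE radj : ℕ → Prop} {M : TOStruct}
  {nd : M.V → Prop} {r : M.V} {π : M.V → SubdivVertex G (layerGroup up dn H - 1)}
  {lay : M.V → ℕ} {pv : ℕ → (i : Fin G.nA) → (j : Fin G.nB) → G.adj i j = true → M.V}

theorem π_eq_root (h : IsPathHost G H up dn hasE radj M nd r π lay pv) {x : M.V} (hx : nd x)
    (h0 : π x = SubdivVertex.root) : x = r := by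
  by_contra hne
  have := h.π_layer x hx hne
  rw [h0] at this
  cases this

/-- The contraction of a path host is the subdivision with a root. -/
theorem rootedAdj_iff (hp : LayerPath H up dn)
    (h : IsPathHost G H up dn hasE radj M nd r π lay pv)
    (u v : SubdivVertex G (layerGroup up dn H - 1)) :
    SubdivVertex.rootedAdj (rootGroups H up dn radj) u v ↔ u ≠ v ∧ ∃ x y, M.E x y ∧ nd x ∧
      nd y ∧ π x = u ∧ π y = v := by
  have hpos := hp.layerGroup_last_pos
  have hroot : ∀ v : SubdivVertex G (layerGroup up dn H - 1),
      (∃ p ∈ rootGroups H up dn radj, v.layer = some p) → v ≠ SubdivVertex.root ∧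
        ∃ y, M.E r y ∧ nd y ∧ π y = v := by
    rintro v ⟨p, hp, hv⟩
    simp only [rootGroups, Finset.mem_image, Finset.mem_filter, Finset.mem_range] at hp
    obtain ⟨t, ⟨ht, hr⟩, rfl⟩ := hp
    obtain ⟨x, hx, hxr, rfl, rfl⟩ := h.surj v t (by omega) hv
    exact ⟨fun h0 => hxr (h.π_eq_root hx h0), x, (h.edge_root x hx hxr).2 hr, hx, rfl⟩
  have hroot' : ∀ y, nd y → y ≠ r → M.E r y → ∃ p ∈ rootGroups H up dn radj,
      (π y).layer = some p := by
    intro y hy hyr hE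
    refine ⟨_, ?_, h.π_layer y hy hyr⟩
    simp only [rootGroups, Finset.mem_image, Finset.mem_filter, Finset.mem_range]
    exact ⟨lay y, ⟨Nat.lt_succ_of_le (h.lay_le y hy hyr), (h.edge_root y hy hyr).1 hE⟩, rfl⟩
  constructor
  · rintro (⟨i, j, hij, k, hk, huv⟩ | ⟨rfl, hv⟩ | ⟨rfl, hu⟩)
    -- A path passes from group `k` to group `k + 1` between two consecutive incomparable layers,
    -- and such layers are joined by edges.
    · obtain ⟨t, ht, h1, h2⟩ := exists_layerGroup_step (up := up) (dn := dn) (H := H) (k := k)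
        (by omega)
      have hc : ¬ (up t ∨ dn t) := fun hc => by
        have := layerGroup_succ_of_cont hc; omega
      have hE := h.edge_path t ht (h.hasE_of_not t ht (fun h => hc (.inl h))
        fun h => hc (.inr h)) i j hij
      have e1 := h.π_path t ht.le i j hij
      have e2 := h.π_path (t + 1) ht i j hij
      rw [h1] at e1
      rw [h2] at e2
      have n1 := h.nd_path t ht.le i j hij
      have n2 := h.nd_path (t + 1) ht i j hij
      have hne : SubdivVertex.onPath (layerGroup up dn H - 1) i j hij k ≠
          SubdivVertex.onPath _ i j hij (k + 1) := fun heq => by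
        have := congrArg SubdivVertex.layer heq
        rw [SubdivVertex.layer_onPath _ _ _ (by omega),
          SubdivVertex.layer_onPath _ _ _ (by omega)] at this
        simp at this
      rcases huv with ⟨rfl, rfl⟩ | ⟨rfl, rfl⟩
      · exact ⟨hne, _, _, hE, n1, n2, e1, e2⟩
      · exact ⟨hne.symm, _, _, h.symm _ _ hE, n2, n1, e2, e1⟩
    · obtain ⟨h1, y, h2, h3, h4⟩ := hroot v hv
      exact ⟨h1.symm, r, y, h2, h.nd_root, h3, h.π_root, h4⟩
    · obtain ⟨h1, y, h2, h3, h4⟩ := hroot u hu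
      exact ⟨h1, y, r, h.symm _ _ h2, h3, h.nd_root, h4, h.π_root⟩
  · rintro ⟨hne, x, y, hE, hx, hy, rfl, rfl⟩
    by_cases hxr : x = r
    · subst hxr
      have hyr : y ≠ x := fun h' => hne (by rw [h'])
      exact .inr (.inl ⟨h.π_root, hroot' y hy hyr hE⟩)
    by_cases hyr : y = r
    · subst hyr
      exact .inr (.inr ⟨h.π_root, hroot' x hx hxr (h.symm _ _ hE)⟩)
    obtain ⟨t, ht, i, j, hij, hxy⟩ := (h.path_of_edge x y hx hy hxr hyr hE).resolve_left hne
    have e1 := h.π_path t ht.le i j hij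
    have e2 := h.π_path (t + 1) ht i j hij
    -- An edge inside a group would have equal images, against `hne`.
    have hstep : layerGroup up dn (t + 1) = layerGroup up dn t + 1 := by
      refine layerGroup_succ_of_not fun hc => hne ?_
      rw [layerGroup_succ_of_cont hc] at e2
      rcases hxy with ⟨rfl, rfl⟩ | ⟨rfl, rfl⟩ <;> rw [e1, e2]
    have := layerGroup_mono (up := up) (dn := dn) (show t + 1 ≤ H from ht)
    rw [hstep] at e2
    refine .inl ⟨i, j, hij, layerGroup up dn t, by omega, ?_⟩
    rcases hxy with ⟨rfl, rfl⟩ | ⟨rfl, rfl⟩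
    · exact .inl ⟨e1, e2⟩
    · exact .inr ⟨e1, e2⟩

end IsPathHost

/-! ### Sections of the contraction -/

open Classical in
/-- The minimal layer of the group with index `k`. -/
noncomputable def minLayerOf (H : ℕ) (up dn : ℕ → Prop) (k : ℕ) : ℕ :=
  if h : ∃ m ≤ H, MinLayer up dn m ∧ layerGroup up dn m = k then h.choose else 0

namespace LayerPath

variable {H : ℕ} {up dn : ℕ → Prop}

theorem minLayerOf_spec (h : LayerPath H up dn) {k : ℕ} (hk : k ≤ layerGroup up dn H) :
    minLayerOf H up dn k ≤ H ∧ MinLayer up dn (minLayerOf H up dn k) ∧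
      layerGroup up dn (minLayerOf H up dn k) = k := by
  have he := h.exists_minLayer_of_le hk
  rw [minLayerOf, dif_pos he]
  exact he.choose_spec

theorem minLayerOf_layerGroup (h : LayerPath H up dn) {m : ℕ} (hm : MinLayer up dn m)
    (hH : m ≤ H) : minLayerOf H up dn (layerGroup up dn m) = m := by
  obtain ⟨-, h1, h2⟩ := h.minLayerOf_spec (layerGroup_mono (up := up) (dn := dn) hH)
  exact h.minLayer_unique h1 hm h2

theorem minLayerOf_lt (h : LayerPath H up dn) {k : ℕ} (hk : 0 < k)
    (hk' : k < layerGroup up dn H) :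
    0 < minLayerOf H up dn k ∧ minLayerOf H up dn k < H := by
  obtain ⟨h1, -, h3⟩ := h.minLayerOf_spec hk'.le
  constructor
  · refine Nat.pos_of_ne_zero fun h0 => ?_
    rw [h0] at h3
    simp only [layerGroup] at h3
    omega
  · refine lt_of_le_of_ne h1 fun h0 => ?_
    rw [h0] at h3
    omega

end LayerPath

/-- The section of the contraction of a path host, given by the images of the vertices of `G`. -/
noncomputable def pathSection {G : BipGraph} {X : Type} (H : ℕ) (up dn : ℕ → Prop) (r : X)
    (a : Fin G.nA → X) (b : Fin G.nB → X)
    (pv : ℕ → (i : Fin G.nA) → (j : Fin G.nB) → G.adj i j = true → X) :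
    SubdivVertex G (layerGroup up dn H - 1) → X
  | .root => r
  | .a i => a i
  | .sub i j hij k => pv (minLayerOf H up dn (k.1 + 1)) i j hij
  | .b j => b j

/-- A vertex of a minimal layer other than the first and the last is its own image. -/
theorem LayerPath.pathSection_onPath {H : ℕ} {up dn : ℕ → Prop} (h : LayerPath H up dn)
    {G : BipGraph} {X : Type} (r : X) (a : Fin G.nA → X) (b : Fin G.nB → X)
    (pv : ℕ → (i : Fin G.nA) → (j : Fin G.nB) → G.adj i j = true → X)
    {m : ℕ} (hm : MinLayer up dn m) (h0 : 0 < m) (hH : m < H) (i : Fin G.nA) (j : Fin G.nB)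
    (hij : G.adj i j = true) :
    pathSection H up dn r a b pv (SubdivVertex.onPath _ i j hij (layerGroup up dn m)) =
      pv m i j hij := by
  have h1 : layerGroup up dn m ≠ 0 := fun h1 => by
    have := h.minLayer_unique h.minLayer_zero hm (by simp [layerGroup, h1]); omega
  have h2 : layerGroup up dn m ≠ layerGroup up dn H := fun h1 => by
    have := h.minLayer_unique hm h.minLayer_last h1; omega
  have h3 := layerGroup_mono (up := up) (dn := dn) hH.le
  have h4 := h.minLayerOf_layerGroup hm hH.le
  obtain ⟨k, hk⟩ : ∃ k, layerGroup up dn m = k + 1 := ⟨_, (Nat.succ_pred h1).symm⟩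
  rw [hk] at h4 ⊢
  rw [SubdivVertex.onPath, dif_pos (show k < layerGroup up dn H - 1 by omega)]
  exact congrArg (fun m => pv m i j hij) h4

theorem LayerPath.onPath_last {H : ℕ} {up dn : ℕ → Prop} (h : LayerPath H up dn)
    {G : BipGraph} (i : Fin G.nA) (j : Fin G.nB) (hij : G.adj i j = true) :
    SubdivVertex.onPath (layerGroup up dn H - 1) i j hij (layerGroup up dn H) = .b j := by
  obtain ⟨k, hk⟩ : ∃ k, layerGroup up dn H = k + 1 :=
    ⟨_, (Nat.succ_pred h.layerGroup_last_pos.ne').symm⟩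
  rw [hk, SubdivVertex.onPath, dif_neg (by omega)]

/-- A path host in which only the root is below the section of the contraction is contracted to a
grounding. -/
theorem IsPathHost.grounding_iso {G : BipGraph} {H : ℕ} {up dn hasE radj : ℕ → Prop}
    {M : TOStruct} {r : M.V} {π : M.V → SubdivVertex G (layerGroup up dn H - 1)} {lay : M.V → ℕ}
    {pv : ℕ → (i : Fin G.nA) → (j : Fin G.nB) → G.adj i j = true → M.V}
    (hp : LayerPath H up dn)
    (h : IsPathHost G H up dn hasE radj M (fun _ => True) r π lay pv)
    (σ : SubdivVertex G (layerGroup up dn H - 1) → M.V) (hσr : σ .root = r)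
    (hπσ : ∀ u, π (σ u) = u) (root_lt : ∀ x, x ≠ r → M.lt r x) (not_lt_root : ∀ x, ¬ M.lt x r)
    (lt_of_ne : ∀ x, σ (π x) ≠ x → M.lt (σ (π x)) x)
    (of_lt : ∀ x y, y ≠ r → M.lt y x → π y = π x ∧ σ (π x) ≠ x) :
    (M.shrink M.Low fun _ => False).Iso
      (grounding ⟨_, _, hp.rootGroups_subset radj⟩ G) := by
  have hroot : ∀ x, M.IsRoot x ↔ x = r := fun x =>
    ⟨fun hx => by_contra fun hne => not_lt_root x (hx r (Ne.symm hne)), fun hx => hx ▸ root_lt⟩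
  have hσ : ∀ u, σ u = r ↔ u = SubdivVertex.root := fun u =>
    ⟨fun hu => by rw [← hπσ u, hu, h.π_root], fun hu => hu ▸ hσr⟩
  refine TOStruct.shrink_iso (U := grounding ⟨_, _, hp.rootGroups_subset radj⟩ G) σ π
    (Function.LeftInverse.injective hπσ) (fun x => ?_) (fun u v => ?_) (fun u v => ?_)
    (fun x _ => ?_) (fun x _ u hu => ?_) (fun u v => ?_)
  · constructor
    · intro hx
      refine ⟨π x, by_contra fun hne => ?_⟩
      have hlt := lt_of_ne x hne
      rcases hx with ⟨hx, -⟩ | hx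
      · have := (hσ _).1 ((hroot _).1 (hx _ hlt))
        have hxr := h.π_eq_root trivial this
        exact not_lt_root _ (hxr ▸ hlt)
      · exact not_lt_root _ ((hroot x).1 hx ▸ hlt)
    · rintro ⟨u, rfl⟩
      refine .inl ⟨fun y hy => (hroot y).2 (by_contra fun hne => ?_), id⟩
      exact (of_lt _ _ hne hy).2 (congrArg σ (hπσ u))
  · change (u = SubdivVertex.root ∧ v ≠ SubdivVertex.root) ↔ _
    constructor
    · rintro ⟨rfl, hv⟩
      rw [hσr]
      exact root_lt _ fun h' => hv ((hσ v).1 h')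
    · intro hlt
      have hu : σ u = r := by_contra fun hne => (of_lt _ _ hne hlt).2 (congrArg σ (hπσ v))
      refine ⟨(hσ u).1 hu, ?_⟩
      rintro rfl
      rw [hσr] at hlt
      exact not_lt_root _ hlt
  · rintro ⟨rfl, hv⟩ ⟨rfl, -⟩
    exact hv rfl
  · by_cases hx : σ (π x) = x
    · exact .inl hx
    · exact .inr (lt_of_ne x hx)
  · rcases hu with rfl | hu
    · exact .inl (hπσ u).symm
    · by_cases hur : σ u = r
      · have := (hσ u).1 hur
        by_cases hxr : π x = SubdivVertex.root
        · exact .inl (this.trans hxr.symm)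
        · exact .inr ⟨this, hxr⟩
      · exact .inl ((hπσ u).symm.trans (of_lt _ _ hur hu).1)
  · refine (h.rootedAdj_iff hp u v).trans (and_congr Iff.rfl
      (exists_congr fun x => exists_congr fun y => ?_))
    simp only [true_and, not_false_eq_true, true_or]
    exact Iff.rfl

/-! ### Relations between codes -/

theorem rank2_eq_iff {a b : ℕ} : rank2 a b = rank2 b a ↔ a = b := by
  unfold rank2
  rcases Nat.lt_trichotomy a b with h | rfl | h
  · simp [h, h.ne, Nat.lt_asymm h]
  · simp
  · simp [h, h.ne', Nat.lt_asymm h]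

theorem rank2_lt_iff {a b : ℕ} : rank2 a b < rank2 b a ↔ a < b := by
  unfold rank2
  rcases Nat.lt_trichotomy a b with h | rfl | h
  · simp [h, Nat.lt_asymm h]
  · simp
  · simp [h, Nat.lt_asymm h]

section Follows

variable {R P : Fin 2 → Fin 2 → Fin 2 → Fin 2 → Prop}

/-- `R` is empty or given by the pattern `P`. -/
def Follows (R P : Fin 2 → Fin 2 → Fin 2 → Fin 2 → Prop) : Prop :=
  (∀ i j i' j', ¬ R i j i' j') ∨ ∀ i j i' j', R i j i' j' ↔ P i j i' j'

/-- A relation that is empty or equal to a pattern is determined by its value at one instance of the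
pattern. This is why `up`, `dn` and `joined` test the indices `0, 0` only. -/
theorem Follows.iff (h : Follows R P) (h0 : P 0 0 0 0) (i j i' j' : Fin 2) :
    R i j i' j' ↔ R 0 0 0 0 ∧ P i j i' j' := by
  rcases h with h | h
  · simp [h]
  · simp [h, h0]

end Follows

namespace TwistVertex

theorem ofLayer_mesh {t : CoreType} {h n s : ℕ} (hs : s < h) (p q : Fin n) :
    (ofLayer (some (s + 1)) p q : TwistVertex t h n) = mesh ⟨s, hs⟩ p q := by
  simp [ofLayer, Nat.succ_le_of_lt hs]

theorem ofLayer_a {t : CoreType} {h n : ℕ} (ht : t = CoreType.one) (p q : Fin n) :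
    (ofLayer (some 0) p q : TwistVertex t h n) = a ht p := by
  simp [ofLayer, ht]

theorem ofLayer_b {t : CoreType} {h n : ℕ} (ht : t = CoreType.one) (p q : Fin n) :
    (ofLayer (some (h + 1)) p q : TwistVertex t h n) = b ht q := by
  simp [ofLayer, ht]

end TwistVertex

namespace Core

variable (τ : Core)

/-- The vertex of the core in the layer `l`, row `i` and column `j`. -/
noncomputable abbrev vertex (l : ℕ) (i j : Fin 2) : TwistVertex τ.type τ.h 2 := .ofLayer (some l) i j

/-- Does the code `l` belong to a layer? -/
def IsLayerCode (l : ℕ) : Prop :=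
  (1 ≤ l ∧ l ≤ τ.h) ∨ (τ.type = CoreType.one ∧ (l = 0 ∨ l = τ.h + 1))

theorem layer_vertex {l : ℕ} (hl : τ.IsLayerCode l) (i j : Fin 2) :
    (τ.vertex l i j).layer = some l := by
  rcases hl with ⟨h1, h2⟩ | ⟨ht, rfl | rfl⟩
  · obtain ⟨l, rfl⟩ : ∃ k, l = k + 1 := ⟨l - 1, by omega⟩
    rw [vertex, TwistVertex.ofLayer_mesh (by omega)]; rfl
  · rw [vertex, TwistVertex.ofLayer_a ht]; rfl
  · rw [vertex, TwistVertex.ofLayer_b ht]; rfl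

theorem vertex_ne_root {l : ℕ} (hl : τ.IsLayerCode l) (i j : Fin 2) :
    τ.vertex l i j ≠ .root := fun h => by
  have := τ.layer_vertex hl i j
  rw [h] at this
  cases this

theorem vertex_ne {l l' : ℕ} (hl : τ.IsLayerCode l) (hl' : τ.IsLayerCode l') (hne : l ≠ l')
    (i j i' j' : Fin 2) : τ.vertex l i j ≠ τ.vertex l' i' j' := fun h => by
  have h1 := τ.layer_vertex hl i j
  rw [h, τ.layer_vertex hl'] at h1
  exact hne (Option.some.inj h1).symm

theorem codeE_symm (c c' : Code) (h : τ.codeE c c') : τ.codeE c' c := τ.common.symm _ _ h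

theorem codeLt_root {l p q : ℕ} (hl : τ.IsLayerCode l) :
    τ.codeLt ⟨none, 0, 0⟩ ⟨some l, p, q⟩ :=
  τ.common.treeOrder.root_lt _ (τ.vertex_ne_root hl _ _)

theorem lt_asymm {x y : TwistVertex τ.type τ.h 2} (h : τ.lt x y) : ¬ τ.lt y x := fun h' =>
  τ.common.treeOrder.irrefl _ (τ.common.treeOrder.trans _ _ _ h h')

theorem not_codeLt_root (c : Code) : ¬ τ.codeLt c ⟨none, 0, 0⟩ := by
  intro h
  change τ.lt _ TwistVertex.root at h
  by_cases h0 : TwistVertex.ofLayer c.layer (rank2 c.row 0) (rank2 c.col 0) =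
      (TwistVertex.root : TwistVertex τ.type τ.h 2)
  · rw [h0] at h
    exact τ.common.treeOrder.irrefl _ h
  · exact τ.lt_asymm h (τ.common.treeOrder.root_lt _ h0)

theorem not_codeE_root : ¬ τ.codeE ⟨none, 0, 0⟩ ⟨none, 0, 0⟩ := τ.common.loopless _

theorem codeE_root {l p q : ℕ} (hl : τ.IsLayerCode l) :
    τ.codeE ⟨none, 0, 0⟩ ⟨some l, p, q⟩ ↔ τ.E .root (τ.vertex l 0 0) :=
  τ.common.root_homogeneous _ _ l (τ.layer_vertex hl _ _) (τ.layer_vertex hl _ _)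

/-- In any core, edges join consecutive layers. -/
theorem layer_of_codeE {l p q l' p' q' : ℕ} (hl : τ.IsLayerCode l) (hl' : τ.IsLayerCode l')
    (h : τ.codeE ⟨some l, p, q⟩ ⟨some l', p', q'⟩) : l + 1 = l' ∨ l' + 1 = l :=
  τ.common.edge_consecutive _ _ l l' (τ.layer_vertex hl _ _) (τ.layer_vertex hl' _ _) h

end Core

/-! ### Cores of type 1 -/

namespace Core

variable (τ : Core)

/-- The pattern of the relations between the layers `t` and `t + 1`. -/
def Pattern (t : ℕ) (i j i' j' : Fin 2) : Prop := (t = τ.h ∨ i = i') ∧ (t = 0 ∨ j = j')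

def up (t : ℕ) : Prop := t ≤ τ.h ∧ τ.lt (τ.vertex t 0 0) (τ.vertex (t + 1) 0 0)

def dn (t : ℕ) : Prop := t ≤ τ.h ∧ τ.lt (τ.vertex (t + 1) 0 0) (τ.vertex t 0 0)

def joined (t : ℕ) : Prop := τ.E (τ.vertex t 0 0) (τ.vertex (t + 1) 0 0)

def rootJoined (t : ℕ) : Prop := τ.E .root (τ.vertex t 0 0)

variable {τ}

theorem isLayerCode_one (ht : τ.type = CoreType.one) {l : ℕ} (hl : l ≤ τ.h + 1) :
    τ.IsLayerCode l := by
  unfold IsLayerCode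
  rcases Nat.eq_zero_or_pos l with h | h
  · exact .inr ⟨ht, .inl h⟩
  · rcases hl.lt_or_eq with h' | h'
    · exact .inl ⟨h, by omega⟩
    · exact .inr ⟨ht, .inr h'⟩

/-- Consecutive layers of a core of type 1. -/
theorem follows_one (ht : τ.type = CoreType.one) {t : ℕ} (hth : t ≤ τ.h) :
    Follows (fun i j i' j' => τ.lt (τ.vertex t i j) (τ.vertex (t + 1) i' j')) (τ.Pattern t) ∧
    Follows (fun i j i' j' => τ.lt (τ.vertex (t + 1) i' j') (τ.vertex t i j)) (τ.Pattern t) ∧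
    Follows (fun i j i' j' => τ.E (τ.vertex t i j) (τ.vertex (t + 1) i' j')) (τ.Pattern t) ∧
    (¬ τ.up t → ¬ τ.dn t → τ.joined t) ∧ (t = 0 → ¬ τ.dn t) ∧ (t = τ.h → ¬ τ.up t) := by
  have h1 := τ.isOne ht
  have hpos := h1.one_le
  rcases Nat.eq_zero_or_pos t with rfl | ht0
  · have hs := h1.first ⟨0, hpos⟩ rfl
    have ea : ∀ i j, τ.vertex 0 i j = .a ht i := fun i j => TwistVertex.ofLayer_a ht i j
    have em : ∀ i j, τ.vertex (0 + 1) i j = .mesh ⟨0, hpos⟩ i j :=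
      fun i j => TwistVertex.ofLayer_mesh hpos i j
    have hP : ∀ i j i' j', τ.Pattern 0 i j i' j' ↔ i = i' := fun i j i' j' => by
      simp [Pattern, show 0 ≠ τ.h by omega]
    simp only [up, dn, joined, ea, em]
    unfold Follows
    simp only [hP]
    unfold IsVerticalStar Never SameRow at hs
    obtain ⟨a1, a2⟩ := hs
    refine ⟨?_, .inl fun i j i' j' => a1 i' j' i j, ?_, ?_, fun _ h => a1 0 0 0 0 h.2,
      by omega⟩
    · rcases a2 with h | h | h
      · exact .inr h.1
      · exact .inr h.1
      · exact .inl h.1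
    · rcases a2 with h | h | h
      · exact .inl h.2
      · exact .inr h.2
      · exact .inr h.2
    · intro h2 h3
      rcases a2 with h | h | h
      · exact absurd ⟨by omega, (h.1 0 0 0 0).2 rfl⟩ h2
      · exact (h.2 0 0 0 0).2 rfl
      · exact (h.2 0 0 0 0).2 rfl
  · obtain ⟨t, rfl⟩ : ∃ k, t = k + 1 := ⟨t - 1, by omega⟩
    have em : ∀ i j, τ.vertex (t + 1) i j = .mesh ⟨t, hth⟩ i j :=
      fun i j => TwistVertex.ofLayer_mesh hth i j
    rcases hth.lt_or_eq with hlt | heq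
    · have hs := h1.middle ⟨t, hth⟩ ⟨t + 1, hlt⟩ rfl
      have em' : ∀ i j, τ.vertex (t + 1 + 1) i j = .mesh ⟨t + 1, hlt⟩ i j :=
        fun i j => TwistVertex.ofLayer_mesh hlt i j
      have hP : ∀ i j i' j', τ.Pattern (t + 1) i j i' j' ↔ i = i' ∧ j = j' := fun i j i' j' => by
        simp [Pattern, show t + 1 ≠ τ.h by omega]
      simp only [up, dn, joined, em, em']
      unfold Follows
      simp only [hP]
      unfold IsMatchingPair PlainMatching Never Diag at hs
      refine ⟨?_, ?_, ?_, ?_, by omega, by omega⟩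
      · rcases hs with h | h | h | h | h
        · exact .inr h.1
        · exact .inl h.1
        · exact .inr h.1
        · exact .inl h.1
        · exact .inl h.1
      · rcases hs with h | h | h | h | h
        · exact .inl fun i j i' j' => h.2.1 i' j' i j
        · exact .inr fun i j i' j' => (h.2.1 i' j' i j).trans (by tauto)
        · exact .inl fun i j i' j' => h.2.1 i' j' i j
        · exact .inr fun i j i' j' => (h.2.1 i' j' i j).trans (by tauto)
        · exact .inl fun i j i' j' => h.2.1 i' j' i j
      · rcases hs with h | h | h | h | h
        · exact .inl h.2.2
        · exact .inl h.2.2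
        · exact .inr h.2.2
        · exact .inr h.2.2
        · exact .inr h.2.2
      · intro h2 h3
        rcases hs with h | h | h | h | h
        · exact absurd ⟨by omega, (h.1 0 0 0 0).2 ⟨rfl, rfl⟩⟩ h2
        · exact absurd ⟨by omega, (h.2.1 0 0 0 0).2 ⟨rfl, rfl⟩⟩ h3
        all_goals exact (h.2.2 0 0 0 0).2 ⟨rfl, rfl⟩
    · have hs := h1.last ⟨t, hth⟩ heq
      have eb : ∀ i j, τ.vertex (t + 1 + 1) i j = .b ht j := fun i j => by
        rw [vertex, heq]; exact TwistVertex.ofLayer_b ht i j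
      have hP : ∀ i j i' j', τ.Pattern (t + 1) i j i' j' ↔ j = j' := fun i j i' j' => by
        simp [Pattern, heq]; omega
      simp only [up, dn, joined, em, eb]
      unfold Follows
      simp only [hP]
      unfold IsHorizontalStar Never SameCol at hs
      obtain ⟨a1, a2⟩ := hs
      refine ⟨.inl a1, ?_, ?_, ?_, by omega, fun _ h => a1 0 0 0 0 h.2⟩
      · rcases a2 with h | h | h
        · exact .inr fun i j i' j' => (h.1 i' j' i j).trans eq_comm
        · exact .inr fun i j i' j' => (h.1 i' j' i j).trans eq_comm
        · exact .inl fun i j i' j' => h.1 i' j' i j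
      · rcases a2 with h | h | h
        · exact .inl fun i j i' j' hE => h.2 i' j' i j (τ.common.symm _ _ hE)
        all_goals
          exact .inr fun i j i' j' => ⟨fun hE => ((h.2 i' j' i j).1 (τ.common.symm _ _ hE)).symm,
            fun hE => τ.common.symm _ _ ((h.2 i' j' i j).2 hE.symm)⟩
      · intro h2 h3
        rcases a2 with h | h | h
        · exact absurd ⟨by omega, (h.1 0 0 0 0).2 rfl⟩ h3
        all_goals exact τ.common.symm _ _ ((h.2 0 0 0 0).2 rfl)

theorem pattern_zero (t : ℕ) : τ.Pattern t 0 0 0 0 := ⟨.inr rfl, .inr rfl⟩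

theorem pattern_rank2 {t p q p' q' : ℕ} :
    τ.Pattern t (rank2 p p') (rank2 q q') (rank2 p' p) (rank2 q' q) ↔
      (t = τ.h ∨ p = p') ∧ (t = 0 ∨ q = q') := by
  simp only [Pattern, rank2_eq_iff]

theorem codeLt_one (ht : τ.type = CoreType.one) {l p q l' p' q' : ℕ} (hl : l ≤ τ.h + 1)
    (hl' : l' ≤ τ.h + 1) : τ.codeLt ⟨some l, p, q⟩ ⟨some l', p', q'⟩ ↔
      (l' = l + 1 ∧ τ.up l ∧ (l = τ.h ∨ p = p') ∧ (l = 0 ∨ q = q')) ∨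
      (l = l' + 1 ∧ τ.dn l' ∧ (l' = τ.h ∨ p = p') ∧ (l' = 0 ∨ q = q')) := by
  have c := isLayerCode_one ht hl
  have c' := isLayerCode_one ht hl'
  by_cases h1 : l' = l + 1
  · subst h1
    have := (follows_one ht (show l ≤ τ.h by omega)).1.iff (pattern_zero l)
      (rank2 p p') (rank2 q q') (rank2 p' p) (rank2 q' q)
    rw [pattern_rank2] at this
    refine this.trans ?_
    simp [up, show l ≤ τ.h by omega]
    omega
  · by_cases h2 : l = l' + 1
    · subst h2
      have := (follows_one ht (show l' ≤ τ.h by omega)).2.1.iff (pattern_zero l')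
        (rank2 p' p) (rank2 q' q) (rank2 p p') (rank2 q q')
      rw [pattern_rank2] at this
      refine this.trans ?_
      simp [dn, show l' ≤ τ.h by omega, eq_comm (a := p'), eq_comm (a := q')]
      omega
    · refine iff_of_false (fun h => ?_) (by tauto)
      have := (τ.isOne ht).lt_consecutive _ _ l l' (τ.layer_vertex c _ _) (τ.layer_vertex c' _ _) h
      omega

theorem codeE_one (ht : τ.type = CoreType.one) {l p q p' q' : ℕ} (hl : l ≤ τ.h) :
    τ.codeE ⟨some l, p, q⟩ ⟨some (l + 1), p', q'⟩ ↔
      τ.joined l ∧ (l = τ.h ∨ p = p') ∧ (l = 0 ∨ q = q') := by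
  have := (follows_one ht hl).2.2.1.iff (pattern_zero l)
    (rank2 p p') (rank2 q q') (rank2 p' p) (rank2 q' q)
  rw [pattern_rank2] at this
  exact this

/-- Two successive comparabilities in the same direction would compose to one between layers at
distance two. If the layers `t` and `t + 2` were both below `t + 1`, the chain condition would make
them comparable or equal. Both are excluded in type 1, and the ends are settled because no guard is
above a mesh vertex. -/
theorem layerPath_one (ht : τ.type = CoreType.one) : LayerPath (τ.h + 1) τ.up τ.dn where
  pos := by omega
  up_lt t h := by
    rcases h.1.lt_or_eq with h1 | h1
    · omega
    · exact absurd h ((follows_one ht h.1).2.2.2.2.2 h1)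
  dn_pos t h := Nat.pos_of_ne_zero fun h0 => (follows_one ht h.1).2.2.2.2.1 h0 h
  dn_lt t h := by have := h.1; omega
  up_dn t h h' := τ.lt_asymm h.2 h'.2
  up_up t h h' := by
    have := (τ.isOne ht).lt_consecutive _ _ t (t + 1 + 1)
      (τ.layer_vertex (isLayerCode_one ht (by have := h.1; omega)) _ _)
      (τ.layer_vertex (isLayerCode_one ht (by have := h'.1; omega)) _ _)
      (τ.common.treeOrder.trans _ _ _ h.2 h'.2)
    omega
  dn_dn t h h' := by
    have := (τ.isOne ht).lt_consecutive _ _ (t + 1 + 1) t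
      (τ.layer_vertex (isLayerCode_one ht (by have := h'.1; omega)) _ _)
      (τ.layer_vertex (isLayerCode_one ht (by have := h.1; omega)) _ _)
      (τ.common.treeOrder.trans _ _ _ h'.2 h.2)
    omega
  up_dn_succ t h h' := by
    have c := isLayerCode_one ht (show t ≤ τ.h + 1 by have := h.1; omega)
    have c' := isLayerCode_one ht (show t + 1 + 1 ≤ τ.h + 1 by have := h'.1; omega)
    rcases τ.common.treeOrder.chain _ _ _ h.2 h'.2 with h1 | h1 | h1
    · have := (τ.isOne ht).lt_consecutive _ _ t (t + 1 + 1) (τ.layer_vertex c _ _)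
        (τ.layer_vertex c' _ _) h1
      omega
    · exact τ.vertex_ne c c' (by omega) _ _ _ _ h1
    · have := (τ.isOne ht).lt_consecutive _ _ (t + 1 + 1) t (τ.layer_vertex c' _ _)
        (τ.layer_vertex c _ _) h1
      omega

end Core

/-! ### Hosts for cores of type 1 -/

/-- The contraction of a host to the subdivision, the `s`-th vertex of an edge being in layer
`s + d`. -/
noncomputable def hostContraction {G : BipGraph} {nf : Bool → ℕ} {L : ℕ} (H : ℕ)
    (up dn : ℕ → Prop) (d : ℕ) : HostVertex G nf L → SubdivVertex G (layerGroup up dn H - 1)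
  | .root => .root
  | .side false _ k => .a k
  | .side true _ k => .b k
  | .cell s i j hij => .onPath _ i j hij (layerGroup up dn (s.1 + d))

namespace Core

variable (τ : Core)

def contracted : Bool → Prop
  | false => τ.up 0
  | true => τ.dn τ.h

-- If the mesh layer next to the guards is contracted into them, each vertex of `G` gets a second
-- side vertex in that layer. It is contracted into the guard and passes on the root adjacency of
-- the layer, even if the vertex is isolated in `G`.
open Classical in
noncomputable def layoutOne : Layout where
  nf t := if τ.contracted t then 2 else 1
  L := τ.h
  sideLayer t f := bif t then τ.h + 1 - f.1 else f.1
  -- Cells have rows and columns of the form `2 + 3 * k`. The other coordinate of a side vertex is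
  -- its family: `0` for a guard, which lacks that index, and `1` in the second family, where it is
  -- shared with no cell.
  sideRow t f := bif t then ⟨f.1, 0, 0, 0, false⟩ else ⟨2, 0, 0, 3, false⟩
  sideCol t f := bif t then ⟨2, 0, 0, 3, false⟩ else ⟨f.1, 0, 0, 0, false⟩
  cellLayer s := s.1 + 1
  cellRow := ⟨2, 0, 0, 3, false⟩
  cellCol := ⟨2, 0, 0, 3, false⟩

variable {τ}

theorem layoutOne_nf_pos (t : Bool) : 0 < τ.layoutOne.nf t := by
  simp only [layoutOne]; split_ifs <;> omega

theorem layoutOne_nf_le (t : Bool) (f : Fin (τ.layoutOne.nf t)) :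
    f.1 = 0 ∨ (f.1 = 1 ∧ τ.contracted t) := by
  have := f.2
  simp only [layoutOne] at this
  split_ifs at this with h
  · have : f.1 = 0 ∨ f.1 = 1 := by omega
    tauto
  · exact .inl (by omega)

variable {G : BipGraph}

theorem code_one_left (f : Fin (τ.layoutOne.nf false)) (k : Fin (G.part false)) :
    τ.layoutOne.code G (.side false f k) = ⟨some f.1, 2 + 3 * k.1, f.1⟩ := by
  simp [Layout.code, Layout.sideCode, Coord.val, layoutOne]

theorem code_one_right (f : Fin (τ.layoutOne.nf true)) (k : Fin (G.part true)) :
    τ.layoutOne.code G (.side true f k) = ⟨some (τ.h + 1 - f.1), f.1, 2 + 3 * k.1⟩ := by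
  simp [Layout.code, Layout.sideCode, Coord.val, layoutOne]

theorem code_one_cell (s : Fin τ.layoutOne.L) (i : Fin G.nA) (j : Fin G.nB) (hij) :
    τ.layoutOne.code G (.cell s i j hij) = ⟨some (s.1 + 1), 2 + 3 * i.1, 2 + 3 * j.1⟩ := by
  simp [Layout.code, Layout.cellCode, Coord.val, layoutOne]

noncomputable def layOne : τ.layoutOne.Vertex G → ℕ
  | .root => 0
  | .side t f _ => τ.layoutOne.sideLayer t f
  | .cell s _ _ _ => s.1 + 1

/-- The vertices of the path that replaces an edge. -/
noncomputable def pathOne (t : ℕ) (i : Fin G.nA) (j : Fin G.nB) (hij : G.adj i j = true) :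
    τ.layoutOne.Vertex G :=
  if t = 0 then .side false ⟨0, layoutOne_nf_pos _⟩ i
  else if h : t - 1 < τ.h then .cell ⟨t - 1, h⟩ i j hij
  else .side true ⟨0, layoutOne_nf_pos _⟩ j

theorem pathOne_zero (i : Fin G.nA) (j : Fin G.nB) (hij : G.adj i j = true) :
    pathOne (τ := τ) 0 i j hij = .side false ⟨0, layoutOne_nf_pos _⟩ i := rfl

theorem pathOne_succ {t : ℕ} (ht : t < τ.h) (i : Fin G.nA) (j : Fin G.nB)
    (hij : G.adj i j = true) : pathOne (τ := τ) (t + 1) i j hij = .cell ⟨t, ht⟩ i j hij := by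
  simp [pathOne, ht]

theorem pathOne_last (i : Fin G.nA) (j : Fin G.nB) (hij : G.adj i j = true) :
    pathOne (τ := τ) (τ.h + 1) i j hij = .side true ⟨0, layoutOne_nf_pos _⟩ j := by
  simp [pathOne]

theorem code_one (hpos : 1 ≤ τ.h) (x : τ.layoutOne.Vertex G) (hx : x ≠ .root) :
    (τ.layoutOne.code G x).layer = some (layOne x) ∧ layOne x ≤ τ.h + 1 := by
  rcases x with _ | ⟨_ | _, f, k⟩ | ⟨s, i, j, hij⟩
  · exact absurd rfl hx
  · refine ⟨rfl, ?_⟩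
    have := layoutOne_nf_le false f
    change f.1 ≤ _; omega
  · refine ⟨rfl, ?_⟩
    change τ.h + 1 - f.1 ≤ _; omega
  · refine ⟨rfl, ?_⟩
    have : s.1 < τ.h := s.2
    change s.1 + 1 ≤ _; omega

/-- Related vertices of consecutive layers have the same contraction or are consecutive on a
path. -/
theorem related_one (hpos : 1 ≤ τ.h) (x y : τ.layoutOne.Vertex G) (hx : x ≠ .root)
    (hy : y ≠ .root) (hl : layOne y = layOne x + 1)
    (hr : layOne x = τ.h ∨ (τ.layoutOne.code G x).row = (τ.layoutOne.code G y).row)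
    (hc : layOne x = 0 ∨ (τ.layoutOne.code G x).col = (τ.layoutOne.code G y).col) :
    hostContraction (τ.h + 1) τ.up τ.dn 1 x = hostContraction (τ.h + 1) τ.up τ.dn 1 y ∨
      ∃ i j hij, x = pathOne (layOne x) i j hij ∧ y = pathOne (layOne x + 1) i j hij := by
  rcases x with _ | ⟨_ | _, f, k⟩ | ⟨s, i, j, hij⟩
  · exact absurd rfl hx
  · have hf := layoutOne_nf_le false f
    have ex : layOne (HostVertex.side false f k : τ.layoutOne.Vertex G) = f.1 := rfl
    rw [ex] at hl hr hc ⊢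
    rcases y with _ | ⟨_ | _, f', k'⟩ | ⟨s', i', j', hij'⟩
    · exact absurd rfl hy
    · have ey : layOne (HostVertex.side false f' k' : τ.layoutOne.Vertex G) = f'.1 := rfl
      have hf' := layoutOne_nf_le false f'
      rw [code_one_left, code_one_left] at hr
      simp only at hr
      rw [ey] at hl
      have hk : k = k' := Fin.ext (by omega)
      left
      rw [hk]
      rfl
    · have ey : layOne (HostVertex.side true f' k' : τ.layoutOne.Vertex G) = τ.h + 1 - f'.1 := rfl
      have hf' := layoutOne_nf_le true f'
      rw [code_one_left, code_one_right] at hr hc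
      simp only at hr hc
      rw [ey] at hl
      omega
    · have ey : layOne (HostVertex.cell s' i' j' hij' : τ.layoutOne.Vertex G) = s'.1 + 1 := rfl
      rw [code_one_left, code_one_cell] at hr hc
      simp only at hr hc
      rw [ey] at hl
      have hs : s'.1 < τ.h := s'.2
      have hf0 : f = ⟨0, layoutOne_nf_pos _⟩ := Fin.ext (by change f.1 = 0; omega)
      have hs0 : s' = ⟨0, hpos⟩ := Fin.ext (by change s'.1 = 0; omega)
      have hk : k = i' := Fin.ext (by omega)
      subst hf0 hs0 hk
      exact .inr ⟨_, j', hij', rfl, (pathOne_succ hpos _ j' hij').symm⟩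
  · have hf := layoutOne_nf_le true f
    have ex : layOne (HostVertex.side true f k : τ.layoutOne.Vertex G) = τ.h + 1 - f.1 := rfl
    rw [ex] at hl hr hc ⊢
    rcases y with _ | ⟨_ | _, f', k'⟩ | ⟨s', i', j', hij'⟩
    · exact absurd rfl hy
    · have ey : layOne (HostVertex.side false f' k' : τ.layoutOne.Vertex G) = f'.1 := rfl
      have hf' := layoutOne_nf_le false f'
      rw [ey] at hl
      omega
    · have ey : layOne (HostVertex.side true f' k' : τ.layoutOne.Vertex G) = τ.h + 1 - f'.1 := rfl
      rw [code_one_right, code_one_right] at hc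
      simp only at hc
      rw [ey] at hl
      have hk : k = k' := Fin.ext (by omega)
      left
      rw [hk]
      rfl
    · have ey : layOne (HostVertex.cell s' i' j' hij' : τ.layoutOne.Vertex G) = s'.1 + 1 := rfl
      have hs : s'.1 < τ.h := s'.2
      rw [ey] at hl
      omega
  · have ex : layOne (HostVertex.cell s i j hij : τ.layoutOne.Vertex G) = s.1 + 1 := rfl
    have hs : s.1 < τ.h := s.2
    rw [ex] at hl hr hc ⊢
    rcases y with _ | ⟨_ | _, f', k'⟩ | ⟨s', i', j', hij'⟩
    · exact absurd rfl hy
    · have ey : layOne (HostVertex.side false f' k' : τ.layoutOne.Vertex G) = f'.1 := rfl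
      have hf' := layoutOne_nf_le false f'
      rw [ey] at hl
      omega
    · have ey : layOne (HostVertex.side true f' k' : τ.layoutOne.Vertex G) = τ.h + 1 - f'.1 := rfl
      have hf' := layoutOne_nf_le true f'
      rw [code_one_cell, code_one_right] at hr hc
      simp only at hr hc
      rw [ey] at hl
      have hf0 : f' = ⟨0, layoutOne_nf_pos _⟩ := Fin.ext (by change f'.1 = 0; omega)
      have hk : j = k' := Fin.ext (by omega)
      subst hf0 hk
      have hsh : s.1 + 1 = τ.h := by simp at hl; omega
      refine .inr ⟨i, _, hij, (pathOne_succ hs _ _ hij).symm, ?_⟩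
      rw [hsh, pathOne_last]
    · have ey : layOne (HostVertex.cell s' i' j' hij' : τ.layoutOne.Vertex G) = s'.1 + 1 := rfl
      have hs' : s'.1 < τ.h := s'.2
      rw [code_one_cell, code_one_cell] at hr hc
      simp only at hr hc
      rw [ey] at hl
      have h1 : i = i' := Fin.ext (by omega)
      have h2 : j = j' := Fin.ext (by omega)
      subst h1 h2
      refine .inr ⟨i, j, hij, (pathOne_succ hs _ _ hij).symm, ?_⟩
      rw [show s.1 + 1 + 1 = s'.1 + 1 by omega]
      exact (pathOne_succ hs' _ _ hij).symm

theorem isLayout_one (ht : τ.type = CoreType.one) : τ.IsLayout τ.layoutOne where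
  injective G x y hxy := by
    have hpos := (τ.isOne ht).one_le
    rcases x with _ | ⟨_ | _, f, k⟩ | ⟨s, i, j, hij⟩ <;>
      rcases y with _ | ⟨_ | _, f', k'⟩ | ⟨s', i', j', hij'⟩
    · rfl
    · cases hxy
    · cases hxy
    · cases hxy
    · cases hxy
    · simp only [code_one_left, Code.mk.injEq, Option.some.injEq] at hxy
      obtain rfl : f = f' := Fin.ext hxy.1
      obtain rfl : k = k' := Fin.ext (by omega)
      rfl
    · rw [code_one_left, code_one_right, Code.mk.injEq, Option.some.injEq] at hxy
      have := layoutOne_nf_le _ f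
      omega
    · rw [code_one_left, code_one_cell, Code.mk.injEq, Option.some.injEq] at hxy
      have := layoutOne_nf_le _ f
      omega
    · cases hxy
    · rw [code_one_left, code_one_right, Code.mk.injEq, Option.some.injEq] at hxy
      have := layoutOne_nf_le _ f'
      omega
    · simp only [code_one_right, Code.mk.injEq, Option.some.injEq] at hxy
      obtain rfl : f = f' := Fin.ext hxy.2.1
      obtain rfl : k = k' := Fin.ext (by omega)
      rfl
    · rw [code_one_right, code_one_cell, Code.mk.injEq, Option.some.injEq] at hxy
      have := layoutOne_nf_le _ f
      omega
    · cases hxy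
    · rw [code_one_left, code_one_cell, Code.mk.injEq, Option.some.injEq] at hxy
      have := layoutOne_nf_le _ f'
      omega
    · rw [code_one_right, code_one_cell, Code.mk.injEq, Option.some.injEq] at hxy
      have := layoutOne_nf_le _ f'
      omega
    · simp only [code_one_cell, Code.mk.injEq, Option.some.injEq] at hxy
      obtain rfl : s = s' := Fin.ext (by omega)
      obtain rfl : i = i' := Fin.ext (by omega)
      obtain rfl : j = j' := Fin.ext (by omega)
      rfl
  valid G x := by
    have hpos := (τ.isOne ht).one_le
    rcases x with _ | ⟨_ | _, f, k⟩ | ⟨s, i, j, hij⟩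
    · exact ⟨.root, rfl, rfl, rfl⟩
    · have hk : k.1 < G.nA := k.2
      rw [code_one_left]
      rcases layoutOne_nf_le _ f with hf | ⟨hf, -⟩ <;> rw [hf]
      · exact ⟨.a ht ⟨2 + 3 * k.1, by omega⟩, rfl, rfl, rfl⟩
      · exact TwistVertex.hasCode_mesh le_rfl hpos (by omega) (by omega)
    · have hk : k.1 < G.nB := k.2
      rw [code_one_right]
      rcases layoutOne_nf_le _ f with hf | ⟨hf, -⟩ <;> rw [hf]
      · exact ⟨.b ht ⟨2 + 3 * k.1, by omega⟩, rfl, rfl, rfl⟩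
      · exact TwistVertex.hasCode_mesh (by omega) (by omega) (by omega) (by omega)
    · have hs : s.1 < τ.h := s.2
      rw [code_one_cell]
      exact TwistVertex.hasCode_mesh (by omega) (by omega) (by omega) (by omega)

theorem codeLt_one_iff (ht : τ.type = CoreType.one) (x y : τ.layoutOne.Vertex G) (hx : x ≠ .root)
    (hy : y ≠ .root) : (τ.hostStruct τ.layoutOne G).lt x y ↔
      (layOne y = layOne x + 1 ∧ τ.up (layOne x) ∧
        (layOne x = τ.h ∨ (τ.layoutOne.code G x).row = (τ.layoutOne.code G y).row) ∧
        (layOne x = 0 ∨ (τ.layoutOne.code G x).col = (τ.layoutOne.code G y).col)) ∨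
      (layOne x = layOne y + 1 ∧ τ.dn (layOne y) ∧
        (layOne y = τ.h ∨ (τ.layoutOne.code G x).row = (τ.layoutOne.code G y).row) ∧
        (layOne y = 0 ∨ (τ.layoutOne.code G x).col = (τ.layoutOne.code G y).col)) := by
  have hpos := (τ.isOne ht).one_le
  obtain ⟨h1, h2⟩ := code_one hpos x hx
  obtain ⟨h3, h4⟩ := code_one hpos y hy
  rw [← codeLt_one ht h2 h4, ← h1, ← h3]
  exact Iff.rfl

theorem hostStruct_one_root_lt (ht : τ.type = CoreType.one) (x : τ.layoutOne.Vertex G)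
    (hx : x ≠ .root) : (τ.hostStruct τ.layoutOne G).lt HostVertex.root x := by
  obtain ⟨h1, h2⟩ := code_one (τ.isOne ht).one_le x hx
  have := τ.codeLt_root (p := (τ.layoutOne.code G x).row) (q := (τ.layoutOne.code G x).col)
    (isLayerCode_one ht h2)
  rw [← h1] at this
  exact this

theorem lt_path_one (ht : τ.type = CoreType.one) {t : ℕ} (i : Fin G.nA) (j : Fin G.nB)
    (hij : G.adj i j = true) :
    (τ.up t → (τ.hostStruct τ.layoutOne G).lt (pathOne t i j hij) (pathOne (t + 1) i j hij)) ∧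
    (τ.dn t → (τ.hostStruct τ.layoutOne G).lt (pathOne (t + 1) i j hij) (pathOne t i j hij)) ∧
    (t ≤ τ.h → τ.joined t →
      (τ.hostStruct τ.layoutOne G).E (pathOne t i j hij) (pathOne (t + 1) i j hij)) := by
  have hpos := (τ.isOne ht).one_le
  have key : ∀ t ≤ τ.h, ∃ p q p' q', τ.layoutOne.code G (pathOne t i j hij) = ⟨some t, p, q⟩ ∧
      τ.layoutOne.code G (pathOne (t + 1) i j hij) = ⟨some (t + 1), p', q'⟩ ∧
      (t = τ.h ∨ p = p') ∧ (t = 0 ∨ q = q') := by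
    intro t hth
    rcases t with _ | t
    · rw [pathOne_zero, pathOne_succ hpos, code_one_cell]
      exact ⟨_, _, _, _, code_one_left _ _, rfl, .inr rfl, .inl rfl⟩
    · rw [pathOne_succ hth, code_one_cell]
      rcases hth.lt_or_eq with h | h
      · rw [pathOne_succ h, code_one_cell]
        exact ⟨_, _, _, _, rfl, rfl, .inr rfl, .inr rfl⟩
      · rw [h, pathOne_last]
        exact ⟨_, _, _, _, by rw [← h], code_one_right _ _, .inl rfl, .inr rfl⟩
  refine ⟨fun h => ?_, fun h => ?_, fun h h' => ?_⟩
  · obtain ⟨p, q, p', q', h1, h2, h3⟩ := key t h.1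
    have := h.1
    simp only [hostStruct]
    rw [h1, h2, codeLt_one ht (by omega) (by omega)]
    exact .inl ⟨rfl, h, h3⟩
  · obtain ⟨p, q, p', q', h1, h2, h3⟩ := key t h.1
    have := h.1
    simp only [hostStruct]
    rw [h1, h2, codeLt_one ht (by omega) (by omega)]
    exact .inr ⟨rfl, h, by rw [eq_comm (a := p')]; exact h3.1, by rw [eq_comm (a := q')]; exact h3.2⟩
  · obtain ⟨p, q, p', q', h1, h2, h3⟩ := key t h
    simp only [hostStruct]
    rw [h1, h2, codeE_one ht h]
    exact ⟨h', h3⟩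

end Core

namespace LayerPath

variable {H : ℕ} {up dn : ℕ → Prop}

theorem layerGroup_eq_zero (h : LayerPath H up dn) {t : ℕ} (ht : t ≤ H)
    (h0 : layerGroup up dn t = 0) : t = 0 ∨ (t = 1 ∧ up 0) := by
  obtain ⟨m, -, h2, h3, h4⟩ := h.exists_minLayer ht
  have hm : m = 0 := h.minLayer_unique h2 h.minLayer_zero (by simpa [layerGroup, h0] using h3)
  subst hm
  rcases h4 with h4 | h4 | h4
  · exact .inl h4.symm
  · exact .inr ⟨by omega, h4.1⟩
  · omega

theorem layerGroup_eq_last (h : LayerPath H up dn) {t : ℕ} (ht : t ≤ H)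
    (h0 : layerGroup up dn t = layerGroup up dn H) : t = H ∨ (t + 1 = H ∧ dn t) := by
  obtain ⟨m, -, h2, h3, h4⟩ := h.exists_minLayer ht
  have hm : m = H := h.minLayer_unique h2 h.minLayer_last (h3.trans h0)
  subst hm
  rcases h4 with h4 | h4 | h4
  · exact .inl h4.symm
  · omega
  · exact .inr ⟨h4.2.symm, h4.1⟩

/-- If the first and the last vertex of each path are the images of its ends, then the vertices of
minimal layers are their own images. -/
theorem pathSection_onPath_of_ends (h : LayerPath H up dn) {G : BipGraph} {X : Type} (r : X)
    (a : Fin G.nA → X) (b : Fin G.nB → X)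
    (pv : ℕ → (i : Fin G.nA) → (j : Fin G.nB) → G.adj i j = true → X)
    (i : Fin G.nA) (j : Fin G.nB) (hij : G.adj i j = true) (ha : pv 0 i j hij = a i)
    (hb : pv H i j hij = b j) {m : ℕ} (hm : MinLayer up dn m) (hH : m ≤ H) :
    pathSection H up dn r a b pv (SubdivVertex.onPath _ i j hij (layerGroup up dn m)) =
      pv m i j hij := by
  rcases Nat.eq_zero_or_pos m with rfl | h0
  · exact ha.symm
  rcases hH.lt_or_eq with hH | rfl
  · exact h.pathSection_onPath r a b pv hm h0 hH i j hij
  · rw [h.onPath_last]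
    exact hb.symm

end LayerPath

namespace Core

variable {τ : Core} {G : BipGraph}

theorem hostContraction_layer (hp : LayerPath (τ.h + 1) τ.up τ.dn) (x : τ.layoutOne.Vertex G)
    (hx : x ≠ .root) : (hostContraction (τ.h + 1) τ.up τ.dn 1 x).layer =
      some (layerGroup τ.up τ.dn (layOne x)) := by
  have hpos := hp.layerGroup_last_pos
  rcases x with _ | ⟨_ | _, f, k⟩ | ⟨s, i, j, hij⟩
  · exact absurd rfl hx
  · change some 0 = some (layerGroup τ.up τ.dn f.1)
    rcases layoutOne_nf_le _ f with hf | ⟨hf, hc⟩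
    · rw [hf]; rfl
    · rw [hf, layerGroup_succ_of_cont (.inl hc)]; rfl
  · change some (_ + 1) = some (layerGroup τ.up τ.dn (τ.h + 1 - f.1))
    rcases layoutOne_nf_le _ f with hf | ⟨hf, hc⟩
    · rw [hf, Nat.sub_zero, Nat.sub_add_cancel hpos]
    · rw [hf, Nat.add_sub_cancel, Nat.sub_add_cancel hpos,
        layerGroup_succ_of_cont (t := τ.h) (.inr hc)]
  · have hs : s.1 < τ.h := s.2
    have := layerGroup_mono (up := τ.up) (dn := τ.dn) (show s.1 + 1 ≤ τ.h + 1 by omega)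
    exact SubdivVertex.layer_onPath _ _ _ (by omega)

theorem isPathHost_one (ht : τ.type = CoreType.one) (G : BipGraph) :
    IsPathHost G (τ.h + 1) τ.up τ.dn τ.joined τ.rootJoined (τ.hostStruct τ.layoutOne G)
      (fun _ => True) HostVertex.root (hostContraction (τ.h + 1) τ.up τ.dn 1) layOne pathOne where
  symm x y h := τ.codeE_symm _ _ h
  nd_root := trivial
  π_root := rfl
  lay_le x _ hx := (code_one (τ.isOne ht).one_le x hx).2
  π_layer x _ hx := hostContraction_layer (layerPath_one ht) x hx
  nd_path _ _ _ _ _ := trivial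
  π_path t hth i j hij := by
    rcases t with _ | t
    · rfl
    · rcases (show t ≤ τ.h by omega).lt_or_eq with h | h
      · rw [pathOne_succ h]; rfl
      · rw [h, pathOne_last, (layerPath_one ht).onPath_last]; rfl
  edge_path t hth hE i j hij := (lt_path_one ht i j hij).2.2 (by omega) hE
  path_of_edge x y _ _ hx hy hE := by
    have hpos := (τ.isOne ht).one_le
    wlog hl : layOne y = layOne x + 1 generalizing x y
    · obtain ⟨h1, h2⟩ := code_one hpos x hx
      obtain ⟨h3, h4⟩ := code_one hpos y hy
      have hE' : τ.codeE ⟨some (layOne x), (τ.layoutOne.code G x).row, (τ.layoutOne.code G x).col⟩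
          ⟨some (layOne y), (τ.layoutOne.code G y).row, (τ.layoutOne.code G y).col⟩ := by
        rw [← h1, ← h3]; exact hE
      have := τ.layer_of_codeE (isLayerCode_one ht h2) (isLayerCode_one ht h4) hE'
      rcases this with h | h
      · exact absurd h.symm hl
      · rcases this y x hy hx (τ.codeE_symm _ _ hE) h.symm with
          h | ⟨t, ht, i, j, hij, h⟩
        · exact .inl h.symm
        · exact .inr ⟨t, ht, i, j, hij, h.symm⟩
    · obtain ⟨h1, h2⟩ := code_one hpos x hx
      obtain ⟨h3, h4⟩ := code_one hpos y hy
      have hE' : τ.codeE ⟨some (layOne x), (τ.layoutOne.code G x).row, (τ.layoutOne.code G x).col⟩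
          ⟨some (layOne x + 1), (τ.layoutOne.code G y).row, (τ.layoutOne.code G y).col⟩ := by
        rw [← hl, ← h1, ← h3]; exact hE
      rw [codeE_one ht (by omega)] at hE'
      rcases related_one hpos x y hx hy hl hE'.2.1 hE'.2.2 with h | ⟨i, j, hij, h⟩
      · exact .inl h
      · exact .inr ⟨layOne x, by omega, i, j, hij, .inl h⟩
  hasE_of_not t hth h1 h2 := (follows_one ht (by omega)).2.2.2.1 h1 h2
  edge_root x _ hx := by
    obtain ⟨h1, h2⟩ := code_one (τ.isOne ht).one_le x hx
    have := τ.codeE_root (p := (τ.layoutOne.code G x).row) (q := (τ.layoutOne.code G x).col)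
      (isLayerCode_one ht h2)
    rw [← h1] at this
    exact this
  surj u t hth hu := by
    have hp := layerPath_one ht
    have hpos := hp.layerGroup_last_pos
    rcases u with _ | i | ⟨i, j, hij, k⟩ | j
    · cases hu
    · have h0 : layerGroup τ.up τ.dn t = 0 := (Option.some.inj hu).symm
      rcases hp.layerGroup_eq_zero hth h0 with rfl | ⟨rfl, hc⟩
      · exact ⟨HostVertex.side false ⟨0, layoutOne_nf_pos _⟩ i, trivial, nofun, rfl, rfl⟩
      -- The second family of side vertices exists precisely in this case.
      · have hc' : τ.contracted false := hc
        exact ⟨HostVertex.side false ⟨1, by simp [layoutOne, hc']⟩ i, trivial, nofun, rfl, rfl⟩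
    · have h0 : k.1 + 1 = layerGroup τ.up τ.dn t := Option.some.inj hu
      have hk := k.2
      have h1 : t ≠ 0 := by rintro rfl; simp [layerGroup] at h0
      have h2 : t ≠ τ.h + 1 := by rintro rfl; omega
      refine ⟨HostVertex.cell ⟨t - 1, ?_⟩ i j hij, trivial, nofun, ?_, ?_⟩
      · change t - 1 < τ.h; omega
      · change SubdivVertex.onPath _ i j hij (layerGroup _ _ (t - 1 + 1)) = _
        rw [Nat.sub_add_cancel (by omega), ← h0, SubdivVertex.onPath, dif_pos hk]
      · change t - 1 + 1 = t; omega
    · have h0 : layerGroup τ.up τ.dn (τ.h + 1) - 1 + 1 = layerGroup τ.up τ.dn t :=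
        Option.some.inj hu
      rcases hp.layerGroup_eq_last hth (by omega) with rfl | ⟨h1, hc⟩
      · exact ⟨HostVertex.side true ⟨0, layoutOne_nf_pos _⟩ j, trivial, nofun, rfl, rfl⟩
      · obtain rfl : t = τ.h := by omega
        have hc' : τ.contracted true := hc
        exact ⟨HostVertex.side true ⟨1, by simp [layoutOne, hc']⟩ j, trivial, nofun, rfl, rfl⟩

/-- The representative of a group is its vertex in the minimal layer. Any order relation not
involving the root stays inside one group, and its upper vertex is not in a minimal layer; so the
representatives are the vertices with only the root below. -/
theorem grounding_one (ht : τ.type = CoreType.one) (G : BipGraph) :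
    ((τ.hostStruct τ.layoutOne G).shrink (τ.hostStruct τ.layoutOne G).Low fun _ => False).Iso
      (grounding ⟨_, _, (layerPath_one ht).rootGroups_subset τ.rootJoined⟩ G) := by
  have hp := layerPath_one ht
  have hpos := (τ.isOne ht).one_le
  have hph := isPathHost_one ht G
  have hlast := hp.layerGroup_last_pos
  let σ : SubdivVertex G (layerGroup τ.up τ.dn (τ.h + 1) - 1) → τ.layoutOne.Vertex G :=
    pathSection (τ.h + 1) τ.up τ.dn .root (fun i => .side false ⟨0, layoutOne_nf_pos _⟩ i)
      (fun j => .side true ⟨0, layoutOne_nf_pos _⟩ j) pathOne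
  have hσp : ∀ {m} (_ : MinLayer τ.up τ.dn m) (_ : m ≤ τ.h + 1) i j hij,
      σ (SubdivVertex.onPath _ i j hij (layerGroup τ.up τ.dn m)) = pathOne m i j hij :=
    fun hm hH i j hij => hp.pathSection_onPath_of_ends _ _ _ _ i j hij rfl (pathOne_last i j hij)
      hm hH
  have hmin : ∀ u, u ≠ SubdivVertex.root → MinLayer τ.up τ.dn (layOne (σ u)) := by
    intro u hu
    rcases u with _ | i | ⟨i, j, hij, k⟩ | j
    · exact absurd rfl hu
    · exact hp.minLayer_zero
    · have hk := k.2
      obtain ⟨-, h2, -⟩ := hp.minLayerOf_spec (k := k.1 + 1) (by omega)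
      have h4 := hp.minLayerOf_lt (k := k.1 + 1) (by omega) (by omega)
      obtain ⟨m, hm⟩ : ∃ m, minLayerOf (τ.h + 1) τ.up τ.dn (k.1 + 1) = m + 1 :=
        ⟨_, (Nat.succ_pred h4.1.ne').symm⟩
      change MinLayer _ _ (layOne (pathOne (minLayerOf _ _ _ _) i j hij))
      rw [hm] at h2
      rw [hm, pathOne_succ (by omega)]
      exact h2
    · exact hp.minLayer_last
  have hrr : ∀ x : τ.layoutOne.Vertex G, hostContraction (τ.h + 1) τ.up τ.dn 1 x = .root →
      x = .root := fun x => hph.π_eq_root trivial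
  refine hph.grounding_iso hp σ rfl (fun u => ?_) (hostStruct_one_root_lt ht)
    (fun x => τ.not_codeLt_root _) (fun x hx => ?_) (fun x y hy hlt => ?_)
  · rcases u with _ | i | ⟨i, j, hij, k⟩ | j
    · rfl
    · rfl
    · have hk := k.2
      obtain ⟨h1, h2, h3⟩ := hp.minLayerOf_spec (k := k.1 + 1) (by omega)
      refine (hph.π_path _ h1 i j hij).trans ?_
      rw [h3, SubdivVertex.onPath, dif_pos hk]
    · rfl
  · rcases x with _ | ⟨_ | _, f, k⟩ | ⟨s, i, j, hij⟩
    · exact absurd rfl hx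
    · rcases layoutOne_nf_le _ f with hf | ⟨hf, hc⟩
      · exact absurd (congrArg (fun f => HostVertex.side false f k)
          (Fin.ext hf.symm : (⟨0, layoutOne_nf_pos _⟩ : Fin _) = f)) hx
      · refine (codeLt_one_iff ht (.side false ⟨0, layoutOne_nf_pos _⟩ k) (.side false f k)
          nofun nofun).2 (.inl ⟨hf, hc, .inr ?_, .inl rfl⟩)
        rw [code_one_left, code_one_left]
    · rcases layoutOne_nf_le _ f with hf | ⟨hf, hc⟩
      · exact absurd (congrArg (fun f => HostVertex.side true f k)
          (Fin.ext hf.symm : (⟨0, layoutOne_nf_pos _⟩ : Fin _) = f)) hx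
      · have e : layOne (HostVertex.side true f k : τ.layoutOne.Vertex G) = τ.h := by
          change τ.h + 1 - f.1 = τ.h; omega
        refine (codeLt_one_iff ht (.side true ⟨0, layoutOne_nf_pos _⟩ k) (.side true f k)
          nofun nofun).2 (.inr ⟨?_, ?_, .inl e, .inr ?_⟩)
        · rw [e]; rfl
        · rw [e]; exact hc
        · rw [code_one_right, code_one_right]
    · have hs : s.1 < τ.h := s.2
      have hs1 : s.1 + 1 ≤ τ.h + 1 := by omega
      obtain ⟨m, h1, h2, h3, h4⟩ := hp.exists_minLayer hs1
      have e : σ (hostContraction (τ.h + 1) τ.up τ.dn 1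
          (.cell s i j hij : τ.layoutOne.Vertex G)) = pathOne m i j hij := by
        change σ (SubdivVertex.onPath _ i j hij (layerGroup _ _ (s.1 + 1))) = _
        rw [← h3, hσp h2 h1]
      have e' : (HostVertex.cell s i j hij : τ.layoutOne.Vertex G) = pathOne (s.1 + 1) i j hij :=
        (pathOne_succ hs i j hij).symm
      have hl := fun t => lt_path_one ht i j hij (t := t)
      rcases h4 with rfl | ⟨h4, h5⟩ | ⟨h4, rfl⟩
      · exact absurd (e.trans e'.symm) hx
      · have := (hl m).1 h4
        rw [← h5, ← e', ← e] at this
        exact this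
      · have := (hl (s.1 + 1)).2.1 h4
        rw [← e', ← e] at this
        exact this
  · have hxr : x ≠ HostVertex.root := by
      rintro rfl
      exact τ.not_codeLt_root _ hlt
    rcases (codeLt_one_iff ht y x hy hxr).1 hlt with ⟨h1, h2, h3, h4⟩ | ⟨h1, h2, h3, h4⟩
    · constructor
      · rcases related_one hpos y x hy hxr h1 h3 h4 with h | ⟨i, j, hij, h5, h6⟩
        · exact h
        · have hle := h2.1
          rw [h5, h6, hph.π_path _ (by omega), hph.π_path _ (by omega),
            layerGroup_succ_of_cont (.inl h2)]
      · intro h5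
        have := hmin _ fun h => hxr (hrr x h)
        rw [h5] at this
        exact this.1 _ h1.symm h2
    · constructor
      · have h3' := h3
        have h4' := h4
        rw [eq_comm (a := (τ.layoutOne.code G y).row)] at h3'
        rw [eq_comm (a := (τ.layoutOne.code G y).col)] at h4'
        rcases related_one hpos x y hxr hy h1 h3' h4' with h | ⟨i, j, hij, h5, h6⟩
        · exact h.symm
        · have hle := h2.1
          rw [h5, h6, hph.π_path _ (by omega), hph.π_path _ (by omega),
            layerGroup_succ_of_cont (.inr h2)]
      · intro h5
        have := hmin _ fun h => hxr (hrr x h)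
        rw [h5] at this
        exact this.2 h2

end Core

/-! ### Relations between consecutive mesh layers -/

namespace Core

variable (τ : Core)

theorem codeLt_mesh {s s' : ℕ} (hs : s < τ.h) (hs' : s' < τ.h) (p q p' q' : ℕ) :
    τ.codeLt ⟨some (s + 1), p, q⟩ ⟨some (s' + 1), p', q'⟩ ↔
      τ.lt (.mesh ⟨s, hs⟩ (rank2 p p') (rank2 q q'))
        (.mesh ⟨s', hs'⟩ (rank2 p' p) (rank2 q' q)) := by
  unfold codeLt
  simp only
  rw [TwistVertex.ofLayer_mesh hs, TwistVertex.ofLayer_mesh hs']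

theorem codeE_mesh {s s' : ℕ} (hs : s < τ.h) (hs' : s' < τ.h) (p q p' q' : ℕ) :
    τ.codeE ⟨some (s + 1), p, q⟩ ⟨some (s' + 1), p', q'⟩ ↔
      τ.E (.mesh ⟨s, hs⟩ (rank2 p p') (rank2 q q'))
        (.mesh ⟨s', hs'⟩ (rank2 p' p) (rank2 q' q)) := by
  unfold codeE
  simp only
  rw [TwistVertex.ofLayer_mesh hs, TwistVertex.ofLayer_mesh hs']

theorem isLayerCode_mesh {s : ℕ} (hs : s < τ.h) : τ.IsLayerCode (s + 1) :=
  .inl ⟨by omega, by omega⟩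

/-- The mesh layer `s` is below the next one, within a matching pair. -/
def meshUp (s : ℕ) : Prop := s + 1 < τ.h ∧ τ.lt (τ.vertex (s + 1) 0 0) (τ.vertex (s + 2) 0 0)

/-- The mesh layer `s` is above the next one, within a matching pair. -/
def meshDn (s : ℕ) : Prop := s + 1 < τ.h ∧ τ.lt (τ.vertex (s + 2) 0 0) (τ.vertex (s + 1) 0 0)

def meshJoined (s : ℕ) : Prop := τ.E (τ.vertex (s + 1) 0 0) (τ.vertex (s + 2) 0 0)

def meshRootJoined (s : ℕ) : Prop := τ.E .root (τ.vertex (s + 1) 0 0)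

variable {τ}

/-- The relations between the layers of a matching pair. -/
theorem matching_relations {s : ℕ} (hs : s + 1 < τ.h)
    (h : IsMatchingPair τ.E τ.lt (.mesh ⟨s, by omega⟩) (.mesh ⟨s + 1, hs⟩)) (p q p' q' : ℕ) :
    (τ.codeLt ⟨some (s + 1), p, q⟩ ⟨some (s + 2), p', q'⟩ ↔ τ.meshUp s ∧ p = p' ∧ q = q') ∧
    (τ.codeLt ⟨some (s + 2), p', q'⟩ ⟨some (s + 1), p, q⟩ ↔ τ.meshDn s ∧ p = p' ∧ q = q') ∧
    (τ.codeE ⟨some (s + 1), p, q⟩ ⟨some (s + 2), p', q'⟩ ↔ τ.meshJoined s ∧ p = p' ∧ q = q') ∧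
    (¬ τ.meshUp s → ¬ τ.meshDn s → τ.meshJoined s) := by
  have hs0 : s < τ.h := by omega
  rw [τ.codeLt_mesh hs0 hs, τ.codeLt_mesh hs hs0, τ.codeE_mesh hs0 hs, meshUp, meshDn, meshJoined]
  simp only [vertex, TwistVertex.ofLayer_mesh hs0, TwistVertex.ofLayer_mesh hs, hs, true_and]
  unfold IsMatchingPair PlainMatching Never Diag at h
  rcases h with h | h | h | h | h <;>
    simp only [h, rank2_eq_iff, true_and, and_self, false_and, not_true_eq_false, not_false_eq_true,
      false_imp_iff, true_imp_iff, implies_true, eq_comm (a := p'), eq_comm (a := q')]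

theorem plain_relations {s : ℕ} (hs : s + 1 < τ.h)
    (h : PlainMatching τ.E τ.lt (.mesh ⟨s, by omega⟩) (.mesh ⟨s + 1, hs⟩)) :
    ¬ τ.meshUp s ∧ ¬ τ.meshDn s := by
  have hs0 : s < τ.h := by omega
  simp only [meshUp, meshDn, vertex, TwistVertex.ofLayer_mesh hs0, TwistVertex.ofLayer_mesh hs]
  exact ⟨fun h' => h.1 _ _ _ _ h'.2, fun h' => h.2.1 _ _ _ _ h'.2⟩

/-! ### Cores of type 2 -/

theorem isMatchingPair_two (ht : τ.type = CoreType.two) {s : ℕ} (hs : s + 1 < τ.h) :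
    IsMatchingPair τ.E τ.lt (.mesh ⟨s, by omega⟩) (.mesh ⟨s + 1, hs⟩) := by
  by_cases h : s = 0 ∨ s + 1 + 1 = τ.h
  · exact .inr (.inr (.inr (.inr ((τ.isTwo ht).outer ⟨s, by omega⟩ ⟨s + 1, hs⟩ rfl h))))
  · exact (τ.isTwo ht).middle ⟨s, by omega⟩ ⟨s + 1, hs⟩ rfl (fun h' => h (.inl h'))
      fun h' => h (.inr h')

theorem codeLt_two (ht : τ.type = CoreType.two) {s s' p q p' q' : ℕ} (hs : s < τ.h)
    (hs' : s' < τ.h) : τ.codeLt ⟨some (s + 1), p, q⟩ ⟨some (s' + 1), p', q'⟩ ↔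
      (s = 0 ∧ s' = 0 ∧ p = p' ∧ q < q') ∨ (s + 1 = τ.h ∧ s' + 1 = τ.h ∧ q = q' ∧ p < p') ∨
      (s' = s + 1 ∧ τ.meshUp s ∧ p = p' ∧ q = q') ∨
      (s = s' + 1 ∧ τ.meshDn s' ∧ p = p' ∧ q = q') := by
  have h2 := τ.isTwo ht
  have hle := h2.two_le
  by_cases e : s' = s
  · subst e
    rw [τ.codeLt_mesh hs hs]
    rcases Nat.eq_zero_or_pos s' with rfl | h0
    · rw [h2.order_first ⟨0, hs⟩ rfl, rank2_eq_iff, rank2_lt_iff]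
      omega
    · by_cases hl : s' + 1 = τ.h
      · rw [h2.order_last ⟨s', hs⟩ hl, rank2_eq_iff, rank2_lt_iff]
        omega
      · refine iff_of_false (h2.order_middle ⟨s', hs⟩ h0.ne' hl _ _ _ _) ?_
        omega
  by_cases e1 : s' = s + 1
  · subst e1
    rw [(matching_relations hs' (isMatchingPair_two ht hs') p q p' q').1]
    simp only [true_and]
    constructor
    · intro h; exact .inr (.inr (.inl h))
    · rintro (h | h | h | h)
      · omega
      · omega
      · exact h
      · omega
  by_cases e2 : s = s' + 1
  · subst e2
    rw [(matching_relations hs (isMatchingPair_two ht hs) p' q' p q).2.1]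
    simp only [true_and, eq_comm (a := p'), eq_comm (a := q')]
    constructor
    · intro h; exact .inr (.inr (.inr h))
    · rintro (h | h | h | h)
      · omega
      · omega
      · omega
      · exact h
  refine iff_of_false (fun h => ?_) (by omega)
  have := h2.lt_consecutive _ _ (s + 1) (s' + 1)
    (τ.layer_vertex (τ.isLayerCode_mesh hs) _ _) (τ.layer_vertex (τ.isLayerCode_mesh hs') _ _) h
  omega

theorem not_meshUp_two (ht : τ.type = CoreType.two) {s : ℕ} (h : s = 0 ∨ s + 2 = τ.h) :
    ¬ τ.meshUp s ∧ ¬ τ.meshDn s := by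
  by_cases hs : s + 1 < τ.h
  · exact plain_relations hs ((τ.isTwo ht).outer ⟨s, by omega⟩ ⟨s + 1, hs⟩ rfl h)
  · exact ⟨fun h => hs h.1, fun h => hs h.1⟩

/-- The inner pairs behave as in type 1. The two outer pairs are plain, so the first and the last
layer form groups of their own. -/
theorem layerPath_two (ht : τ.type = CoreType.two) : LayerPath (τ.h - 1) τ.meshUp τ.meshDn where
  pos := by have := (τ.isTwo ht).two_le; omega
  up_lt t h := by
    have := h.1
    have h2 : t + 2 ≠ τ.h := fun h2 => (not_meshUp_two ht (.inr h2)).1 h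
    omega
  dn_pos t h := Nat.pos_of_ne_zero fun h0 => (not_meshUp_two ht (.inl h0)).2 h
  dn_lt t h := by have := h.1; omega
  up_dn t h h' := τ.lt_asymm h.2 h'.2
  up_up t h h' := by
    have h1 := h'.1
    have := (τ.isTwo ht).lt_consecutive _ _ (t + 1) (t + 1 + 2)
      (τ.layer_vertex (τ.isLayerCode_mesh (s := t) (by omega)) _ _)
      (τ.layer_vertex (τ.isLayerCode_mesh (s := t + 2) h1) _ _)
      (τ.common.treeOrder.trans _ _ _ h.2 h'.2)
    omega
  dn_dn t h h' := by
    have h1 := h'.1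
    have := (τ.isTwo ht).lt_consecutive _ _ (t + 1 + 2) (t + 1)
      (τ.layer_vertex (τ.isLayerCode_mesh (s := t + 2) h1) _ _)
      (τ.layer_vertex (τ.isLayerCode_mesh (s := t) (by omega)) _ _)
      (τ.common.treeOrder.trans _ _ _ h'.2 h.2)
    omega
  up_dn_succ t h h' := by
    have h0 := h'.1
    have c := τ.isLayerCode_mesh (s := t) (by omega)
    have c' := τ.isLayerCode_mesh (s := t + 2) h0
    rcases τ.common.treeOrder.chain _ _ _ h.2 h'.2 with h1 | h1 | h1
    · have := (τ.isTwo ht).lt_consecutive _ _ (t + 1) (t + 1 + 2) (τ.layer_vertex c _ _)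
        (τ.layer_vertex c' _ _) h1
      omega
    · exact τ.vertex_ne c c' (by omega) _ _ _ _ h1
    · have := (τ.isTwo ht).lt_consecutive _ _ (t + 1 + 2) (t + 1) (τ.layer_vertex c' _ _)
        (τ.layer_vertex c _ _) h1
      omega

end Core

/-! ### Hosts for cores of type 2 -/

namespace Core

variable (τ : Core)

/-- The layout with one vertex in the first or last mesh layer for each vertex of `G`. -/
def layoutTwo : Layout where
  nf _ := 1
  L := τ.h
  sideLayer t _ := bif t then τ.h - 1 + 1 else 1
  -- The coordinate `1` is smaller than every `2 + 3 * k`, so the side vertex lies at the bottom of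
  -- its row of `μ_1`, or of its column of `μ_h`.
  sideRow t _ := bif t then ⟨1, 0, 0, 0, false⟩ else ⟨2, 0, 0, 3, false⟩
  sideCol t _ := bif t then ⟨2, 0, 0, 3, false⟩ else ⟨1, 0, 0, 0, false⟩
  cellLayer s := s.1 + 1
  cellRow := ⟨2, 0, 0, 3, false⟩
  cellCol := ⟨2, 0, 0, 3, false⟩

variable {τ} {G : BipGraph}

/-- The layer, row and column of a vertex. -/
def posTwo : τ.layoutTwo.Vertex G → ℕ × ℕ × ℕ
  | .root => (0, 0, 0)
  | .side false _ k => (0, 2 + 3 * k.1, 1)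
  | .side true _ k => (τ.h - 1, 1, 2 + 3 * k.1)
  | .cell s i j _ => (s.1, 2 + 3 * i.1, 2 + 3 * j.1)

theorem code_two (x : τ.layoutTwo.Vertex G) (hx : x ≠ .root) :
    τ.layoutTwo.code G x = ⟨some ((posTwo x).1 + 1), (posTwo x).2.1, (posTwo x).2.2⟩ := by
  rcases x with _ | ⟨_ | _, f, k⟩ | ⟨s, i, j, hij⟩
  · exact absurd rfl hx
  all_goals simp [Layout.code, Layout.sideCode, Layout.cellCode, Coord.val, layoutTwo, posTwo]

theorem posTwo_lt (hle : 2 ≤ τ.h) (x : τ.layoutTwo.Vertex G) : (posTwo x).1 < τ.h := by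
  rcases x with _ | ⟨_ | _, f, k⟩ | ⟨s, i, j, hij⟩
  · change 0 < τ.h; omega
  · change 0 < τ.h; omega
  · change τ.h - 1 < τ.h; omega
  · exact s.2

theorem posTwo_injective {x y : τ.layoutTwo.Vertex G} (hx : x ≠ .root)
    (hy : y ≠ .root) (h : posTwo x = posTwo y) : x = y := by
  rcases x with _ | ⟨_ | _, f, k⟩ | ⟨s, i, j, hij⟩ <;>
    rcases y with _ | ⟨_ | _, f', k'⟩ | ⟨s', i', j', hij'⟩ <;>
    first
    | exact absurd rfl hx
    | exact absurd rfl hy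
    | (simp only [posTwo, Prod.mk.injEq] at h
       first
       | omega
       | (obtain rfl : f = f' := Subsingleton.elim (α := Fin 1) f f'
          obtain rfl : k = k' := Fin.ext (by omega)
          rfl)
       | (obtain rfl : s = s' := Fin.ext (by omega)
          obtain rfl : i = i' := Fin.ext (by omega)
          obtain rfl : j = j' := Fin.ext (by omega)
          rfl))

theorem isLayout_two (ht : τ.type = CoreType.two) : τ.IsLayout τ.layoutTwo where
  injective G x y hxy := by
    by_cases hx : x = .root <;> by_cases hy : y = .root
    · exact hx.trans hy.symm
    · subst hx
      rw [code_two y hy] at hxy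
      cases hxy
    · subst hy
      rw [code_two x hx] at hxy
      cases hxy
    · rw [code_two x hx, code_two y hy, Code.mk.injEq, Option.some.injEq] at hxy
      exact posTwo_injective hx hy
        (Prod.ext (by omega) (Prod.ext hxy.2.1 hxy.2.2))
  valid G x := by
    by_cases hx : x = .root
    · subst hx
      exact ⟨.root, rfl, rfl, rfl⟩
    · have := posTwo_lt (τ.isTwo ht).two_le x
      rw [code_two x hx]
      refine TwistVertex.hasCode_mesh (by omega) (by omega) ?_ ?_
      · rcases x with _ | ⟨_ | _, f, k⟩ | ⟨s, i, j, hij⟩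
        · exact absurd rfl hx
        · have : k.1 < G.nA := k.2
          change 2 + 3 * k.1 < _; omega
        · change 1 < _; omega
        · change 2 + 3 * i.1 < _; omega
      · rcases x with _ | ⟨_ | _, f, k⟩ | ⟨s, i, j, hij⟩
        · exact absurd rfl hx
        · change 1 < _; omega
        · have : k.1 < G.nB := k.2
          change 2 + 3 * k.1 < _; omega
        · change 2 + 3 * j.1 < _; omega

/-- In contrast to type 1 the path consists of cells only, its ends too: the side vertex of an end
lies below the end cells of its row or column, which are contracted to it. The root is a default
value out of range. -/
noncomputable def pathTwo (t : ℕ) (i : Fin G.nA) (j : Fin G.nB) (hij : G.adj i j = true) :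
    τ.layoutTwo.Vertex G :=
  if h : t < τ.h then .cell ⟨t, h⟩ i j hij else .root

theorem pathTwo_of_lt {t : ℕ} (h : t < τ.h) (i : Fin G.nA) (j : Fin G.nB)
    (hij : G.adj i j = true) : pathTwo (τ := τ) t i j hij = .cell ⟨t, h⟩ i j hij := dif_pos h

theorem lt_two_iff (ht : τ.type = CoreType.two) (x y : τ.layoutTwo.Vertex G) (hx : x ≠ .root)
    (hy : y ≠ .root) : (τ.hostStruct τ.layoutTwo G).lt x y ↔
      ((posTwo x).1 = 0 ∧ (posTwo y).1 = 0 ∧ (posTwo x).2.1 = (posTwo y).2.1 ∧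
        (posTwo x).2.2 < (posTwo y).2.2) ∨
      ((posTwo x).1 + 1 = τ.h ∧ (posTwo y).1 + 1 = τ.h ∧ (posTwo x).2.2 = (posTwo y).2.2 ∧
        (posTwo x).2.1 < (posTwo y).2.1) ∨
      ((posTwo y).1 = (posTwo x).1 + 1 ∧ τ.meshUp (posTwo x).1 ∧
        (posTwo x).2.1 = (posTwo y).2.1 ∧ (posTwo x).2.2 = (posTwo y).2.2) ∨
      ((posTwo x).1 = (posTwo y).1 + 1 ∧ τ.meshDn (posTwo y).1 ∧
        (posTwo x).2.1 = (posTwo y).2.1 ∧ (posTwo x).2.2 = (posTwo y).2.2) := by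
  have hle := (τ.isTwo ht).two_le
  rw [← codeLt_two ht (posTwo_lt hle x) (posTwo_lt hle y), ← code_two x hx, ← code_two y hy]
  exact Iff.rfl

/-- Vertices of consecutive layers with the same row and column are consecutive on a path. -/
theorem path_of_pos_two {x y : τ.layoutTwo.Vertex G} (hx : x ≠ .root)
    (hy : y ≠ .root) (hl : (posTwo y).1 = (posTwo x).1 + 1)
    (hr : (posTwo x).2.1 = (posTwo y).2.1) (hc : (posTwo x).2.2 = (posTwo y).2.2) :
    ∃ i j hij, x = pathTwo (posTwo x).1 i j hij ∧ y = pathTwo (posTwo y).1 i j hij := by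
  rcases x with _ | ⟨_ | _, f, k⟩ | ⟨s, i, j, hij⟩ <;>
    rcases y with _ | ⟨_ | _, f', k'⟩ | ⟨s', i', j', hij'⟩ <;>
    first
    | exact absurd rfl hx
    | exact absurd rfl hy
    | (simp only [posTwo] at hl hr hc
       omega)
    | (simp only [posTwo] at hl hr hc
       obtain rfl : i = i' := Fin.ext (by omega)
       obtain rfl : j = j' := Fin.ext (by omega)
       exact ⟨i, j, hij, (pathTwo_of_lt s.2 i j hij).symm, (pathTwo_of_lt s'.2 i j hij).symm⟩)

theorem isPathHost_two (ht : τ.type = CoreType.two) (G : BipGraph) :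
    IsPathHost G (τ.h - 1) τ.meshUp τ.meshDn τ.meshJoined τ.meshRootJoined
      (τ.hostStruct τ.layoutTwo G) (fun _ => True) HostVertex.root
      (hostContraction (τ.h - 1) τ.meshUp τ.meshDn 0) (fun x => (posTwo x).1) pathTwo where
  symm x y h := τ.codeE_symm _ _ h
  nd_root := trivial
  π_root := rfl
  lay_le x _ hx := by
    have := posTwo_lt (τ.isTwo ht).two_le x
    change (posTwo x).1 ≤ _
    omega
  π_layer x _ hx := by
    have hpos := (layerPath_two ht).layerGroup_last_pos
    rcases x with _ | ⟨_ | _, f, k⟩ | ⟨s, i, j, hij⟩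
    · exact absurd rfl hx
    · rfl
    · exact congrArg some (Nat.sub_add_cancel hpos)
    · have hs : s.1 < τ.h := s.2
      have := layerGroup_mono (up := τ.meshUp) (dn := τ.meshDn) (show s.1 ≤ τ.h - 1 by omega)
      exact SubdivVertex.layer_onPath _ _ _ (by rw [Nat.add_zero]; omega)
  nd_path _ _ _ _ _ := trivial
  π_path t hth i j hij := by
    have := (τ.isTwo ht).two_le
    rw [pathTwo_of_lt (by omega)]; rfl
  edge_path t hth hE i j hij := by
    have h1 : t + 1 < τ.h := by omega
    have h0 : t < τ.h := by omega
    have := (matching_relations h1 (isMatchingPair_two ht h1) (2 + 3 * i.1) (2 + 3 * j.1)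
      (2 + 3 * i.1) (2 + 3 * j.1)).2.2.1.2 ⟨hE, rfl, rfl⟩
    rw [pathTwo_of_lt h0, pathTwo_of_lt h1]
    have e := code_two (.cell ⟨t, h0⟩ i j hij : τ.layoutTwo.Vertex G) nofun
    have e' := code_two (.cell ⟨t + 1, h1⟩ i j hij : τ.layoutTwo.Vertex G) nofun
    exact (congrArg₂ τ.codeE e e').mpr this
  path_of_edge x y _ _ hx hy hE := by
    have hle := (τ.isTwo ht).two_le
    have hE' : τ.codeE (τ.layoutTwo.code G x) (τ.layoutTwo.code G y) := hE
    have hlx := posTwo_lt hle x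
    have hly := posTwo_lt hle y
    rw [code_two x hx, code_two y hy] at hE'
    rcases τ.layer_of_codeE (τ.isLayerCode_mesh hlx) (τ.isLayerCode_mesh hly) hE' with h | h
    · have h1 : (posTwo y).1 = (posTwo x).1 + 1 := by omega
      rw [h1] at hE' hly
      obtain ⟨-, h2, h3⟩ := (matching_relations hly (isMatchingPair_two ht hly) _ _ _ _).2.2.1.1 hE'
      obtain ⟨i, j, hij, h4, h5⟩ := path_of_pos_two hx hy h1 h2 h3
      exact .inr ⟨(posTwo x).1, by omega, i, j, hij, .inl ⟨h4, h1 ▸ h5⟩⟩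
    · have h1 : (posTwo x).1 = (posTwo y).1 + 1 := by omega
      have hE' := τ.codeE_symm _ _ hE'
      rw [h1] at hE' hlx
      obtain ⟨-, h2, h3⟩ := (matching_relations hlx (isMatchingPair_two ht hlx) _ _ _ _).2.2.1.1 hE'
      obtain ⟨i, j, hij, h4, h5⟩ := path_of_pos_two hy hx h1 h2 h3
      exact .inr ⟨(posTwo y).1, by omega, i, j, hij, .inr ⟨h4, h1 ▸ h5⟩⟩
  hasE_of_not t hth h1 h2 := by
    have h3 : t + 1 < τ.h := by omega
    exact (matching_relations h3 (isMatchingPair_two ht h3) 0 0 0 0).2.2.2 h1 h2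
  edge_root x _ hx := by
    have := τ.codeE_root (p := (posTwo x).2.1) (q := (posTwo x).2.2)
      (τ.isLayerCode_mesh (posTwo_lt (τ.isTwo ht).two_le x))
    rw [← code_two x hx] at this
    exact this
  surj u t hth hu := by
    have hp := layerPath_two ht
    have hle := (τ.isTwo ht).two_le
    have hpos := hp.layerGroup_last_pos
    rcases u with _ | i | ⟨i, j, hij, k⟩ | j
    · cases hu
    · have h0 : layerGroup τ.meshUp τ.meshDn t = 0 := (Option.some.inj hu).symm
      rcases hp.layerGroup_eq_zero hth h0 with rfl | ⟨rfl, hc⟩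
      · exact ⟨HostVertex.side false ⟨0, Nat.one_pos⟩ i, trivial, nofun, rfl, rfl⟩
      · exact absurd hc (not_meshUp_two ht (.inl rfl)).1
    · have h0 : k.1 + 1 = layerGroup τ.meshUp τ.meshDn t := Option.some.inj hu
      have h1 : t < τ.h := by omega
      refine ⟨HostVertex.cell ⟨t, h1⟩ i j hij, trivial, nofun, ?_, rfl⟩
      change SubdivVertex.onPath _ i j hij (layerGroup _ _ t) = _
      rw [← h0, SubdivVertex.onPath, dif_pos k.2]
    · have h0 : layerGroup τ.meshUp τ.meshDn (τ.h - 1) - 1 + 1 = layerGroup τ.meshUp τ.meshDn t :=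
        Option.some.inj hu
      rcases hp.layerGroup_eq_last hth (by omega) with rfl | ⟨h1, hc⟩
      · exact ⟨HostVertex.side true ⟨0, Nat.one_pos⟩ j, trivial, nofun, rfl, rfl⟩
      · exact absurd hc (not_meshUp_two ht (.inr (by omega))).2

/-- Within `μ_1` each row is a chain above its side vertex, and within `μ_h` each column is; these
chains are contracted to the ends of the paths. The layers in between are contracted in groups as in
type 1. -/
theorem grounding_two (ht : τ.type = CoreType.two) (G : BipGraph) :
    ((τ.hostStruct τ.layoutTwo G).shrink (τ.hostStruct τ.layoutTwo G).Low fun _ => False).Iso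
      (grounding ⟨_, _, (layerPath_two ht).rootGroups_subset τ.meshRootJoined⟩ G) := by
  have hp := layerPath_two ht
  have hle := (τ.isTwo ht).two_le
  have hph := isPathHost_two ht G
  have hlast := hp.layerGroup_last_pos
  let σ : SubdivVertex G (layerGroup τ.meshUp τ.meshDn (τ.h - 1) - 1) → τ.layoutTwo.Vertex G :=
    pathSection (τ.h - 1) τ.meshUp τ.meshDn .root (fun i => .side false ⟨0, Nat.one_pos⟩ i)
      (fun j => .side true ⟨0, Nat.one_pos⟩ j) pathTwo
  have hσp : ∀ {m} (_ : MinLayer τ.meshUp τ.meshDn m) (_ : 0 < m) (_ : m < τ.h - 1) i j hij,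
      σ (SubdivVertex.onPath _ i j hij (layerGroup τ.meshUp τ.meshDn m)) = pathTwo m i j hij :=
    fun hm h0 hH i j hij => hp.pathSection_onPath _ _ _ _ hm h0 hH i j hij
  -- What characterises a representative: a minimal layer and, in an outer layer, the coordinate `1`
  -- of the side vertices.
  have hmin : ∀ u, u ≠ SubdivVertex.root →
      MinLayer τ.meshUp τ.meshDn (posTwo (σ u)).1 ∧ ((posTwo (σ u)).1 = 0 → (posTwo (σ u)).2.2 = 1) ∧
      ((posTwo (σ u)).1 + 1 = τ.h → (posTwo (σ u)).2.1 = 1) := by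
    intro u hu
    rcases u with _ | i | ⟨i, j, hij, k⟩ | j
    · exact absurd rfl hu
    · refine ⟨hp.minLayer_zero, fun _ => rfl, fun h => ?_⟩
      change 0 + 1 = τ.h at h
      omega
    · have hk := k.2
      obtain ⟨-, h2, -⟩ := hp.minLayerOf_spec (k := k.1 + 1) (by omega)
      have h4 := hp.minLayerOf_lt (k := k.1 + 1) (by omega) (by omega)
      have e : σ (.sub i j hij k) = .cell ⟨minLayerOf (τ.h - 1) τ.meshUp τ.meshDn (k.1 + 1),
          by change _ < τ.h; omega⟩ i j hij := pathTwo_of_lt (by omega) _ _ _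
      rw [e]
      refine ⟨h2, fun h => ?_, fun h => ?_⟩ <;> simp only [posTwo] at h <;> omega
    · refine ⟨hp.minLayer_last, fun h => ?_, fun _ => rfl⟩
      change τ.h - 1 = 0 at h
      omega
  have hrr : ∀ x : τ.layoutTwo.Vertex G, hostContraction (τ.h - 1) τ.meshUp τ.meshDn 0 x = .root →
      x = .root := fun x => hph.π_eq_root trivial
  refine hph.grounding_iso hp σ rfl (fun u => ?_) (fun x hx => ?_)
    (fun x => τ.not_codeLt_root _) (fun x hx => ?_) (fun x y hy hlt => ?_)
  · rcases u with _ | i | ⟨i, j, hij, k⟩ | j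
    · rfl
    · rfl
    · have hk := k.2
      obtain ⟨h1, h2, h3⟩ := hp.minLayerOf_spec (k := k.1 + 1) (by omega)
      refine (hph.π_path _ h1 i j hij).trans ?_
      rw [h3, SubdivVertex.onPath, dif_pos hk]
    · rfl
  · have := τ.codeLt_root (p := (posTwo x).2.1) (q := (posTwo x).2.2)
      (τ.isLayerCode_mesh (posTwo_lt hle x))
    rw [← code_two x hx] at this
    exact this
  · rcases x with _ | ⟨_ | _, f, k⟩ | ⟨s, i, j, hij⟩
    · exact absurd rfl hx
    · exact absurd (congrArg (fun f => HostVertex.side false f k)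
        (Subsingleton.elim (α := Fin 1) ⟨0, Nat.one_pos⟩ f)) hx
    · exact absurd (congrArg (fun f => HostVertex.side true f k)
        (Subsingleton.elim (α := Fin 1) ⟨0, Nat.one_pos⟩ f)) hx
    · have hs : s.1 < τ.h := s.2
      rcases Nat.eq_zero_or_pos s.1 with h0 | h0
      · have e : hostContraction (τ.h - 1) τ.meshUp τ.meshDn 0
            (.cell s i j hij : τ.layoutTwo.Vertex G) = .a i := by
          change SubdivVertex.onPath _ i j hij (layerGroup _ _ s.1) = _
          rw [h0]; rfl
        rw [e]
        refine (lt_two_iff ht (.side false ⟨0, Nat.one_pos⟩ i) (.cell s i j hij) nofun nofun).2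
          (.inl ⟨rfl, h0, rfl, ?_⟩)
        change 1 < 2 + 3 * j.1
        omega
      by_cases h1 : s.1 + 1 = τ.h
      · have e : hostContraction (τ.h - 1) τ.meshUp τ.meshDn 0
            (.cell s i j hij : τ.layoutTwo.Vertex G) = .b j := by
          change SubdivVertex.onPath _ i j hij (layerGroup _ _ s.1) = _
          rw [show s.1 = τ.h - 1 by omega, hp.onPath_last]
        rw [e]
        refine (lt_two_iff ht (.side true ⟨0, Nat.one_pos⟩ j) (.cell s i j hij) nofun nofun).2
          (.inr (.inl ⟨Nat.sub_add_cancel (by omega), h1, rfl, ?_⟩))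
        change 1 < 2 + 3 * i.1
        omega
      obtain ⟨m, h2, h3, h4, h5⟩ := hp.exists_minLayer (show s.1 ≤ τ.h - 1 by omega)
      have hm : 0 < m ∧ m < τ.h - 1 := by
        rcases h5 with h5 | ⟨h5, h6⟩ | ⟨h5, h6⟩
        · omega
        · refine ⟨Nat.pos_of_ne_zero fun h7 => (not_meshUp_two ht (.inl h7)).1 h5, by omega⟩
        · have : s.1 + 2 ≠ τ.h := fun h7 => (not_meshUp_two ht (.inr h7)).2 h5
          omega
      have hmh : m < τ.h := by omega
      have e : σ (hostContraction (τ.h - 1) τ.meshUp τ.meshDn 0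
          (.cell s i j hij : τ.layoutTwo.Vertex G)) = .cell ⟨m, hmh⟩ i j hij := by
        change σ (SubdivVertex.onPath _ i j hij (layerGroup _ _ s.1)) = _
        rw [← h4, hσp h3 hm.1 hm.2, pathTwo_of_lt hmh]
      rw [e] at hx ⊢
      refine (lt_two_iff ht (.cell ⟨m, hmh⟩ i j hij) (.cell s i j hij) nofun nofun).2 ?_
      rcases h5 with rfl | ⟨h5, h6⟩ | ⟨h5, h6⟩
      · exact absurd rfl hx
      · exact .inr (.inr (.inl ⟨h6, h5, rfl, rfl⟩))
      · exact .inr (.inr (.inr ⟨h6, h5, rfl, rfl⟩))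
  · have hxr : x ≠ HostVertex.root := by
      rintro rfl
      exact τ.not_codeLt_root _ hlt
    have hmx : σ (hostContraction (τ.h - 1) τ.meshUp τ.meshDn 0 x) = x →
        MinLayer τ.meshUp τ.meshDn (posTwo x).1 ∧ ((posTwo x).1 = 0 → (posTwo x).2.2 = 1) ∧
        ((posTwo x).1 + 1 = τ.h → (posTwo x).2.1 = 1) := by
      intro h
      have := hmin _ fun h => hxr (hrr x h)
      rwa [h] at this
    rcases (lt_two_iff ht y x hy hxr).1 hlt with ⟨h1, h2, h3, h4⟩ | ⟨h1, h2, h3, h4⟩ |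
      ⟨h1, h2, h3, h4⟩ | ⟨h1, h2, h3, h4⟩
    · constructor
      · have key : ∀ z : τ.layoutTwo.Vertex G, z ≠ .root → (posTwo z).1 = 0 →
            ∃ i : Fin G.nA, hostContraction (τ.h - 1) τ.meshUp τ.meshDn 0 z = .a i ∧
              (posTwo z).2.1 = 2 + 3 * i.1 := by
          intro z hz h0
          rcases z with _ | ⟨_ | _, f, k⟩ | ⟨s, i, j, hij⟩
          · exact absurd rfl hz
          · exact ⟨k, rfl, rfl⟩
          · change τ.h - 1 = 0 at h0
            omega
          · refine ⟨i, ?_, rfl⟩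
            change SubdivVertex.onPath _ i j hij (layerGroup _ _ s.1) = _
            rw [show s.1 = 0 from h0]; rfl
        obtain ⟨i, e1, e2⟩ := key y hy h1
        obtain ⟨i', e3, e4⟩ := key x hxr h2
        rw [e1, e3, show i = i' from Fin.ext (by omega)]
      · intro h
        have h5 := (hmx h).2.1 h2
        have h6 : 1 ≤ (posTwo y).2.2 := by
          rcases y with _ | ⟨_ | _, f, k⟩ | ⟨s, i, j, hij⟩
          · exact absurd rfl hy
          all_goals simp only [posTwo]; omega
        omega
    · constructor
      · have key : ∀ z : τ.layoutTwo.Vertex G, z ≠ .root → (posTwo z).1 + 1 = τ.h →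
            ∃ j : Fin G.nB, hostContraction (τ.h - 1) τ.meshUp τ.meshDn 0 z = .b j ∧
              (posTwo z).2.2 = 2 + 3 * j.1 := by
          intro z hz h0
          rcases z with _ | ⟨_ | _, f, k⟩ | ⟨s, i, j, hij⟩
          · exact absurd rfl hz
          · change 0 + 1 = τ.h at h0
            omega
          · exact ⟨k, rfl, rfl⟩
          · refine ⟨j, ?_, rfl⟩
            change s.1 + 1 = τ.h at h0
            change SubdivVertex.onPath _ i j hij (layerGroup _ _ s.1) = _
            rw [show s.1 = τ.h - 1 by omega, hp.onPath_last]
        obtain ⟨i, e1, e2⟩ := key y hy h1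
        obtain ⟨i', e3, e4⟩ := key x hxr h2
        rw [e1, e3, show i = i' from Fin.ext (by omega)]
      · intro h
        have h5 := (hmx h).2.2 h2
        have h6 : 1 ≤ (posTwo y).2.1 := by
          rcases y with _ | ⟨_ | _, f, k⟩ | ⟨s, i, j, hij⟩
          · exact absurd rfl hy
          all_goals simp only [posTwo]; omega
        omega
    · constructor
      · have hlx := posTwo_lt hle x
        obtain ⟨i, j, hij, h5, h6⟩ := path_of_pos_two hy hxr h1 h3 h4
        rw [h5, h6, hph.π_path _ (by omega), hph.π_path _ (by omega), h1,
            layerGroup_succ_of_cont (.inl h2)]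
      · intro h
        exact (hmx h).1.1 _ h1.symm h2
    · constructor
      · have hly := posTwo_lt hle y
        obtain ⟨i, j, hij, h5, h6⟩ := path_of_pos_two hxr hy h1 h3.symm h4.symm
        rw [h5, h6, hph.π_path _ (by omega), hph.π_path _ (by omega), h1,
            layerGroup_succ_of_cont (.inr h2)]
      · intro h
        exact (hmx h).1.2 h2

end Core

/-! ### The order of a core of type 3 -/

/-- A layer, a row (`own false`) and a column (`own true`). -/
@[ext]
structure RackPos where
  lay : ℕ
  own : Bool → ℕ

/-- The position in the layer `l` with coordinate `o` in the direction `t` and `c` in the other. -/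
def RackPos.at (t : Bool) (l o c : ℕ) : RackPos := ⟨l, fun b => bif b == t then o else c⟩

theorem RackPos.at_own (t : Bool) (l o c : ℕ) : (RackPos.at t l o c).own t = o := by
  simp [RackPos.at]

theorem RackPos.at_own_not (t : Bool) (l o c : ℕ) : (RackPos.at t l o c).own (!t) = c := by
  cases t <;> rfl

/-- The relations between the layers `0, …, H` of a core of type 3. The first and the last layer are
the chains `cl false` and `cl true`; `ab t l` says that the layer `l` is above the chain `cl t`, `V t`
that its relation to the next layer is simply vertical (horizontal), `mb l l'` that
the middle layer `l` is below the middle layer `l'`, and `je l l'` that there are edges between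
`l` and `l'`. -/
structure RackFrame where
  H : ℕ
  V : Bool → Prop
  rev : Bool → Bool
  ab : Bool → ℕ → Prop
  mb : ℕ → ℕ → Prop
  je : ℕ → ℕ → Prop
  radj : ℕ → Prop

namespace RackFrame

variable (F : RackFrame)

def cl (t : Bool) : ℕ := bif t then F.H else 0

/-- The layer next to a chain. -/
def nb (t : Bool) : ℕ := bif t then F.H - 1 else 1

/-- The order of the coordinates across a chain. -/
def crossLt (t : Bool) (c c' : ℕ) : Prop := if F.rev t then c' < c else c < c'

def Lt (x y : RackPos) : Prop :=
  (∃ t, x.lay = F.cl t ∧ y.lay = F.cl t ∧ (x.own t < y.own t ∨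
    (x.own t = y.own t ∧ F.crossLt t (x.own (!t)) (y.own (!t))))) ∨
  (∃ t, x.lay = F.cl t ∧ y.lay ≠ F.cl t ∧ (F.ab t y.lay ∨
    (F.V t ∧ y.lay = F.nb t ∧ x.own t ≤ y.own t))) ∨
  (F.mb x.lay y.lay ∧ x.own = y.own)

/-- Positions with coordinates below `2` stand for the vertices of a core, so `trans` and `chain`
are the tree-order axioms of the core itself. The restrictions on `ab`, `mb` and `V` below all come
from evaluating these axioms at a few such positions. -/
structure IsTree : Prop where
  pos : 1 ≤ F.H
  two_le : ∀ t, F.V t → 2 ≤ F.H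
  not_ab_nb : ∀ t, F.V t → ¬ F.ab t (F.nb t)
  not_ab_zero : ¬ F.ab true 0
  mb_mid : ∀ l l', F.mb l l' → 0 < l ∧ l < F.H ∧ 0 < l' ∧ l' < F.H ∧ (l' = l + 1 ∨ l = l' + 1)
  je_symm : ∀ l l', F.je l l' → F.je l' l
  je_consecutive : ∀ l l', F.je l l' → l' = l + 1 ∨ l = l' + 1
  je_nb : ∀ t, F.je (F.cl t) (F.nb t) ↔ ¬ F.V t
  je_mid : ∀ l, 0 < l → l + 1 < F.H → ¬ F.mb l (l + 1) → ¬ F.mb (l + 1) l → F.je l (l + 1)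
  trans : ∀ x y z : RackPos, x.lay ≤ F.H → y.lay ≤ F.H → z.lay ≤ F.H → (∀ t, x.own t < 2) →
    (∀ t, y.own t < 2) → (∀ t, z.own t < 2) → F.Lt x y → F.Lt y z → F.Lt x z
  chain : ∀ x y z : RackPos, x.lay ≤ F.H → y.lay ≤ F.H → z.lay ≤ F.H → (∀ t, x.own t < 2) →
    (∀ t, y.own t < 2) → (∀ t, z.own t < 2) → F.Lt x z → F.Lt y z → F.Lt x y ∨ x = y ∨ F.Lt y x

variable {F}

/-- `IsTree` is not assumed, since this description of `Lt` is used to prove that the frame of a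
core satisfies `IsTree`. -/
theorem lt_chain_iff_of_mid (hpos : 1 ≤ F.H) (hmb : ∀ l l', F.mb l l' → 0 < l ∧ l < F.H) {t : Bool}
    {x y : RackPos} (hx : x.lay = F.cl t) (hy : y.lay = F.cl t) :
    F.Lt x y ↔ x.own t < y.own t ∨
      (x.own t = y.own t ∧ F.crossLt t (x.own (!t)) (y.own (!t))) := by
  have hne : ∀ t', x.lay = F.cl t' → t' = t := by
    intro t' ht'
    rw [hx] at ht'
    cases t <;> cases t' <;> simp [cl] at ht' ⊢ <;> omega
  constructor
  · rintro (⟨t', h1, -, h3⟩ | ⟨t', h1, h2, -⟩ | ⟨h1, -⟩)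
    · rwa [hne t' h1] at h3
    · rw [hne t' h1] at h2
      exact absurd hy h2
    · have := hmb _ _ h1
      rw [hx] at this
      cases t <;> simp [cl] at this
  · intro h1
    exact .inl ⟨t, hx, hy, h1⟩

theorem lt_out_iff_of_mid (hpos : 1 ≤ F.H) (hmb : ∀ l l', F.mb l l' → 0 < l ∧ l < F.H) {t : Bool}
    {x y : RackPos} (hx : x.lay = F.cl t) (hy : y.lay ≠ F.cl t) :
    F.Lt x y ↔ F.ab t y.lay ∨ (F.V t ∧ y.lay = F.nb t ∧ x.own t ≤ y.own t) := by
  have hne : ∀ t', x.lay = F.cl t' → t' = t := by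
    intro t' ht'
    rw [hx] at ht'
    cases t <;> cases t' <;> simp [cl] at ht' ⊢ <;> omega
  constructor
  · rintro (⟨t', h1, h2, -⟩ | ⟨t', h1, -, h3⟩ | ⟨h1, -⟩)
    · rw [hne t' h1] at h2
      exact absurd h2 hy
    · rwa [hne t' h1] at h3
    · have := hmb _ _ h1
      rw [hx] at this
      cases t <;> simp [cl] at this
  · intro h1
    exact .inr (.inl ⟨t, hx, hy, h1⟩)

theorem lt_chain_iff (h : F.IsTree) {t : Bool} {x y : RackPos} (hx : x.lay = F.cl t)
    (hy : y.lay = F.cl t) : F.Lt x y ↔ x.own t < y.own t ∨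
      (x.own t = y.own t ∧ F.crossLt t (x.own (!t)) (y.own (!t))) :=
  lt_chain_iff_of_mid h.pos (fun _ _ hm => ⟨(h.mb_mid _ _ hm).1, (h.mb_mid _ _ hm).2.1⟩) hx hy

theorem lt_out_iff (h : F.IsTree) {t : Bool} {x y : RackPos} (hx : x.lay = F.cl t)
    (hy : y.lay ≠ F.cl t) : F.Lt x y ↔ F.ab t y.lay ∨
      (F.V t ∧ y.lay = F.nb t ∧ x.own t ≤ y.own t) :=
  lt_out_iff_of_mid h.pos (fun _ _ hm => ⟨(h.mb_mid _ _ hm).1, (h.mb_mid _ _ hm).2.1⟩) hx hy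

theorem lt_mid_iff {x y : RackPos} (hx : ∀ t, x.lay ≠ F.cl t) :
    F.Lt x y ↔ F.mb x.lay y.lay ∧ x.own = y.own := by
  constructor
  · rintro (⟨t, h, -⟩ | ⟨t, h, -⟩ | h)
    · exact absurd h (hx t)
    · exact absurd h (hx t)
    · exact h
  · exact fun h => .inr (.inr h)

theorem cl_ne_cl (h : F.IsTree) (t : Bool) : F.cl (!t) ≠ F.cl t := by
  have := h.pos
  cases t <;> simp [cl] <;> omega

theorem nb_ne_cl (h2 : 2 ≤ F.H) (t t' : Bool) : F.nb t ≠ F.cl t' := by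
  cases t <;> cases t' <;> simp [nb, cl] <;> omega

theorem cl_le (t : Bool) : F.cl t ≤ F.H := by cases t <;> simp [cl]

theorem nb_le (h : F.IsTree) (t : Bool) : F.nb t ≤ F.H := by
  have := h.pos
  cases t <;> simp [nb]; omega

theorem mid_ne_cl (h : F.IsTree) {l l' : ℕ} (hm : F.mb l l') (t : Bool) :
    l ≠ F.cl t ∧ l' ≠ F.cl t := by
  have := h.mb_mid _ _ hm
  cases t <;> simp [cl] <;> omega

theorem own_lt (t : Bool) (l : ℕ) {o c : ℕ} (ho : o < 2) (hc : c < 2) (b : Bool) :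
    (RackPos.at t l o c).own b < 2 := by
  simp only [RackPos.at]
  cases b == t <;> assumption

/-- The other chain is below the layer next to a simply vertical chain only if it is below the
chain. -/
theorem ab_cl_of_ab_nb (h : F.IsTree) {t : Bool} (hV : F.V t) (hab : F.ab (!t) (F.nb t)) :
    F.ab (!t) (F.cl t) := by
  have h2 := h.two_le t hV
  have n1 := nb_ne_cl h2 t t
  have n2 := nb_ne_cl h2 t (!t)
  have n3 := cl_ne_cl h t
  have hz : F.Lt (.at t (F.cl (!t)) 0 0) (.at t (F.nb t) 0 0) :=
    (lt_out_iff h rfl n2).2 (.inl hab)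
  have hw : F.Lt (.at t (F.cl t) 0 0) (.at t (F.nb t) 0 0) :=
    (lt_out_iff h rfl n1).2 (.inr ⟨hV, rfl, by simp [RackPos.at_own]⟩)
  have b := fun l o c => own_lt t l (o := o) (c := c)
  rcases h.chain _ _ _ (cl_le t) (cl_le (!t)) (nb_le h t) (b _ _ _ (by omega) (by omega))
    (b _ _ _ (by omega) (by omega)) (b _ _ _ (by omega) (by omega)) hw hz with h1 | h1 | h1
  · have hx : F.Lt (.at t (F.cl t) 1 0) (.at t (F.cl (!t)) 0 0) := by
      rcases (lt_out_iff h rfl n3).1 h1 with h3 | ⟨-, h3, -⟩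
      · exact (lt_out_iff h rfl n3).2 (.inl h3)
      · exact absurd h3.symm n2
    have := h.trans _ _ _ (cl_le t) (cl_le (!t)) (nb_le h t) (b _ _ _ (by omega) (by omega))
      (b _ _ _ (by omega) (by omega)) (b _ _ _ (by omega) (by omega)) hx hz
    rcases (lt_out_iff h rfl n1).1 this with h3 | ⟨-, -, h3⟩
    · exact absurd h3 (h.not_ab_nb t hV)
    · simp [RackPos.at_own] at h3
  · exact absurd (congrArg RackPos.lay h1).symm n3
  · rcases (lt_out_iff h rfl (Ne.symm n3)).1 h1 with h3 | ⟨-, h3, -⟩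
    · exact h3
    · exact absurd h3.symm (nb_ne_cl h2 (!t) t)

/-- Suppose a middle layer is below the layer next to a simply vertical chain. Both have vertices
below a common one, so by the chain condition the entire chain is below the middle layer. By
transitivity its row `1` is then below row `0` of the next layer, against verticality. -/
theorem not_mb_nb (h : F.IsTree) {t : Bool} (hV : F.V t) (l : ℕ) : ¬ F.mb l (F.nb t) := by
  intro hm
  have h2 := h.two_le t hV
  have n1 := nb_ne_cl h2 t t
  have nl := fun t => (mid_ne_cl h hm t).1
  have hl : l ≤ F.H := (h.mb_mid _ _ hm).2.1.le
  have hln : l ≠ F.nb t := by have := h.mb_mid _ _ hm; omega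
  have b := fun l o c => own_lt t l (o := o) (c := c)
  have hw : F.Lt (.at t (F.cl t) 1 0) (.at t (F.nb t) 1 0) :=
    (lt_out_iff h rfl n1).2 (.inr ⟨hV, rfl, by simp [RackPos.at_own]⟩)
  have hz : ∀ o, F.Lt (.at t l o 0) (.at t (F.nb t) o 0) := fun o =>
    (lt_mid_iff nl).2 ⟨hm, rfl⟩
  rcases h.chain _ _ _ (cl_le t) hl (nb_le h t) (b _ _ _ (by omega) (by omega))
    (b _ _ _ (by omega) (by omega)) (b _ _ _ (by omega) (by omega)) hw (hz 1) with h1 | h1 | h1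
  · have hab : F.ab t l := by
      rcases (lt_out_iff h rfl (nl t)).1 h1 with h3 | ⟨-, h3, -⟩
      · exact h3
      · exact absurd h3 hln
    have hx : F.Lt (.at t (F.cl t) 1 0) (.at t l 0 0) := (lt_out_iff h rfl (nl t)).2 (.inl hab)
    have := h.trans _ _ _ (cl_le t) hl (nb_le h t) (b _ _ _ (by omega) (by omega))
      (b _ _ _ (by omega) (by omega)) (b _ _ _ (by omega) (by omega)) hx (hz 0)
    rcases (lt_out_iff h rfl n1).1 this with h3 | ⟨-, -, h3⟩
    · exact absurd h3 (h.not_ab_nb t hV)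
    · simp [RackPos.at_own] at h3
  · exact absurd (congrArg RackPos.lay h1).symm (nl t)
  · exact absurd rfl (mid_ne_cl h ((lt_mid_iff nl).1 h1).1 t).2

/-- A layer `l` above the layer next to a simply vertical chain is above the chain by transitivity,
hence above all of it. Then row `1` of the chain and row `0` of the next layer are below a common
vertex of `l`, although they are incomparable. -/
theorem not_nb_mb (h : F.IsTree) {t : Bool} (hV : F.V t) (l : ℕ) : ¬ F.mb (F.nb t) l := by
  intro hm
  have h2 := h.two_le t hV
  have n1 := nb_ne_cl h2 t t
  have nl := fun t => (mid_ne_cl h hm t).2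
  have hl : l ≤ F.H := (h.mb_mid _ _ hm).2.2.2.1.le
  have hln : l ≠ F.nb t := by have := h.mb_mid _ _ hm; omega
  have b := fun l o c => own_lt t l (o := o) (c := c)
  have hw : F.Lt (.at t (F.cl t) 0 0) (.at t (F.nb t) 0 0) :=
    (lt_out_iff h rfl n1).2 (.inr ⟨hV, rfl, by simp [RackPos.at_own]⟩)
  have hz : F.Lt (.at t (F.nb t) 0 0) (.at t l 0 0) := (lt_mid_iff (nb_ne_cl h2 t)).2 ⟨hm, rfl⟩
  have hx := h.trans _ _ _ (cl_le t) (nb_le h t) hl (b _ _ _ (by omega) (by omega))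
    (b _ _ _ (by omega) (by omega)) (b _ _ _ (by omega) (by omega)) hw hz
  have hab : F.ab t l := by
    rcases (lt_out_iff h rfl (nl t)).1 hx with h3 | ⟨-, h3, -⟩
    · exact h3
    · exact absurd h3 hln
  have hx' : F.Lt (.at t (F.cl t) 1 0) (.at t l 0 0) := (lt_out_iff h rfl (nl t)).2 (.inl hab)
  rcases h.chain _ _ _ (cl_le t) (nb_le h t) hl (b _ _ _ (by omega) (by omega))
    (b _ _ _ (by omega) (by omega)) (b _ _ _ (by omega) (by omega)) hx' hz with h1 | h1 | h1
  · rcases (lt_out_iff h rfl n1).1 h1 with h3 | ⟨-, -, h3⟩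
    · exact absurd h3 (h.not_ab_nb t hV)
    · simp [RackPos.at_own] at h3
  · exact absurd (congrArg RackPos.lay h1).symm n1
  · exact absurd rfl (mid_ne_cl h ((lt_mid_iff (nb_ne_cl h2 t)).1 h1).1 t).2

/-- The chain condition gives one direction and transitivity the other. The simply vertical
alternative does not occur, since a layer next to such a chain is not comparable to a middle layer.
-/
theorem ab_iff_of_mb (h : F.IsTree) {l l' : ℕ} (hm : F.mb l l') (t : Bool) :
    F.ab t l' ↔ F.ab t l := by
  have nl := fun t => (mid_ne_cl h hm t).1
  have nl' := fun t => (mid_ne_cl h hm t).2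
  have hl : l ≤ F.H := (h.mb_mid _ _ hm).2.1.le
  have hl' : l' ≤ F.H := (h.mb_mid _ _ hm).2.2.2.1.le
  have b := fun l o c => own_lt t l (o := o) (c := c)
  have hz : F.Lt (.at t l 0 0) (.at t l' 0 0) := (lt_mid_iff nl).2 ⟨hm, rfl⟩
  constructor
  · intro hab
    have hw : F.Lt (.at t (F.cl t) 0 0) (.at t l' 0 0) := (lt_out_iff h rfl (nl' t)).2 (.inl hab)
    rcases h.chain _ _ _ (cl_le t) hl hl' (b _ _ _ (by omega) (by omega))
      (b _ _ _ (by omega) (by omega)) (b _ _ _ (by omega) (by omega)) hw hz with h1 | h1 | h1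
    · rcases (lt_out_iff h rfl (nl t)).1 h1 with h3 | ⟨hV, h3, -⟩
      · exact h3
      · change l = F.nb t at h3
        exact absurd (h3 ▸ hm) (not_nb_mb h hV l')
    · exact absurd (congrArg RackPos.lay h1).symm (nl t)
    · exact absurd rfl (mid_ne_cl h ((lt_mid_iff nl).1 h1).1 t).2
  · intro hab
    have hw : F.Lt (.at t (F.cl t) 0 0) (.at t l 0 0) := (lt_out_iff h rfl (nl t)).2 (.inl hab)
    have := h.trans _ _ _ (cl_le t) hl hl' (b _ _ _ (by omega) (by omega))
      (b _ _ _ (by omega) (by omega)) (b _ _ _ (by omega) (by omega)) hw hz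
    rcases (lt_out_iff h rfl (nl' t)).1 this with h3 | ⟨hV, h3, -⟩
    · exact h3
    · change l' = F.nb t at h3
      exact absurd (h3 ▸ hm) (not_mb_nb h hV l)

/-- The composite would relate a middle layer to itself or to one at distance two. -/
theorem mb_trans_false (h : F.IsTree) {l l' l'' : ℕ} (hm : F.mb l l') (hm' : F.mb l' l'') :
    False := by
  have nl := fun t => (mid_ne_cl h hm t).1
  have nl' := fun t => (mid_ne_cl h hm' t).1
  have b := fun l o c => own_lt false l (o := o) (c := c)
  have h1 := h.mb_mid _ _ hm
  have h2 := h.mb_mid _ _ hm'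
  have := h.trans (.at false l 0 0) (.at false l' 0 0) (.at false l'' 0 0) h1.2.1.le h2.2.1.le
    h2.2.2.2.1.le (b _ _ _ (by omega) (by omega))
    (b _ _ _ (by omega) (by omega)) (b _ _ _ (by omega) (by omega))
    ((lt_mid_iff nl).2 ⟨hm, rfl⟩) ((lt_mid_iff nl').2 ⟨hm', rfl⟩)
  have h3 := h.mb_mid _ _ ((lt_mid_iff nl).1 this).1
  simp only [RackPos.at] at h3
  omega

/-- Distinct layers below the same one would be comparable by the chain condition, which gives two
successive comparabilities. -/
theorem mb_unique (h : F.IsTree) {l l' m : ℕ} (hm : F.mb l m) (hm' : F.mb l' m) : l = l' := by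
  have nl := fun t => (mid_ne_cl h hm t).1
  have nl' := fun t => (mid_ne_cl h hm' t).1
  have b := fun l o c => own_lt false l (o := o) (c := c)
  have h1 := h.mb_mid _ _ hm
  have h2 := h.mb_mid _ _ hm'
  have := h.chain (.at false l 0 0) (.at false l' 0 0) (.at false m 0 0) h1.2.1.le h2.2.1.le
    h2.2.2.2.1.le (b _ _ _ (by omega) (by omega))
    (b _ _ _ (by omega) (by omega)) (b _ _ _ (by omega) (by omega))
    ((lt_mid_iff nl).2 ⟨hm, rfl⟩) ((lt_mid_iff nl').2 ⟨hm', rfl⟩)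
  rcases this with h3 | h3 | h3
  · exact (mb_trans_false h ((lt_mid_iff nl).1 h3).1 hm').elim
  · exact congrArg RackPos.lay h3
  · exact (mb_trans_false h ((lt_mid_iff nl').1 h3).1 hm).elim

/-- Transitivity through the last layer. The test position has row `1` in the first chain and row
`0` in layer `m`, so the resulting relation cannot be the merely vertical one. -/
theorem ab_false_of_ab_true (h : F.IsTree) {m : ℕ} (h0 : 0 < m) (hH : m < F.H)
    (hm : F.ab true m) (hAB : F.ab false F.H) : F.ab false m := by
  have b := fun l o c => own_lt false l (o := o) (c := c)
  have := h.trans (.at false 0 1 0) (.at false F.H 0 0) (.at false m 0 0) (Nat.zero_le _) le_rfl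
    hH.le (b _ _ _ (by omega) (by omega))
    (b _ _ _ (by omega) (by omega)) (b _ _ _ (by omega) (by omega))
    ((lt_out_iff h (t := false) rfl (cl_ne_cl h false)).2 (.inl hAB))
    ((lt_out_iff h (t := true) rfl hH.ne).2 (.inl hm))
  rcases (lt_out_iff h (t := false) rfl h0.ne').1 this with h3 | ⟨-, -, h3⟩
  · exact h3
  · simp [RackPos.at_own] at h3

/-- The two chains have a common vertex above them, so they are comparable, and the last layer is
never below the first. -/
theorem ab_of_ab_ab (h : F.IsTree) {m : ℕ} (h0 : 0 < m) (hH : m < F.H)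
    (hm : F.ab true m) (hm' : F.ab false m) : F.ab false F.H := by
  have b := fun l o c => own_lt false l (o := o) (c := c)
  have hpos := h.pos
  have := h.chain (.at false 0 0 0) (.at false F.H 0 0) (.at false m 0 0) (Nat.zero_le _) le_rfl
    hH.le (b _ _ _ (by omega) (by omega))
    (b _ _ _ (by omega) (by omega)) (b _ _ _ (by omega) (by omega))
    ((lt_out_iff h (t := false) rfl h0.ne').2 (.inl hm'))
    ((lt_out_iff h (t := true) rfl hH.ne).2 (.inl hm))
  rcases this with h3 | h3 | h3
  · rcases (lt_out_iff h (t := false) rfl (cl_ne_cl h false)).1 h3 with h4 | ⟨-, h4, -⟩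
    · exact h4
    · change F.H = 1 at h4
      omega
  · have := congrArg RackPos.lay h3
    simp only [RackPos.at] at this
    omega
  · rcases (lt_out_iff h (t := true) rfl (cl_ne_cl h true)).1 h3 with h4 | ⟨-, h4, -⟩
    · exact absurd h4 h.not_ab_zero
    · change 0 = F.H - 1 at h4
      omega

/-- With one middle layer next to two simply vertical chains, row `1` of the first chain and a
vertex of the last have a common upper bound, so they are comparable. The last layer is not below
the first; and if the first is below the last, transitivity puts its row `1` below row `0` of the
middle layer. -/
theorem nb_ne_of_V (h : F.IsTree) (h1 : F.V false) (h2 : F.V true) : F.nb false ≠ F.nb true := by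
  intro he
  have hH := h.two_le _ h1
  have hH2 : F.H = 2 := by simp [nb] at he; omega
  have b := fun l o c => own_lt false l (o := o) (c := c)
  have hn : ∀ t, (1 : ℕ) ≠ F.cl t := fun t => nb_ne_cl hH false t
  have := h.chain (.at false 0 1 0) (.at false F.H 0 0) (.at false 1 1 0) (Nat.zero_le _) le_rfl
    (show 1 ≤ F.H by omega) (b _ _ _ (by omega) (by omega))
    (b _ _ _ (by omega) (by omega)) (b _ _ _ (by omega) (by omega))
    ((lt_out_iff h (t := false) rfl (hn _)).2 (.inr ⟨h1, rfl, le_rfl⟩))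
    ((lt_out_iff h (t := true) rfl (hn _)).2 (.inr ⟨h2, by simp [RackPos.at, nb, hH2], le_rfl⟩))
  rcases this with h3 | h3 | h3
  · have := h.trans _ _ (.at false 1 0 0) (Nat.zero_le _) le_rfl
      (show 1 ≤ F.H by omega) (b _ _ _ (by omega) (by omega))
      (b _ _ _ (by omega) (by omega)) (b _ _ _ (by omega) (by omega)) h3
      ((lt_out_iff h (t := true) rfl (hn _)).2 (.inr ⟨h2, by simp [RackPos.at, nb, hH2], le_rfl⟩))
    rcases (lt_out_iff h (t := false) rfl (hn _)).1 this with h4 | ⟨-, -, h4⟩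
    · exact h.not_ab_nb _ h1 h4
    · simp [RackPos.at_own] at h4
  · have := congrArg RackPos.lay h3
    simp only [RackPos.at] at this
    omega
  · rcases (lt_out_iff h (t := true) rfl (cl_ne_cl h true)).1 h3 with h4 | ⟨-, h4, -⟩
    · exact h.not_ab_zero h4
    · change 0 = F.H - 1 at h4
      omega

theorem nb_ne_nb (h : F.IsTree) {t : Bool} (h1 : F.V t) (h2 : F.V (!t)) : F.nb (!t) ≠ F.nb t := by
  cases t
  · exact (nb_ne_of_V h h1 h2).symm
  · exact nb_ne_of_V h h2 h1

/-! ### The layers as a path -/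

-- A simply vertical or horizontal pair is contracted like a comparable pair of middle layers. A
-- layer above an entire chain is not: that relation survives in the rack.
variable (F) in
def up (l : ℕ) : Prop := (l = 0 ∧ F.V false) ∨ F.mb l (l + 1)

variable (F) in
def dn (l : ℕ) : Prop := (l + 1 = F.H ∧ F.V true) ∨ F.mb (l + 1) l

theorem layerPath (h : F.IsTree) : LayerPath F.H F.up F.dn where
  pos := h.pos
  up_lt t := by
    rintro (⟨rfl, hV⟩ | hm)
    · exact h.two_le _ hV
    · exact (h.mb_mid _ _ hm).2.2.2.1
  dn_pos t := by
    rintro (⟨h1, hV⟩ | hm)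
    · have := h.two_le _ hV; omega
    · exact (h.mb_mid _ _ hm).2.2.1
  dn_lt t := by
    rintro (⟨h1, hV⟩ | hm)
    · omega
    · exact (h.mb_mid _ _ hm).2.2.2.1
  up_dn t := by
    rintro (⟨rfl, hV⟩ | hm) (⟨h1, hV'⟩ | hm')
    · have := h.two_le _ hV; omega
    · have := h.mb_mid _ _ hm'; omega
    · have := h.mb_mid _ _ hm; omega
    · exact mb_trans_false h hm hm'
  up_up t := by
    rintro (⟨rfl, hV⟩ | hm) (⟨h1, hV'⟩ | hm')
    · omega
    · exact not_nb_mb h hV _ hm'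
    · omega
    · exact mb_trans_false h hm hm'
  dn_dn t := by
    rintro (⟨h1, hV⟩ | hm) (⟨h1', hV'⟩ | hm')
    · omega
    · have := h.mb_mid _ _ hm'; omega
    · refine not_nb_mb h hV' t ?_
      rwa [show F.nb true = t + 1 by simp [nb]; omega]
    · exact mb_trans_false h hm' hm
  up_dn_succ t := by
    rintro (⟨rfl, hV⟩ | hm) (⟨h1, hV'⟩ | hm')
    · exact nb_ne_of_V h hV hV' (by simp [nb]; omega)
    · exact not_mb_nb h hV _ hm'
    · refine not_mb_nb h hV' t ?_
      rwa [show F.nb true = t + 1 by simp [nb]; omega]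
    · have := mb_unique h hm hm'; omega

theorem minLayer_iff (h : F.IsTree) {l : ℕ} (h0 : 0 < l) (hH : l < F.H) :
    MinLayer F.up F.dn l ↔ (∀ m, ¬ F.mb m l) ∧ ∀ t, F.V t → l ≠ F.nb t := by
  constructor
  · rintro ⟨h1, h2⟩
    refine ⟨fun m hm => ?_, fun t hV hl => ?_⟩
    · rcases (h.mb_mid _ _ hm).2.2.2.2 with h3 | h3
      · subst h3
        exact h1 m rfl (.inr hm)
      · subst h3
        exact h2 (.inr hm)
    · cases t
      · exact h1 0 hl.symm (.inl ⟨rfl, hV⟩)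
      · exact h2 (.inl ⟨by simp [nb] at hl; omega, hV⟩)
  · rintro ⟨h1, h2⟩
    refine ⟨fun t ht => ?_, ?_⟩
    · rintro (⟨rfl, hV⟩ | hm)
      · exact h2 false hV ht.symm
      · exact h1 _ (ht ▸ hm)
    · rintro (⟨h3, hV⟩ | hm)
      · exact h2 true hV (by simp [nb]; omega)
      · exact h1 _ hm

theorem je_of_not (h : F.IsTree) {l : ℕ} (hl : l < F.H) (hu : ¬ F.up l) (hd : ¬ F.dn l) :
    F.je l (l + 1) := by
  rcases Nat.eq_zero_or_pos l with rfl | h0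
  · exact (h.je_nb false).2 fun hV => hu (.inl ⟨rfl, hV⟩)
  by_cases h1 : l + 1 = F.H
  · have := (h.je_nb true).2 fun hV => hd (.inl ⟨h1, hV⟩)
    have := h.je_symm _ _ this
    rwa [show F.nb true = l by simp [nb]; omega, show F.cl true = l + 1 from h1.symm] at this
  · exact h.je_mid l h0 (by omega) (fun hm => hu (.inr hm)) fun hm => hd (.inr hm)

/-- A middle layer above another one has edges to its other neighbour. -/
theorem exists_je_of_not_minLayer (h : F.IsTree) {l : ℕ} (hH : l < F.H)
    (hl : ¬ MinLayer F.up F.dn l) : ∃ l' ≤ F.H, F.je l l' := by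
  have hp := layerPath h
  rcases not_and_or.1 hl with h1 | h1
  · push Not at h1
    obtain ⟨t, rfl, hu⟩ := h1
    exact ⟨_, hH, je_of_not h hH (hp.up_up t hu) (hp.up_dn_succ t hu)⟩
  · rw [not_not] at h1
    have h0 := hp.dn_pos l h1
    obtain ⟨t, rfl⟩ : ∃ t, l = t + 1 := ⟨l - 1, by omega⟩
    exact ⟨t, by omega, h.je_symm _ _ (je_of_not h (by omega)
      (fun hu => hp.up_dn_succ t hu h1) fun hd => hp.dn_dn t hd h1)⟩

/-- A middle layer without edges is below another one, unless it is next to a simply vertical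
chain. -/
theorem exists_mb_of_not_je (h : F.IsTree) {l : ℕ} (h0 : 0 < l) (hH : l < F.H)
    (hl : ∀ l' ≤ F.H, ¬ F.je l l') : ∃ l' ≤ F.H, F.mb l l' := by
  have hmin : MinLayer F.up F.dn l := by_contra fun hn => by
    obtain ⟨l', h1, h2⟩ := exists_je_of_not_minLayer h hH hn
    exact hl l' h1 h2
  have hm := (minLayer_iff h h0 hH).1 hmin
  have hu : F.up l ∨ F.dn l := by
    by_contra hn
    rw [not_or] at hn
    exact hl _ hH (je_of_not h hH hn.1 hn.2)
  rcases hu with (⟨h1, -⟩ | h1) | (⟨h1, hV⟩ | h1)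
  · omega
  · exact ⟨_, hH, h1⟩
  · exact absurd (by simp [nb]; omega) (hm.2 true hV)
  · exact absurd h1 (hm.1 _)

end RackFrame

/-! ### Hosts for cores of type 3 -/

namespace RackFrame

variable (F : RackFrame) (n : ℕ) (G : BipGraph)

abbrev Vertex : Type := HostVertex G (fun _ => n) (F.H + 1)

/-- The largest coordinate. -/
abbrev top : ℕ := 3 * G.nA + 3 * G.nB + 3

/-- A coordinate across the chain `t`, read in the direction of the order. -/
def crossKey (t : Bool) (c : ℕ) : ℕ := if F.rev t then top G - c else c

-- The layer next to a simply vertical chain compares with it through the coordinate along the chain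
-- only. There the marks `1` and `2` are moved to `3 + 3 * k` and `4 + 3 * k`, so that the vertex of
-- family `3`, at `3 + 3 * k`, is above the first mark and not above the second. Otherwise an edge
-- distinguishes the first mark and no shift is needed.
open Classical in
noncomputable def shift (t : Bool) : ℕ := if F.V t then 1 else 0

/-- The offset of the coordinate along the chain in the family `f`. -/
def famShift (f : ℕ) : ℕ := if f = 0 then 0 else if f = 2 then 2 else 1

/-- The coordinate across the chain in the family `f`. -/
def famKey (f : ℕ) : ℕ := if f = 0 then 1 else if f = 2 then top G else top G - 1

variable {n G}

theorem three_le_top : 3 ≤ top G := Nat.le_add_left _ _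

/-- Read in the direction of the cross order, the kept vertex of a row has key `1`, the cells
follow, and the marks `1` and `2` have the keys `top - 1` and `top`. The layer `H + 1` of the root
is out of range and so is never the layer of a chain. -/
noncomputable def pos : F.Vertex n G → RackPos
  | .root => ⟨F.H + 1, fun _ => 0⟩
  | .side t f k => .at t (if f.1 = 3 then F.nb t else F.cl t)
      (2 + 3 * k.1 + F.shift t * famShift f.1) (F.crossKey G t (famKey G f.1))
  | .cell s i j _ => ⟨s.1, fun b => bif b then 2 + 3 * j.1 else 2 + 3 * i.1⟩

noncomputable abbrev lay (x : F.Vertex n G) : ℕ := (F.pos x).lay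

noncomputable abbrev own (t : Bool) (x : F.Vertex n G) : ℕ := (F.pos x).own t

noncomputable def cross (t : Bool) (x : F.Vertex n G) : ℕ := F.crossKey G t ((F.pos x).own (!t))

variable (n G)

noncomputable def host : TOStruct where
  V := F.Vertex n G
  E x y := (x = .root ∧ y ≠ .root ∧ F.radj (F.lay y)) ∨ (y = .root ∧ x ≠ .root ∧ F.radj (F.lay x)) ∨
    (x ≠ .root ∧ y ≠ .root ∧ F.je (F.lay x) (F.lay y) ∧ (F.pos x).own = (F.pos y).own)
  lt x y := (x = .root ∧ y ≠ .root) ∨ (x ≠ .root ∧ y ≠ .root ∧ F.Lt (F.pos x) (F.pos y))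

variable {F n G}

def IsCell (x : F.Vertex n G) : Prop := ∃ s i j hij, x = .cell s i j hij

theorem IsCell.ne_root {x : F.Vertex n G} (h : IsCell x) : x ≠ .root := by
  obtain ⟨s, i, j, hij, rfl⟩ := h
  exact nofun

theorem IsCell.ne_side {x : F.Vertex n G} (h : IsCell x) (t : Bool) (f k) : x ≠ .side t f k := by
  obtain ⟨s, i, j, hij, rfl⟩ := h
  exact nofun

theorem cases_vertex {x : F.Vertex n G} (hx : x ≠ .root) :
    (∃ (t : Bool) (f : Fin n) (k : Fin (G.part t)), x = .side t f k) ∨ IsCell x := by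
  rcases x with _ | ⟨t, f, k⟩ | ⟨s, i, j, hij⟩
  · exact absurd rfl hx
  · exact .inl ⟨t, f, k, rfl⟩
  · exact .inr ⟨s, i, j, hij, rfl⟩

theorem top_eq (t : Bool) : top G = 3 * G.part t + 3 * G.part (!t) + 3 := by
  cases t
  · change 3 * G.nA + 3 * G.nB + 3 = 3 * G.nA + 3 * G.nB + 3; rfl
  · change 3 * G.nA + 3 * G.nB + 3 = 3 * G.nB + 3 * G.nA + 3; omega

theorem IsCell.own {x : F.Vertex n G} (h : IsCell x) (t : Bool) :
    ∃ k : Fin (G.part t), F.own t x = 2 + 3 * k.1 := by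
  obtain ⟨s, i, j, hij, rfl⟩ := h
  cases t
  · exact ⟨i, rfl⟩
  · exact ⟨j, rfl⟩

theorem IsCell.lay_le {x : F.Vertex n G} (h : IsCell x) : F.lay x ≤ F.H := by
  obtain ⟨s, i, j, hij, rfl⟩ := h
  exact Nat.le_of_lt_succ s.2

theorem shift_le (t : Bool) : F.shift t ≤ 1 := by
  unfold shift; split_ifs <;> omega

theorem shift_of_V {t : Bool} (h : F.V t) : F.shift t = 1 := if_pos h

theorem shift_of_not {t : Bool} (h : ¬ F.V t) : F.shift t = 0 := if_neg h

theorem own_side (t : Bool) (f : Fin n) (k : Fin (G.part t)) :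
    F.own t (.side t f k : F.Vertex n G) = 2 + 3 * k.1 + F.shift t * famShift f.1 :=
  RackPos.at_own _ _ _ _

theorem famShift_le (f : ℕ) : famShift f ≤ 2 := by
  unfold famShift; split_ifs <;> omega

theorem own_side_le (t : Bool) (f : Fin n) (k : Fin (G.part t)) :
    F.own t (.side t f k : F.Vertex n G) ≤ 3 * G.part t + 1 := by
  rw [own_side]
  have := famShift_le f.1
  have := k.2
  rcases Nat.le_one_iff_eq_zero_or_eq_one.1 (shift_le (F := F) t) with h | h <;> rw [h] <;> omega

theorem famKey_cases (f : ℕ) : famKey G f = 1 ∨ famKey G f = top G ∨ famKey G f = top G - 1 := by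
  unfold famKey; split_ifs <;> simp

theorem own_not_side (t : Bool) (f : Fin n) (k : Fin (G.part t)) :
    F.own (!t) (.side t f k : F.Vertex n G) = F.crossKey G t (famKey G f.1) :=
  RackPos.at_own_not _ _ _ _

theorem crossKey_crossKey (t : Bool) {c : ℕ} (hc : c ≤ top G) :
    F.crossKey G t (F.crossKey G t c) = c := by
  unfold crossKey; split_ifs <;> omega

theorem cross_side (t : Bool) (f : Fin n) (k : Fin (G.part t)) :
    F.cross t (.side t f k : F.Vertex n G) = famKey G f.1 := by
  have hle : famKey G f.1 ≤ top G := by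
    have := famKey_cases (G := G) f.1
    have := three_le_top (G := G)
    omega
  rw [cross, ← crossKey_crossKey (F := F) t (c := famKey G f.1) hle]
  exact congrArg _ (own_not_side t f k)

theorem own_not_side_cases (t : Bool) (f : Fin n) (k : Fin (G.part t)) :
    F.own (!t) (.side t f k : F.Vertex n G) ≤ 1 ∨
      (top G - 1 ≤ F.own (!t) (.side t f k : F.Vertex n G) ∧
        F.own (!t) (.side t f k : F.Vertex n G) ≤ top G) := by
  have := famKey_cases (G := G) f.1
  rw [own_not_side]
  unfold crossKey; split_ifs <;> omega

theorem IsCell.cross {x : F.Vertex n G} (h : IsCell x) (t : Bool) :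
    1 < F.cross t x ∧ F.cross t x < top G - 1 := by
  obtain ⟨k, hk⟩ := h.own (!t)
  have h1 := k.2
  have h2 := top_eq (G := G) t
  rw [RackFrame.cross, show (F.pos x).own (!t) = _ from hk]
  unfold crossKey; split_ifs <;> omega

theorem lay_side (t : Bool) (f : Fin n) (k : Fin (G.part t)) :
    F.lay (.side t f k : F.Vertex n G) = if f.1 = 3 then F.nb t else F.cl t := rfl

theorem lay_le (h : F.IsTree) {x : F.Vertex n G} (hx : x ≠ .root) : F.lay x ≤ F.H := by
  rcases cases_vertex hx with ⟨t, f, k, rfl⟩ | hc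
  · rw [lay_side]
    split_ifs
    · exact nb_le h t
    · exact cl_le t
  · exact hc.lay_le

theorem ne_root_of_lay {x : F.Vertex n G} {t : Bool} (hx : F.lay x = F.cl t) : x ≠ .root := by
  rintro rfl
  have := cl_le (F := F) t
  rw [← hx] at this
  change F.H + 1 ≤ F.H at this
  omega

theorem own_le_top (x : F.Vertex n G) (t : Bool) : F.own t x ≤ top G := by
  rcases x with _ | ⟨t', f, k⟩ | ⟨s, i, j, hij⟩
  · exact Nat.zero_le _
  · have h0 := top_eq (G := G) t'
    by_cases htt : t = t'
    · subst htt
      have := own_side_le (F := F) t f k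
      omega
    · obtain rfl : t = !t' := by cases t <;> cases t' <;> simp_all
      have := own_not_side_cases (F := F) t' f k
      omega
  · obtain ⟨k, hk⟩ := IsCell.own (F := F) (n := n) ⟨s, i, j, hij, rfl⟩ t
    have h0 := top_eq (G := G) t
    have := k.2
    rw [hk]
    omega

theorem cell_ext {x y : F.Vertex n G} (hx : IsCell x) (hy : IsCell y) (hl : F.lay x = F.lay y)
    (ho : (F.pos x).own = (F.pos y).own) : x = y := by
  obtain ⟨s, i, j, hij, rfl⟩ := hx
  obtain ⟨s', i', j', hij', rfl⟩ := hy
  have h0 : 2 + 3 * i.1 = 2 + 3 * i'.1 := congrFun ho false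
  have h1 : 2 + 3 * j.1 = 2 + 3 * j'.1 := congrFun ho true
  obtain rfl : s = s' := Fin.ext hl
  obtain rfl : i = i' := Fin.ext (by omega)
  obtain rfl : j = j' := Fin.ext (by omega)
  rfl

/-- The cell of another layer with the same row and column. -/
theorem IsCell.exists_layer {x : F.Vertex n G} (hx : IsCell x) {l : ℕ} (hl : l ≤ F.H) :
    ∃ y : F.Vertex n G, IsCell y ∧ F.lay y = l ∧ (F.pos y).own = (F.pos x).own := by
  obtain ⟨s, i, j, hij, rfl⟩ := hx
  exact ⟨.cell ⟨l, Nat.lt_succ_of_le hl⟩ i j hij, ⟨_, _, _, _, rfl⟩, rfl, rfl⟩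

/-! #### The order of a host -/

theorem not_lt_root (x : F.Vertex n G) : ¬ (F.host n G).lt x HostVertex.root := by
  rintro (⟨-, h⟩ | ⟨-, h, -⟩) <;> exact h rfl

theorem root_lt {x : F.Vertex n G} (hx : x ≠ .root) : (F.host n G).lt HostVertex.root x :=
  .inl ⟨rfl, hx⟩

theorem isRoot_iff (x : F.Vertex n G) : (F.host n G).IsRoot x ↔ x = .root := by
  constructor
  · intro h
    by_contra hne
    exact not_lt_root x (h HostVertex.root (Ne.symm hne))
  · rintro rfl y hy
    exact root_lt hy

theorem lt_iff {x y : F.Vertex n G} (hx : x ≠ .root) (hy : y ≠ .root) :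
    (F.host n G).lt x y ↔ F.Lt (F.pos x) (F.pos y) := by
  constructor
  · rintro (⟨h, -⟩ | ⟨-, -, h⟩)
    · exact absurd h hx
    · exact h
  · exact fun h => .inr ⟨hx, hy, h⟩

theorem crossLt_iff (t : Bool) {c c' : ℕ} (hc : c ≤ top G) (hc' : c' ≤ top G) :
    F.crossLt t c c' ↔ F.crossKey G t c < F.crossKey G t c' := by
  unfold crossLt crossKey
  split_ifs <;> omega

theorem host_lt_chain (h : F.IsTree) {t : Bool} {x y : F.Vertex n G} (hx : F.lay x = F.cl t)
    (hy : F.lay y = F.cl t) : (F.host n G).lt x y ↔ F.own t x < F.own t y ∨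
      (F.own t x = F.own t y ∧ F.cross t x < F.cross t y) := by
  rw [lt_iff (ne_root_of_lay hx) (ne_root_of_lay hy), lt_chain_iff h hx hy,
    crossLt_iff t (own_le_top x _) (own_le_top y _)]
  exact Iff.rfl

theorem host_lt_out (h : F.IsTree) {t : Bool} {x y : F.Vertex n G} (hx : F.lay x = F.cl t)
    (hy : F.lay y ≠ F.cl t) (hyr : y ≠ .root) : (F.host n G).lt x y ↔ F.ab t (F.lay y) ∨
      (F.V t ∧ F.lay y = F.nb t ∧ F.own t x ≤ F.own t y) := by
  rw [lt_iff (ne_root_of_lay hx) hyr, lt_out_iff h hx hy]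

theorem host_lt_mid {x y : F.Vertex n G} (hx : ∀ t, F.lay x ≠ F.cl t)
    (hxr : x ≠ .root) (hyr : y ≠ .root) : (F.host n G).lt x y ↔ F.mb (F.lay x) (F.lay y) ∧
      (F.pos x).own = (F.pos y).own := by
  rw [lt_iff hxr hyr, lt_mid_iff hx]

theorem eq_cl_of_cl {t : Bool} {l : ℕ} (h : ∃ t, l = F.cl t) (ht : l ≠ F.cl t) :
    l = F.cl (!t) := by
  obtain ⟨t', h⟩ := h
  by_cases h' : t' = t
  · exact absurd (h' ▸ h) ht
  · rwa [show t' = !t by cases t <;> cases t' <;> simp_all] at h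

/-- Vertices outside of a chain that are below one of its vertices are below all of them. -/
theorem lt_chain_of_lt (h : F.IsTree) (h2 : 2 ≤ F.H) {t : Bool} {u x y : F.Vertex n G}
    (hx : F.lay x = F.cl t) (hy : F.lay y = F.cl t) (hu : F.lay u ≠ F.cl t)
    (hlt : (F.host n G).lt u x) : (F.host n G).lt u y := by
  by_cases hur : u = .root
  · subst hur
    exact root_lt (ne_root_of_lay hy)
  by_cases hm : ∃ t, F.lay u = F.cl t
  · have hu' := eq_cl_of_cl hm hu
    have hn := (cl_ne_cl h t).symm
    rw [host_lt_out h hu' (by rwa [hx]) (ne_root_of_lay hx), hx] at hlt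
    rw [host_lt_out h hu' (by rwa [hy]) (ne_root_of_lay hy), hy]
    rcases hlt with h1 | ⟨-, h1, -⟩
    · exact .inl h1
    · exact absurd h1.symm (nb_ne_cl h2 _ _)
  · push Not at hm
    rw [host_lt_mid hm hur (ne_root_of_lay hx), hx] at hlt
    exact absurd rfl (mid_ne_cl h hlt.1 t).2

/-- Below a vertex outside of a chain, a chain is an initial segment. -/
theorem lt_out_of_le (h : F.IsTree) {t : Bool} {u v y : F.Vertex n G} (hu : F.lay u = F.cl t)
    (hv : F.lay v = F.cl t) (hy : F.lay y ≠ F.cl t) (ho : F.own t u ≤ F.own t v)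
    (hlt : (F.host n G).lt v y) : (F.host n G).lt u y := by
  have hyr : y ≠ .root := by
    rintro rfl
    exact not_lt_root _ hlt
  rw [host_lt_out h hv hy hyr] at hlt
  rw [host_lt_out h hu hy hyr]
  rcases hlt with h1 | ⟨h1, h3, h4⟩
  · exact .inl h1
  · exact .inr ⟨h1, h3, ho.trans h4⟩

/-- Mutually comparable chains do not exist. -/
theorem not_ab_both (h : F.IsTree) (t : Bool) : ¬ (F.ab t (F.cl (!t)) ∧ F.ab (!t) (F.cl t)) := by
  rintro ⟨h1, h2⟩
  cases t
  · exact h.not_ab_zero h2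
  · exact h.not_ab_zero h1

/-! #### The edges of a host -/

theorem host_E_symm (h : F.IsTree) (x y : F.Vertex n G) (hE : (F.host n G).E x y) :
    (F.host n G).E y x := by
  rcases hE with h1 | h1 | ⟨h1, h2, h3, h4⟩
  · exact .inr (.inl h1)
  · exact .inl h1
  · exact .inr (.inr ⟨h2, h1, h.je_symm _ _ h3, h4.symm⟩)

theorem host_E_iff {x y : F.Vertex n G} (hx : x ≠ .root) (hy : y ≠ .root) :
    (F.host n G).E x y ↔ F.je (F.lay x) (F.lay y) ∧ (F.pos x).own = (F.pos y).own := by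
  constructor
  · rintro (⟨h, -⟩ | ⟨h, -⟩ | ⟨-, -, h⟩)
    · exact absurd h hx
    · exact absurd h hy
    · exact h
  · rintro ⟨h1, h2⟩
    exact .inr (.inr ⟨hx, hy, h1, h2⟩)

theorem famKey_ne {f f' : ℕ} (hf : f < 4) (hf' : f' < 4) (h : famKey G f = famKey G f') :
    f = f' ∨ (f = 1 ∧ f' = 3) ∨ (f = 3 ∧ f' = 1) := by
  have := three_le_top (G := G)
  unfold famKey at h
  split_ifs at h <;> omega

/-- The cross coordinate of a side vertex is at the border of the range, at most `1` or at least
`top - 1`, where no cell has a coordinate. -/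
theorem not_own_side_cell {t : Bool} {f : Fin n} {k : Fin (G.part t)} {y : F.Vertex n G}
    (hy : IsCell y) : (F.pos (.side t f k : F.Vertex n G)).own ≠ (F.pos y).own := by
  intro ho
  obtain ⟨k', hk'⟩ := hy.own (!t)
  have h1 := own_not_side_cases (F := F) t f k
  have h2 : F.own (!t) (.side t f k : F.Vertex n G) = F.own (!t) y := congrFun ho (!t)
  have h3 := top_eq (G := G) t
  have := k'.2
  omega

theorem not_own_side_side {t : Bool} {f f' : Fin n} {k : Fin (G.part t)} {k' : Fin (G.part (!t))} :
    (F.pos (.side t f k : F.Vertex n G)).own ≠ (F.pos (.side (!t) f' k' : F.Vertex n G)).own := by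
  intro ho
  have h1 := own_not_side_cases (F := F) t f k
  have h2 : F.own (!t) (.side t f k : F.Vertex n G) = F.own (!t) (.side (!t) f' k' : F.Vertex n G) :=
    congrFun ho (!t)
  have h3 := top_eq (G := G) t
  have h4 := own_side_le (F := F) (!t) f' k'
  have h5 := own_side (F := F) (!t) f' k'
  omega

/-- Distinct positions for distinct vertices. -/
theorem own_side_eq (hn : n ≤ 4) {t : Bool} {f f' : Fin n} {k k' : Fin (G.part t)}
    (ho : (F.pos (.side t f k : F.Vertex n G)).own = (F.pos (.side t f' k' : F.Vertex n G)).own) :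
    k = k' ∧ (f = f' ∨ (f.1 = 1 ∧ f'.1 = 3) ∨ (f.1 = 3 ∧ f'.1 = 1)) := by
  have h2 : F.crossKey G t (F.own (!t) (.side t f k : F.Vertex n G)) =
      F.crossKey G t (F.own (!t) (.side t f' k' : F.Vertex n G)) :=
    congrArg (F.crossKey G t) (congrFun ho (!t))
  have h3 := (cross_side (F := F) t f k).symm.trans (h2.trans (cross_side t f' k'))
  have hf := f.2
  have hf' := f'.2
  have h4 := famKey_ne (by omega) (by omega) h3
  have h1 : F.own t (.side t f k : F.Vertex n G) = F.own t (.side t f' k' : F.Vertex n G) :=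
    congrFun ho t
  have e1 := own_side (F := F) t f k
  have e2 := own_side (F := F) t f' k'
  have h5 : famShift f.1 = famShift f'.1 := by
    rcases h4 with h4 | ⟨h4, h5⟩ | ⟨h4, h5⟩
    · rw [h4]
    · rw [h4, h5]; rfl
    · rw [h4, h5]; rfl
  rw [h5] at e1
  refine ⟨Fin.ext (by omega), ?_⟩
  rw [Fin.ext_iff]
  exact h4

theorem eq_nb_of_je (h : F.IsTree) {t : Bool} {l : ℕ} (hl : l ≤ F.H) (hj : F.je (F.cl t) l) :
    l = F.nb t := by
  have := h.je_consecutive _ _ hj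
  cases t <;> simp [cl, nb] at * <;> omega

/-- An edge needs equal rows and equal columns. A side vertex agrees in both with no cell and with
no side vertex of the other part; within its part, only families `1` and `3` of the same vertex of
`G` agree and differ in layer, and they are joined only if the chain is not simply vertical. -/
theorem edge_cases (h : F.IsTree) (hn : n ≤ 4) {x y : F.Vertex n G} (hx : x ≠ .root)
    (hy : y ≠ .root) (hE : (F.host n G).E x y) :
    (∃ (t : Bool) (k : Fin (G.part t)) (f f' : Fin n), ¬ F.V t ∧
      ((f.1 = 1 ∧ f'.1 = 3) ∨ (f.1 = 3 ∧ f'.1 = 1)) ∧ x = .side t f k ∧ y = .side t f' k) ∨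
    (IsCell x ∧ IsCell y) := by
  rw [host_E_iff hx hy] at hE
  obtain ⟨hj, ho⟩ := hE
  rcases cases_vertex hx with ⟨t, f, k, rfl⟩ | hcx <;>
    rcases cases_vertex hy with ⟨t', f', k', rfl⟩ | hcy
  · by_cases htt : t' = t
    · subst htt
      obtain ⟨rfl, h1⟩ := own_side_eq hn ho
      have hne : F.lay (.side t' f k : F.Vertex n G) ≠ F.lay (.side t' f' k : F.Vertex n G) := by
        have := h.je_consecutive _ _ hj
        omega
      have h1 := h1.resolve_left fun h2 => hne (by rw [h2])
      refine .inl ⟨t', k, f, f', ?_, h1, rfl, rfl⟩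
      rw [← h.je_nb]
      rcases h1 with ⟨h2, h3⟩ | ⟨h2, h3⟩
      · rw [lay_side, lay_side, if_neg (by omega), if_pos h3] at hj
        exact hj
      · rw [lay_side, lay_side, if_pos h2, if_neg (by omega)] at hj
        exact h.je_symm _ _ hj
    · obtain rfl : t' = !t := by cases t <;> cases t' <;> simp_all
      exact absurd ho not_own_side_side
  · exact absurd ho (not_own_side_cell hcy)
  · exact absurd ho.symm (not_own_side_cell hcx)
  · exact .inr ⟨hcx, hcy⟩

theorem bare_iff (x : F.Vertex n G) : (F.host n G).Bare x ↔
    ∀ y, (F.host n G).E x y → y = .root :=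
  forall_congr' fun y => imp_congr_right fun _ => isRoot_iff y

theorem IsCell.not_bare {x : F.Vertex n G} (hx : IsCell x) {l : ℕ} (hl : l ≤ F.H)
    (hj : F.je (F.lay x) l) : ¬ (F.host n G).Bare x := by
  rw [bare_iff]
  intro hb
  obtain ⟨y, hy, rfl, ho⟩ := hx.exists_layer hl
  exact hy.ne_root (hb y ((host_E_iff hx.ne_root hy.ne_root).2 ⟨hj, ho.symm⟩))

theorem IsCell.bare_of_V (h : F.IsTree) (hn : n ≤ 4) {x : F.Vertex n G} (hx : IsCell x) {t : Bool}
    (hl : F.lay x = F.cl t) (hV : F.V t) : (F.host n G).Bare x := by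
  rw [bare_iff]
  intro y hE
  by_contra hy
  rcases edge_cases h hn hx.ne_root hy hE with ⟨t', k, f, f', -, -, h1, -⟩ | ⟨-, hc⟩
  · exact hx.ne_side _ _ _ h1
  · have := (host_E_iff hx.ne_root hy).1 hE
    rw [hl] at this
    have h1 := this.1
    rw [eq_nb_of_je h hc.lay_le h1] at h1
    exact (h.je_nb t).1 h1 hV

theorem bare_side (h : F.IsTree) (hn : n ≤ 4) {t : Bool} {f : Fin n} {k : Fin (G.part t)}
    (hf : F.V t ∨ f.1 = 0 ∨ f.1 = 2) : (F.host n G).Bare (.side t f k : F.Vertex n G) := by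
  rw [bare_iff]
  intro y hE
  by_contra hy
  rcases edge_cases h hn (x := .side t f k) nofun hy hE with ⟨t', k', f₁, f', hV, hf', h1, -⟩ | ⟨hc, -⟩
  · cases h1
    rcases hf with hf | hf
    · exact hV hf
    · omega
  · exact absurd rfl (hc.ne_side t f k)

end RackFrame

namespace RackFrame

variable {F : RackFrame} {G : BipGraph}

variable (F) in
/-- The vertices `0`: kept, `1` and `2`: the marked end of the row, `3`: the mark next to the chain. -/
abbrev sd (t : Bool) (f : Fin 4) (k : Fin (G.part t)) : F.Vertex 4 G := .side t f k

variable (F G) in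
noncomputable abbrev host4 : TOStruct := F.host 4 G

section Values

variable (t : Bool) (k : Fin (G.part t))

theorem own_zero : F.own t (F.sd t 0 k) = 2 + 3 * k.1 := own_side t _ k

theorem own_one : F.own t (F.sd t 1 k) = 2 + 3 * k.1 + F.shift t :=
  (own_side t _ k).trans (congrArg _ (Nat.mul_one _))

theorem own_two : F.own t (F.sd t 2 k) = 2 + 3 * k.1 + F.shift t * 2 := own_side t _ k

theorem own_three : F.own t (F.sd t 3 k) = 2 + 3 * k.1 + F.shift t :=
  (own_side t _ k).trans (congrArg _ (Nat.mul_one _))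

theorem cross_zero : F.cross t (F.sd t 0 k) = 1 := cross_side t _ k

theorem cross_one : F.cross t (F.sd t 1 k) = top G - 1 := cross_side t _ k

theorem cross_two : F.cross t (F.sd t 2 k) = top G := cross_side t _ k

theorem lay_zero : F.lay (F.sd t 0 k) = F.cl t := rfl

theorem lay_one : F.lay (F.sd t 1 k) = F.cl t := rfl

theorem lay_two : F.lay (F.sd t 2 k) = F.cl t := rfl

theorem lay_three : F.lay (F.sd t 3 k) = F.nb t := rfl

end Values

theorem sd_ne_root (t : Bool) (f : Fin 4) (k : Fin (G.part t)) : F.sd t f k ≠ .root := nofun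

theorem cases_chain (h2 : 2 ≤ F.H) {t : Bool} {x : F.Vertex 4 G} (hx : F.lay x = F.cl t) :
    (∃ k, x = F.sd t 0 k) ∨ (∃ k, x = F.sd t 1 k) ∨ (∃ k, x = F.sd t 2 k) ∨ IsCell x := by
  rcases cases_vertex (ne_root_of_lay hx) with ⟨t', f, k, rfl⟩ | hc
  · rw [lay_side] at hx
    have hf : f.1 ≠ 3 := fun h3 => by
      rw [if_pos h3] at hx
      exact nb_ne_cl h2 _ _ hx
    rw [if_neg hf] at hx
    obtain rfl : t' = t := by
      cases t <;> cases t' <;> simp [cl] at hx ⊢ <;> omega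
    have := f.2
    rcases (show f.1 = 0 ∨ f.1 = 1 ∨ f.1 = 2 by omega) with h | h | h
    · exact .inl ⟨k, congrArg (HostVertex.side t' · k) (Fin.ext h)⟩
    · exact .inr (.inl ⟨k, congrArg (HostVertex.side t' · k) (Fin.ext h)⟩)
    · exact .inr (.inr (.inl ⟨k, congrArg (HostVertex.side t' · k) (Fin.ext h)⟩))
  · exact .inr (.inr (.inr hc))

theorem cases_mid {x : F.Vertex 4 G} (hxr : x ≠ .root) (hx : ∀ t, F.lay x ≠ F.cl t) :
    (∃ t k, x = F.sd t 3 k) ∨ IsCell x := by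
  rcases cases_vertex hxr with ⟨t, f, k, rfl⟩ | hc
  · left
    have hf : f.1 = 3 := by
      by_contra hf
      have := hx t
      rw [lay_side, if_neg hf] at this
      exact this rfl
    exact ⟨t, k, congrArg (HostVertex.side t · k) (Fin.ext hf)⟩
  · exact .inr hc

/-- Coordinates of the vertices of a chain: `k` is the index of the row. -/
theorem chain_coord (h2 : 2 ≤ F.H) {t : Bool} {x : F.Vertex 4 G} (hx : F.lay x = F.cl t) :
    ∃ k : Fin (G.part t),
      (x = F.sd t 0 k ∧ F.own t x = 2 + 3 * k.1 ∧ F.cross t x = 1) ∨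
      (x = F.sd t 1 k ∧ F.own t x = 2 + 3 * k.1 + F.shift t ∧ F.cross t x = top G - 1) ∨
      (x = F.sd t 2 k ∧ F.own t x = 2 + 3 * k.1 + F.shift t * 2 ∧ F.cross t x = top G) ∨
      (IsCell x ∧ F.own t x = 2 + 3 * k.1 ∧ 1 < F.cross t x ∧ F.cross t x < top G - 1) := by
  rcases cases_chain h2 hx with ⟨k, rfl⟩ | ⟨k, rfl⟩ | ⟨k, rfl⟩ | hc
  · exact ⟨k, .inl ⟨rfl, own_zero t k, cross_zero t k⟩⟩
  · exact ⟨k, .inr (.inl ⟨rfl, own_one t k, cross_one t k⟩)⟩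
  · exact ⟨k, .inr (.inr (.inl ⟨rfl, own_two t k, cross_two t k⟩))⟩
  · obtain ⟨k, hk⟩ := hc.own t
    exact ⟨k, .inr (.inr (.inr ⟨hc, hk, hc.cross t⟩))⟩

/-- The row of the vertex `k`: its kept vertex and its cells in the chain. -/
def InRow (t : Bool) (k : Fin (G.part t)) (u : F.Vertex 4 G) : Prop :=
  u = F.sd t 0 k ∨ (IsCell u ∧ F.lay u = F.cl t ∧ F.own t u = 2 + 3 * k.1)

theorem InRow.coord {t : Bool} {k : Fin (G.part t)} {u : F.Vertex 4 G} (hu : InRow t k u) :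
    F.lay u = F.cl t ∧ F.own t u = 2 + 3 * k.1 ∧ 1 ≤ F.cross t u ∧ F.cross t u < top G - 1 ∧
      (u = F.sd t 0 k ∨ 1 < F.cross t u) := by
  have := three_le_top (G := G)
  rcases hu with rfl | ⟨hc, h1, h2⟩
  · rw [cross_zero]
    exact ⟨rfl, own_zero t k, le_rfl, by omega, .inl rfl⟩
  · exact ⟨h1, h2, (hc.cross t).1.le, (hc.cross t).2, .inr (hc.cross t).1⟩

theorem InRow.ne_one {t : Bool} {k : Fin (G.part t)} {u : F.Vertex 4 G} (hu : InRow t k u)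
    (t' : Bool) (k' : Fin (G.part t')) : u ≠ F.sd t' 1 k' := by
  rcases hu with rfl | ⟨hc, -⟩
  · intro h
    cases h
  · exact hc.ne_side _ _ _

theorem InRow.bare (h : F.IsTree) {t : Bool} (hV : F.V t) {k : Fin (G.part t)} {u : F.Vertex 4 G}
    (hu : InRow t k u) : (F.host4 G).Bare u := by
  rcases hu with rfl | ⟨hc, hl, -⟩
  · exact bare_side h le_rfl (.inl hV)
  · exact hc.bare_of_V h le_rfl hl hV

theorem InRow.zero_lt (h : F.IsTree) {t : Bool} {k : Fin (G.part t)} {u z : F.Vertex 4 G}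
    (hu : InRow t k u) (hz : (F.host4 G).lt u z) : (F.host4 G).lt (F.sd t 0 k) z := by
  obtain ⟨h1, h2, h3, -, -⟩ := hu.coord
  have e1 := own_zero (F := F) t k
  by_cases hzc : F.lay z = F.cl t
  · rw [host_lt_chain h h1 hzc] at hz
    rw [host_lt_chain h (lay_zero t k) hzc, e1, cross_zero]
    omega
  · exact lt_out_of_le h (lay_zero t k) h1 hzc (by omega) hz

theorem finite_vertex : Finite (F.Vertex 4 G) :=
  Finite.of_surjective (HostVertex.enum G (fun _ => 4) (F.H + 1)).get fun x =>
    List.get_of_mem (HostVertex.mem_enum x)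

/-- A vertex directly above a row covers a vertex of the row. -/
theorem exists_cov_row (h : F.IsTree) {t : Bool} {k : Fin (G.part t)} {x : F.Vertex 4 G}
    (hx : (F.host4 G).lt (F.sd t 0 k) x)
    (hz : ∀ z, (F.host4 G).lt (F.sd t 0 k) z → (F.host4 G).lt z x → InRow t k z) :
    ∃ u, InRow t k u ∧ (F.host4 G).Cov u x := by
  have := finite_vertex (F := F) (G := G)
  obtain ⟨u, ⟨hu, hux⟩, hmax⟩ := Set.exists_max_image
    {u : F.Vertex 4 G | InRow t k u ∧ (F.host4 G).lt u x} (F.cross t) (Set.toFinite _)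
    ⟨F.sd t 0 k, .inl rfl, hx⟩
  refine ⟨u, hu, hux, fun z huz hzx => ?_⟩
  have hzr := hz z (hu.zero_lt h huz) hzx
  have h1 := hmax z ⟨hzr, hzx⟩
  have h2 := hu.coord
  have h3 := hzr.coord
  rw [host_lt_chain h h2.1 h3.1] at huz
  omega

/-! #### Covers -/

theorem lt_one_two (h : F.IsTree) (t : Bool) (k : Fin (G.part t)) :
    (F.host4 G).lt (F.sd t 1 k) (F.sd t 2 k) := by
  have := three_le_top (G := G)
  rw [host_lt_chain h (lay_one t k) (lay_two t k), own_one, own_two, cross_one, cross_two]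
  omega

theorem lt_zero_one (h : F.IsTree) (t : Bool) (k : Fin (G.part t)) :
    (F.host4 G).lt (F.sd t 0 k) (F.sd t 1 k) := by
  have := three_le_top (G := G)
  rw [host_lt_chain h (lay_zero t k) (lay_one t k), own_zero, own_one, cross_zero, cross_one]
  omega

theorem lt_one_three (h : F.IsTree) {t : Bool} (hV : F.V t) (k : Fin (G.part t)) :
    (F.host4 G).lt (F.sd t 1 k) (F.sd t 3 k) := by
  refine (host_lt_out h (lay_one t k) (y := F.sd t 3 k) (nb_ne_cl (h.two_le t hV) t t)
    (sd_ne_root _ _ _)).2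
    (.inr ⟨hV, rfl, ?_⟩)
  rw [own_one, own_three]

/-- No vertex of the chain is strictly between the marks `1` and `2` of a row, and what is below a
chain vertex from outside the chain is below the whole chain. -/
theorem cov_two (h : F.IsTree) (h2 : 2 ≤ F.H) {t : Bool} {k : Fin (G.part t)} {u : F.Vertex 4 G}
    (hu : (F.host4 G).lt u (F.sd t 2 k)) : u = F.sd t 1 k ∨ (F.host4 G).lt u (F.sd t 1 k) := by
  by_cases hl : F.lay u = F.cl t
  · obtain ⟨k', hk'⟩ := chain_coord h2 hl
    have h3 := three_le_top (G := G)
    have h4 := shift_le (F := F) t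
    rw [host_lt_chain h hl (lay_two t k), own_two, cross_two] at hu
    rw [host_lt_chain h hl (lay_one t k), own_one, cross_one]
    by_cases hkk : k' = k
    · subst hkk
      rcases hk' with hk' | hk' | hk' | hk'
      · omega
      · exact .inl hk'.1
      · omega
      · omega
    · have : k'.1 ≠ k.1 := fun h => hkk (Fin.ext h)
      right
      omega
  · exact .inr (lt_chain_of_lt h h2 (lay_two t k) (lay_one t k) hl hu)

/-- The chain vertices below family `3` are those with coordinate at most `3 + 3 * k`, and the mark
`1` is the last of them. No middle layer is below this one, and the other chain is below it only if
it is below the chain. -/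
theorem cov_three (h : F.IsTree) {t : Bool} (hV : F.V t) {k : Fin (G.part t)} {u : F.Vertex 4 G}
    (hu : (F.host4 G).lt u (F.sd t 3 k)) : u = F.sd t 1 k ∨ (F.host4 G).lt u (F.sd t 1 k) := by
  have h2 := h.two_le t hV
  have hn := fun t' => nb_ne_cl h2 t t'
  by_cases hl : F.lay u = F.cl t
  · obtain ⟨k', hk'⟩ := chain_coord h2 hl
    have h4 := shift_of_V hV
    rw [host_lt_out h hl (y := F.sd t 3 k) (hn t) (sd_ne_root _ _ _), own_three] at hu
    rcases hu with hu | ⟨-, -, hu⟩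
    · exact absurd hu (h.not_ab_nb t hV)
    have h3 := three_le_top (G := G)
    rw [host_lt_chain h hl (lay_one t k), own_one, cross_one]
    by_cases hkk : k' = k
    · subst hkk
      rcases hk' with hk' | hk' | hk' | hk'
      · omega
      · exact .inl hk'.1
      · omega
      · omega
    · have : k'.1 ≠ k.1 := fun h => hkk (Fin.ext h)
      right
      omega
  right
  by_cases hur : u = .root
  · subst hur
    exact root_lt nofun
  by_cases hm : ∃ t, F.lay u = F.cl t
  · have hl' := eq_cl_of_cl hm hl
    rw [host_lt_out h hl' (y := F.sd t 3 k) (hn _) (sd_ne_root _ _ _)] at hu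
    refine (host_lt_out h hl' (y := F.sd t 1 k) (cl_ne_cl h t).symm (sd_ne_root _ _ _)).2 (.inl ?_)
    rcases hu with hu | ⟨hV', hu, -⟩
    · exact ab_cl_of_ab_nb h hV hu
    · exact absurd hu.symm (nb_ne_nb h hV hV')
  · push Not at hm
    rw [host_lt_mid hm hur (sd_ne_root _ _ _)] at hu
    exact absurd hu.1 (not_mb_nb h hV _)

/-- The last vertex of a chain is above the others. -/
theorem exists_last (h : F.IsTree) (h2 : 2 ≤ F.H) {t : Bool} {u : F.Vertex 4 G}
    (hu : F.lay u = F.cl t) : ∃ k, u = F.sd t 2 k ∨ (F.host4 G).lt u (F.sd t 2 k) := by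
  obtain ⟨k, hk⟩ := chain_coord h2 hu
  have hk2 := k.2
  have h3 := three_le_top (G := G)
  have h4 := shift_le (F := F) t
  refine ⟨⟨G.part t - 1, by omega⟩, ?_⟩
  rw [host_lt_chain h hu (lay_two t _), own_two, cross_two]
  rcases hk with hk | hk | hk | hk
  · right; simp only; omega
  · right; simp only; omega
  · by_cases hkk : k.1 = G.part t - 1
    · exact .inl (hk.1.trans (congrArg (F.sd t 2) (Fin.ext hkk)))
    · right; simp only; omega
  · right; simp only; omega

/-- A vertex covered by a vertex in a layer above its whole chain is the last of the chain. -/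
theorem eq_two_of_cov_ab (h : F.IsTree) (h2 : 2 ≤ F.H) {t : Bool} {u x : F.Vertex 4 G}
    (hu : F.lay u = F.cl t) (hx : F.lay x ≠ F.cl t) (hxr : x ≠ .root) (hab : F.ab t (F.lay x))
    (hc : (F.host4 G).Cov u x) : ∃ t k, u = F.sd t 2 k := by
  obtain ⟨k, hk | hk⟩ := exists_last h h2 hu
  · exact ⟨t, k, hk⟩
  · exact absurd ((host_lt_out h (lay_two t k) hx hxr).2 (.inl hab)) (hc.2 _ hk)

/-- Directly before the first vertex of a row comes the mark `2` of the preceding row. Before the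
first row comes the last vertex of the other chain, again a mark `2`, or just the root. -/
theorem cov_zero (h : F.IsTree) (h2 : 2 ≤ F.H) {t : Bool} {k : Fin (G.part t)} {u : F.Vertex 4 G}
    (hur : u ≠ .root) (hc : (F.host4 G).Cov u (F.sd t 0 k)) : ∃ t k, u = F.sd t 2 k := by
  have h3 := three_le_top (G := G)
  have h4 := shift_le (F := F) t
  by_cases hl : F.lay u = F.cl t
  · obtain ⟨k', hk'⟩ := chain_coord h2 hl
    have hlt := hc.1
    rw [host_lt_chain h hl (lay_zero t k), own_zero, cross_zero] at hlt
    have hk2 : k'.1 < k.1 := by omega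
    by_cases he : u = F.sd t 2 k'
    · exact ⟨t, k', he⟩
    refine absurd ?_ (hc.2 (F.sd t 2 k') ?_)
    · rw [host_lt_chain h (lay_two t k') (lay_zero t k), own_zero, own_two]
      omega
    · rw [host_lt_chain h hl (lay_two t k'), own_two, cross_two]
      rcases hk' with hk' | hk' | hk' | hk'
      · omega
      · omega
      · exact absurd hk'.1 he
      · omega
  · by_cases hm : ∃ t, F.lay u = F.cl t
    · have hl' := eq_cl_of_cl hm hl
      have hlt := hc.1
      rw [host_lt_out h hl' (y := F.sd t 0 k) (cl_ne_cl h t).symm (sd_ne_root _ _ _)] at hlt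
      rcases hlt with hlt | ⟨-, hlt, -⟩
      · exact eq_two_of_cov_ab h h2 hl' (x := F.sd t 0 k) (cl_ne_cl h t).symm (sd_ne_root _ _ _) hlt hc
      · exact absurd hlt.symm (nb_ne_cl h2 _ _)
    · push Not at hm
      have hlt := hc.1
      rw [host_lt_mid hm hur (sd_ne_root _ _ _)] at hlt
      exact absurd rfl (mid_ne_cl h hlt.1 t).2

theorem cov_minLayer (h : F.IsTree) (h2 : 2 ≤ F.H) {x u : F.Vertex 4 G} (hxr : x ≠ .root)
    (hx : ∀ t, F.lay x ≠ F.cl t)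
    (hm : (∀ m, ¬ F.mb m (F.lay x)) ∧ ∀ t, F.V t → F.lay x ≠ F.nb t) (hur : u ≠ .root)
    (hc : (F.host4 G).Cov u x) : ∃ t k, u = F.sd t 2 k := by
  have hlt := hc.1
  by_cases hm' : ∃ t, F.lay u = F.cl t
  · obtain ⟨t, hl⟩ := hm'
    rw [host_lt_out h hl (hx t) hxr] at hlt
    rcases hlt with hlt | ⟨hV, hlt, -⟩
    · exact eq_two_of_cov_ab h h2 hl (hx t) hxr hlt hc
    · exact absurd hlt (hm.2 t hV)
  · push Not at hm'
    rw [host_lt_mid hm' hur hxr] at hlt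
    exact absurd hlt.1 (hm.1 _)

/-- The kept vertex of the row is below `x` and above everything that precedes the row, so nothing
before the row can be covered by `x`. -/
theorem cov_row_cell (h : F.IsTree) (h2 : 2 ≤ F.H) {t : Bool} (hV : F.V t) {k : Fin (G.part t)}
    {x u : F.Vertex 4 G} (hx : x = F.sd t 1 k ∨
      (IsCell x ∧ F.lay x = F.cl t ∧ F.own t x = 2 + 3 * k.1))
    (hc : (F.host4 G).Cov u x) : InRow t k u := by
  have h3 := three_le_top (G := G)
  have hs := shift_of_V hV
  have hxl : F.lay x = F.cl t ∧ (x = F.sd t 1 k ∧ F.own t x = 2 + 3 * k.1 + F.shift t ∧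
      F.cross t x = top G - 1 ∨ IsCell x ∧ F.own t x = 2 + 3 * k.1 ∧ 1 < F.cross t x ∧
        F.cross t x < top G - 1) := by
    rcases hx with rfl | ⟨h4, h5, h6⟩
    · exact ⟨rfl, .inl ⟨rfl, own_one t k, cross_one t k⟩⟩
    · exact ⟨h5, .inr ⟨h4, h6, h4.cross t⟩⟩
  obtain ⟨hxl, hxc⟩ := hxl
  have ha : (F.host4 G).lt (F.sd t 0 k) x := by
    rw [host_lt_chain h (lay_zero t k) hxl, own_zero, cross_zero]
    omega
  by_cases hl : F.lay u = F.cl t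
  · obtain ⟨k', hk'⟩ := chain_coord h2 hl
    have hlt := hc.1
    rw [host_lt_chain h hl hxl] at hlt
    by_cases hkk : k' = k
    · subst hkk
      rcases hk' with hk' | hk' | hk' | hk'
      · exact .inl hk'.1
      · omega
      · omega
      · exact .inr ⟨hk'.1, hl, hk'.2.1⟩
    · have : k'.1 ≠ k.1 := fun h => hkk (Fin.ext h)
      refine absurd ha (hc.2 _ ?_)
      rw [host_lt_chain h hl (lay_zero t k), own_zero, cross_zero]
      omega
  · exact absurd ha (hc.2 _ (lt_chain_of_lt h h2 hxl (lay_zero t k) hl hc.1))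

/-! #### Terminal vertices -/

theorem not_bare_one (h : F.IsTree) {t : Bool} (hV : ¬ F.V t) (k : Fin (G.part t)) :
    (F.host4 G).E (F.sd t 1 k) (F.sd t 3 k) := by
  refine (host_E_iff (x := F.sd t 1 k) (y := F.sd t 3 k) (sd_ne_root _ _ _) (sd_ne_root _ _ _)).2 ⟨(h.je_nb t).2 hV, ?_⟩
  change (RackPos.at _ _ _ _).own = (RackPos.at _ _ _ _).own
  rfl

/-- The kept vertex, the cells and the mark `1` of a row have a mark above them. A bare middle cell
belongs to a layer without edges, which is below another middle layer, so the cell is below another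
cell of the same edge of `G`. -/
theorem cases_bare_leaf (h : F.IsTree) (h2 : 2 ≤ F.H) {q : F.Vertex 4 G} (hq : q ≠ .root)
    (hb : (F.host4 G).Bare q) (hleaf : (F.host4 G).Leaf q) :
    ∃ t k, q = F.sd t 2 k ∨ (F.V t ∧ q = F.sd t 3 k) := by
  have h3 := three_le_top (G := G)
  by_cases hm : ∃ t, F.lay q = F.cl t
  · obtain ⟨t, hl⟩ := hm
    rcases cases_chain h2 hl with ⟨k, rfl⟩ | ⟨k, rfl⟩ | ⟨k, rfl⟩ | hc
    · exact absurd (lt_zero_one h t k) (hleaf _)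
    · exact absurd (lt_one_two h t k) (hleaf _)
    · exact ⟨t, k, .inl rfl⟩
    · obtain ⟨k, hk⟩ := hc.own t
      have := hc.cross t
      refine absurd ?_ (hleaf (F.sd t 1 k))
      rw [host_lt_chain h hl (lay_one t k), own_one, cross_one]
      omega
  · push Not at hm
    rcases cases_mid hq hm with ⟨t, k, rfl⟩ | hc
    · by_cases hV : F.V t
      · exact ⟨t, k, .inr ⟨hV, rfl⟩⟩
      · have := hb _ (host_E_symm h _ _ (not_bare_one h hV k))
        rw [isRoot_iff] at this
        cases this
    · have h0 : 0 < F.lay q := Nat.pos_of_ne_zero (hm false)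
      have hH : F.lay q < F.H := lt_of_le_of_ne hc.lay_le (hm true)
      obtain ⟨l, hl, hmb⟩ := exists_mb_of_not_je h h0 hH fun l hl hj => hc.not_bare hl hj hb
      obtain ⟨y, hy, rfl, ho⟩ := hc.exists_layer hl
      exact absurd ((host_lt_mid hm hq hy.ne_root).2 ⟨hmb, ho.symm⟩) (hleaf y)

theorem eq_one_of_cov_bare_leaf (h : F.IsTree) (h2 : 2 ≤ F.H) {u q : F.Vertex 4 G}
    (hc : (F.host4 G).Cov u q) (hb : (F.host4 G).Bare q) (hleaf : (F.host4 G).Leaf q) :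
    ∃ t k, u = F.sd t 1 k := by
  have hq : q ≠ .root := by
    rintro rfl
    exact not_lt_root _ hc.1
  obtain ⟨t, k, rfl | ⟨hV, rfl⟩⟩ := cases_bare_leaf h h2 hq hb hleaf
  · exact ⟨t, k, (cov_two h h2 hc.1).resolve_right fun h' => hc.2 _ h' (lt_one_two h t k)⟩
  · exact ⟨t, k, (cov_three h hV hc.1).resolve_right fun h' => hc.2 _ h' (lt_one_three h hV k)⟩

theorem terminal_cov (h : F.IsTree) (h2 : 2 ≤ F.H) {p : F.Vertex 4 G}
    (hp : (F.host4 G).Terminal p) : (F.host4 G).Bare p ∧ ∃ u : F.Vertex 4 G, u ≠ .root ∧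
      (F.host4 G).Cov u p ∧ (¬ (F.host4 G).Bare u ∨ ∃ t k, u = F.sd t 1 k) := by
  obtain ⟨hb, u, hu, hc, h3⟩ := hp
  refine ⟨hb, u, fun h' => hu ((isRoot_iff u).2 h'), hc, h3.imp_right ?_⟩
  rintro ⟨q, -, h4, h5, h6⟩
  exact eq_one_of_cov_bare_leaf h h2 h4 h5 h6

theorem cov_one_two (h : F.IsTree) (h2 : 2 ≤ F.H) (t : Bool) (k : Fin (G.part t)) :
    (F.host4 G).Cov (F.sd t 1 k) (F.sd t 2 k) := by
  refine ⟨lt_one_two h t k, fun z h3 h4 => ?_⟩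
  have hzz : ∀ z : F.Vertex 4 G, (F.host4 G).lt (F.sd t 1 k) z → z ≠ F.sd t 1 k := by
    rintro z hz rfl
    rw [host_lt_chain h (lay_one t k) (lay_one t k)] at hz
    omega
  have h5 := (cov_two h h2 h4).resolve_left (hzz z h3)
  by_cases hl : F.lay z = F.cl t
  · rw [host_lt_chain h (lay_one t k) hl] at h3
    rw [host_lt_chain h hl (lay_one t k)] at h5
    omega
  · by_cases hzr : z = .root
    · subst hzr
      exact not_lt_root _ h3
    by_cases hm : ∃ t, F.lay z = F.cl t
    · have hl' := eq_cl_of_cl hm hl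
      rw [host_lt_out h (lay_one t k) hl hzr] at h3
      rw [host_lt_out h hl' (y := F.sd t 1 k) (cl_ne_cl h t).symm (sd_ne_root _ _ _)] at h5
      rcases h3 with h3 | ⟨-, h3, -⟩
      · rcases h5 with h5 | ⟨-, h5, -⟩
        · exact not_ab_both h t ⟨hl' ▸ h3, h5⟩
        · exact absurd h5.symm (nb_ne_cl h2 _ _)
      · exact absurd (h3.symm.trans hl') (nb_ne_cl h2 _ _)
    · push Not at hm
      rw [host_lt_mid hm hzr (sd_ne_root _ _ _)] at h5
      exact absurd rfl (mid_ne_cl h h5.1 t).2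

theorem cov_one_three (h : F.IsTree) {t : Bool} (hV : F.V t) (k : Fin (G.part t)) :
    (F.host4 G).Cov (F.sd t 1 k) (F.sd t 3 k) := by
  have h2 := h.two_le t hV
  refine ⟨lt_one_three h hV k, fun z h3 h4 => ?_⟩
  have hne : z ≠ F.sd t 1 k := by
    rintro rfl
    rw [host_lt_chain h (lay_one t k) (lay_one t k)] at h3
    omega
  have h5 := (cov_three h hV h4).resolve_left hne
  refine (cov_one_two h h2 t k).2 z h3 ?_
  by_cases hl : F.lay z = F.cl t
  · have h6 := three_le_top (G := G)
    rw [host_lt_chain h hl (lay_one t k), own_one, cross_one] at h5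
    rw [host_lt_chain h hl (lay_two t k), own_two, cross_two]
    omega
  · exact lt_chain_of_lt h h2 (lay_one t k) (lay_two t k) hl h5

theorem leaf_three (h : F.IsTree) (h2 : 2 ≤ F.H) (t : Bool) (k : Fin (G.part t)) :
    (F.host4 G).Leaf (F.sd t 3 k) := by
  intro y hy
  have hyr : y ≠ .root := by
    rintro rfl
    exact not_lt_root _ hy
  have hm : ∀ t', F.lay (F.sd t 3 k) ≠ F.cl t' := nb_ne_cl h2 t
  rw [host_lt_mid hm nofun hyr] at hy
  have hmy : ∀ t', F.lay y ≠ F.cl t' := fun t' => (mid_ne_cl h hy.1 t').2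
  rcases cases_mid hyr hmy with ⟨t', k', rfl⟩ | hc
  · by_cases htt : t' = t
    · subst htt
      have := h.mb_mid _ _ hy.1
      rw [lay_three, lay_three] at this
      omega
    · obtain rfl : t' = !t := by cases t <;> cases t' <;> simp_all
      exact not_own_side_side hy.2
  · exact not_own_side_cell hc hy.2

/-- The mark `2` covers the mark `1`. The latter is joined to family `3` if the chain is not simply
vertical; otherwise it is also covered by family `3`, a bare leaf. -/
theorem terminal_two (h : F.IsTree) (h2 : 2 ≤ F.H) (t : Bool) (k : Fin (G.part t)) :
    (F.host4 G).Terminal (F.sd t 2 k) := by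
  refine ⟨bare_side h le_rfl (.inr (.inr rfl)), F.sd t 1 k,
    fun h' => absurd ((isRoot_iff _).1 h') nofun, cov_one_two h h2 t k, ?_⟩
  by_cases hV : F.V t
  · exact .inr ⟨F.sd t 3 k, (fun h' => by cases h'), cov_one_three h hV k,
      bare_side h le_rfl (.inl hV), leaf_three h h2 t k⟩
  · exact .inl fun hb => absurd ((isRoot_iff _).1 (hb _ (not_bare_one h hV k))) nofun

/-- A mark `2` is bare, and only marks `1` can be covered by bare leaves, so covering it makes no
vertex terminal. -/
theorem not_terminal_of_cov_two (h : F.IsTree) (h2 : 2 ≤ F.H) {p : F.Vertex 4 G}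
    (hp : ∀ u : F.Vertex 4 G, u ≠ .root → (F.host4 G).Cov u p → ∃ t k, u = F.sd t 2 k) :
    ¬ (F.host4 G).Terminal p := by
  intro ht
  obtain ⟨-, u, hu, hc, h3⟩ := terminal_cov h h2 ht
  obtain ⟨t, k, rfl⟩ := hp u hu hc
  rcases h3 with h3 | ⟨t', k', h3⟩
  · exact h3 (bare_side h le_rfl (.inr (.inr rfl)))
  · cases h3

theorem not_terminal_of_cov_row (h : F.IsTree) (h2 : 2 ≤ F.H) {t : Bool} (hV : F.V t)
    {k : Fin (G.part t)} {p : F.Vertex 4 G} (hp : ∀ u, (F.host4 G).Cov u p → InRow t k u) :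
    ¬ (F.host4 G).Terminal p := by
  intro ht
  obtain ⟨-, u, hu, hc, h3⟩ := terminal_cov h h2 ht
  rcases h3 with h3 | ⟨t', k', h3⟩
  · exact h3 ((hp u hc).bare h hV)
  · exact (hp u hc).ne_one _ _ h3

theorem not_terminal_one (h : F.IsTree) (h2 : 2 ≤ F.H) (t : Bool) (k : Fin (G.part t)) :
    ¬ (F.host4 G).Terminal (F.sd t 1 k) := by
  by_cases hV : F.V t
  · exact not_terminal_of_cov_row h h2 hV fun u hu => cov_row_cell h h2 hV (.inl rfl) hu
  · exact fun ht => absurd ((isRoot_iff _).1 (ht.1 _ (not_bare_one h hV k))) nofun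

theorem InRow.not_terminal (h : F.IsTree) (h2 : 2 ≤ F.H) {t : Bool} {k : Fin (G.part t)}
    {u : F.Vertex 4 G} (hu : InRow t k u) : ¬ (F.host4 G).Terminal u := by
  rcases hu with rfl | ⟨hc, hl, ho⟩
  · exact not_terminal_of_cov_two h h2 fun u hu hc => cov_zero h h2 hu hc
  · by_cases hV : F.V t
    · exact not_terminal_of_cov_row h h2 hV fun u hu => cov_row_cell h h2 hV (.inr ⟨hc, hl, ho⟩) hu
    · intro ht
      refine hc.not_bare (nb_le h t) ?_ ht.1
      rw [hl]
      exact (h.je_nb t).2 hV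

/-! #### The definable predicates -/

/-- `x` covers the greatest vertex of the row below it, and a vertex of a row is neither the root
nor terminal. -/
theorem not_initial_of_row (h : F.IsTree) (h2 : 2 ≤ F.H) {t : Bool} {k : Fin (G.part t)}
    {x : F.Vertex 4 G} (hx : (F.host4 G).lt (F.sd t 0 k) x)
    (hz : ∀ z, (F.host4 G).lt (F.sd t 0 k) z → (F.host4 G).lt z x → InRow t k z) :
    ¬ (F.host4 G).Initial x := by
  obtain ⟨u, hu, hc⟩ := exists_cov_row h hx hz
  intro hi
  rcases hi u hc with h3 | h3
  · exact ne_root_of_lay hu.coord.1 ((isRoot_iff u).1 h3)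
  · exact hu.not_terminal h h2 h3

theorem not_lt_of_ab (h : F.IsTree) (h2 : 2 ≤ F.H) {t : Bool} {k : Fin (G.part t)}
    {z : F.Vertex 4 G} (hl : F.lay z = F.cl (!t)) (hz : (F.host4 G).lt (F.sd t 0 k) z) :
    ¬ F.ab (!t) (F.cl t) := by
  intro hab
  have hn : F.lay z ≠ F.cl t := by rw [hl]; exact cl_ne_cl h t
  rw [host_lt_out h (lay_zero t k) hn (ne_root_of_lay hl), hl] at hz
  rcases hz with hz | ⟨-, hz, -⟩
  · exact not_ab_both h t ⟨hz, hab⟩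
  · exact absurd hz.symm (nb_ne_cl h2 _ _)

/-- The vertices of a chain that are not kept. -/
theorem not_initial_chain (h : F.IsTree) (h2 : 2 ≤ F.H) {t : Bool} {k : Fin (G.part t)}
    {x : F.Vertex 4 G} (hx : x = F.sd t 1 k ∨
      (IsCell x ∧ F.lay x = F.cl t ∧ F.own t x = 2 + 3 * k.1)) : ¬ (F.host4 G).Initial x := by
  have h3 := three_le_top (G := G)
  have hs := shift_le (F := F) t
  have hxl : F.lay x = F.cl t ∧ (x = F.sd t 1 k ∧ F.own t x = 2 + 3 * k.1 + F.shift t ∧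
      F.cross t x = top G - 1 ∨ IsCell x ∧ F.own t x = 2 + 3 * k.1 ∧ 1 < F.cross t x ∧
        F.cross t x < top G - 1) := by
    rcases hx with rfl | ⟨h4, h5, h6⟩
    · exact ⟨rfl, .inl ⟨rfl, own_one t k, cross_one t k⟩⟩
    · exact ⟨h5, .inr ⟨h4, h6, h4.cross t⟩⟩
  obtain ⟨hxl, hxc⟩ := hxl
  refine not_initial_of_row h h2 (t := t) (k := k) ?_ fun z hz hzx => ?_
  · rw [host_lt_chain h (lay_zero t k) hxl, own_zero, cross_zero]
    omega
  · by_cases hl : F.lay z = F.cl t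
    · obtain ⟨k', hk'⟩ := chain_coord h2 hl
      rw [host_lt_chain h (lay_zero t k) hl, own_zero, cross_zero] at hz
      rw [host_lt_chain h hl hxl] at hzx
      obtain rfl : k' = k := Fin.ext (by omega)
      rcases hk' with hk' | hk' | hk' | hk'
      · exact .inl hk'.1
      · omega
      · omega
      · exact .inr ⟨hk'.1, hl, hk'.2.1⟩
    · exfalso
      have hzr : z ≠ .root := by
        rintro rfl
        exact not_lt_root _ hz
      by_cases hm : ∃ t, F.lay z = F.cl t
      · have hl' := eq_cl_of_cl hm hl
        refine not_lt_of_ab h h2 hl' hz ?_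
        rw [host_lt_out h hl' (by rw [hxl]; exact (cl_ne_cl h t).symm) (ne_root_of_lay hxl),
          hxl] at hzx
        rcases hzx with h4 | ⟨-, h4, -⟩
        · exact h4
        · exact absurd h4.symm (nb_ne_cl h2 _ _)
      · push Not at hm
        rw [host_lt_mid hm hzr (ne_root_of_lay hxl), hxl] at hzx
        exact absurd rfl (mid_ne_cl h hzx.1 t).2

/-- In the chain, such a cell is above exactly the vertices with coordinate at most `2 + 3 * k`, so
it covers a vertex of row `k`. -/
theorem not_initial_nb (h : F.IsTree) {t : Bool} (hV : F.V t) {x : F.Vertex 4 G} (hx : IsCell x)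
    (hl : F.lay x = F.nb t) : ¬ (F.host4 G).Initial x := by
  have h2 := h.two_le t hV
  have hn : ∀ t', F.lay x ≠ F.cl t' := fun t' => by rw [hl]; exact nb_ne_cl h2 t t'
  obtain ⟨k, hk⟩ := hx.own t
  have hs := shift_of_V hV
  refine not_initial_of_row h h2 (t := t) (k := k) ?_ fun z hz hzx => ?_
  · rw [host_lt_out h (lay_zero t k) (hn t) hx.ne_root, own_zero]
    exact .inr ⟨hV, hl, hk.ge⟩
  · by_cases hlz : F.lay z = F.cl t
    · obtain ⟨k', hk'⟩ := chain_coord h2 hlz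
      rw [host_lt_chain h (lay_zero t k) hlz, own_zero, cross_zero] at hz
      rw [host_lt_out h hlz (hn t) hx.ne_root] at hzx
      rcases hzx with h4 | ⟨-, -, h4⟩
      · rw [hl] at h4
        exact absurd h4 (h.not_ab_nb t hV)
      obtain rfl : k' = k := Fin.ext (by omega)
      rcases hk' with hk' | hk' | hk' | hk'
      · exact .inl hk'.1
      · omega
      · omega
      · exact .inr ⟨hk'.1, hlz, hk'.2.1⟩
    · exfalso
      have hzr : z ≠ .root := by
        rintro rfl
        exact not_lt_root _ hz
      by_cases hm : ∃ t, F.lay z = F.cl t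
      · have hl' := eq_cl_of_cl hm hlz
        refine not_lt_of_ab h h2 hl' hz ?_
        rw [host_lt_out h hl' (hn _) hx.ne_root, hl] at hzx
        rcases hzx with h4 | ⟨hV', h4, -⟩
        · exact ab_cl_of_ab_nb h hV h4
        · exact absurd h4.symm (nb_ne_nb h hV hV')
      · push Not at hm
        rw [host_lt_mid hm hzr hx.ne_root, hl] at hzx
        exact absurd hzx.1 (not_mb_nb h hV _)

/-- The cell covers the cell of the same edge of `G` in the layer below. That layer is minimal, so
the lower cell covers only marks `2` and possibly the root, and hence is not terminal. -/
theorem not_initial_mid (h : F.IsTree) (h2 : 2 ≤ F.H) {x : F.Vertex 4 G} (hx : IsCell x) {l : ℕ}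
    (hm : F.mb l (F.lay x)) : ¬ (F.host4 G).Initial x := by
  have hl := h.mb_mid _ _ hm
  have nl := fun t => (mid_ne_cl h hm t).1
  obtain ⟨u, hu, rfl, ho⟩ := hx.exists_layer hl.2.1.le
  have hmin : (∀ m, ¬ F.mb m (F.lay u)) ∧ ∀ t, F.V t → F.lay u ≠ F.nb t :=
    ⟨fun m hm' => mb_trans_false h hm' hm, fun t hV he => not_nb_mb h hV _ (he ▸ hm)⟩
  have hc : (F.host4 G).Cov u x := by
    refine ⟨(host_lt_mid nl hu.ne_root hx.ne_root).2 ⟨hm, ho⟩, fun z h3 h4 => ?_⟩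
    have hzr : z ≠ .root := by
      rintro rfl
      exact not_lt_root _ h3
    rw [host_lt_mid nl hu.ne_root hzr] at h3
    have nz := fun t => (mid_ne_cl h h3.1 t).2
    rw [host_lt_mid nz hzr hx.ne_root] at h4
    exact mb_trans_false h h3.1 h4.1
  intro hi
  rcases hi u hc with h3 | h3
  · exact hu.ne_root ((isRoot_iff u).1 h3)
  · exact not_terminal_of_cov_two h h2 (fun w hw hcw => cov_minLayer h h2 hu.ne_root nl hmin hw hcw) h3

theorem initial_of_cov_two (h : F.IsTree) (h2 : 2 ≤ F.H) {p : F.Vertex 4 G}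
    (hp : ∀ u : F.Vertex 4 G, u ≠ .root → (F.host4 G).Cov u p → ∃ t k, u = F.sd t 2 k) :
    (F.host4 G).Initial p := by
  intro u hc
  by_cases hu : u = .root
  · exact .inl ((isRoot_iff u).2 hu)
  · obtain ⟨t, k, rfl⟩ := hp u hu hc
    exact .inr (terminal_two h h2 t k)

/-- The kept vertices, apart from the root. -/
def IsKept (x : F.Vertex 4 G) : Prop :=
  (∃ t k, x = F.sd t 0 k) ∨ (IsCell x ∧ 0 < F.lay x ∧ F.lay x < F.H ∧ MinLayer F.up F.dn (F.lay x))

/-- Kept chain vertices and cells of minimal middle layers cover only marks `2`, which are terminal,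
and the root. Every other vertex considered here covers a vertex that is not terminal: one of its
row, a mark `1`, or a cell of a lower layer. The vertices excluded by `hoff` are those to be
deleted. -/
theorem initial_iff (h : F.IsTree) (h2 : 2 ≤ F.H) {x : F.Vertex 4 G} (hx : x ≠ .root)
    (hoff : ∀ t k, ¬ F.V t → x ≠ F.sd t 3 k) : (F.host4 G).Initial x ↔ IsKept x := by
  by_cases hm : ∃ t, F.lay x = F.cl t
  · obtain ⟨t, hl⟩ := hm
    have hcell : IsCell x → ¬ (0 < F.lay x ∧ F.lay x < F.H) := by
      rintro - ⟨h3, h4⟩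
      rw [hl] at h3 h4
      cases t <;> simp [cl] at h3 h4
    rcases cases_chain h2 hl with ⟨k, rfl⟩ | ⟨k, rfl⟩ | ⟨k, rfl⟩ | hc
    · exact iff_of_true (initial_of_cov_two h h2 fun u hu hc => cov_zero h h2 hu hc)
        (.inl ⟨t, k, rfl⟩)
    · refine iff_of_false (not_initial_chain h h2 (.inl rfl)) ?_
      rintro (⟨t', k', h3⟩ | ⟨h3, -⟩)
      · cases h3
      · exact h3.ne_side _ _ _ rfl
    · refine iff_of_false (fun hi => ?_) ?_
      · rcases hi _ (cov_one_two h h2 t k) with h3 | h3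
        · exact absurd ((isRoot_iff _).1 h3) nofun
        · exact not_terminal_one h h2 t k h3
      · rintro (⟨t', k', h3⟩ | ⟨h3, -⟩)
        · cases h3
        · exact h3.ne_side _ _ _ rfl
    · obtain ⟨k, hk⟩ := hc.own t
      refine iff_of_false (not_initial_chain h h2 (.inr ⟨hc, hl, hk⟩)) ?_
      rintro (⟨t', k', h3⟩ | ⟨-, h4, h5, -⟩)
      · exact hc.ne_side _ _ _ h3
      · exact hcell hc ⟨h4, h5⟩
  · push Not at hm
    rcases cases_mid hx hm with ⟨t, k, rfl⟩ | hc
    · have hV : F.V t := by_contra fun hV => hoff t k hV rfl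
      refine iff_of_false (fun hi => ?_) ?_
      · rcases hi _ (cov_one_three h hV k) with h3 | h3
        · exact absurd ((isRoot_iff _).1 h3) nofun
        · exact not_terminal_one h h2 t k h3
      · rintro (⟨t', k', h3⟩ | ⟨h3, -⟩)
        · cases h3
        · exact h3.ne_side _ _ _ rfl
    · have h0 : 0 < F.lay x := Nat.pos_of_ne_zero (hm false)
      have hH : F.lay x < F.H := lt_of_le_of_ne hc.lay_le (hm true)
      have hmin := minLayer_iff h h0 hH
      by_cases hML : MinLayer F.up F.dn (F.lay x)
      · exact iff_of_true (initial_of_cov_two h h2 fun u hu hc' =>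
          cov_minLayer h h2 hx hm (hmin.1 hML) hu hc') (.inr ⟨hc, h0, hH, hML⟩)
      · refine iff_of_false ?_ ?_
        · have hML' := hML
          rw [hmin, not_and_or] at hML'
          push Not at hML'
          rcases hML' with ⟨m, h3⟩ | ⟨t, hV, h3⟩
          · exact not_initial_mid h h2 hc h3
          · exact not_initial_nb h hV hc h3
        · rintro (⟨t', k', h3⟩ | ⟨-, -, -, h3⟩)
          · exact hc.ne_side _ _ _ h3
          · exact hML h3

/-- The mark `1` is covered by the bare mark `2`, which betrays its partner in family `3`; a vertex
of family `3` is covered by nothing. Apart from these edges, both ends are cells. What covers a cell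
with edges is a cell of a chain that has edges, a mark `1`, or a cell of a non-minimal middle layer,
and none of these is bare. -/
theorem pendant_iff (h : F.IsTree) (h2 : 2 ≤ F.H) (x : F.Vertex 4 G) :
    (F.host4 G).Pendant x ↔ ∃ t k, ¬ F.V t ∧ x = F.sd t 3 k := by
  constructor
  · rintro ⟨hx, c, hc, hE, u, hcu, hb⟩
    replace hx := mt (isRoot_iff x).2 hx
    replace hc := mt (isRoot_iff c).2 hc
    have hur : u ≠ .root := by
      rintro rfl
      exact not_lt_root _ hcu.1
    rcases edge_cases h le_rfl hx hc hE with ⟨t, k, f, f', hV, hf, rfl, rfl⟩ | ⟨hx', hc'⟩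
    · rcases hf with ⟨hf, hf'⟩ | ⟨hf, hf'⟩
      · rw [show f' = 3 from Fin.ext hf'] at hcu
        exact absurd hcu.1 (leaf_three h h2 t k u)
      · exact ⟨t, k, hV, congrArg (HostVertex.side t · k) (Fin.ext hf)⟩
    · exfalso
      by_cases hm : ∃ t, F.lay c = F.cl t
      · obtain ⟨t, hl⟩ := hm
        have hV : ¬ F.V t := by
          have := ((host_E_iff hx hc).1 hE).1
          rw [hl] at this
          have hj := h.je_symm _ _ this
          have hj' := hj
          rw [eq_nb_of_je h hx'.lay_le hj] at hj'
          exact (h.je_nb t).1 hj'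
        have hs := shift_of_not hV
        obtain ⟨k, hk⟩ := hc'.own t
        have hcr := hc'.cross t
        have h3 := three_le_top (G := G)
        have hc1 : (F.host4 G).lt c (F.sd t 1 k) := by
          rw [host_lt_chain h hl (lay_one t k), own_one, cross_one]
          omega
        have h4 := hcu.2 _ hc1
        by_cases hlu : F.lay u = F.cl t
        · obtain ⟨k', hk'⟩ := chain_coord h2 hlu
          have h5 := hcu.1
          rw [host_lt_chain h hl hlu] at h5
          rw [host_lt_chain h (lay_one t k) hlu, own_one, cross_one] at h4
          rcases hk' with hk' | hk' | hk' | hk'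
          · omega
          · obtain ⟨rfl, -⟩ := hk'
            exact absurd ((isRoot_iff _).1 (hb _ (not_bare_one h hV k'))) nofun
          · omega
          · refine hk'.1.not_bare (nb_le h t) ?_ hb
            rw [hlu]
            exact (h.je_nb t).2 hV
        · have h5 := hcu.1
          rw [host_lt_out h hl hlu hur] at h5
          rw [host_lt_out h (lay_one t k) hlu hur] at h4
          rcases h5 with h5 | h5
          · exact h4 (.inl h5)
          · exact hV h5.1
      · push Not at hm
        have h5 := hcu.1
        rw [host_lt_mid hm hc hur] at h5
        have hmu := fun t => (mid_ne_cl h h5.1 t).2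
        rcases cases_mid hur hmu with ⟨t, k, rfl⟩ | hcu'
        · exact not_own_side_cell hc' h5.2.symm
        · have h0 : 0 < F.lay u := Nat.pos_of_ne_zero (hmu false)
          have hH : F.lay u < F.H := lt_of_le_of_ne hcu'.lay_le (hmu true)
          obtain ⟨l, hl, hj⟩ := exists_je_of_not_minLayer h hH fun hML =>
            ((minLayer_iff h h0 hH).1 hML).1 _ h5.1
          exact hcu'.not_bare hl hj hb
  · rintro ⟨t, k, hV, rfl⟩
    refine ⟨fun h' => absurd ((isRoot_iff _).1 h') nofun, F.sd t 1 k,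
      fun h' => absurd ((isRoot_iff _).1 h') nofun, host_E_symm h _ _ (not_bare_one h hV k),
      F.sd t 2 k, cov_one_two h h2 t k, bare_side h le_rfl (.inr (.inr rfl))⟩

end RackFrame

/-! ### The order of a rack -/

namespace SubdivVertex

variable {G : BipGraph} {h : ℕ}

/-- The order of a rack. -/
def rackLt (CA CB : Finset ℕ) : SubdivVertex G h → SubdivVertex G h → Prop
  | root, root => False
  | root, _ => True
  | a i, a i' => i.1 < i'.1
  | a _, b _ => h + 1 ∈ CA
  | a _, sub _ _ _ k => k.1 + 1 ∈ CA ∨ (k.1 + 1 ∈ CB ∧ h + 1 ∈ CA)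
  | b j, b j' => j.1 < j'.1
  | b _, sub _ _ _ k => k.1 + 1 ∈ CB
  | _, _ => False

/-- The recursion along predecessors that determines the transitive closure. For a subdivision
vertex it relies on `CA` and `CB` being disjoint, as `pred` gives precedence to `CA`. -/
theorem rackLt_pred_iff {CA CB : Finset ℕ} (hd : Disjoint CA CB) (x y : SubdivVertex G h) :
    rackLt CA CB x y ↔ y ≠ root ∧ (pred CA CB y = x ∨ rackLt CA CB x (pred CA CB y)) := by
  rcases y with _ | ⟨i, hi⟩ | ⟨i, j, hij, k⟩ | ⟨j, hj⟩
  · cases x <;> simp [rackLt]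
  · rcases i with _ | i <;> rcases x with _ | ⟨i', hi'⟩ | _ | _ <;>
      simp [rackLt, pred, a.injEq, Fin.ext_iff]
    omega
  · have hA : 0 < G.nA := i.pos
    have hB : 0 < G.nB := j.pos
    have hne : k.1 + 1 ∈ CA → k.1 + 1 ∉ CB := fun h1 h2 => Finset.disjoint_left.1 hd h1 h2
    rcases x with _ | ⟨i', hi'⟩ | _ | ⟨j', hj'⟩ <;> simp only [pred, maxA, maxB, dif_pos hA, dif_pos hB] <;>
      split_ifs <;> simp [rackLt, Fin.ext_iff, *] <;> omega
  · by_cases hA : 0 < G.nA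
    · rcases j with _ | j <;> rcases x with _ | ⟨i', hi'⟩ | _ | ⟨j', hj'⟩ <;>
        simp only [pred, maxA, dif_pos hA] <;> try split_ifs
      all_goals simp [rackLt, Fin.ext_iff, *]
      all_goals omega
    · rcases j with _ | j <;> rcases x with _ | ⟨i', hi'⟩ | _ | ⟨j', hj'⟩ <;>
        simp only [pred, maxA, dif_neg hA, ite_self]
      all_goals simp [rackLt, Fin.ext_iff]
      all_goals omega

/-- The number of elements below a vertex is at most its height. -/
def height : SubdivVertex G h → ℕ
  | root => 0
  | a i => i.1 + 1
  | b j => G.nA + j.1 + 1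
  | sub _ _ _ _ => G.nA + G.nB + 1

theorem height_pred_lt (CA CB : Finset ℕ) {y : SubdivVertex G h} (hy : y ≠ root) :
    (pred CA CB y).height < y.height := by
  have hmA : (maxA G h).height ≤ G.nA := by
    unfold maxA; split_ifs <;> simp [height]; omega
  have hmB : (maxB G h).height ≤ G.nA + G.nB := by
    unfold maxB; split_ifs <;> simp [height]; omega
  have hr : (root : SubdivVertex G h).height = 0 := rfl
  rcases y with _ | ⟨_ | i, hi⟩ | ⟨i, j, hij, k⟩ | ⟨_ | j, hj⟩
  · exact absurd rfl hy
  · simp [pred, height]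
  · simp [pred, height]
  · have e : (sub i j hij k : SubdivVertex G h).height = G.nA + G.nB + 1 := rfl
    simp only [pred, e]
    split_ifs <;> omega
  · have e : (b ⟨0, hj⟩ : SubdivVertex G h).height = G.nA + 0 + 1 := rfl
    simp only [pred, e]
    split_ifs <;> omega
  · simp [pred, height]

theorem transGen_pred_iff {CA CB : Finset ℕ} (hd : Disjoint CA CB) (x y : SubdivVertex G h) :
    Relation.TransGen (fun x y => y ≠ root ∧ pred CA CB y = x) x y ↔ rackLt CA CB x y := by
  -- Passing to the predecessor lowers the height, so the transitive closure is unfolded from its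
  -- upper end.
  induction hn : y.height using Nat.strong_induction_on generalizing y with
  | _ n ih =>
    subst hn
    rw [rackLt_pred_iff hd, Relation.TransGen.tail'_iff]
    constructor
    · rintro ⟨z, hxz, hy, rfl⟩
      refine ⟨hy, ?_⟩
      rcases Relation.reflTransGen_iff_eq_or_transGen.1 hxz with h1 | h1
      · exact .inl h1
      · exact .inr ((ih _ (height_pred_lt CA CB hy) _ rfl).1 h1)
    · rintro ⟨hy, h1⟩
      refine ⟨_, ?_, hy, rfl⟩
      rcases h1 with h1 | h1
      · exact Relation.reflTransGen_iff_eq_or_transGen.2 (.inl h1)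
      · exact Relation.reflTransGen_iff_eq_or_transGen.2
          (.inr ((ih _ (height_pred_lt CA CB hy) _ rfl).2 h1))

/-- The vertex of the subdivision that comes from a vertex of the part `t`. -/
def ofPart (h : ℕ) : (t : Bool) → Fin (G.part t) → SubdivVertex G h
  | false, k => a k
  | true, k => b k

theorem cases_ofPart (u : SubdivVertex G h) : u = root ∨ (∃ t k, u = ofPart h t k) ∨
    ∃ i j hij k, u = sub i j hij k := by
  rcases u with _ | i | ⟨i, j, hij, k⟩ | j
  · exact .inl rfl
  · exact .inr (.inl ⟨false, i, rfl⟩)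
  · exact .inr (.inr ⟨i, j, hij, k, rfl⟩)
  · exact .inr (.inl ⟨true, j, rfl⟩)

end SubdivVertex

/-! ### The definable minor of a host is a rack -/

namespace RackFrame

variable {F : RackFrame} {n : ℕ} {G : BipGraph}

variable (F n G) in
/-- The contraction of a host to the subdivision. -/
noncomputable abbrev contract : F.Vertex n G → SubdivVertex G (layerGroup F.up F.dn F.H - 1) :=
  hostContraction F.H F.up F.dn 0

/-- The vertices of the path that replaces an edge. -/
noncomputable def pathCell (t : ℕ) (i : Fin G.nA) (j : Fin G.nB) (hij : G.adj i j = true) :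
    F.Vertex n G :=
  if h : t < F.H + 1 then .cell ⟨t, h⟩ i j hij else .root

theorem pathCell_of_le {t : ℕ} (h : t ≤ F.H) (i : Fin G.nA) (j : Fin G.nB)
    (hij : G.adj i j = true) :
    (pathCell t i j hij : F.Vertex n G) = .cell ⟨t, Nat.lt_succ_of_le h⟩ i j hij :=
  dif_pos (Nat.lt_succ_of_le h)

variable (F n G) in
/-- The kept vertices, indexed by the vertices of the subdivision. -/
noncomputable def kept [NeZero n] : SubdivVertex G (layerGroup F.up F.dn F.H - 1) → F.Vertex n G :=
  pathSection F.H F.up F.dn .root (fun i => .side false (0 : Fin n) i)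
    (fun j => .side true (0 : Fin n) j) pathCell

theorem contract_side (t : Bool) (f : Fin n) (k : Fin (G.part t)) :
    F.contract n G (.side t f k) = .ofPart _ t k := by cases t <;> rfl

variable [NeZero n]

theorem kept_ofPart (t : Bool) (k : Fin (G.part t)) :
    F.kept n G (.ofPart _ t k) = .side t (0 : Fin n) k := by cases t <;> rfl

/-- The vertices that are contracted to a vertex of `G`. -/
def Attached (t : Bool) (k : Fin (G.part t)) (x : F.Vertex n G) : Prop :=
  F.contract n G x = .ofPart _ t k ∧ 2 + 3 * k.1 ≤ F.own t x ∧ F.own t x ≤ 4 + 3 * k.1 ∧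
    ((F.lay x = F.cl t ∧ (x = .side t (0 : Fin n) k ∨ 1 < F.cross t x)) ∨
      (F.V t ∧ F.lay x = F.nb t))

theorem attached_side (t : Bool) (f : Fin n) (k : Fin (G.part t)) (hf : f.1 = 3 → F.V t) :
    Attached t k (.side t f k : F.Vertex n G) := by
  have h1 := own_side (F := F) t f k
  have h2 := shift_le (F := F) t
  have h3 := famShift_le f.1
  have h4 := Nat.mul_le_mul h2 h3
  refine ⟨contract_side t f k, by omega, by omega, ?_⟩
  rw [lay_side]
  split_ifs with h5
  · exact .inr ⟨hf h5, rfl⟩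
  · refine .inl ⟨rfl, ?_⟩
    by_cases h6 : f = 0
    · exact .inl (by rw [h6])
    · right
      have h7 : f.1 ≠ 0 := fun h => h6 (Fin.ext h)
      have := three_le_top (G := G)
      rw [cross_side, famKey, if_neg h7]
      split_ifs <;> omega

theorem attached_cell {t : Bool} {x : F.Vertex n G} (hx : IsCell x)
    {k : Fin (G.part t)} (hk : F.own t x = 2 + 3 * k.1)
    (hc : F.contract n G x = .ofPart _ t k)
    (hl : F.lay x = F.cl t ∨ (F.V t ∧ F.lay x = F.nb t)) : Attached t k x :=
  ⟨hc, hk.ge, by omega, hl.imp_left fun hl => ⟨hl, .inr (hx.cross t).1⟩⟩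

theorem layerGroup_mid (h : F.IsTree) {l : ℕ} (hl : l ≤ F.H)
    (h0 : layerGroup F.up F.dn l ≠ 0)
    (hH : layerGroup F.up F.dn l ≠ layerGroup F.up F.dn F.H) :
    0 < l ∧ l < F.H ∧ ∃ m, 0 < m ∧ m < F.H ∧ MinLayer F.up F.dn m ∧
      layerGroup F.up F.dn m = layerGroup F.up F.dn l ∧ (m = l ∨ F.mb m l) := by
  obtain ⟨m, h1, h2, h3, h4⟩ := (layerPath h).exists_minLayer hl
  have hl0 : l ≠ 0 := fun h' => h0 (by rw [h']; rfl)
  have hlH : l ≠ F.H := fun h' => hH (by rw [h'])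
  have hm0 : m ≠ 0 := fun h' => h0 (by rw [← h3, h']; rfl)
  have hmH : m ≠ F.H := fun h' => hH (by rw [← h3, h'])
  refine ⟨by omega, by omega, m, by omega, by omega, h2, h3, ?_⟩
  rcases h4 with h4 | ⟨(⟨h4, -⟩ | h4), h5⟩ | ⟨(⟨h4, -⟩ | h4), h5⟩
  · exact .inl h4
  · omega
  · subst h5; exact .inr h4
  · omega
  · subst h5; exact .inr h4

/-- The vertices that are contracted to a subdivision vertex. -/
theorem attached_or_mid (h : F.IsTree) {x : F.Vertex n G} (hx : x ≠ .root)
    (hoff : ∀ t (f : Fin n) k, f.1 = 3 → ¬ F.V t → x ≠ .side t f k) :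
    (∃ t k, Attached t k x) ∨
    ∃ i j hij, ∃ k : Fin (layerGroup F.up F.dn F.H - 1), F.contract n G x = .sub i j hij k ∧
      x = pathCell (F.lay x) i j hij ∧ layerGroup F.up F.dn (F.lay x) = k.1 + 1 := by
  have hp := layerPath h
  have hpos := hp.layerGroup_last_pos
  rcases x with _ | ⟨t, f, k⟩ | ⟨s, i, j, hij⟩
  · exact absurd rfl hx
  · exact .inl ⟨t, k, attached_side t f k fun hf => by_contra fun hV => hoff t f k hf hV rfl⟩
  · have hs : s.1 ≤ F.H := Nat.le_of_lt_succ s.2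
    have hcell : IsCell (.cell s i j hij : F.Vertex n G) := ⟨s, i, j, hij, rfl⟩
    have hc : F.contract n G (.cell s i j hij) =
      .onPath _ i j hij (layerGroup F.up F.dn s.1) := rfl
    by_cases h0 : layerGroup F.up F.dn s.1 = 0
    · refine .inl ⟨false, i, attached_cell hcell rfl (by rw [hc, h0]; rfl) ?_⟩
      rcases hp.layerGroup_eq_zero hs h0 with h1 | ⟨h1, h2 | h2⟩
      · exact .inl h1
      · exact .inr ⟨h2.2, h1⟩
      · have := h.mb_mid _ _ h2; omega
    by_cases hH : layerGroup F.up F.dn s.1 = layerGroup F.up F.dn F.H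
    · refine .inl ⟨true, j, attached_cell hcell rfl (by rw [hc, hH, hp.onPath_last]; rfl) ?_⟩
      rcases hp.layerGroup_eq_last hs hH with h1 | ⟨h1, h2 | h2⟩
      · exact .inl h1
      · exact .inr ⟨h2.2, by change s.1 = F.H - 1; omega⟩
      · have := h.mb_mid _ _ h2; omega
    · have hm := layerGroup_mono (up := F.up) (dn := F.dn) hs
      obtain ⟨k, hk⟩ : ∃ k, layerGroup F.up F.dn s.1 = k + 1 := ⟨_, (Nat.succ_pred h0).symm⟩
      have hkl : k < layerGroup F.up F.dn F.H - 1 := by omega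
      refine .inr ⟨i, j, hij, ⟨k, hkl⟩, ?_, (pathCell_of_le hs i j hij).symm, hk⟩
      rw [hc, hk, SubdivVertex.onPath, dif_pos hkl]

theorem kept_sub (h : F.IsTree) (i : Fin G.nA) (j : Fin G.nB) (hij : G.adj i j = true)
    (k : Fin (layerGroup F.up F.dn F.H - 1)) :
    ∃ m, m = minLayerOf F.H F.up F.dn (k.1 + 1) ∧ 0 < m ∧ m < F.H ∧ MinLayer F.up F.dn m ∧
      layerGroup F.up F.dn m = k.1 + 1 ∧ F.kept n G (.sub i j hij k) = pathCell m i j hij ∧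
      IsCell (pathCell m i j hij : F.Vertex n G) ∧
      F.lay (pathCell m i j hij : F.Vertex n G) = m := by
  have hp := layerPath h
  have hk := k.2
  obtain ⟨h1, h2, h3⟩ := hp.minLayerOf_spec (k := k.1 + 1) (by omega)
  have h4 := hp.minLayerOf_lt (k := k.1 + 1) (by omega) (by omega)
  refine ⟨_, rfl, h4.1, h4.2, h2, h3, rfl, ?_, ?_⟩
  · rw [pathCell_of_le h1]; exact ⟨_, _, _, _, rfl⟩
  · rw [pathCell_of_le h1]; rfl

theorem contract_kept (h : F.IsTree) (u) : F.contract n G (F.kept n G u) = u := by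
  rcases u.cases_ofPart with rfl | ⟨t, k, rfl⟩ | ⟨i, j, hij, k, rfl⟩
  · rfl
  · rw [kept_ofPart, contract_side]
  · obtain ⟨m, -, h1, h2, h3, h4, h5, -⟩ := kept_sub (n := n) h i j hij k
    rw [h5, pathCell_of_le h2.le]
    change SubdivVertex.onPath _ i j hij (layerGroup F.up F.dn m) = _
    rw [h4, SubdivVertex.onPath, dif_pos k.2]

/-! #### Parameters of the rack -/

variable (F) in
open Classical in
noncomputable def setB : Finset ℕ :=
  (Finset.Icc 1 (layerGroup F.up F.dn F.H - 1)).filter fun k =>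
    F.ab true (minLayerOf F.H F.up F.dn k)

-- If a layer is above both chains, the second chain is above the first, so the predecessor of the
-- layer is the maximum of the second. Hence `setA` excludes `setB`.
variable (F) in
open Classical in
noncomputable def setA : Finset ℕ :=
  (Finset.Icc 1 (layerGroup F.up F.dn F.H - 1 + 1)).filter fun k =>
    F.ab false (minLayerOf F.H F.up F.dn k) ∧ k ∉ F.setB

open Classical in
theorem setA_subset : F.setA ⊆ Finset.Icc 1 (layerGroup F.up F.dn F.H - 1 + 1) :=
  Finset.filter_subset _ _

open Classical in
theorem setB_subset : F.setB ⊆ Finset.Icc 1 (layerGroup F.up F.dn F.H - 1) :=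
  Finset.filter_subset _ _

noncomputable def rackParam (h : F.IsTree) : RackParam where
  h := layerGroup F.up F.dn F.H - 1
  N := rootGroups F.H F.up F.dn F.radj
  CA := F.setA
  CB := F.setB
  N_sub := (layerPath h).rootGroups_subset F.radj
  CA_sub := setA_subset
  CB_sub := setB_subset
  disj := Finset.disjoint_left.2 fun k (h1 : k ∈ F.setA) h2 => by
    classical
    exact (Finset.mem_filter.1 h1).2.2 h2

theorem mem_setB {k : ℕ} (hk : k < layerGroup F.up F.dn F.H - 1) :
    k + 1 ∈ F.setB ↔ F.ab true (minLayerOf F.H F.up F.dn (k + 1)) := by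
  simp only [setB, Finset.mem_filter, Finset.mem_Icc]
  exact ⟨fun h => h.2, fun h => ⟨by omega, h⟩⟩

theorem mem_setA {k : ℕ} (hk : k < layerGroup F.up F.dn F.H - 1) :
    k + 1 ∈ F.setA ↔ F.ab false (minLayerOf F.H F.up F.dn (k + 1)) ∧
      ¬ F.ab true (minLayerOf F.H F.up F.dn (k + 1)) := by
  simp only [setA, Finset.mem_filter, Finset.mem_Icc, mem_setB hk]
  exact ⟨fun h => h.2, fun h => ⟨by omega, h⟩⟩

theorem last_mem_setA (h : F.IsTree) :
    layerGroup F.up F.dn F.H - 1 + 1 ∈ F.setA ↔ F.ab false F.H := by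
  have hp := layerPath h
  have hpos := hp.layerGroup_last_pos
  have h1 : minLayerOf F.H F.up F.dn (layerGroup F.up F.dn F.H) = F.H :=
    hp.minLayerOf_layerGroup hp.minLayer_last le_rfl
  rw [Nat.sub_add_cancel hpos]
  have h2 : layerGroup F.up F.dn F.H ∉ F.setB := fun hm => by
    have := Finset.mem_Icc.1 (setB_subset hm)
    omega
  simp only [setA, Finset.mem_filter, Finset.mem_Icc, h1]
  exact ⟨fun h => h.2.1, fun h => ⟨by omega, h, h2⟩⟩

section RackLt

open SubdivVertex

theorem rackLt_ofPart (t : Bool) (k k' : Fin (G.part t)) :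
    rackLt F.setA F.setB (ofPart (layerGroup F.up F.dn F.H - 1) t k) (ofPart _ t k') ↔
      k.1 < k'.1 := by cases t <;> exact Iff.rfl

theorem rackLt_ofPart_not (h : F.IsTree) (t : Bool) (k : Fin (G.part t)) (k' : Fin (G.part (!t))) :
    rackLt F.setA F.setB (ofPart (layerGroup F.up F.dn F.H - 1) t k) (ofPart _ (!t) k') ↔
      F.ab t (F.cl (!t)) := by
  cases t
  · exact last_mem_setA h
  · exact iff_of_false id h.not_ab_zero

/-- In a rack a layer is above the first chain directly, or through the second chain when that one
is above the first. The lemmas `ab_false_of_ab_true` and `ab_of_ab_ab` identify this with the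
relation of the frame. -/
theorem rackLt_sub (h : F.IsTree) (t : Bool) (k : Fin (G.part t)) (i : Fin G.nA) (j : Fin G.nB)
    (hij : G.adj i j = true) (l : Fin (layerGroup F.up F.dn F.H - 1)) :
    rackLt F.setA F.setB (ofPart _ t k) (sub i j hij l) ↔
      F.ab t (minLayerOf F.H F.up F.dn (l.1 + 1)) := by
  obtain ⟨m, hm, h1, h2, -⟩ := kept_sub (n := 1) h i j hij l
  cases t
  · change (l.1 + 1 ∈ F.setA ∨ l.1 + 1 ∈ F.setB ∧ _ ∈ F.setA) ↔ _
    rw [mem_setA l.2, mem_setB l.2, last_mem_setA h, ← hm]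
    have h3 := ab_false_of_ab_true h h1 h2
    have h4 := ab_of_ab_ab h h1 h2
    tauto
  · exact mem_setB l.2

theorem rackLt_asymm {CA CB : Finset ℕ} {h : ℕ} (u v : SubdivVertex G h)
    (h1 : rackLt CA CB u v) : ¬ rackLt CA CB v u := by
  rcases u with _ | _ | _ | _ <;> rcases v with _ | _ | _ | _ <;> simp [rackLt] at h1 ⊢ <;> omega

theorem rackLt_iff_lt (h : F.IsTree) (u v : SubdivVertex G (layerGroup F.up F.dn F.H - 1)) :
    rackLt F.setA F.setB u v ↔ (F.host n G).lt (F.kept n G u) (F.kept n G v) := by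
  have hside : ∀ t (k : Fin (G.part t)), F.lay (.side t (0 : Fin n) k : F.Vertex n G) = F.cl t :=
    fun t k => by rw [lay_side, if_neg (by simp)]
  have hne : ∀ t (k : Fin (G.part t)), (.side t (0 : Fin n) k : F.Vertex n G) ≠ .root :=
    fun _ _ => nofun
  have hown : ∀ t (k : Fin (G.part t)),
      F.own t (.side t (0 : Fin n) k : F.Vertex n G) = 2 + 3 * k.1 :=
    fun t k => by rw [own_side]; simp [famShift]
  have hcross : ∀ t (k : Fin (G.part t)),
      F.cross t (.side t (0 : Fin n) k : F.Vertex n G) = 1 :=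
    fun t k => by rw [cross_side]; simp [famKey]
  have hmid : ∀ {m}, 0 < m → m < F.H → ∀ t, m ≠ F.cl t := by
    intro m h1 h2 t
    cases t <;> simp [cl] <;> omega
  rcases u.cases_ofPart with rfl | ⟨t, k, rfl⟩ | ⟨i, j, hij, k, rfl⟩ <;>
    rcases v.cases_ofPart with rfl | ⟨t', k', rfl⟩ | ⟨i', j', hij', k', rfl⟩
  · exact iff_of_false id (not_lt_root _)
  · rw [kept_ofPart]
    exact iff_of_true (by cases t' <;> trivial) (root_lt (hne t' k'))
  · obtain ⟨m', -, -, -, -, -, e, hc, -⟩ := kept_sub (n := n) h i' j' hij' k'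
    rw [e]
    exact iff_of_true trivial (root_lt hc.ne_root)
  · exact iff_of_false (by cases t <;> exact id) (not_lt_root _)
  · rw [kept_ofPart, kept_ofPart]
    by_cases htt : t' = t
    · subst htt
      rw [rackLt_ofPart, host_lt_chain h (hside _ _) (hside _ _), hown, hown, hcross, hcross]
      omega
    · obtain rfl : t' = !t := by cases t <;> cases t' <;> simp_all
      rw [rackLt_ofPart_not h, host_lt_out h (hside _ _) (by rw [hside]; exact cl_ne_cl h t) (hne _ k'),
        hside]
      refine ⟨.inl, fun h' => h'.resolve_right ?_⟩
      rintro ⟨hV, h1, -⟩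
      exact nb_ne_cl (h.two_le t hV) _ _ h1.symm
  · obtain ⟨m', hm', h1, h2, h3, h4, e, hc, hl⟩ := kept_sub (n := n) h i' j' hij' k'
    rw [rackLt_sub h, kept_ofPart, e,
      host_lt_out h (hside _ _) (by rw [hl]; exact hmid h1 h2 t) hc.ne_root, hl, ← hm']
    refine ⟨.inl, fun h' => h'.resolve_right ?_⟩
    rintro ⟨hV, h5, -⟩
    exact ((minLayer_iff h h1 h2).1 h3).2 t hV h5
  · exact iff_of_false id (not_lt_root _)
  · obtain ⟨m, hm, h1, h2, h3, h4, e, hc, hl⟩ := kept_sub (n := n) h i j hij k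
    refine iff_of_false (by cases t' <;> exact id) fun hlt => ?_
    rw [kept_ofPart, e, host_lt_mid (by rw [hl]; exact hmid h1 h2) hc.ne_root (hne _ k'), hside] at hlt
    exact (mid_ne_cl h hlt.1 t').2 rfl
  · obtain ⟨m, hm, h1, h2, h3, h4, e, hc, hl⟩ := kept_sub (n := n) h i j hij k
    obtain ⟨m', hm', h1', h2', h3', h4', e', hc', hl'⟩ := kept_sub (n := n) h i' j' hij' k'
    refine iff_of_false id fun hlt => ?_
    rw [e, e', host_lt_mid (by rw [hl]; exact hmid h1 h2) hc.ne_root hc'.ne_root, hl, hl'] at hlt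
    exact ((minLayer_iff h h1' h2').1 h3').1 _ hlt.1

end RackLt

end RackFrame

/-! ### The contraction of a host of type 3 onto its rack -/

namespace RackFrame

variable {F : RackFrame} {n : ℕ} {G : BipGraph}

/-- The vertices that are deleted. -/
def Off (x : F.Vertex n G) : Prop := ∃ t, ∃ f : Fin n, ∃ k, f.1 = 3 ∧ ¬ F.V t ∧ x = .side t f k

theorem IsCell.not_off {x : F.Vertex n G} (hx : IsCell x) : ¬ Off x := by
  rintro ⟨t, f, k, -, -, h⟩
  exact hx.ne_side t f k h

theorem not_off_root : ¬ Off (.root : F.Vertex n G) := by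
  rintro ⟨t, f, k, -, -, h⟩
  cases h

theorem not_off_side {t : Bool} {f : Fin n} {k : Fin (G.part t)} (hf : f.1 = 3 → F.V t) :
    ¬ Off (.side t f k : F.Vertex n G) := by
  rintro ⟨t', f', k', h1, h2, h⟩
  cases h
  exact h2 (hf h1)

theorem layerGroup_nb (h : F.IsTree) {t : Bool} (hV : F.V t) :
    layerGroup F.up F.dn (F.nb t) = layerGroup F.up F.dn (F.cl t) := by
  cases t
  · exact layerGroup_succ_of_cont (.inl (.inl ⟨rfl, hV⟩))
  · have hpos := h.pos
    have := layerGroup_succ_of_cont (up := F.up) (dn := F.dn) (t := F.H - 1)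
      (.inr (.inl ⟨by omega, hV⟩))
    rw [show F.H - 1 + 1 = F.H by omega] at this
    exact this.symm

theorem layer_ofPart (h : F.IsTree) (t : Bool) (k : Fin (G.part t)) :
    (SubdivVertex.ofPart (layerGroup F.up F.dn F.H - 1) t k).layer =
      some (layerGroup F.up F.dn (F.cl t)) := by
  have hpos := (layerPath h).layerGroup_last_pos
  cases t
  · rfl
  · exact congrArg some (by change _ = layerGroup F.up F.dn F.H; omega)

theorem eq_cl_or_nb (h : F.IsTree) {l : ℕ} (hl : l ≤ F.H) {t : Bool}
    (hg : layerGroup F.up F.dn l = layerGroup F.up F.dn (F.cl t)) :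
    l = F.cl t ∨ (F.V t ∧ l = F.nb t) := by
  have hp := layerPath h
  have hpos := h.pos
  cases t
  · rcases hp.layerGroup_eq_zero hl hg with h1 | ⟨h1, h2 | h2⟩
    · exact .inl h1
    · exact .inr ⟨h2.2, h1⟩
    · have := h.mb_mid _ _ h2; omega
  · rcases hp.layerGroup_eq_last hl hg with h1 | ⟨h1, h2 | h2⟩
    · exact .inl h1
    · exact .inr ⟨h2.2, by change l = F.H - 1; omega⟩
    · have := h.mb_mid _ _ h2; omega

/-- Deleting family `3` where it has edges leaves the edges of the paths as the only ones outside
the root. Next to a simply vertical chain family `3` remains, and it represents the neighbouring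
layer over every vertex of `G`; this is the purpose of `hV`. -/
theorem isPathHost [NeZero n] (h : F.IsTree) (hn : n ≤ 4) (hV : ∀ t, F.V t → 3 < n) :
    IsPathHost G F.H F.up F.dn (fun l => F.je l (l + 1)) F.radj (F.host n G) (fun x => ¬ Off x)
      HostVertex.root (F.contract n G) F.lay pathCell where
  symm := host_E_symm h
  nd_root := not_off_root
  π_root := rfl
  lay_le _ _ hx := lay_le h hx
  π_layer x hx hr := by
    rcases x with _ | ⟨t, f, k⟩ | ⟨s, i, j, hij⟩
    · exact absurd rfl hr
    · have e := contract_side (F := F) (n := n) t f k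
      refine (congrArg SubdivVertex.layer e).trans ((layer_ofPart h t k).trans ?_)
      rw [lay_side]
      split_ifs with hf
      · rw [layerGroup_nb h (by_contra fun hV => hx ⟨t, f, k, hf, hV, rfl⟩)]
      · rfl
    · have h1 := layerGroup_mono (up := F.up) (dn := F.dn) (Nat.le_of_lt_succ s.2)
      have h2 := (layerPath h).layerGroup_last_pos
      have h3 : layerGroup F.up F.dn s.1 ≤ layerGroup F.up F.dn F.H - 1 + 1 := by omega
      exact SubdivVertex.layer_onPath i j hij h3
  nd_path l hl i j hij := by
    rw [pathCell_of_le hl]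
    exact IsCell.not_off ⟨_, _, _, _, rfl⟩
  π_path l hl i j hij := by
    rw [pathCell_of_le hl]
    rfl
  edge_path l hl hj i j hij := by
    rw [pathCell_of_le hl.le, pathCell_of_le (t := l + 1) hl]
    refine .inr (.inr ⟨nofun, nofun, ?_⟩)
    exact ⟨hj, rfl⟩
  path_of_edge x y hx hy hxr hyr hE := by
    right
    rcases edge_cases h hn hxr hyr hE with ⟨t, k, f, f', h1, h2, rfl, rfl⟩ | ⟨hcx, hcy⟩
    · rcases h2 with ⟨h2, h3⟩ | ⟨h2, h3⟩
      · exact absurd ⟨t, f', k, h3, h1, rfl⟩ hy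
      · exact absurd ⟨t, f, k, h2, h1, rfl⟩ hx
    · obtain ⟨hj, ho⟩ := (host_E_iff hxr hyr).1 hE
      have hlx := hcx.lay_le
      have hly := hcy.lay_le
      obtain ⟨s, i, j, hij, rfl⟩ := hcx
      have hyc : ∀ {l}, (hl : F.lay y = l) → y = pathCell l i j hij := by
        intro l hl
        have hle : l ≤ F.H := hl ▸ hly
        rw [pathCell_of_le hle]
        exact cell_ext hcy ⟨_, _, _, _, rfl⟩ hl ho.symm
      have hxc : (.cell s i j hij : F.Vertex n G) = pathCell s.1 i j hij :=
        (pathCell_of_le hlx i j hij).symm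
      rcases h.je_consecutive _ _ hj with h1 | h1
      · refine ⟨s.1, ?_, i, j, hij, .inl ⟨hxc, hyc h1⟩⟩
        change F.lay y = s.1 + 1 at h1
        omega
      · change s.1 = F.lay y + 1 at h1
        change s.1 ≤ F.H at hlx
        refine ⟨F.lay y, by omega, i, j, hij, .inr ⟨hyc rfl, ?_⟩⟩
        rw [← h1]
        exact hxc
  hasE_of_not l hl := je_of_not h hl
  edge_root x _ hx := by
    constructor
    · rintro (⟨-, -, h1⟩ | ⟨h1, -⟩ | ⟨h1, -⟩)
      · exact h1
      · exact absurd h1 hx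
      · exact absurd rfl h1
    · exact fun h1 => .inl ⟨rfl, hx, h1⟩
  surj u l hl hu := by
    rcases u.cases_ofPart with rfl | ⟨t, k, rfl⟩ | ⟨i, j, hij, k, rfl⟩
    · cases hu
    · rw [layer_ofPart h] at hu
      rcases eq_cl_or_nb h hl (Option.some.inj hu).symm with h1 | ⟨h1, h2⟩
      · refine ⟨.side t (0 : Fin n) k, not_off_side (by simp), nofun, contract_side t _ k, ?_⟩
        rw [lay_side, if_neg (by simp), h1]
      · refine ⟨.side t (⟨3, hV t h1⟩ : Fin n) k, not_off_side fun _ => h1, nofun,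
          contract_side t _ k, ?_⟩
        rw [lay_side, if_pos rfl, h2]
    · have hk : layerGroup F.up F.dn l = k.1 + 1 := (Option.some.inj hu).symm
      refine ⟨.cell ⟨l, Nat.lt_succ_of_le hl⟩ i j hij, IsCell.not_off ⟨_, _, _, _, rfl⟩, nofun,
        ?_, rfl⟩
      change SubdivVertex.onPath _ i j hij (layerGroup F.up F.dn l) = _
      rw [hk, SubdivVertex.onPath, dif_pos k.2]

section Order

variable [NeZero n]

theorem side_facts (t : Bool) (k : Fin (G.part t)) :
    (.side t (0 : Fin n) k : F.Vertex n G) ≠ .root ∧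
    F.lay (.side t (0 : Fin n) k : F.Vertex n G) = F.cl t ∧
    F.own t (.side t (0 : Fin n) k : F.Vertex n G) = 2 + 3 * k.1 ∧
    F.cross t (.side t (0 : Fin n) k : F.Vertex n G) = 1 :=
  ⟨nofun, by rw [lay_side, if_neg (by simp)], by rw [own_side]; simp [famShift],
    by rw [cross_side]; simp [famKey]⟩

/-- The minimal layer of the group of a layer. -/
theorem mid_cases (h : F.IsTree) {l m : ℕ} (hl : l ≤ F.H)
    {k : Fin (layerGroup F.up F.dn F.H - 1)} (hk : layerGroup F.up F.dn l = k.1 + 1)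
    (hm : MinLayer F.up F.dn m) (hmk : layerGroup F.up F.dn m = k.1 + 1) :
    0 < l ∧ l < F.H ∧ (m = l ∨ F.mb m l) := by
  have hk2 := k.2
  obtain ⟨h1, h2, m', h3, h4, h5, h6, h7⟩ := layerGroup_mid h hl (by omega) (by omega)
  obtain rfl := (layerPath h).minLayer_unique h5 hm (by omega)
  exact ⟨h1, h2, h7⟩

theorem mid_ne {l : ℕ} (h0 : 0 < l) (hH : l < F.H) (t : Bool) : l ≠ F.cl t := by
  cases t <;> simp [cl] <;> omega

theorem kept_contract_le (h : F.IsTree) {x : F.Vertex n G} (hx : ¬ Off x) :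
    F.kept n G (F.contract n G x) = x ∨ (F.host n G).lt (F.kept n G (F.contract n G x)) x := by
  by_cases hr : x = .root
  · subst hr
    exact .inl rfl
  rcases attached_or_mid h hr (fun t f k hf hV e => hx ⟨t, f, k, hf, hV, e⟩) with
    ⟨t, k, hc, ho, ho', hl⟩ | ⟨i, j, hij, k, hc, hxc, hg⟩
  · obtain ⟨s1, s2, s3, s4⟩ := side_facts (F := F) (n := n) t k
    rw [hc, kept_ofPart]
    rcases hl with ⟨hl, rfl | hl'⟩ | ⟨hV, hl⟩
    · exact .inl rfl
    · right
      rw [host_lt_chain h s2 hl, s3, s4]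
      omega
    · right
      rw [host_lt_out h s2 (by rw [hl]; exact nb_ne_cl (h.two_le t hV) _ _) hr, s3]
      exact .inr ⟨hV, hl, ho⟩
  · obtain ⟨m, -, h1, h2, h3, h4, e, hcm, hlm⟩ := kept_sub (n := n) h i j hij k
    obtain ⟨g1, g2, g3⟩ := mid_cases h (lay_le h hr) hg h3 h4
    rw [hc, e]
    rcases g3 with g3 | g3
    · left
      rw [g3]
      exact hxc.symm
    · right
      rw [host_lt_mid (by rw [hlm]; exact mid_ne h1 h2) hcm.ne_root hr, hlm]
      refine ⟨g3, ?_⟩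
      rw [hxc, pathCell_of_le h2.le, pathCell_of_le g2.le]
      rfl

/-- Together with `kept_contract_le` this makes `kept (contract x)` the greatest kept vertex weakly
below `x`. Within one chain, vertices attached to `k` have coordinates in the interval from `2 + 3 *
k` to `4 + 3 * k`, and these intervals are disjoint for distinct `k`. Kept vertices of other layers
compare with `x` as they do with its representative, by the restrictions on the frame. -/
theorem le_kept_contract (h : F.IsTree) {x : F.Vertex n G} (hx : ¬ Off x)
    (u : SubdivVertex G (layerGroup F.up F.dn F.H - 1))
    (hu : F.kept n G u = x ∨ (F.host n G).lt (F.kept n G u) x) :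
    u = F.contract n G x ∨ (F.host n G).lt (F.kept n G u) (F.kept n G (F.contract n G x)) := by
  rcases hu with rfl | hu
  · exact .inl (contract_kept h u).symm
  have hr : x ≠ .root := by
    rintro rfl
    exact not_lt_root _ hu
  rcases attached_or_mid h hr (fun t f k hf hV e => hx ⟨t, f, k, hf, hV, e⟩) with
    ⟨t, k, hc, ho, ho', hl⟩ | ⟨i, j, hij, k, hc, hxc, hg⟩
  · obtain ⟨s1, s2, s3, s4⟩ := side_facts (F := F) (n := n) t k
    rw [hc, kept_ofPart]
    rcases u.cases_ofPart with rfl | ⟨t', k', rfl⟩ | ⟨i', j', hij', k', rfl⟩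
    · exact .inr (root_lt s1)
    · rw [kept_ofPart] at hu ⊢
      by_cases htt : t' = t
      · subst htt
        obtain ⟨r1, r2, r3, r4⟩ := side_facts (F := F) (n := n) t' k'
        have hle : F.own t' (.side t' (0 : Fin n) k' : F.Vertex n G) ≤ F.own t' x := by
          rcases hl with ⟨hl, -⟩ | ⟨hV, hl⟩
          · rw [host_lt_chain h r2 hl] at hu
            omega
          · rw [host_lt_out h r2 (by rw [hl]; exact nb_ne_cl (h.two_le t' hV) _ _) hr, hl] at hu
            rcases hu with hu | hu
            · exact absurd hu (h.not_ab_nb t' hV)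
            · exact hu.2.2
        rw [r3] at hle
        rcases Nat.lt_or_ge k'.1 k.1 with hk | hk
        · right
          rw [host_lt_chain h r2 s2, r3, s3]
          omega
        · left
          rw [show k' = k from Fin.ext (by omega)]
      · obtain rfl : t' = !t := by cases t <;> cases t' <;> simp_all
        obtain ⟨r1, r2, r3, r4⟩ := side_facts (F := F) (n := n) (!t) k'
        have hcl := (cl_ne_cl h t).symm
        right
        rw [host_lt_out h r2 (by rw [s2]; exact hcl) s1, s2]
        left
        rcases hl with ⟨hl, -⟩ | ⟨hV, hl⟩
        · rw [host_lt_out h r2 (by rw [hl]; exact hcl) hr, hl] at hu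
          rcases hu with hu | ⟨hV, hu, -⟩
          · exact hu
          · exact absurd hu.symm (nb_ne_cl (h.two_le _ hV) _ _)
        · rw [host_lt_out h r2 (by rw [hl]; exact nb_ne_cl (h.two_le t hV) _ _) hr, hl] at hu
          rcases hu with hu | ⟨hV', hu, -⟩
          · exact ab_cl_of_ab_nb h hV hu
          · exact absurd hu.symm (nb_ne_nb h hV hV')
    · obtain ⟨m, -, h1, h2, h3, h4, e, hcm, hlm⟩ := kept_sub (n := n) h i' j' hij' k'
      rw [e, host_lt_mid (by rw [hlm]; exact mid_ne h1 h2) hcm.ne_root hr, hlm] at hu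
      rcases hl with ⟨hl, -⟩ | ⟨hV, hl⟩
      · exact absurd hl (mid_ne_cl h hu.1 t).2
      · exact absurd (hl ▸ hu.1) (not_mb_nb h hV m)
  · obtain ⟨m, -, h1, h2, h3, h4, e, hcm, hlm⟩ := kept_sub (n := n) h i j hij k
    obtain ⟨g1, g2, g3⟩ := mid_cases h (lay_le h hr) hg h3 h4
    have hmin := (minLayer_iff h h1 h2).1 h3
    rw [hc, e]
    rcases u.cases_ofPart with rfl | ⟨t', k', rfl⟩ | ⟨i', j', hij', k', rfl⟩
    · exact .inr (root_lt hcm.ne_root)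
    · rw [kept_ofPart] at hu ⊢
      obtain ⟨r1, r2, r3, r4⟩ := side_facts (F := F) (n := n) t' k'
      right
      rw [host_lt_out h r2 (by rw [hlm]; exact mid_ne h1 h2 t') hcm.ne_root, hlm]
      left
      rw [host_lt_out h r2 (mid_ne g1 g2 t') hr] at hu
      rcases hu with hu | ⟨hV, hu, -⟩
      · rcases g3 with g3 | g3
        · rwa [g3]
        · exact (ab_iff_of_mb h g3 t').1 hu
      · rcases g3 with g3 | g3
        · exact absurd (g3.trans hu) (hmin.2 t' hV)
        · exact absurd (hu ▸ g3) (not_mb_nb h hV m)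
    · obtain ⟨m', -, h1', h2', h3', h4', e', hcm', hlm'⟩ := kept_sub (n := n) h i' j' hij' k'
      rw [e', host_lt_mid (by rw [hlm']; exact mid_ne h1' h2') hcm'.ne_root hr, hlm'] at hu
      rcases g3 with g3 | g3
      · exact absurd (g3 ▸ hu.1) (hmin.1 m')
      · obtain rfl := mb_unique h hu.1 g3
        left
        have hxo : (F.pos (pathCell m' i j hij : F.Vertex n G)).own = (F.pos x).own := by
          rw [hxc, pathCell_of_le h2.le, pathCell_of_le g2.le]
          rfl
        have := cell_ext hcm' hcm (by rw [hlm, hlm']) (hu.2.trans hxo.symm)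
        rw [← e, ← e'] at this
        rw [← contract_kept (n := n) h (.sub i' j' hij' k'), this, contract_kept h]

end Order

theorem isCell_of_kept [NeZero n] (h : F.IsTree) (x : F.Vertex n G) :
    (∃ u, F.kept n G u = x) ↔ x = .root ∨ (∃ t k, x = .side t (0 : Fin n) k) ∨
      (IsCell x ∧ 0 < F.lay x ∧ F.lay x < F.H ∧ MinLayer F.up F.dn (F.lay x)) := by
  constructor
  · rintro ⟨u, rfl⟩
    rcases u.cases_ofPart with rfl | ⟨t, k, rfl⟩ | ⟨i, j, hij, k, rfl⟩
    · exact .inl rfl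
    · exact .inr (.inl ⟨t, k, kept_ofPart t k⟩)
    · obtain ⟨m, -, h1, h2, h3, h4, e, hcm, hlm⟩ := kept_sub (n := n) h i j hij k
      rw [e]
      refine .inr (.inr ⟨hcm, ?_⟩)
      rw [hlm]
      exact ⟨h1, h2, h3⟩
  · rintro (rfl | ⟨t, k, rfl⟩ | ⟨⟨s, i, j, hij, rfl⟩, h0, hH, hm⟩)
    · exact ⟨.root, rfl⟩
    · exact ⟨_, kept_ofPart t k⟩
    · refine ⟨.onPath _ i j hij (layerGroup F.up F.dn s.1), ?_⟩
      refine ((layerPath h).pathSection_onPath _ _ _ _ hm h0 hH i j hij).trans ?_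
      exact pathCell_of_le (Nat.le_of_lt_succ s.2) i j hij

/-- The formulas enter only through what they select: `D` exactly, and `S` outside the root and the
deleted vertices. The number `n` of families is free, so that cores with two layers can do with one.
-/
theorem shrink_iso_rack [NeZero n] (h : F.IsTree) (hn : n ≤ 4) (hV : ∀ t, F.V t → 3 < n)
    {S D : F.Vertex n G → Prop} (hD : ∀ x, D x ↔ Off x)
    (hS : ∀ x, x ≠ .root → ¬ Off x → (S x ↔ (∃ t k, x = .side t (0 : Fin n) k) ∨
      (IsCell x ∧ 0 < F.lay x ∧ F.lay x < F.H ∧ MinLayer F.up F.dn (F.lay x)))) :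
    ((F.host n G).shrink S D).Iso (rack (rackParam h) G) := by
  have hlt : ∀ u v, (rack (rackParam h) G).lt u v ↔
      (F.host n G).lt (F.kept n G u) (F.kept n G v) := fun u v =>
    (SubdivVertex.transGen_pred_iff (rackParam h).disj u v).trans (rackLt_iff_lt h u v)
  have hnd : ∀ x, (¬ D x ∨ (F.host n G).IsRoot x) ↔ ¬ Off x := by
    intro x
    rw [hD, isRoot_iff]
    refine ⟨?_, .inl⟩
    rintro (h1 | rfl)
    · exact h1
    · exact not_off_root
  refine TOStruct.shrink_iso (M := F.host n G) (U := rack (rackParam h) G) (F.kept n G)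
    (F.contract n G) (Function.LeftInverse.injective (contract_kept h)) (fun x => ?_) hlt
    (fun u v h1 h2 => ?_) (fun x hx => kept_contract_le h ((hnd x).1 hx)) (fun x hx u hu => ?_)
    (fun u v => ?_)
  · refine Iff.trans ?_ (isCell_of_kept h x).symm
    refine (or_congr (and_congr_right fun _ => not_congr (hD x)) (isRoot_iff x)).trans ?_
    by_cases hr : x = .root
    · exact iff_of_true (.inr hr) (.inl hr)
    · have hoff : ((∃ t k, x = .side t (0 : Fin n) k) ∨
          (IsCell x ∧ 0 < F.lay x ∧ F.lay x < F.H ∧ MinLayer F.up F.dn (F.lay x))) → ¬ Off x := by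
        rintro (⟨t, k, rfl⟩ | ⟨hc, -⟩)
        · exact not_off_side (by simp)
        · exact hc.not_off
      constructor
      · rintro (⟨h1, h2⟩ | h1)
        · exact .inr ((hS x hr h2).1 h1)
        · exact .inl h1
      · rintro (h1 | h1)
        · exact .inr h1
        · exact .inl ⟨(hS x hr (hoff h1)).2 h1, hoff h1⟩
  · exact rackLt_asymm u v ((SubdivVertex.transGen_pred_iff (rackParam h).disj u v).1 h1)
      ((SubdivVertex.transGen_pred_iff (rackParam h).disj v u).1 h2)
  · exact (le_kept_contract h ((hnd x).1 hx) u hu).imp_right (hlt _ _).2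
  · refine ((isPathHost h hn hV).rootedAdj_iff (layerPath h) u v).trans (and_congr Iff.rfl
      (exists_congr fun x => exists_congr fun y => ?_))
    exact and_congr_right fun _ => and_congr (hnd x).symm (and_congr_left fun _ => (hnd y).symm)

end RackFrame

/-! ### Cores of type 3 -/

section Patterns

variable {W : Type} {R : W → W → Prop} {μ ν : Fin 2 → Fin 2 → W}

theorem iff_of_diag_or_never (h : Diag R μ ν ∨ Never R μ ν) (i j i' j' : Fin 2) :
    R (μ i j) (ν i' j') ↔ R (μ 0 0) (ν 0 0) ∧ i = i' ∧ j = j' := by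
  rcases h with h | h
  · simp [h i j i' j', h 0 0 0 0]
  · simp [h i j i' j', h 0 0 0 0]

theorem iff_of_never_or_always (h : Never R μ ν ∨ Always R μ ν) (i j i' j' : Fin 2) :
    R (μ i j) (ν i' j') ↔ Always R μ ν := by
  rcases h with h | h
  · exact iff_of_false (h _ _ _ _) fun h' => h i j i' j' (h' _ _ _ _)
  · exact iff_of_true (h _ _ _ _) h

end Patterns

namespace Core

variable (τ : Core) (revI revJ : Bool)

/-- The frame of a core of type 3. -/
def frame : RackFrame where
  H := τ.h - 1
  -- By `E_of_two`, in a core of type 3 the absence of edges already excludes two layers; the first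
  -- conjunct records that the layer next to the chain is a middle layer.
  V t := 2 < τ.h ∧ ¬ τ.E (τ.vertex ((bif t then τ.h - 1 else 0) + 1) 0 0)
    (τ.vertex ((bif t then τ.h - 1 - 1 else 1) + 1) 0 0)
  -- In a frame the columns are read in the direction of their order on the last layer. A reversal
  -- of the columns therefore shows up in the first chain, as the direction of the columns within a
  -- row.
  rev t := bif t then revI else revJ
  ab t l := Always τ.lt (τ.vertex ((bif t then τ.h - 1 else 0) + 1)) (τ.vertex (l + 1))
  mb l l' := 0 < l ∧ l < τ.h - 1 ∧ 0 < l' ∧ l' < τ.h - 1 ∧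
    τ.lt (τ.vertex (l + 1) 0 0) (τ.vertex (l' + 1) 0 0)
  je l l' := l < τ.h ∧ l' < τ.h ∧ τ.E (τ.vertex (l + 1) 0 0) (τ.vertex (l' + 1) 0 0)
  radj l := τ.E .root (τ.vertex (l + 1) 0 0)

variable {τ revI revJ}

theorem vertex_succ {l : ℕ} (hl : l < τ.h) : τ.vertex (l + 1) = .mesh ⟨l, hl⟩ := by
  funext i j
  exact TwistVertex.ofLayer_mesh hl i j

theorem E_pattern (c : IsCoreThreeWith revI revJ τ.E τ.lt) {s : ℕ} (hs : s + 1 < τ.h) :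
    Diag τ.E (τ.vertex (s + 1)) (τ.vertex (s + 1 + 1)) ∨
      Never τ.E (τ.vertex (s + 1)) (τ.vertex (s + 1 + 1)) := by
  rw [vertex_succ hs, vertex_succ (l := s) (by omega)]
  by_cases h0 : s = 0
  · subst h0
    exact (c.first ⟨0, by omega⟩ ⟨1, hs⟩ rfl rfl).imp And.left And.left
  by_cases h1 : s + 1 + 1 = τ.h
  · exact (c.last ⟨s, by omega⟩ ⟨s + 1, hs⟩ rfl h1).imp And.left And.left
  · rcases c.middle ⟨s, by omega⟩ ⟨s + 1, hs⟩ rfl h0 h1 with h | h | h | h | h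
    · exact .inr h.2.2
    · exact .inr h.2.2
    · exact .inl h.2.2
    · exact .inl h.2.2
    · exact .inl h.2.2

/-- With two layers the only pair is also the last one, and a simply horizontal relation would put
the last layer below the first. -/
theorem E_of_two (c : IsCoreThreeWith revI revJ τ.E τ.lt) (h2 : τ.h = 2) :
    Diag τ.E (τ.vertex 1) (τ.vertex 2) := by
  have h0 : 0 < τ.h := by omega
  have h1 : 1 < τ.h := by omega
  rw [vertex_succ h0, vertex_succ h1]
  rcases c.last ⟨0, h0⟩ ⟨1, h1⟩ rfl h2.symm with h | h
  · exact h.1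
  · exact absurd ((h.2 0 0 0 0).2 (.inl rfl)) (c.not_lt_first ⟨0, h0⟩ ⟨1, h1⟩ rfl one_ne_zero _ _ _ _)

theorem lt_pattern_mid (c : IsCoreThreeWith revI revJ τ.E τ.lt) {s s' : ℕ} (h0 : 0 < s)
    (hH : s < τ.h - 1) (h0' : 0 < s')
    (hH' : s' < τ.h - 1) :
    (Diag τ.lt (τ.vertex (s + 1)) (τ.vertex (s' + 1)) ∧ (s' = s + 1 ∨ s = s' + 1)) ∨
      Never τ.lt (τ.vertex (s + 1)) (τ.vertex (s' + 1)) := by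
  have hs : s < τ.h := by omega
  have hs' : s' < τ.h := by omega
  rw [vertex_succ hs, vertex_succ hs']
  by_cases e : s' = s
  · subst e
    exact .inr (c.order_middle ⟨s', hs⟩ h0.ne' (show s' + 1 ≠ τ.h by omega))
  by_cases e1 : s' = s + 1
  · subst e1
    rcases c.middle ⟨s, hs⟩ ⟨s + 1, hs'⟩ rfl h0.ne' (show s + 1 + 1 ≠ τ.h by omega) with
      h | h | h | h | h
    · exact .inl ⟨h.1, .inl rfl⟩
    · exact .inr h.1
    · exact .inl ⟨h.1, .inl rfl⟩
    · exact .inr h.1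
    · exact .inr h.1
  by_cases e2 : s = s' + 1
  · subst e2
    rcases c.middle ⟨s', hs'⟩ ⟨s' + 1, hs⟩ rfl h0'.ne' (show s' + 1 + 1 ≠ τ.h by omega) with
      h | h | h | h | h
    · exact .inr h.2.1
    · exact .inl ⟨h.2.1, .inr rfl⟩
    · exact .inr h.2.1
    · exact .inl ⟨h.2.1, .inr rfl⟩
    · exact .inr h.2.1
  right
  rcases Nat.lt_or_ge s s' with h | h
  · exact (c.middle_far ⟨s, hs⟩ ⟨s', hs'⟩ h0.ne' h0'.ne' (show s + 1 ≠ τ.h by omega)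
      (show s' + 1 ≠ τ.h by omega) (show s + 1 < s' by omega)).1
  · exact (c.middle_far ⟨s', hs'⟩ ⟨s, hs⟩ h0'.ne' h0.ne' (show s' + 1 ≠ τ.h by omega)
      (show s + 1 ≠ τ.h by omega) (show s' + 1 < s by omega)).2

/-- The relations between a chain and the next layer. -/
theorem lt_pattern_nb (c : IsCoreThreeWith revI revJ τ.E τ.lt) (t : Bool) (h3 : 2 < τ.h) :
    let μ := τ.vertex ((bif t then τ.h - 1 else 0) + 1)
    let ν := τ.vertex ((bif t then τ.h - 1 - 1 else 1) + 1)
    (Diag τ.E μ ν ∧ (Never τ.lt μ ν ∨ Always τ.lt μ ν)) ∨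
    (Never τ.E μ ν ∧ ∀ i j i' j', τ.lt (μ i j) (ν i' j') ↔
      bif t then j = j' ∨ revLT revJ j j' else i ≤ i') := by
  have h0 : 0 < τ.h := by omega
  have h1 : 1 < τ.h := by omega
  have h2 : τ.h - 1 < τ.h := by omega
  have h4 : τ.h - 1 - 1 < τ.h := by omega
  cases t
  · simp only [cond_false]
    rw [vertex_succ h0, vertex_succ h1]
    exact c.first ⟨0, h0⟩ ⟨1, h1⟩ rfl rfl
  · simp only [cond_true]
    rw [vertex_succ h2, vertex_succ h4]
    rcases c.last ⟨τ.h - 1 - 1, h4⟩ ⟨τ.h - 1, h2⟩ (show τ.h - 1 - 1 + 1 = τ.h - 1 by omega)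
      (show τ.h - 1 + 1 = τ.h by omega) with ⟨h5, h6⟩ | ⟨h5, h6⟩
    · refine .inl ⟨fun i j i' j' => ?_, h6⟩
      rw [eq_comm (a := i), eq_comm (a := j), ← h5 i' j' i j]
      exact ⟨τ.common.symm _ _, τ.common.symm _ _⟩
    · exact .inr ⟨fun i j i' j' h => h5 _ _ _ _ (τ.common.symm _ _ h), h6⟩

/-- The relations between a chain and the layers that are not next to it. -/
theorem lt_pattern_far (c : IsCoreThreeWith revI revJ τ.E τ.lt) (t : Bool) {l : ℕ} (hl : l < τ.h)
    (hcl : l ≠ bif t then τ.h - 1 else 0)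
    (hnb : 2 < τ.h → l ≠ bif t then τ.h - 1 - 1 else 1) :
    Never τ.lt (τ.vertex ((bif t then τ.h - 1 else 0) + 1)) (τ.vertex (l + 1)) ∨
      Always τ.lt (τ.vertex ((bif t then τ.h - 1 else 0) + 1)) (τ.vertex (l + 1)) := by
  have hle := c.two_le
  have h0 : 0 < τ.h := by omega
  have h1 : 1 < τ.h := by omega
  have h2 : τ.h - 1 < τ.h := by omega
  cases t
  · simp only [cond_false] at hcl hnb ⊢
    rw [vertex_succ h0, vertex_succ hl]
    by_cases e : l = 1
    · subst e
      have hh : τ.h = 2 := by omega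
      rcases c.first ⟨0, h0⟩ ⟨1, h1⟩ rfl rfl with h | h
      · exact h.2
      · have := (E_of_two c hh 0 0 0 0).2 ⟨rfl, rfl⟩
        rw [vertex_succ h0, vertex_succ h1] at this
        exact absurd this (h.1 _ _ _ _)
    · exact c.first_far ⟨0, h0⟩ ⟨l, hl⟩ rfl (show 1 < l by omega)
  · simp only [cond_true] at hcl hnb ⊢
    rw [vertex_succ h2, vertex_succ hl]
    by_cases e : l = 0
    · subst e
      exact .inl (c.not_lt_first ⟨0, h0⟩ ⟨τ.h - 1, h2⟩ rfl (show τ.h - 1 ≠ 0 by omega))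
    · exact c.last_far ⟨τ.h - 1, h2⟩ ⟨l, hl⟩ (show τ.h - 1 + 1 = τ.h by omega) e
        (show l + 1 < τ.h - 1 by omega)

theorem not_always_of_vertical {W : Type} {R : W → W → Prop} {μ ν : Fin 2 → Fin 2 → W} (t : Bool)
    (h : ∀ i j i' j', R (μ i j) (ν i' j') ↔ bif t then j = j' ∨ revLT revJ j j' else i ≤ i') :
    ¬ Always R μ ν := by
  intro h'
  cases t
  · exact absurd (show (1 : Fin 2) ≤ 0 from (h 1 0 0 0).1 (h' _ _ _ _)) (by decide)
  · have h8 := (h 0 0 0 1).1 (h' _ _ _ _)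
    have h9 := (h 0 1 0 0).1 (h' _ _ _ _)
    cases revJ <;> simp [revLT] at h8 h9

/-- Only the order types of the indices matter. This generality serves twice: for the indices of the
core itself, where it yields `IsTree`, and for the ranks of the coordinates in a host. -/
theorem lt_vertex_iff (c : IsCoreThreeWith revI revJ τ.E τ.lt) {x y : RackPos} (hx : x.lay < τ.h)
    (hy : y.lay < τ.h) {i j i' j' : Fin 2}
    (hi : i < i' ↔ x.own false < y.own false) (hi' : i' < i ↔ y.own false < x.own false)
    (hj : revLT revJ j j' ↔ x.own true < y.own true)
    (hj' : revLT revJ j' j ↔ y.own true < x.own true) :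
    τ.lt (τ.vertex (x.lay + 1) i j) (τ.vertex (y.lay + 1) i' j') ↔ (τ.frame revI revJ).Lt x y := by
  have hle := c.two_le
  have hpos : 1 ≤ (τ.frame revI revJ).H := show 1 ≤ τ.h - 1 by omega
  have hmb : ∀ l l', (τ.frame revI revJ).mb l l' → 0 < l ∧ l < (τ.frame revI revJ).H :=
    fun _ _ h => ⟨h.1, h.2.1⟩
  have ei : i = i' ↔ x.own false = y.own false := by
    rw [Fin.lt_def] at hi hi'
    rw [Fin.ext_iff]
    omega
  have ei' : i ≤ i' ↔ x.own false ≤ y.own false := by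
    rw [← not_lt, ← not_lt, hi']
  have ej : j = j' ↔ x.own true = y.own true := by
    unfold revLT at hj hj'
    rw [Fin.ext_iff]
    split_ifs at hj hj' <;> rw [Fin.lt_def] at hj hj' <;> omega
  have ej' : (j = j' ∨ revLT revJ j j') ↔ x.own true ≤ y.own true := by
    rw [ej, hj]
    omega
  have hc : j < j' ↔ (τ.frame revI revJ).crossLt false (x.own true) (y.own true) := by
    change _ ↔ if revJ then _ else _
    cases revJ
    · exact hj
    · exact hj'
  have hc' : revLT revI i i' ↔ (τ.frame revI revJ).crossLt true (x.own false) (y.own false) := by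
    change _ ↔ if revI then _ else _
    cases revI
    · exact hi
    · exact hi'
  by_cases hcl : ∃ t, x.lay = (τ.frame revI revJ).cl t
  · obtain ⟨t, ht⟩ := hcl
    by_cases ht' : y.lay = (τ.frame revI revJ).cl t
    · rw [RackFrame.lt_chain_iff_of_mid hpos hmb ht ht', ht, ht']
      have hlt : (τ.frame revI revJ).cl t < τ.h := ht ▸ hx
      rw [vertex_succ hlt]
      cases t
      · exact (c.order_first ⟨0, hlt⟩ rfl i j i' j').trans (or_congr hi (and_congr ei hc))
      · exact (c.order_last ⟨τ.h - 1, hlt⟩ (show τ.h - 1 + 1 = τ.h by omega) i j i' j').trans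
          (or_congr hj (and_congr ej hc'))
    · rw [RackFrame.lt_out_iff_of_mid hpos hmb ht ht', ht]
      by_cases hn : 2 < τ.h ∧ y.lay = (τ.frame revI revJ).nb t
      · obtain ⟨h3, hn⟩ := hn
        rw [hn]
        rcases lt_pattern_nb c t h3 with ⟨h5, h6⟩ | ⟨h5, h6⟩
        · refine (iff_of_never_or_always h6 i j i' j').trans (or_iff_left ?_).symm
          rintro ⟨hV, -⟩
          exact hV.2 ((h5 0 0 0 0).2 ⟨rfl, rfl⟩)
        · refine (h6 i j i' j').trans (Iff.trans ?_ (or_iff_right ?_).symm)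
          · have hV : (τ.frame revI revJ).V t := ⟨h3, h5 _ _ _ _⟩
            refine Iff.trans ?_ (and_iff_right hV).symm
            refine Iff.trans ?_ (and_iff_right rfl).symm
            cases t
            · exact ei'
            · exact ej'
          · exact not_always_of_vertical t h6
      · have hn' : 2 < τ.h → y.lay ≠ (τ.frame revI revJ).nb t := fun h3 h4 => hn ⟨h3, h4⟩
        refine (iff_of_never_or_always (lt_pattern_far c t hy ht' hn') i j i' j').trans
          (or_iff_left ?_).symm
        rintro ⟨hV, h4, -⟩
        exact hn' hV.1 h4
  · push Not at hcl
    rw [RackFrame.lt_mid_iff hcl]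
    have h0 : x.lay ≠ 0 := hcl false
    have h1 : x.lay ≠ τ.h - 1 := hcl true
    have hown : x.own = y.own ↔ i = i' ∧ j = j' := by
      rw [ei, ej]
      refine ⟨fun h => ⟨congrFun h _, congrFun h _⟩, fun h => ?_⟩
      funext b
      cases b
      · exact h.1
      · exact h.2
    rw [hown]
    by_cases h2 : y.lay = 0
    · refine iff_of_false (fun h => ?_) fun h => absurd h2 (h.1.2.2.1.ne')
      rw [vertex_succ hx, vertex_succ hy] at h
      exact c.not_lt_first ⟨y.lay, hy⟩ ⟨x.lay, hx⟩ h2 h0 _ _ _ _ h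
    by_cases h3 : y.lay = τ.h - 1
    · refine iff_of_false (fun h => ?_) fun h => absurd h3 (h.1.2.2.2.1.ne)
      rw [vertex_succ hx, vertex_succ hy] at h
      exact c.not_lt_last ⟨y.lay, hy⟩ ⟨x.lay, hx⟩ (show y.lay + 1 = τ.h by omega) h0
        (show x.lay + 1 ≠ τ.h by omega) _ _ _ _ h
    have hp := lt_pattern_mid c (s := x.lay) (s' := y.lay) (by omega) (by omega) (by omega) (by omega)
    rw [iff_of_diag_or_never (hp.imp_left And.left) i j i' j']
    refine and_congr_left fun _ => ⟨fun h => ⟨by omega, by omega, by omega, by omega, h⟩,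
      fun h => h.2.2.2.2⟩

theorem E_vertex_iff (c : IsCoreThreeWith revI revJ τ.E τ.lt)
    {l l' : ℕ} (hl : l < τ.h) (hl' : l' < τ.h) (i j i' j' : Fin 2) :
    τ.E (τ.vertex (l + 1) i j) (τ.vertex (l' + 1) i' j') ↔
      (τ.frame revI revJ).je l l' ∧ i = i' ∧ j = j' := by
  have hcons : ∀ i j i' j', τ.E (τ.vertex (l + 1) i j) (τ.vertex (l' + 1) i' j') →
      l + 1 + 1 = l' + 1 ∨ l' + 1 + 1 = l + 1 := fun i j i' j' h =>
    τ.common.edge_consecutive _ _ (l + 1) (l' + 1) (τ.layer_vertex (τ.isLayerCode_mesh hl) _ _)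
      (τ.layer_vertex (τ.isLayerCode_mesh hl') _ _) h
  have hje : (τ.frame revI revJ).je l l' ↔ τ.E (τ.vertex (l + 1) 0 0) (τ.vertex (l' + 1) 0 0) :=
    ⟨fun h => h.2.2, fun h => ⟨hl, hl', h⟩⟩
  rw [hje]
  by_cases e : l' = l + 1
  · subst e
    exact iff_of_diag_or_never (E_pattern c hl') i j i' j'
  by_cases e' : l = l' + 1
  · subst e'
    have hs : ∀ x y, τ.E x y ↔ τ.E y x := fun x y => ⟨τ.common.symm _ _, τ.common.symm _ _⟩
    rw [hs, hs (τ.vertex _ 0 0), eq_comm (a := i), eq_comm (a := j)]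
    exact iff_of_diag_or_never (E_pattern c hl) i' j' i j
  · refine iff_of_false (fun h => ?_) fun h => ?_
    · have := hcons _ _ _ _ h; omega
    · have := hcons _ _ _ _ h.1; omega

/-- The row of a vertex of the core, and its column read in the direction of the order. -/
theorem exists_lt_vertex (c : IsCoreThreeWith revI revJ τ.E τ.lt) :
    ∃ v : RackPos → TwistVertex τ.type τ.h 2,
    (∀ x y, x.lay ≤ τ.h - 1 → y.lay ≤ τ.h - 1 → (∀ t, x.own t < 2) → (∀ t, y.own t < 2) →
      ((τ.lt (v x) (v y) ↔ (τ.frame revI revJ).Lt x y) ∧ (v x = v y → x = y))) := by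
  have hle := c.two_le
  -- The identity of `{0, 1}` or, for decreasing columns, the exchange of its elements.
  let f : Bool → ℕ → Fin 2 := fun r k => if k = (bif r then 0 else 1) then 1 else 0
  have hf : ∀ r a b, a < 2 → b < 2 → (revLT r (f r a) (f r b) ↔ a < b) := by
    intro r a b ha hb
    interval_cases a <;> interval_cases b <;> cases r <;> simp [f, revLT]
  have hf' : ∀ a b, a < 2 → b < 2 → (f false a < f false b ↔ a < b) := hf false
  have hinj : ∀ r a b, a < 2 → b < 2 → f r a = f r b → a = b := by
    intro r a b ha hb h
    have h1 := hf r a b ha hb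
    have h2 := hf r b a hb ha
    rw [h] at h1 h2
    have h3 : ¬ revLT r (f r b) (f r b) := by unfold revLT; split_ifs <;> exact lt_irrefl _
    have := mt h1.2 h3
    have := mt h2.2 h3
    omega
  refine ⟨fun x => τ.vertex (x.lay + 1) (f false (x.own false)) (f revJ (x.own true)),
    fun x y hx hy ox oy => ⟨?_, fun h => ?_⟩⟩
  · exact lt_vertex_iff c (by omega) (by omega) (hf' _ _ (ox _) (oy _)) (hf' _ _ (oy _) (ox _))
      (hf _ _ _ (ox _) (oy _)) (hf _ _ _ (oy _) (ox _))
  · have hx' : x.lay < τ.h := by omega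
    have hy' : y.lay < τ.h := by omega
    have h' : τ.vertex (x.lay + 1) _ _ = τ.vertex (y.lay + 1) _ _ := h
    rw [vertex_succ hx', vertex_succ hy', TwistVertex.mesh.injEq, Fin.mk.injEq] at h'
    refine RackPos.ext h'.1 (funext fun b => ?_)
    cases b
    · exact hinj _ _ _ (ox _) (oy _) h'.2.1
    · exact hinj _ _ _ (ox _) (oy _) h'.2.2

/-- The axioms of the order are pulled back from the core along the embedding of `exists_lt_vertex`;
the other fields are read off from the clauses that define a core of type 3. -/
theorem frame_isTree (c : IsCoreThreeWith revI revJ τ.E τ.lt) : (τ.frame revI revJ).IsTree := by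
  have hle := c.two_le
  obtain ⟨v, hv⟩ := exists_lt_vertex c
  refine ⟨show 1 ≤ τ.h - 1 by omega, fun t hV => ?_, fun t hV hab => ?_, fun hab => ?_,
    fun l l' hm => ?_, fun l l' hj => ⟨hj.2.1, hj.1, τ.common.symm _ _ hj.2.2⟩, fun l l' hj => ?_,
    fun t => ?_, fun l h0 hH hu hd => ?_, fun x y z hx hy hz ox oy oz h1 h2 => ?_,
    fun x y z hx hy hz ox oy oz h1 h2 => ?_⟩
  · have := hV.1
    change 2 ≤ τ.h - 1
    omega
  · rcases lt_pattern_nb c t hV.1 with ⟨h5, h6⟩ | ⟨h5, h6⟩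
    · exact hV.2 ((h5 0 0 0 0).2 ⟨rfl, rfl⟩)
    · exact not_always_of_vertical t h6 hab
  · have h := hab 0 0 0 0
    have h0 : 0 < τ.h := by omega
    have h1 : τ.h - 1 < τ.h := by omega
    rw [vertex_succ h0] at h
    change τ.lt (τ.vertex (τ.h - 1 + 1) 0 0) _ at h
    rw [vertex_succ h1] at h
    exact c.not_lt_first ⟨0, h0⟩ ⟨τ.h - 1, h1⟩ rfl (show τ.h - 1 ≠ 0 by omega) _ _ _ _ h
  · obtain ⟨h1, h2, h3, h4, h5⟩ := hm
    refine ⟨h1, h2, h3, h4, ?_⟩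
    rcases lt_pattern_mid c h1 h2 h3 h4 with h | h
    · exact h.2
    · exact absurd h5 (h _ _ _ _)
  · have := τ.common.edge_consecutive _ _ (l + 1) (l' + 1)
      (τ.layer_vertex (τ.isLayerCode_mesh hj.1) _ _)
      (τ.layer_vertex (τ.isLayerCode_mesh hj.2.1) _ _) hj.2.2
    omega
  · have hcl : (τ.frame revI revJ).cl t < τ.h := by
      cases t
      · change 0 < τ.h; omega
      · change τ.h - 1 < τ.h; omega
    have hnb : (τ.frame revI revJ).nb t < τ.h := by
      cases t
      · change 1 < τ.h; omega
      · change τ.h - 1 - 1 < τ.h; omega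
    constructor
    · exact fun hj hV => hV.2 hj.2.2
    · intro hV
      refine ⟨hcl, hnb, ?_⟩
      by_cases h3 : 2 < τ.h
      · exact not_not.1 fun h => hV ⟨h3, h⟩
      · have h2 : τ.h = 2 := by omega
        have h4 := (E_of_two c h2 0 0 0 0).2 ⟨rfl, rfl⟩
        cases t
        · exact h4
        · change τ.E (τ.vertex (τ.h - 1 + 1) 0 0) (τ.vertex (τ.h - 1 - 1 + 1) 0 0)
          rw [show τ.h - 1 + 1 = 2 by omega, show τ.h - 1 - 1 + 1 = 1 by omega]
          exact τ.common.symm _ _ h4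
  · have hH' : l + 1 < τ.h - 1 := hH
    have hs : l < τ.h := by omega
    have hs' : l + 1 < τ.h := by omega
    refine ⟨hs, hs', ?_⟩
    have hu' : ¬ τ.lt (τ.vertex (l + 1) 0 0) (τ.vertex (l + 1 + 1) 0 0) := fun h =>
      hu ⟨h0, by omega, by omega, hH', h⟩
    have hd' : ¬ τ.lt (τ.vertex (l + 1 + 1) 0 0) (τ.vertex (l + 1) 0 0) := fun h =>
      hd ⟨by omega, hH', h0, by omega, h⟩
    rw [vertex_succ hs, vertex_succ hs'] at hu' hd' ⊢
    rcases c.middle ⟨l, hs⟩ ⟨l + 1, hs'⟩ rfl h0.ne' (show l + 1 + 1 ≠ τ.h by omega) with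
      h | h | h | h | h
    · exact absurd ((h.1 0 0 0 0).2 ⟨rfl, rfl⟩) hu'
    · exact absurd ((h.2.1 0 0 0 0).2 ⟨rfl, rfl⟩) hd'
    · exact absurd ((h.1 0 0 0 0).2 ⟨rfl, rfl⟩) hu'
    · exact absurd ((h.2.1 0 0 0 0).2 ⟨rfl, rfl⟩) hd'
    · exact (h.2.2 0 0 0 0).2 ⟨rfl, rfl⟩
  · rw [← (hv _ _ hx hy ox oy).1] at h1
    rw [← (hv _ _ hy hz oy oz).1] at h2
    rw [← (hv _ _ hx hz ox oz).1]
    exact τ.common.treeOrder.trans _ _ _ h1 h2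
  · rw [← (hv _ _ hx hz ox oz).1] at h1
    rw [← (hv _ _ hy hz oy oz).1] at h2
    rw [← (hv _ _ hx hy ox oy).1, ← (hv _ _ hy hx oy ox).1]
    rcases τ.common.treeOrder.chain _ _ _ h1 h2 with h | h | h
    · exact .inl h
    · exact .inr (.inl ((hv _ _ hx hy ox oy).2 h))
    · exact .inr (.inr h)

end Core

/-! ### Layouts for type 3, and the resulting racks -/

namespace RackFrame

variable {F : RackFrame} {n : ℕ} {G : BipGraph}

/-- Families `1` and `3` of a vertex share both coordinates and are told apart by their layers only.
This requires a layer next to the chain that is not a chain itself, so `2 ≤ F.H` as soon as family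
`3` exists. -/
theorem pos_injective (hn : n ≤ 4) (h2 : 3 < n → 2 ≤ F.H) {x y : F.Vertex n G} (hx : x ≠ .root)
    (hy : y ≠ .root) (h : F.pos x = F.pos y) : x = y := by
  have hl : F.lay x = F.lay y := congrArg RackPos.lay h
  have ho := congrArg RackPos.own h
  rcases cases_vertex hx with ⟨t, f, k, rfl⟩ | hcx <;>
    rcases cases_vertex hy with ⟨t', f', k', rfl⟩ | hcy
  · by_cases htt : t' = t
    · subst htt
      have hf := f.2
      have hf' := f'.2
      obtain ⟨rfl, h1⟩ := own_side_eq hn ho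
      rw [lay_side, lay_side] at hl
      rcases h1 with rfl | ⟨h1, h3⟩ | ⟨h1, h3⟩
      · rfl
      · rw [if_neg (by omega), if_pos h3] at hl
        exact absurd hl.symm (nb_ne_cl (h2 (by omega)) _ _)
      · rw [if_pos h1, if_neg (by omega)] at hl
        exact absurd hl (nb_ne_cl (h2 (by omega)) _ _)
    · obtain rfl : t' = !t := by cases t <;> cases t' <;> simp_all
      exact absurd ho not_own_side_side
  · exact absurd ho (not_own_side_cell hcy)
  · exact absurd ho.symm (not_own_side_cell hcx)
  · exact cell_ext hcx hcy hl ho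

end RackFrame

namespace Core

variable (τ : Core) (revI revJ : Bool) (n : ℕ)

/-- The coordinate along a chain of the vertices of a family. -/
noncomputable def ownCoord (t : Bool) (f : ℕ) (rev : Bool) : Coord :=
  ⟨2 + (τ.frame revI revJ).shift t * RackFrame.famShift f, 0, 0, 3, rev⟩

/-- The coordinate across a chain of the vertices of a family. -/
def crossCoord (f : ℕ) (rev : Bool) : Coord :=
  if f = 0 then ⟨1, 0, 0, 0, rev⟩ else if f = 2 then ⟨3, 3, 3, 0, rev⟩ else ⟨2, 3, 3, 0, rev⟩

/-- The codes of the positions `RackFrame.pos`. Reversing the columns for `revJ` turns coordinates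
read in the direction of the order into column indices of the twist. -/
noncomputable def layoutThree : Layout where
  nf _ := n
  L := (τ.frame revI revJ).H + 1
  sideLayer t f := (if f.1 = 3 then (τ.frame revI revJ).nb t else (τ.frame revI revJ).cl t) + 1
  sideRow t f := bif t then crossCoord f.1 revI else τ.ownCoord revI revJ t f.1 false
  sideCol t f := bif t then τ.ownCoord revI revJ t f.1 revJ else crossCoord f.1 false
  cellLayer s := s.1 + 1
  cellRow := ⟨2, 0, 0, 3, false⟩
  cellCol := ⟨2, 0, 0, 3, revJ⟩

/-- The column with a given coordinate in the direction of the order on the columns. -/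
def flipCol (G : BipGraph) (revJ : Bool) (q : ℕ) : ℕ := if revJ then RackFrame.top G - q else q

variable {τ revI revJ n} {G : BipGraph}

theorem crossCoord_val (f k : ℕ) (rev : Bool) : (crossCoord f rev).val G.nA G.nB k =
    if rev then RackFrame.top G - RackFrame.famKey G f else RackFrame.famKey G f := by
  unfold crossCoord RackFrame.famKey Coord.val
  split_ifs <;> simp only [RackFrame.top] at * <;> omega

theorem flipCol_flipCol {q : ℕ} (hq : q ≤ RackFrame.top G) :
    flipCol G revJ (flipCol G revJ q) = q := by
  unfold flipCol
  split_ifs <;> omega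

theorem code_three (x : (τ.frame revI revJ).Vertex n G) (hx : x ≠ .root) :
    (τ.layoutThree revI revJ n).code G x =
      ⟨some ((τ.frame revI revJ).lay x + 1), (τ.frame revI revJ).own false x,
        flipCol G revJ ((τ.frame revI revJ).own true x)⟩ := by
  have hkey : ∀ f, RackFrame.famKey G f ≤ RackFrame.top G := fun f => by
    have := RackFrame.famKey_cases (G := G) f
    have := RackFrame.three_le_top (G := G)
    omega
  rcases x with _ | ⟨_ | _, f, k⟩ | ⟨s, i, j, hij⟩
  · exact absurd rfl hx
  · have h1 : (τ.ownCoord revI revJ false f.1 false).val G.nA G.nB k.1 =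
        2 + 3 * k.1 + (τ.frame revI revJ).shift false * RackFrame.famShift f.1 := by
      simp only [Coord.val, ownCoord]
      simp
      omega
    have h2 : (crossCoord f.1 false).val G.nA G.nB k.1 =
        flipCol G revJ (flipCol G revJ (RackFrame.famKey G f.1)) := by
      rw [crossCoord_val, flipCol_flipCol (hkey _)]
      rfl
    exact congrArg₂ (Code.mk _) h1 h2
  · have h1 : (τ.ownCoord revI revJ true f.1 revJ).val G.nA G.nB k.1 =
        flipCol G revJ
          (2 + 3 * k.1 + (τ.frame revI revJ).shift true * RackFrame.famShift f.1) := by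
      unfold Coord.val ownCoord flipCol RackFrame.top
      cases revJ <;> simp <;> omega
    exact congrArg₂ (Code.mk _) (crossCoord_val f.1 k.1 revI) h1
  · refine congrArg₂ (Code.mk _) ?_ ?_
    · change (Coord.mk 2 0 0 3 false).val G.nA G.nB i.1 = 2 + 3 * i.1
      simp [Coord.val]
    · change (Coord.mk 2 0 0 3 revJ).val G.nA G.nB j.1 = flipCol G revJ (2 + 3 * j.1)
      simp only [Coord.val, flipCol, RackFrame.top]
      split_ifs <;> simp

theorem lay_three (c : IsCoreThreeWith revI revJ τ.E τ.lt) {x : (τ.frame revI revJ).Vertex n G}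
    (hx : x ≠ .root) : (τ.frame revI revJ).lay x < τ.h := by
  have h1 := RackFrame.lay_le (frame_isTree c) hx
  have h2 : (τ.frame revI revJ).H = τ.h - 1 := rfl
  have := c.two_le
  omega

theorem isLayout_three (c : IsCoreThreeWith revI revJ τ.E τ.lt) (hn : n ≤ 4)
    (h2 : 3 < n → 2 < τ.h) : τ.IsLayout (τ.layoutThree revI revJ n) where
  injective G x y hxy := by
    by_cases hx : x = .root <;> by_cases hy : y = .root
    · exact hx.trans hy.symm
    · subst hx
      rw [code_three y hy] at hxy
      cases hxy
    · subst hy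
      rw [code_three x hx] at hxy
      cases hxy
    · rw [code_three x hx, code_three y hy, Code.mk.injEq, Option.some.injEq] at hxy
      obtain ⟨e1, e2, e3⟩ := hxy
      have e4 := congrArg (flipCol G revJ) e3
      rw [flipCol_flipCol (RackFrame.own_le_top (F := τ.frame revI revJ) x true),
        flipCol_flipCol (RackFrame.own_le_top (F := τ.frame revI revJ) y true)] at e4
      refine RackFrame.pos_injective (F := τ.frame revI revJ) hn (fun h => ?_) hx hy
        (RackPos.ext (Nat.succ.inj e1) (funext fun b => ?_))
      · have := h2 h
        change 2 ≤ τ.h - 1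
        omega
      · cases b
        · exact e2
        · exact e4
  valid G x := by
    by_cases hx : x = .root
    · subst hx
      exact ⟨.root, rfl, rfl, rfl⟩
    · have h1 := lay_three c hx
      have h3 := RackFrame.own_le_top (F := τ.frame revI revJ) x false
      have h4 := RackFrame.own_le_top (F := τ.frame revI revJ) x true
      have h5 : RackFrame.top G = 3 * G.nA + 3 * G.nB + 3 := rfl
      rw [code_three x hx]
      refine TwistVertex.hasCode_mesh (by omega) (by omega) (by omega) ?_
      unfold flipCol
      split_ifs <;> omega

theorem revLT_rank2 (r : Bool) (a b : ℕ) :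
    revLT r (rank2 a b) (rank2 b a) ↔ if r then b < a else a < b := by
  unfold revLT
  split_ifs <;> exact rank2_lt_iff

/-- Both structures have the same vertex type by definition, so they are shown to be equal and not
merely isomorphic. This replaces the core by its frame. -/
theorem hostStruct_three (c : IsCoreThreeWith revI revJ τ.E τ.lt) (n : ℕ) (G : BipGraph) :
    τ.hostStruct (τ.layoutThree revI revJ n) G = (τ.frame revI revJ).host n G := by
  have hflip : ∀ x y : (τ.frame revI revJ).Vertex n G,
      (revLT revJ (rank2 (flipCol G revJ ((τ.frame revI revJ).own true x))
          (flipCol G revJ ((τ.frame revI revJ).own true y)))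
        (rank2 (flipCol G revJ ((τ.frame revI revJ).own true y))
          (flipCol G revJ ((τ.frame revI revJ).own true x))) ↔
        (τ.frame revI revJ).own true x < (τ.frame revI revJ).own true y) := by
    intro x y
    have h1 := RackFrame.own_le_top (F := τ.frame revI revJ) x true
    have h2 := RackFrame.own_le_top (F := τ.frame revI revJ) y true
    rw [revLT_rank2]
    unfold flipCol
    split_ifs <;> omega
  have hE : ∀ x y : (τ.frame revI revJ).Vertex n G,
      τ.codeE ((τ.layoutThree revI revJ n).code G x) ((τ.layoutThree revI revJ n).code G y) ↔
        ((τ.frame revI revJ).host n G).E x y := by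
    intro x y
    by_cases hx : x = .root <;> by_cases hy : y = .root
    · subst hx hy
      refine iff_of_false τ.not_codeE_root ?_
      rintro (⟨-, h, -⟩ | ⟨-, h, -⟩ | ⟨h, -⟩) <;> exact h rfl
    · subst hx
      rw [code_three y hy]
      refine (τ.codeE_root (τ.isLayerCode_mesh (lay_three c hy))).trans
        ⟨fun h => .inl ⟨rfl, hy, h⟩, ?_⟩
      rintro (⟨-, -, h⟩ | ⟨h, -⟩ | ⟨h, -⟩)
      · exact h
      · exact absurd h hy
      · exact absurd rfl h
    · subst hy
      rw [code_three x hx]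
      refine Iff.trans ⟨τ.codeE_symm _ _, τ.codeE_symm _ _⟩
        ((τ.codeE_root (τ.isLayerCode_mesh (lay_three c hx))).trans
          ⟨fun h => .inr (.inl ⟨rfl, hx, h⟩), ?_⟩)
      rintro (⟨h, -⟩ | ⟨-, -, h⟩ | ⟨-, h, -⟩)
      · exact absurd h hx
      · exact h
      · exact absurd rfl h
    · rw [code_three x hx, code_three y hy, RackFrame.host_E_iff hx hy]
      refine (E_vertex_iff c (lay_three c hx) (lay_three c hy) _ _ _ _).trans
        (and_congr_right fun _ => ?_)
      rw [rank2_eq_iff, rank2_eq_iff]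
      constructor
      · rintro ⟨h1, h2⟩
        have h3 := congrArg (flipCol G revJ) h2
        rw [flipCol_flipCol (RackFrame.own_le_top (F := τ.frame revI revJ) x true),
          flipCol_flipCol (RackFrame.own_le_top (F := τ.frame revI revJ) y true)] at h3
        funext b
        cases b
        · exact h1
        · exact h3
      · exact fun h => ⟨congrFun h false, congrArg (flipCol G revJ) (congrFun h true)⟩
  have hlt : ∀ x y : (τ.frame revI revJ).Vertex n G,
      τ.codeLt ((τ.layoutThree revI revJ n).code G x) ((τ.layoutThree revI revJ n).code G y) ↔
        ((τ.frame revI revJ).host n G).lt x y := by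
    intro x y
    by_cases hy : y = .root
    · subst hy
      exact iff_of_false (τ.not_codeLt_root _) (RackFrame.not_lt_root x)
    by_cases hx : x = .root
    · subst hx
      rw [code_three y hy]
      exact iff_of_true (τ.codeLt_root (τ.isLayerCode_mesh (lay_three c hy))) (RackFrame.root_lt hy)
    · rw [code_three x hx, code_three y hy, RackFrame.lt_iff hx hy]
      exact lt_vertex_iff c (x := (τ.frame revI revJ).pos x) (y := (τ.frame revI revJ).pos y)
        (lay_three c hx) (lay_three c hy) rank2_lt_iff rank2_lt_iff (hflip x y) (hflip y x)
  unfold hostStruct RackFrame.host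
  rw [TOStruct.mk.injEq]
  refine ⟨rfl, heq_of_eq ?_, heq_of_eq ?_⟩
  · funext x y
    exact propext (hE x y)
  · funext x y
    exact propext (hlt x y)

theorem rack_long (c : IsCoreThreeWith revI revJ τ.E τ.lt) (h3 : 2 < τ.h) (G : BipGraph) :
    ((τ.hostStruct (τ.layoutThree revI revJ 4) G).shrink (TOStruct.Initial _)
      (TOStruct.Pendant _)).Iso (rack (RackFrame.rackParam (frame_isTree c)) G) := by
  have h := frame_isTree c
  have h2 : 2 ≤ (τ.frame revI revJ).H := show 2 ≤ τ.h - 1 by omega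
  rw [hostStruct_three c]
  refine RackFrame.shrink_iso_rack h le_rfl (fun _ _ => by omega) (fun x => ?_) fun x hx hoff => ?_
  · refine (RackFrame.pendant_iff h h2 x).trans ⟨?_, ?_⟩
    · rintro ⟨t, k, hV, e⟩
      exact ⟨t, 3, k, rfl, hV, e⟩
    · rintro ⟨t, f, k, hf, hV, e⟩
      obtain rfl : f = 3 := Fin.ext hf
      exact ⟨t, k, hV, e⟩
  · exact RackFrame.initial_iff h h2 hx fun t k hV e => hoff ⟨t, 3, k, rfl, hV, e⟩

/-- Without middle layers there is no place for family `3`, but marks are not needed: every cell is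
joined to the cell of the same edge in the other chain, so apart from the root the kept vertices are
exactly the bare ones. -/
theorem rack_short (c : IsCoreThreeWith revI revJ τ.E τ.lt) (h2 : τ.h = 2) (G : BipGraph) :
    ((τ.hostStruct (τ.layoutThree revI revJ 1) G).shrink (TOStruct.Bare _)
      (fun _ => False)).Iso (rack (RackFrame.rackParam (frame_isTree c)) G) := by
  have h := frame_isTree c
  have hH : (τ.frame revI revJ).H = 1 := by
    change τ.h - 1 = 1
    omega
  have hV : ∀ t, ¬ (τ.frame revI revJ).V t := fun t ht => by
    have := h.two_le t ht
    omega
  rw [hostStruct_three c]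
  refine RackFrame.shrink_iso_rack h (by omega) (fun t ht => absurd ht (hV t)) (fun x => ?_)
    fun x hx _ => ?_
  · refine iff_of_false id ?_
    rintro ⟨t, f, k, hf, -⟩
    have := f.2
    omega
  · rcases RackFrame.cases_vertex hx with ⟨t, f, k, rfl⟩ | hc
    · obtain rfl : f = 0 := Subsingleton.elim _ _
      exact iff_of_true (RackFrame.bare_side h (by omega) (.inr (.inl rfl))) (.inl ⟨t, k, rfl⟩)
    · refine iff_of_false ?_ ?_
      · have hl := hc.lay_le
        have hcl : ∃ t, (τ.frame revI revJ).lay x = (τ.frame revI revJ).cl t := by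
          rcases Nat.eq_zero_or_pos ((τ.frame revI revJ).lay x) with h0 | h0
          · exact ⟨false, h0⟩
          · exact ⟨true, show _ = (τ.frame revI revJ).H by omega⟩
        obtain ⟨t, ht⟩ := hcl
        refine hc.not_bare (RackFrame.nb_le h t) ?_
        rw [ht]
        exact (h.je_nb t).2 (hV t)
      · rintro (⟨t, k, e⟩ | ⟨-, h1, h3, -⟩)
        · exact hc.ne_side _ _ _ e
        · omega

theorem exists_rack_host (τ : Core) (ht : τ.type = CoreType.three) :
    ∃ (Λ : Layout) (S D : ∀ M : TOStruct, M.V → Prop), τ.IsLayout Λ ∧ IsFOProperty S ∧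
      IsFOProperty D ∧ ∃ P, ∀ G, ((τ.hostStruct Λ G).shrink (S _) (D _)).Iso (rack P G) := by
  obtain ⟨revI, revJ, c⟩ := τ.isThree ht
  by_cases h3 : 2 < τ.h
  · exact ⟨τ.layoutThree revI revJ 4, TOStruct.Initial, TOStruct.Pendant,
      isLayout_three c le_rfl fun _ => h3, (FODef.initial 0).isFOProperty,
      (FODef.pendant 0).isFOProperty, _, rack_long c h3⟩
  · have := c.two_le
    exact ⟨τ.layoutThree revI revJ 1, TOStruct.Bare, fun _ _ => False,
      isLayout_three c (by omega) fun h => by omega, (FODef.bare 0).isFOProperty,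
      FODef.isFOProperty (Q := fun _ _ => False) FODef.never, _, rack_short c (by omega)⟩

end Core

/-! ### From a layout to the host and its minor -/

theorem Core.exists_host {τ : Core} {Λ : Layout} (hΛ : τ.IsLayout Λ)
    {S D : ∀ M : TOStruct, M.V → Prop} (hS : IsFOProperty S) (hD : IsFOProperty D) :
    ∃ (Host : BipGraph → CodedStruct) (I : DefinableMinor),
      PolyTimeComputable BipGraph.size BipGraph.code CodedStruct.code Host ∧
      (∀ C : Set TOStruct, IsTOWSClass C → IsHereditary C → IsIndependent C →
        (∀ n : ℕ, 2 ≤ n → τ.twist n ∈ C) → ∀ G : BipGraph, (Host G).toStruct ∈ C) ∧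
      ∀ G U, ((τ.hostStruct Λ G).shrink (S _) (D _)).Iso U → (I.apply (Host G).toStruct).Iso U := by
  obtain ⟨I, hI⟩ := exists_definableMinor hS hD
  refine ⟨τ.host Λ, I, τ.polyTime_host Λ, fun C _ hC _ hτ G => ?_, fun G U hU => ?_⟩
  · exact hC _ (hτ _ (by omega)) _ (hΛ.isInducedSub G)
  · rw [← hI] at hU
    exact (TOStruct.apply_iso (τ.host_iso Λ G) I).trans hU

theorem mainTheorem10 (τ : Core) :
    ∃ (Host : BipGraph → CodedStruct) (I : DefinableMinor),
      PolyTimeComputable BipGraph.size BipGraph.code CodedStruct.code Host ∧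
      (∀ C : Set TOStruct, IsTOWSClass C → IsHereditary C → IsIndependent C →
        (∀ n : ℕ, 2 ≤ n → τ.twist n ∈ C) → ∀ G : BipGraph, (Host G).toStruct ∈ C) ∧
      (τ.type = CoreType.one ∨ τ.type = CoreType.two →
        ∃ P : GroundingParam, ∀ G : BipGraph,
          (I.apply (Host G).toStruct).Iso (grounding P G)) ∧
      (τ.type = CoreType.three →
        ∃ P : RackParam, ∀ G : BipGraph,
          (I.apply (Host G).toStruct).Iso (rack P G)) := by
  rcases ht : τ.type with _ | _ | _
  · obtain ⟨Host, I, h1, h2, h3⟩ := Core.exists_host (Core.isLayout_one ht)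
      (FODef.low 0).isFOProperty (FODef.isFOProperty (Q := fun _ _ => False) FODef.never)
    exact ⟨Host, I, h1, h2, fun _ => ⟨_, fun G => h3 G _ (Core.grounding_one ht G)⟩, nofun⟩
  · obtain ⟨Host, I, h1, h2, h3⟩ := Core.exists_host (Core.isLayout_two ht)
      (FODef.low 0).isFOProperty (FODef.isFOProperty (Q := fun _ _ => False) FODef.never)
    exact ⟨Host, I, h1, h2, fun _ => ⟨_, fun G => h3 G _ (Core.grounding_two ht G)⟩, nofun⟩
  · obtain ⟨Λ, S, D, hΛ, hS, hD, P, hP⟩ := τ.exists_rack_host ht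
    obtain ⟨Host, I, h1, h2, h3⟩ := Core.exists_host hΛ hS hD
    exact ⟨Host, I, h1, h2, nofun, fun _ => ⟨P, fun G => h3 G _ (hP G)⟩⟩
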